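/- Let $D_\varepsilon=(0,1)\times(-\frac\varepsilon2,\frac\varepsilon2)$ with $\varepsilon=1/n$, $n\in\mathbb N$, $n\ge 1$. Let $\nu=\nu_0+\nu_1$ on $[0,1]$, where $\nu_0$ is a constant, $\nu_1\in C^2([0,1])$, $\nu\ge\kappa>0$ on $(0,1)$, and $\nu_1=0$ on $(0,\rho)\cup(1-\rho,1)$ for some $\rho>0$. Let $f_1\in C^\infty([0,1])$, and let $\varphi_0,\varphi_1\in C^2([-\frac12,\frac12])$ vanish at $\pm\frac12$ and satisfy $\int_{-1/2}^{1/2}\varphi_0=\int_{-1/2}^{1/2}\varphi_1$. Write $(\mathcal Du)_{ij}=\frac12(\partial_ju_i+\partial_iu_j)$, and let $\delta_{jl}$ be the Kronecker symbol. **Exact problem.** Let $(u_\varepsilon,p_\varepsilon)$ be the solution of $$-\operatorname{div}(\nu(x_1)\mathcal Du_\varepsilon)+\nabla p_\varepsilon=f_1(x_1)e_1,\qquad \operatorname{div}u_\varepsilon=0\quad\text{in }D_\varepsilon,$$ $$u_\varepsilon=0\ \text{ on } x_2=\pm\tfrac\varepsilon2,\qquad u_\varepsilon(i,x_2)=\varepsilon^2\varphi_i(x_2/\varepsilon)\,e_1\quad(i=0,1).$$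 That is, $u_\varepsilon\in H^1(D_\varepsilon)^2$ is divergence free, has these traces and satisfies $\int_{D_\varepsilon}\nu\,\mathcal Du_\varepsilon:\mathcal D\psi=\int_{D_\varepsilon}f_1\psi_1$ for all divergence-free $\psi\in H^1_0(D_\varepsilon)^2$, and $p_\varepsilon$ is a distribution for which the first equation holds in the sense of distributions. **Regular ansatz.** Let $k\ge0$. For $0\le j\le k$ let $u_{1,j},u_{2,j}\in C^2([0,1]\times[-\frac12,\frac12])$, $p_j\in C^1([0,1]\times[-\frac12,\frac12])$ and $q_j\in C^1([0,1])$ be functions of $(x_1,\xi_2)$, respectively $x_1$, such that, with terms of negative index equal to $0$, $$-\partial_{x_1}(\nu\,\partial_{x_1}u_{1,j-2})-\tfrac\nu2\partial_{\xi_2}^2u_{1,j}-\tfrac\nu2\partial_{\xi_2}\partial_{x_1}u_{2,j-2}+\partial_{x_1}p_{j-1}+q_j'=f_1\delta_{j0},$$ $$\tfrac12\partial_{x_1}\big[\nu(\partial_{\xi_2}u_{1,j-1}+\partial_{x_1}u_{2,j-3})\big]+\nu\,\partial^2_{\xi_2}u_{2,j-1}-\partial_{\xi_2}p_j=0,\qquad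 \partial_{x_1}u_{1,j}+\partial_{\xi_2}u_{2,j}=0,$$ $$u_{1,j}=u_{2,j}=0\ \text{ at }\xi_2=\pm\tfrac12,\qquad \int_{-1/2}^{1/2}p_j\,d\xi_2=0,\qquad \int_{-1/2}^{1/2}\big(\varphi_0\delta_{j0}-u_{1,j}(0,\xi_2)\big)\,d\xi_2=0.$$ Such functions exist for every $k$ if $\nu_1\in C^\infty$; if $\nu_1$ is only $C^2$, their existence for the given $k$ is assumed. Put $$u^k=\Big(\sum_{j=0}^k\varepsilon^{j+2}u_{1,j}(x_1,\tfrac{x_2}\varepsilon),\ \sum_{j=0}^k\varepsilon^{j+3}u_{2,j}(x_1,\tfrac{x_2}\varepsilon)\Big),\qquad p^k=\sum_{j=0}^k\varepsilon^{j+1}p_j(x_1,\tfrac{x_2}\varepsilon)+\sum_{j=0}^k\varepsilon^jq_j(x_1).$$ **Boundary layers.** Let $\Pi^+=(0,\infty)\times(-\frac12,\frac12)$ and $\Pi^-=(-\infty,0)\times(-\frac12,\frac12)$. For $0\le j\le k$ let $(u^0_j,p^0_j)$ on $\Pi^+$ and $(u^1_j,p^1_j)$ on $\Pi^-$ be the weak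 solutions, with $u^i_j\in H^1(\Pi^\pm)^2$ and $p^i_j\in L^1_{\rm loc}(\Pi^\pm)$, of $$-\tfrac{\nu_0}2\Delta u^i_j+\nabla p^i_j=0,\qquad \operatorname{div}u^i_j=0,\qquad u^i_j=0\text{ at }\xi_2=\pm\tfrac12,$$ $$u^i_j(0,\xi_2)=\varphi_i(\xi_2)\,\delta_{j0}\,e_1-\big(u_{1,j}(i,\xi_2),\,u_{2,j-1}(i,\xi_2)\big).$$ **Asymptotic solution.** Put $$\hat u^k=u^k+\sum_{j=0}^k\varepsilon^{j+2}\Big(u^0_j\big(\tfrac{x_1}\varepsilon,\tfrac{x_2}\varepsilon\big)+u^1_j\big(\tfrac{x_1-1}\varepsilon,\tfrac{x_2}\varepsilon\big)\Big),\qquad \hat p^k=p^k+\sum_{j=0}^k\varepsilon^{j+1}\Big(p^0_j\big(\tfrac{x_1}\varepsilon,\tfrac{x_2}\varepsilon\big)+p^1_j\big(\tfrac{x_1-1}\varepsilon,\tfrac{x_2}\varepsilon\big)\Big).$$ **Theorem.** There is a constant $C$ independent of $\varepsilon$ such that, for all $\varepsilon=1/n$, $$\|\hat u^k-u_\varepsilon\|_{H^1(D_\varepsilon)^2}\le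 C\varepsilon^{k+\frac32},\qquad \|\nabla\hat p^k-\nabla p_\varepsilon\|_{H^{-1}(D_\varepsilon)}\le C\varepsilon^{k+\frac32},$$ where the $H^{-1}$ norm is the norm dual to $\|\nabla\psi\|_{L^2(D_\varepsilon)}$ on $H^1_0(D_\varepsilon)^2$. -/

import Mathlib

open MeasureTheory Set TopologicalSpace
open scoped Distributions LineDeriv ContDiff ENNReal

noncomputable section

namespace ThinChannel

/-! ### Domains -/

/-- The thin channel `D_ε = (0,1) × (-ε/2, ε/2)`. -/
def channel (ε : ℝ) : Opens (ℝ × ℝ) :=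
  ⟨Ioo 0 1 ×ˢ Ioo (-(ε / 2)) (ε / 2), isOpen_Ioo.prod isOpen_Ioo⟩

/-- The half-strip `Π⁺ = (0,∞) × (-1/2, 1/2)`. -/
def stripPos : Opens (ℝ × ℝ) :=
  ⟨Ioi 0 ×ˢ Ioo (-(1 / 2)) (1 / 2), isOpen_Ioi.prod isOpen_Ioo⟩

/-- The half-strip `Π⁻ = (-∞,0) × (-1/2, 1/2)`. -/
def stripNeg : Opens (ℝ × ℝ) :=
  ⟨Iio 0 ×ˢ Ioo (-(1 / 2)) (1 / 2), isOpen_Iio.prod isOpen_Ioo⟩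

/-! ### Sobolev spaces on an open subset of the plane -/

/-- The canonical basis of the plane. -/
def e : Fin 2 → ℝ × ℝ := ![(1, 0), (0, 1)]

/-- `g` is the `i`-th partial derivative of `v` on `Ω` in the sense of distributions. -/
def IsWeakPartial (Ω : Opens (ℝ × ℝ)) (i : Fin 2) (v g : ℝ × ℝ → ℝ) : Prop :=
  ∀ η : 𝓓(Ω, ℝ), ∫ x in Ω, v x * (∂_{e i} η) x = -∫ x in Ω, g x * η x

/-- `v ∈ H¹(Ω)`: `v` and its first weak derivatives are in `L²(Ω)`. -/
def MemH1 (Ω : Opens (ℝ × ℝ)) (v : ℝ × ℝ → ℝ) : Prop :=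
  MemLp v 2 (volume.restrict Ω) ∧
    ∀ i, ∃ g, MemLp g 2 (volume.restrict Ω) ∧ IsWeakPartial Ω i v g

open Classical in
/-- The `i`-th weak derivative in `L²(Ω)` (determined almost everywhere on `Ω`); it is `0` by
convention when there is none, which does not happen for `v ∈ H¹(Ω)`. -/
def weakPartial (Ω : Opens (ℝ × ℝ)) (i : Fin 2) (v : ℝ × ℝ → ℝ) : ℝ × ℝ → ℝ :=
  if h : ∃ g, MemLp g 2 (volume.restrict Ω) ∧ IsWeakPartial Ω i v g then h.choose else 0

/-- The square of the `H¹(Ω)` norm of `v ∈ H¹(Ω)`. -/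
def h1NormSq (Ω : Opens (ℝ × ℝ)) (v : ℝ × ℝ → ℝ) : ℝ≥0∞ :=
  eLpNorm v 2 (volume.restrict Ω) ^ 2 +
    ∑ i, eLpNorm (weakPartial Ω i v) 2 (volume.restrict Ω) ^ 2

/-- The norm of a vector field in `(H¹(Ω))²`. -/
def h1Norm (Ω : Opens (ℝ × ℝ)) (u : Fin 2 → ℝ × ℝ → ℝ) : ℝ≥0∞ :=
  (∑ i, h1NormSq Ω (u i)) ^ (1 / 2 : ℝ)

/-- `v ∈ H¹₀(Ω)`: `v` lies in the closure of the test functions in `H¹(Ω)`. -/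
def MemH10 (Ω : Opens (ℝ × ℝ)) (v : ℝ × ℝ → ℝ) : Prop :=
  MemH1 Ω v ∧ ∀ δ : ℝ≥0∞, 0 < δ → ∃ η : 𝓓(Ω, ℝ), h1NormSq Ω (fun x => v x - η x) < δ

/-- `v ∈ H¹(Ω)` takes the (continuous) boundary values `g` on `∂Ω`, in the sense of traces:
`v` differs by an element of `H¹₀(Ω)` from a function of `H¹(Ω)` that is continuous on the closure
of `Ω` and equal to `g` on the boundary. -/
def HasBoundaryValue (Ω : Opens (ℝ × ℝ)) (v g : ℝ × ℝ → ℝ) : Prop :=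
  ∃ G : ℝ × ℝ → ℝ, ContinuousOn G (closure Ω) ∧ MemH1 Ω G ∧ EqOn G g (frontier Ω) ∧
    MemH10 Ω (fun x => v x - G x)

/-- The vector field `u` is divergence free on `Ω`. -/
def DivFree (Ω : Opens (ℝ × ℝ)) (u : Fin 2 → ℝ × ℝ → ℝ) : Prop :=
  ∀ᵐ x ∂volume.restrict (Ω : Set (ℝ × ℝ)), ∑ i, weakPartial Ω i (u i) x = 0

/-- The space `H(Ω)` of divergence free fields in `(H¹₀(Ω))²`. -/
def MemH (Ω : Opens (ℝ × ℝ)) (ψ : Fin 2 → ℝ × ℝ → ℝ) : Prop :=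
  (∀ i, MemH10 Ω (ψ i)) ∧ DivFree Ω ψ

/-- The symmetric gradient `(𝒟u)ᵢⱼ = (∂ⱼuᵢ + ∂ᵢuⱼ)/2`. -/
def symGrad (Ω : Opens (ℝ × ℝ)) (u : Fin 2 → ℝ × ℝ → ℝ) (i j : Fin 2) (x : ℝ × ℝ) : ℝ :=
  (weakPartial Ω j (u i) x + weakPartial Ω i (u j) x) / 2

/-- The distribution on `Ω` defined by a locally integrable function. -/
def toDistribution (Ω : Opens (ℝ × ℝ)) (p : ℝ × ℝ → ℝ) : Distribution Ω ℝ ⊤ :=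
  (TestFunction.integralAgainstBilinCLM (ContinuousLinearMap.mul ℝ ℝ) volume p :
    𝓓(Ω, ℝ) →L[ℝ] ℝ)

/-- The gradient of a distribution. -/
def grad {Ω : Opens (ℝ × ℝ)} (p : Distribution Ω ℝ ⊤) : Fin 2 → Distribution Ω ℝ ⊤ :=
  fun i => ∂_{e i} p

/-- The norm in `(H⁻¹(Ω))²` of a vector of distributions, by duality with `(H¹₀(Ω))²` normed by
`‖∇ψ‖_{L²(Ω)}` (it suffices to test on the dense subspace of test functions). It is infinite if the
distribution is not in `H⁻¹`. -/
def hMinusOneNorm {Ω : Opens (ℝ × ℝ)} (T : Fin 2 → Distribution Ω ℝ ⊤) : ℝ≥0∞ :=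
  ⨆ ψ : Fin 2 → 𝓓(Ω, ℝ),
    ENNReal.ofReal |∑ i, T i (ψ i)| /
      (∑ i, ∑ j, eLpNorm (fun x => (∂_{e j} (ψ i)) x) 2 (volume.restrict Ω) ^ 2) ^ (1 / 2 : ℝ)

/-! ### The exact problem -/

/-- The boundary velocity: `ε² φ₀(x₂/ε) e₁` on `x₁ = 0`, `ε² φ₁(x₂/ε) e₁` on `x₁ = 1`, and `0` on
the lateral boundary. -/
def channelData (ε : ℝ) (φ₀ φ₁ : ℝ → ℝ) (i : Fin 2) (x : ℝ × ℝ) : ℝ :=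
  if i = 0 then
    if x.1 = 0 then ε ^ 2 * φ₀ (x.2 / ε) else if x.1 = 1 then ε ^ 2 * φ₁ (x.2 / ε) else 0
  else 0

/-- `(u, p)` is the solution of the Stokes problem
`-div(ν(x₁) 𝒟u) + ∇p = f₁(x₁) e₁`, `div u = 0` in `D_ε`, with the boundary values `channelData`:
`u` is the weak solution and `p` is a distribution for which the first equation holds in the sense
of distributions. -/
structure IsStokesSolution (ε : ℝ) (ν f₁ φ₀ φ₁ : ℝ → ℝ) (u : Fin 2 → ℝ × ℝ → ℝ)
    (p : Distribution (channel ε) ℝ ⊤) : Prop where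
  memH1 : ∀ i, MemH1 (channel ε) (u i)
  divFree : DivFree (channel ε) u
  boundary : ∀ i, HasBoundaryValue (channel ε) (u i) (channelData ε φ₀ φ₁ i)
  weak : ∀ ψ, MemH (channel ε) ψ →
    ∫ x in channel ε, ν x.1 * ∑ i, ∑ j, symGrad (channel ε) u i j x * symGrad (channel ε) ψ i j x
      = ∫ x in channel ε, f₁ x.1 * ψ 0 x
  momentum : ∀ ψ : Fin 2 → 𝓓(channel ε, ℝ),
    (∫ x in channel ε, ν x.1 * ∑ i, ∑ j, symGrad (channel ε) u i j x * (∂_{e j} (ψ i)) x)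
      + ∑ i, grad p i (ψ i) = ∫ x in channel ε, f₁ x.1 * ψ 0 x

/-! ### The regular ansatz -/

/-- The coefficients `u_{1,j}(x₁,ξ₂)`, `u_{2,j}(x₁,ξ₂)`, `p_j(x₁,ξ₂)`, `q_j(x₁)` of the regular
ansatz. -/
structure RegularCoeffs where
  u₁ : ℕ → ℝ × ℝ → ℝ
  u₂ : ℕ → ℝ × ℝ → ℝ
  p : ℕ → ℝ × ℝ → ℝ
  q : ℕ → ℝ → ℝ

/-- The term `a_{j-s}` of a family of functions, with `a_m = 0` for `m < 0`. -/
def lag (a : ℕ → ℝ × ℝ → ℝ) (s j : ℕ) : ℝ × ℝ → ℝ := if s ≤ j then a (j - s) else 0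

/-- The classical partial derivative in the first variable. -/
def d₁ (g : ℝ × ℝ → ℝ) (x : ℝ × ℝ) : ℝ := deriv (fun t => g (t, x.2)) x.1

/-- The classical partial derivative in the second variable. -/
def d₂ (g : ℝ × ℝ → ℝ) (x : ℝ × ℝ) : ℝ := deriv (fun t => g (x.1, t)) x.2

/-- The coefficients of the regular ansatz up to order `k` solve, for `j ≤ k` and in the classical
sense, the equations obtained by equating the powers of `ε` in the Stokes system, with no slip on
the lateral boundary, mean zero `p_j`, and the flux condition at the left end. -/
structure IsRegularAnsatz (ν f₁ φ₀ : ℝ → ℝ) (k : ℕ) (R : RegularCoeffs) : Prop where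
  contDiff_u₁ : ∀ j ≤ k, ContDiffOn ℝ 2 (R.u₁ j) (Icc 0 1 ×ˢ Icc (-(1 / 2)) (1 / 2))
  contDiff_u₂ : ∀ j ≤ k, ContDiffOn ℝ 2 (R.u₂ j) (Icc 0 1 ×ˢ Icc (-(1 / 2)) (1 / 2))
  contDiff_p : ∀ j ≤ k, ContDiffOn ℝ 1 (R.p j) (Icc 0 1 ×ˢ Icc (-(1 / 2)) (1 / 2))
  contDiff_q : ∀ j ≤ k, ContDiffOn ℝ 1 (R.q j) (Icc 0 1)
  momentum₁ : ∀ j ≤ k, ∀ x ∈ Ioo (0 : ℝ) 1 ×ˢ Ioo (-(1 / 2) : ℝ) (1 / 2),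
    -d₁ (fun y => ν y.1 * d₁ (lag R.u₁ 2 j) y) x - ν x.1 / 2 * d₂ (d₂ (R.u₁ j)) x
      - ν x.1 / 2 * d₂ (d₁ (lag R.u₂ 2 j)) x + d₁ (lag R.p 1 j) x + deriv (R.q j) x.1
      = if j = 0 then f₁ x.1 else 0
  momentum₂ : ∀ j ≤ k, ∀ x ∈ Ioo (0 : ℝ) 1 ×ˢ Ioo (-(1 / 2) : ℝ) (1 / 2),
    1 / 2 * d₁ (fun y => ν y.1 * (d₂ (lag R.u₁ 1 j) y + d₁ (lag R.u₂ 3 j) y)) x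
      + ν x.1 * d₂ (d₂ (lag R.u₂ 1 j)) x - d₂ (R.p j) x = 0
  incompressible : ∀ j ≤ k, ∀ x ∈ Ioo (0 : ℝ) 1 ×ˢ Ioo (-(1 / 2) : ℝ) (1 / 2),
    d₁ (R.u₁ j) x + d₂ (R.u₂ j) x = 0
  noSlip : ∀ j ≤ k, ∀ t ∈ Icc (0 : ℝ) 1,
    R.u₁ j (t, -(1 / 2)) = 0 ∧ R.u₁ j (t, 1 / 2) = 0 ∧
      R.u₂ j (t, -(1 / 2)) = 0 ∧ R.u₂ j (t, 1 / 2) = 0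
  mean_p : ∀ j ≤ k, ∀ t ∈ Icc (0 : ℝ) 1, ∫ ξ in (-(1 / 2) : ℝ)..(1 / 2), R.p j (t, ξ) = 0
  flux : ∀ j ≤ k,
    ∫ ξ in (-(1 / 2) : ℝ)..(1 / 2), ((if j = 0 then φ₀ ξ else 0) - R.u₁ j (0, ξ)) = 0

/-- The regular part `u^k` of the velocity. -/
def regularVelocity (ε : ℝ) (k : ℕ) (R : RegularCoeffs) : Fin 2 → ℝ × ℝ → ℝ :=
  ![fun x => ∑ j ∈ Finset.range (k + 1), ε ^ (j + 2) * R.u₁ j (x.1, x.2 / ε),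
    fun x => ∑ j ∈ Finset.range (k + 1), ε ^ (j + 3) * R.u₂ j (x.1, x.2 / ε)]

/-- The regular part `p^k` of the pressure. -/
def regularPressure (ε : ℝ) (k : ℕ) (R : RegularCoeffs) (x : ℝ × ℝ) : ℝ :=
  ∑ j ∈ Finset.range (k + 1), ε ^ (j + 1) * R.p j (x.1, x.2 / ε)
    + ∑ j ∈ Finset.range (k + 1), ε ^ j * R.q j x.1

/-! ### The boundary layer correctors -/

/-- The coefficients `u_j(ξ)`, `p_j(ξ)` of a boundary layer corrector. -/
structure LayerCoeffs where
  u : ℕ → Fin 2 → ℝ × ℝ → ℝ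
  p : ℕ → ℝ × ℝ → ℝ

/-- The boundary velocity of the `j`-th boundary layer at the end `x₁ = a` of the channel:
`φ δ_{j0} e₁ - (u_{1,j}(a,ξ₂), u_{2,j-1}(a,ξ₂))` on `ξ₁ = 0`, and `0` on the lateral boundary. -/
def layerData (a : ℝ) (φ : ℝ → ℝ) (R : RegularCoeffs) (j : ℕ) (i : Fin 2) (ξ : ℝ × ℝ) : ℝ :=
  if ξ.1 = 0 then
    (if j = 0 ∧ i = 0 then φ ξ.2 else 0) - ![R.u₁ j (a, ξ.2), lag R.u₂ 1 j (a, ξ.2)] i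
  else 0

/-- `(u, p)` is a (weak, finite energy) solution of the boundary layer problem
`-(ν₀/2) Δu + ∇p = 0`, `div u = 0` in the half-strip `Ω`, `u = g` on the boundary of `Ω`. The
condition `u → 0` at infinity is expressed by `u ∈ H¹(Ω)`. -/
structure IsLayer (Ω : Opens (ℝ × ℝ)) (ν₀ : ℝ) (g u : Fin 2 → ℝ × ℝ → ℝ) (p : ℝ × ℝ → ℝ) :
    Prop where
  memH1 : ∀ i, MemH1 Ω (u i)
  divFree : DivFree Ω u
  boundary : ∀ i, HasBoundaryValue Ω (u i) (g i)
  weak : ∀ ψ, MemH Ω ψ →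
    ∫ ξ in Ω, ν₀ / 2 * ∑ i, ∑ j, weakPartial Ω j (u i) ξ * weakPartial Ω j (ψ i) ξ = 0
  locallyIntegrable : LocallyIntegrableOn p Ω
  momentum : ∀ ψ : Fin 2 → 𝓓(Ω, ℝ),
    (∫ ξ in Ω, ν₀ / 2 * ∑ i, ∑ j, weakPartial Ω j (u i) ξ * (∂_{e j} (ψ i)) ξ)
      + ∑ i, grad (toDistribution Ω p) i (ψ i) = 0

/-- The velocity `u_{BL}^k` of a boundary layer corrector, in the fast variables. -/
def layerVelocity (ε : ℝ) (k : ℕ) (B : LayerCoeffs) (i : Fin 2) (ξ : ℝ × ℝ) : ℝ :=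
  ∑ j ∈ Finset.range (k + 1), ε ^ (j + 2) * B.u j i ξ

/-- The pressure `p_{BL}^k` of a boundary layer corrector, in the fast variables. -/
def layerPressure (ε : ℝ) (k : ℕ) (B : LayerCoeffs) (ξ : ℝ × ℝ) : ℝ :=
  ∑ j ∈ Finset.range (k + 1), ε ^ (j + 1) * B.p j ξ

/-! ### The asymptotic solution -/

/-- The asymptotic velocity `û^k`: the regular part plus the two boundary layer correctors. -/
def asymptVelocity (ε : ℝ) (k : ℕ) (R : RegularCoeffs) (B₀ B₁ : LayerCoeffs) (i : Fin 2)
    (x : ℝ × ℝ) : ℝ :=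
  regularVelocity ε k R i x + layerVelocity ε k B₀ i (x.1 / ε, x.2 / ε)
    + layerVelocity ε k B₁ i ((x.1 - 1) / ε, x.2 / ε)

/-- The asymptotic pressure: the regular part plus the two boundary layer correctors. -/
def asymptPressure (ε : ℝ) (k : ℕ) (R : RegularCoeffs) (B₀ B₁ : LayerCoeffs) (x : ℝ × ℝ) : ℝ :=
  regularPressure ε k R x + layerPressure ε k B₀ (x.1 / ε, x.2 / ε)
    + layerPressure ε k B₁ ((x.1 - 1) / ε, x.2 / ε)

end ThinChannel

end

/-! ### Weak derivatives in the plane, extension by zero and membership in H¹₀. -/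

noncomputable section

namespace ThinChannel

/-! ### Square integrable functions -/

section L2

variable {α : Type*} [MeasurableSpace α] {μ : Measure α} {f g b : α → ℝ}

/-! The estimate is an energy estimate for an approximate solution all of whose defects have L² size
ε^(k+1) √ε = ε^(k+3/2). Three defects occur.

The regular ansatz cancels the powers of ε up to ε^k in the momentum equation, so its residual is
O(ε^(k+1)) pointwise; as the channel has area ε, this is O(ε^(k+1) √ε) in L²
(`IsRegularAnsatz.exists_residual`).

The boundary layers solve a Stokes equation with viscosity ν₀ instead of ν₀ + ν₁. Since ν₁ vanishes
near both ends, the discrepancy involves only the part of each layer at a fixed distance from its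
end, that is, at distance of order 1/ε in the fast variables. There the layer is smaller than every
power of ε.

The boundary values do not match exactly. The layer of index j corrects the transversal velocity of
index j-1, so ε^(k+3) u_{2,k} is left over at the ends; an explicit solenoidal field removes it
(`IsRegularAnsatz.exists_lift`). Moreover each layer has a small trace at the opposite end; cutting
it off there removes the trace at a negligible cost (`exists_endApprox`).

After these corrections the error z is divergence free and lies in H¹₀, hence is admissible in the
weak formulation, and the pressures disappear. For solenoidal z in H¹₀ the transposed part of the
gradient integrates to zero, so that the symmetric gradient controls the full one with an explicit
constant (`MemH.korn`), and Poincaré's inequality across the channel controls z itself. The same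
observation identifies the form of -(ν₀/2)Δ with the symmetric form, which makes the layers
compatible with the exact problem (`sform_const`). The bound for the pressure follows by testing the
same equation with fields that need not be solenoidal: the gradient of the pressure error is
expressed through quantities already estimated.

The decay of the layers is a Saint-Venant argument. A square integrable solenoidal field on a
half-strip that vanishes on the walls has zero flux, hence a stream function Ψ vanishing on both
walls (`DivFreeStrip.exists_stream`). Multiplying Ψ, rather than the velocity, by a cutoff c(x₁)
gives solenoidal test fields, and no estimate of the pressure is needed. The energy E(t) beyond the
section at distance t then satisfies E(t+2) ≤ 5M (E(t) - E(t+2)), which forces geometric decay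
(`StripFlow.geomDecay_grad`). The same multiplication of Ψ cuts off the layers in the channel.

Since H¹₀ is the closure of the test functions and boundary values are given through continuous
representatives, two facts about flat boundaries link the definitions to the argument: a continuous
H¹ function that vanishes on a coordinate line has no singular derivative there (`Sob.remove_wall`),
and an H¹ function of the plane that vanishes off an open rectangle lies in H¹₀ of it
(`Sob.memH10`). -/

theorem integrable_mul_of_memLp (hf : MemLp f 2 μ) (hg : MemLp g 2 μ) :
    Integrable (fun x => f x * g x) μ := hf.integrable_mul hg

theorem integrable_fun_add (hf : Integrable f μ) (hg : Integrable g μ) :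
    Integrable (fun x => f x + g x) μ := hf.add hg

theorem memLp_bdd_mul {p : ℝ≥0∞} {C : ℝ} (hb : AEStronglyMeasurable b μ)
    (hC : ∀ᵐ x ∂μ, |b x| ≤ C) (hf : MemLp f p μ) : MemLp (fun x => b x * f x) p μ := by
  refine hf.of_le_mul (c := C) (hb.mul hf.1) ?_
  filter_upwards [hC] with x hx
  rw [norm_mul]
  exact mul_le_mul_of_nonneg_right hx (norm_nonneg _)

/-- The `L²` norm as a real number. -/
def nrm (μ : Measure α) (f : α → ℝ) : ℝ := (eLpNorm f 2 μ).toReal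

theorem nrm_nonneg : 0 ≤ nrm μ f := ENNReal.toReal_nonneg

theorem nrm_congr (h : f =ᵐ[μ] g) : nrm μ f = nrm μ g := by rw [nrm, nrm, eLpNorm_congr_ae h]

theorem ofReal_nrm (hf : MemLp f 2 μ) : ENNReal.ofReal (nrm μ f) = eLpNorm f 2 μ :=
  ENNReal.ofReal_toReal hf.2.ne

theorem nrm_le_iff (hf : MemLp f 2 μ) {C : ℝ} (hC : 0 ≤ C) :
    nrm μ f ≤ C ↔ eLpNorm f 2 μ ≤ ENNReal.ofReal C := by
  rw [nrm, ENNReal.le_ofReal_iff_toReal_le hf.2.ne hC]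

theorem nrm_sq (hf : MemLp f 2 μ) : nrm μ f ^ 2 = ∫ x, f x ^ 2 ∂μ := by
  rw [nrm, hf.eLpNorm_eq_integral_rpow_norm (by simp) (by simp),
    ENNReal.toReal_ofReal (by positivity)]
  have h0 : 0 ≤ ∫ x, f x ^ 2 ∂μ := integral_nonneg fun x => sq_nonneg _
  simp only [ENNReal.toReal_ofNat, Real.rpow_ofNat, Real.norm_eq_abs, sq_abs]
  rw [← Real.rpow_natCast, ← Real.rpow_mul h0]
  norm_num

theorem abs_integral_mul_le (hf : MemLp f 2 μ) (hg : MemLp g 2 μ) :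
    |∫ x, f x * g x ∂μ| ≤ nrm μ f * nrm μ g := by
  have h := integral_mul_norm_le_Lp_mul_Lq (μ := μ) (f := f) (g := g) (p := 2) (q := 2)
    Real.HolderConjugate.two_two (by simpa using hf) (by simpa using hg)
  have e : ∀ {f : α → ℝ}, MemLp f 2 μ → (∫ x, ‖f x‖ ^ (2 : ℝ) ∂μ) ^ (1 / (2 : ℝ)) = nrm μ f := by
    intro f hf
    rw [← Real.sqrt_eq_rpow, ← Real.sqrt_sq (nrm_nonneg (μ := μ) (f := f)), nrm_sq hf]
    simp
  rw [e hf, e hg] at h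
  refine le_trans ?_ h
  refine (norm_integral_le_integral_norm fun x => f x * g x).trans (le_of_eq ?_)
  simp

theorem nrm_add_le (hf : MemLp f 2 μ) (hg : MemLp g 2 μ) :
    nrm μ (fun x => f x + g x) ≤ nrm μ f + nrm μ g := by
  rw [nrm, nrm, nrm, ← ENNReal.toReal_add hf.2.ne hg.2.ne]
  exact ENNReal.toReal_mono (ENNReal.add_ne_top.2 ⟨hf.2.ne, hg.2.ne⟩)
    (eLpNorm_add_le hf.1 hg.1 (by simp))

theorem nrm_const_mul (c : ℝ) : nrm μ (fun x => c * f x) = |c| * nrm μ f := by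
  have := eLpNorm_const_smul c f 2 μ
  rw [nrm, nrm, show (fun x => c * f x) = c • f from rfl, this]
  simp

theorem nrm_sub_le (hf : MemLp f 2 μ) (hg : MemLp g 2 μ) :
    nrm μ (fun x => f x - g x) ≤ nrm μ f + nrm μ g := by
  have := nrm_add_le hf (hg.const_mul (-1))
  rw [nrm_const_mul] at this
  simpa [sub_eq_add_neg] using this

theorem nrm_le_of_abs_le (hg : MemLp g 2 μ) (h : ∀ᵐ x ∂μ, |f x| ≤ |g x|) : nrm μ f ≤ nrm μ g :=
  ENNReal.toReal_mono hg.2.ne (eLpNorm_mono_ae h)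

theorem nrm_bdd_mul_le {C : ℝ} (hC0 : 0 ≤ C) (hC : ∀ᵐ x ∂μ, |b x| ≤ C) (hf : MemLp f 2 μ) :
    nrm μ (fun x => b x * f x) ≤ C * nrm μ f := by
  rw [← abs_of_nonneg hC0, ← nrm_const_mul]
  refine nrm_le_of_abs_le (hf.const_mul C) ?_
  filter_upwards [hC] with x hx
  rw [abs_mul, abs_mul, abs_of_nonneg hC0]
  exact mul_le_mul_of_nonneg_right hx (abs_nonneg _)

theorem memLp_finset_sum' {ι : Type*} (s : Finset ι) {F : ι → α → ℝ}
    (h : ∀ j ∈ s, MemLp (F j) 2 μ) : MemLp (fun x => ∑ j ∈ s, F j x) 2 μ :=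
  memLp_finsetSum s h

theorem nrm_sum_le {ι : Type*} (s : Finset ι) {F : ι → α → ℝ} (h : ∀ j ∈ s, MemLp (F j) 2 μ) :
    nrm μ (fun x => ∑ j ∈ s, F j x) ≤ ∑ j ∈ s, nrm μ (F j) := by
  classical
  induction s using Finset.induction_on with
  | empty => simp [nrm]
  | insert a s ha ih =>
    simp only [Finset.sum_insert ha]
    have hs : ∀ j ∈ s, MemLp (F j) 2 μ := fun j hj => h j (by simp [hj])
    exact (nrm_add_le (h a (by simp)) (memLp_finset_sum' s hs)).trans
      (add_le_add_right (ih hs) _)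

end L2

/-! ### Test functions -/

/-- `η` is a smooth function with compact support in `U`. -/
structure IsTest (U : Set (ℝ × ℝ)) (η : ℝ × ℝ → ℝ) : Prop where
  smooth : ContDiff ℝ ∞ η
  compact : HasCompactSupport η
  supp : tsupport η ⊆ U

/-- The `i`-th partial derivative of a differentiable function. -/
def pd (i : Fin 2) (η : ℝ × ℝ → ℝ) (x : ℝ × ℝ) : ℝ := fderiv ℝ η x (e i)

theorem tsupport_pd_subset (i : Fin 2) (η : ℝ × ℝ → ℝ) : tsupport (pd i η) ⊆ tsupport η := by
  refine closure_minimal ?_ isClosed_closure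
  intro x hx
  by_contra h
  refine hx ?_
  have : x ∉ tsupport (fderiv ℝ η) := fun h' => h (tsupport_fderiv_subset ℝ h')
  simp [pd, image_eq_zero_of_notMem_tsupport this]

theorem contDiff_pd {i : Fin 2} {η : ℝ × ℝ → ℝ} (h : ContDiff ℝ ∞ η) : ContDiff ℝ ∞ (pd i η) :=
  (h.fderiv_right (m := ∞) (by simp)).clm_apply contDiff_const

theorem pd_mul {i : Fin 2} {a η : ℝ × ℝ → ℝ} {x : ℝ × ℝ} (ha : DifferentiableAt ℝ a x)
    (hη : DifferentiableAt ℝ η x) :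
    pd i (fun y => a y * η y) x = a x * pd i η x + pd i a x * η x := by
  simp only [pd]
  rw [fderiv_fun_mul ha hη]
  simp [mul_comm]

namespace IsTest

variable {U V : Set (ℝ × ℝ)} {η : ℝ × ℝ → ℝ}

theorem mono (h : IsTest U η) (hUV : U ⊆ V) : IsTest V η := ⟨h.1, h.2, h.3.trans hUV⟩

theorem der (h : IsTest U η) (i : Fin 2) : IsTest U (pd i η) :=
  ⟨contDiff_pd h.1, h.2.mono' ((subset_tsupport _).trans (tsupport_pd_subset i η)),
    (tsupport_pd_subset i η).trans h.3⟩

theorem continuous (h : IsTest U η) : Continuous η := h.1.continuous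

theorem differentiable (h : IsTest U η) : Differentiable ℝ η := h.1.differentiable (by simp)

theorem memLp (h : IsTest U η) (p : ℝ≥0∞) (μ : Measure (ℝ × ℝ)) [IsFiniteMeasureOnCompacts μ] :
    MemLp η p μ :=
  h.continuous.memLp_of_hasCompactSupport h.2

theorem eq_zero (h : IsTest U η) {x : ℝ × ℝ} (hx : x ∉ U) : η x = 0 :=
  image_eq_zero_of_notMem_tsupport fun h' => hx (h.3 h')

theorem bounded (h : IsTest U η) : ∃ C, ∀ x, |η x| ≤ C :=
  h.continuous.bounded_above_of_compact_support h.2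

/-- Multiplication by a smooth function, localizing the support. -/
theorem mul_left (h : IsTest U η) {a : ℝ × ℝ → ℝ} (ha : ContDiff ℝ ∞ a)
    (hV : tsupport a ∩ U ⊆ V) : IsTest V (fun x => a x * η x) :=
  ⟨ha.mul h.1, h.2.mul_left, fun _ hx =>
    hV ⟨tsupport_mul_subset_left hx, h.3 (tsupport_mul_subset_right hx)⟩⟩

theorem mul (h : IsTest U η) {a : ℝ × ℝ → ℝ} (ha : ContDiff ℝ ∞ a) :
    IsTest U (fun x => a x * η x) := h.mul_left ha inter_subset_right

end IsTest

theorem isTest_testFunction {Ω : Opens (ℝ × ℝ)} (η : 𝓓(Ω, ℝ)) : IsTest Ω η :=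
  ⟨η.contDiff, η.hasCompactSupport, η.tsupport_subset⟩

/-- The bundled test function. -/
def IsTest.bundle {Ω : Opens (ℝ × ℝ)} {η : ℝ × ℝ → ℝ} (h : IsTest Ω η) : 𝓓(Ω, ℝ) :=
  ⟨η, h.1, h.2, h.3⟩

@[simp] theorem IsTest.coe_bundle {Ω : Opens (ℝ × ℝ)} {η : ℝ × ℝ → ℝ} (h : IsTest Ω η) :
    (h.bundle : ℝ × ℝ → ℝ) = η := rfl

theorem lineDeriv_eq_pd {Ω : Opens (ℝ × ℝ)} (η : 𝓓(Ω, ℝ)) (i : Fin 2) (x : ℝ × ℝ) :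
    (∂_{e i} η) x = pd i η x := by
  rw [TestFunction.lineDerivOp_eq_lineDerivCLM ℝ, TestFunction.lineDerivCLM_apply_of_le (by simp),
    ((isTest_testFunction η).differentiable x).lineDeriv_eq_fderiv, pd]

/-! ### Weak derivatives of functions on the plane -/

/-- `g` is the `i`-th weak derivative of `v` on `U`. -/
def HasWeak (U : Set (ℝ × ℝ)) (i : Fin 2) (v g : ℝ × ℝ → ℝ) : Prop :=
  ∀ η, IsTest U η → ∫ x, v x * pd i η x = -∫ x, g x * η x

/-- `v` and `g` are square integrable on the plane, and `g` is the weak gradient of `v` on `U`. -/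
structure Sob (U : Set (ℝ × ℝ)) (v : ℝ × ℝ → ℝ) (g : Fin 2 → ℝ × ℝ → ℝ) : Prop where
  memLp : MemLp v 2
  memLp_grad : ∀ i, MemLp (g i) 2
  weak : ∀ i, HasWeak U i v (g i)

theorem setIntegral_mul_eq {U : Set (ℝ × ℝ)} (hU : MeasurableSet U) (v w : ℝ × ℝ → ℝ) :
    ∫ x in U, v x * w x = ∫ x, U.indicator v x * w x := by
  rw [← integral_indicator hU]
  congr with x
  by_cases hx : x ∈ U <;> simp [hx]

theorem isWeakPartial_iff {Ω : Opens (ℝ × ℝ)} {i : Fin 2} {v g : ℝ × ℝ → ℝ} :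
    IsWeakPartial Ω i v g ↔
      HasWeak Ω i ((Ω : Set (ℝ × ℝ)).indicator v) ((Ω : Set (ℝ × ℝ)).indicator g) := by
  constructor
  · intro h η hη
    have := h hη.bundle
    simp only [lineDeriv_eq_pd, hη.coe_bundle] at this
    rwa [setIntegral_mul_eq Ω.isOpen.measurableSet, setIntegral_mul_eq Ω.isOpen.measurableSet]
      at this
  · intro h η
    simp only [lineDeriv_eq_pd]
    rw [setIntegral_mul_eq Ω.isOpen.measurableSet, setIntegral_mul_eq Ω.isOpen.measurableSet]
    exact h η (isTest_testFunction η)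

theorem HasWeak.congr {U : Set (ℝ × ℝ)} (hU : MeasurableSet U) {i : Fin 2} {v g v' g' : ℝ × ℝ → ℝ}
    (h : HasWeak U i v g) (hv : v =ᵐ[volume.restrict U] v') (hg : g =ᵐ[volume.restrict U] g') :
    HasWeak U i v' g' := by
  intro η hη
  rw [Filter.EventuallyEq, ae_restrict_iff' hU] at hv hg
  have h1 : ∫ x, v' x * pd i η x = ∫ x, v x * pd i η x := by
    refine integral_congr_ae ?_
    filter_upwards [hv] with x hx
    by_cases hxU : x ∈ U
    · simp [hx hxU]
    · simp [(hη.der i).eq_zero hxU]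
  have h2 : ∫ x, g' x * η x = ∫ x, g x * η x := by
    refine integral_congr_ae ?_
    filter_upwards [hg] with x hx
    by_cases hxU : x ∈ U
    · simp [hx hxU]
    · simp [hη.eq_zero hxU]
  rw [h1, h2, h η hη]

theorem HasWeak.mono {U V : Set (ℝ × ℝ)} {i : Fin 2} {v g : ℝ × ℝ → ℝ} (h : HasWeak V i v g)
    (hUV : U ⊆ V) : HasWeak U i v g := fun η hη => h η (hη.mono hUV)

/-- The fundamental lemma of the calculus of variations for `g - g'`. It makes the derivative
selected by `weakPartial` computable: any square integrable weak derivative agrees with it almost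
everywhere. -/
theorem HasWeak.unique {U : Set (ℝ × ℝ)} (hU : IsOpen U) {i : Fin 2} {v g g' : ℝ × ℝ → ℝ}
    (h : HasWeak U i v g) (h' : HasWeak U i v g') (hg : MemLp g 2) (hg' : MemLp g' 2) :
    g =ᵐ[volume.restrict U] g' := by
  rw [Filter.EventuallyEq, ae_restrict_iff' hU.measurableSet]
  have key := hU.ae_eq_zero_of_integral_contDiff_smul_eq_zero (f := fun x => g x - g' x)
    (μ := volume) (((hg.sub hg').locallyIntegrable (by simp)).locallyIntegrableOn U)
    (fun η h1 h2 h3 => ?_)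
  · filter_upwards [key] with x hx hxU
    exact sub_eq_zero.mp (hx hxU)
  · have hη : IsTest U η := ⟨h1, h2, h3⟩
    have e1 := h η hη
    have e2 := h' η hη
    have i1 : Integrable (fun x => g x * η x) := hg.integrable_mul (hη.memLp 2 _)
    have i2 : Integrable (fun x => g' x * η x) := hg'.integrable_mul (hη.memLp 2 _)
    have : ∀ x, η x • (g x - g' x) = g x * η x - g' x * η x := fun x => by
      simp only [smul_eq_mul]; ring
    simp only [this]
    rw [integral_sub i1 i2]
    linarith

theorem memLp_indicator {U : Set (ℝ × ℝ)} (hU : MeasurableSet U) {v : ℝ × ℝ → ℝ}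
    (hv : MemLp v 2 (volume.restrict U)) : MemLp (U.indicator v) 2 :=
  (memLp_indicator_iff_restrict hU).mpr hv

theorem weakPartial_spec {Ω : Opens (ℝ × ℝ)} {v : ℝ × ℝ → ℝ} (h : MemH1 Ω v) (i : Fin 2) :
    MemLp (weakPartial Ω i v) 2 (volume.restrict Ω) ∧ IsWeakPartial Ω i v (weakPartial Ω i v) := by
  have := h.2 i
  simp only [weakPartial, dif_pos this]
  exact this.choose_spec

theorem MemH1.sob {Ω : Opens (ℝ × ℝ)} {v : ℝ × ℝ → ℝ} (h : MemH1 Ω v) :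
    Sob Ω ((Ω : Set (ℝ × ℝ)).indicator v)
      (fun i => (Ω : Set (ℝ × ℝ)).indicator (weakPartial Ω i v)) :=
  ⟨memLp_indicator Ω.isOpen.measurableSet h.1,
    fun i => memLp_indicator Ω.isOpen.measurableSet (weakPartial_spec h i).1,
    fun i => isWeakPartial_iff.1 (weakPartial_spec h i).2⟩

/-- A function that agrees on `Ω` with one having a square integrable weak gradient on `Ω`. -/
theorem Sob.isWeakPartial {Ω : Opens (ℝ × ℝ)} {v v' : ℝ × ℝ → ℝ} {g : Fin 2 → ℝ × ℝ → ℝ}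
    (h : Sob Ω v' g) (hv : v' =ᵐ[volume.restrict Ω] v) (i : Fin 2) :
    IsWeakPartial Ω i v (g i) := by
  rw [isWeakPartial_iff]
  refine (h.weak i).congr Ω.isOpen.measurableSet ?_ ?_
  · exact hv.trans (indicator_ae_eq_restrict Ω.isOpen.measurableSet).symm
  · exact (indicator_ae_eq_restrict Ω.isOpen.measurableSet).symm

theorem Sob.memH1 {Ω : Opens (ℝ × ℝ)} {v v' : ℝ × ℝ → ℝ} {g : Fin 2 → ℝ × ℝ → ℝ}
    (h : Sob Ω v' g) (hv : v' =ᵐ[volume.restrict Ω] v) : MemH1 Ω v :=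
  ⟨(memLp_congr_ae hv).1 (h.memLp.restrict _), fun i =>
    ⟨g i, (h.memLp_grad i).restrict _, h.isWeakPartial hv i⟩⟩

theorem Sob.weakPartial_ae {Ω : Opens (ℝ × ℝ)} {v v' : ℝ × ℝ → ℝ} {g : Fin 2 → ℝ × ℝ → ℝ}
    (h : Sob Ω v' g) (hv : v' =ᵐ[volume.restrict Ω] v) (i : Fin 2) :
    weakPartial Ω i v =ᵐ[volume.restrict Ω] g i := by
  have hm := h.memH1 hv
  have h1 : HasWeak Ω i v' ((Ω : Set (ℝ × ℝ)).indicator (weakPartial Ω i v)) :=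
    (hm.sob.weak i).congr Ω.isOpen.measurableSet
      ((indicator_ae_eq_restrict Ω.isOpen.measurableSet).trans hv.symm) (ae_eq_refl _)
  exact (indicator_ae_eq_restrict Ω.isOpen.measurableSet).symm.trans
    (h1.unique Ω.isOpen (h.weak i) (hm.sob.memLp_grad i) (h.memLp_grad i))

namespace Sob

variable {U V : Set (ℝ × ℝ)} {v w : ℝ × ℝ → ℝ} {g k : Fin 2 → ℝ × ℝ → ℝ}

theorem mono (h : Sob V v g) (hUV : U ⊆ V) : Sob U v g :=
  ⟨h.1, h.2, fun i => (h.3 i).mono hUV⟩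

theorem congr (hU : MeasurableSet U) (h : Sob U v g) (hv : v =ᵐ[volume.restrict U] w)
    (hg : ∀ i, g i =ᵐ[volume.restrict U] k i) (hw : MemLp w 2) (hk : ∀ i, MemLp (k i) 2) :
    Sob U w k :=
  ⟨hw, hk, fun i => (h.3 i).congr hU hv (hg i)⟩

theorem add (h : Sob U v g) (h' : Sob U w k) :
    Sob U (fun x => v x + w x) (fun i x => g i x + k i x) := by
  refine ⟨h.1.add h'.1, fun i => (h.2 i).add (h'.2 i), fun i η hη => ?_⟩
  simp only [add_mul]
  rw [integral_add (integrable_mul_of_memLp h.1 ((hη.der i).memLp 2 _))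
    (integrable_mul_of_memLp h'.1 ((hη.der i).memLp 2 _)), integral_add
    (integrable_mul_of_memLp (h.2 i) (hη.memLp 2 _)) (integrable_mul_of_memLp (h'.2 i) (hη.memLp 2 _)),
    h.3 i η hη, h'.3 i η hη]
  ring

theorem const_mul (h : Sob U v g) (c : ℝ) :
    Sob U (fun x => c * v x) (fun i x => c * g i x) := by
  refine ⟨h.1.const_mul c, fun i => (h.2 i).const_mul c, fun i η hη => ?_⟩
  simp only [mul_assoc, integral_const_mul]
  rw [h.3 i η hη]
  ring

theorem sub (h : Sob U v g) (h' : Sob U w k) :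
    Sob U (fun x => v x - w x) (fun i x => g i x - k i x) := by
  have := h.add (h'.const_mul (-1))
  simpa [sub_eq_add_neg] using this

theorem zero : Sob U (fun _ => 0) (fun _ _ => 0) :=
  ⟨MemLp.zero, fun _ => MemLp.zero, fun i η _ => by simp⟩

theorem sum {ι : Type*} (s : Finset ι) {v : ι → ℝ × ℝ → ℝ} {g : ι → Fin 2 → ℝ × ℝ → ℝ}
    (h : ∀ j ∈ s, Sob U (v j) (g j)) :
    Sob U (fun x => ∑ j ∈ s, v j x) (fun i x => ∑ j ∈ s, g j i x) := by
  classical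
  induction s using Finset.induction_on with
  | empty => simpa using zero
  | insert a s ha ih =>
    simp only [Finset.sum_insert ha]
    exact (h a (by simp)).add (ih fun j hj => h j (by simp [hj]))

/-- Product with a smooth function, which may localize the domain. -/
theorem mul (h : Sob U v g) {a : ℝ × ℝ → ℝ} (ha : ContDiff ℝ ∞ a) (hV : tsupport a ∩ V ⊆ U)
    {C : ℝ} (hC : ∀ x, |a x| ≤ C) (hC' : ∀ i x, |pd i a x| ≤ C) :
    Sob V (fun x => a x * v x) (fun i x => a x * g i x + pd i a x * v x) := by
  have hbd : ∀ {b f : ℝ × ℝ → ℝ}, Continuous b → (∀ x, |b x| ≤ C) → MemLp f 2 →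
      MemLp (fun x => b x * f x) 2 := fun {b f} hb hbC hf =>
    memLp_bdd_mul (C := C) hb.aestronglyMeasurable (ae_of_all _ hbC) hf
  have hpa : ∀ i, Continuous (pd i a) := fun i => (contDiff_pd ha).continuous
  refine ⟨hbd ha.continuous hC h.1,
    fun i => (hbd ha.continuous hC (h.2 i)).add (hbd (hpa i) (hC' i) h.1), fun i η hη => ?_⟩
  have ht := hη.mul_left ha hV
  have h0 := h.3 i _ ht
  have had : Differentiable ℝ a := ha.differentiable (by simp)
  have hpd : ∀ x, v x * pd i (fun y => a y * η y) x
      = a x * v x * pd i η x + pd i a x * v x * η x := fun x => by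
    rw [pd_mul (had x) (hη.differentiable x)]; ring
  simp only [hpd] at h0
  rw [integral_add (integrable_mul_of_memLp (hbd ha.continuous hC h.1) ((hη.der i).memLp 2 _))
    (integrable_mul_of_memLp (hbd (hpa i) (hC' i) h.1) (hη.memLp 2 _))] at h0
  simp only [add_mul]
  rw [integral_add (integrable_mul_of_memLp (hbd ha.continuous hC (h.2 i)) (hη.memLp 2 _))
    (integrable_mul_of_memLp (hbd (hpa i) (hC' i) h.1) (hη.memLp 2 _))]
  have : ∀ x, g i x * (a x * η x) = a x * g i x * η x := fun x => by ring
  simp only [this] at h0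
  linarith

end Sob

end ThinChannel

end

noncomputable section

namespace ThinChannel

open Filter Topology

/-! ### Functions vanishing on the boundary -/

theorem IsTest.sob {U V : Set (ℝ × ℝ)} {η : ℝ × ℝ → ℝ} (h : IsTest U η) :
    Sob V η (fun i => pd i η) := by
  refine ⟨h.memLp 2 _, fun i => (h.der i).memLp 2 _, fun i ζ hζ => ?_⟩
  exact integral_mul_fderiv_eq_neg_fderiv_mul_of_integrable
    (integrable_mul_of_memLp ((h.der i).memLp 2 _) (hζ.memLp 2 _))
    (integrable_mul_of_memLp (h.memLp 2 _) ((hζ.der i).memLp 2 _))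
    (integrable_mul_of_memLp (h.memLp 2 _) (hζ.memLp 2 _))
    (fun x _ => h.differentiable x) (fun x _ => hζ.differentiable x)

theorem h1NormSq_eq {Ω : Opens (ℝ × ℝ)} {v : ℝ × ℝ → ℝ} (h : MemH1 Ω v) :
    h1NormSq Ω v = ENNReal.ofReal (nrm (volume.restrict Ω) v ^ 2 +
      ∑ i, nrm (volume.restrict Ω) (weakPartial Ω i v) ^ 2) := by
  rw [h1NormSq, ENNReal.ofReal_add (sq_nonneg _) (Finset.sum_nonneg fun i _ => sq_nonneg _),
    ENNReal.ofReal_sum_of_nonneg (fun i _ => sq_nonneg _), ENNReal.ofReal_pow nrm_nonneg,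
    ofReal_nrm h.1]
  congr 1
  refine Finset.sum_congr rfl fun i _ => ?_
  rw [ENNReal.ofReal_pow nrm_nonneg, ofReal_nrm (weakPartial_spec h i).1]

theorem MemH1.sub_test {Ω : Opens (ℝ × ℝ)} {v η : ℝ × ℝ → ℝ} (h : MemH1 Ω v) (hη : IsTest Ω η) :
    MemH1 Ω (fun x => v x - η x) ∧ ∀ i, weakPartial Ω i (fun x => v x - η x)
      =ᵐ[volume.restrict Ω] fun x => weakPartial Ω i v x - pd i η x := by
  have h1 := h.sob.sub (hη.sob (V := Ω))
  have h2 : (fun x => (Ω : Set (ℝ × ℝ)).indicator v x - η x)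
      =ᵐ[volume.restrict Ω] fun x => v x - η x := by
    filter_upwards [indicator_ae_eq_restrict (f := v) Ω.isOpen.measurableSet] with x hx
    rw [hx]
  refine ⟨h1.memH1 h2, fun i => (h1.weakPartial_ae h2 i).trans ?_⟩
  filter_upwards [indicator_ae_eq_restrict (f := weakPartial Ω i v) Ω.isOpen.measurableSet]
    with x hx
  rw [hx]

theorem memH10_iff {Ω : Opens (ℝ × ℝ)} {v : ℝ × ℝ → ℝ} :
    MemH10 Ω v ↔ MemH1 Ω v ∧ ∀ δ : ℝ, 0 < δ → ∃ η, IsTest Ω η ∧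
      nrm (volume.restrict Ω) (fun x => v x - η x) ≤ δ ∧
      ∀ i, nrm (volume.restrict Ω) (fun x => weakPartial Ω i v x - pd i η x) ≤ δ := by
  refine and_congr_right fun hv => ⟨fun h δ hδ => ?_, fun h δ hδ => ?_⟩
  · obtain ⟨η, hη⟩ := h (ENNReal.ofReal (δ ^ 2)) (by positivity)
    have ht := isTest_testFunction η
    obtain ⟨h1, h2⟩ := hv.sub_test ht
    refine ⟨η, ht, ?_⟩
    rw [h1NormSq_eq h1, ENNReal.ofReal_lt_ofReal_iff (by positivity)] at hη
    have hs : ∀ i, 0 ≤ nrm (volume.restrict Ω) (weakPartial Ω i fun x => v x - η x) ^ 2 :=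
      fun i => sq_nonneg _
    rw [Fin.sum_univ_two] at hη
    have h0 := sq_nonneg (nrm (volume.restrict (Ω : Set (ℝ × ℝ))) (fun x => v x - η x))
    refine ⟨abs_le_of_sq_le_sq' (by linarith [hs 0, hs 1]) hδ.le |>.2, fun i => ?_⟩
    rw [← nrm_congr (h2 i)]
    refine abs_le_of_sq_le_sq' ?_ hδ.le |>.2
    fin_cases i
    · simp only [Fin.zero_eta]; linarith [hs 0, hs 1]
    · simp only [Fin.mk_one]; linarith [hs 0, hs 1]
  · obtain ⟨r, hr, hrδ⟩ : ∃ r : ℝ, 0 < r ∧ ENNReal.ofReal r < δ := by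
      obtain ⟨q, hq, hqδ⟩ := ENNReal.lt_iff_exists_nnreal_btwn.1 hδ
      exact ⟨q, by simpa using hq, by simpa using hqδ⟩
    -- The squared norm consists of three squares, each allowed to be at most r/3.
    obtain ⟨η, ht, h1, h2⟩ := h (Real.sqrt (r / 3)) (by positivity)
    obtain ⟨h3, h4⟩ := hv.sub_test ht
    refine ⟨ht.bundle, lt_of_le_of_lt ?_ hrδ⟩
    simp only [ht.coe_bundle]
    rw [h1NormSq_eq h3]
    refine ENNReal.ofReal_le_ofReal ?_
    have hsq : ∀ {f : ℝ × ℝ → ℝ}, nrm (volume.restrict Ω) f ≤ √(r / 3) →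
        nrm (volume.restrict Ω) f ^ 2 ≤ r / 3 := fun hf => by
      calc _ ≤ √(r / 3) ^ 2 := pow_le_pow_left₀ nrm_nonneg hf 2
        _ = _ := Real.sq_sqrt (by positivity)
    rw [Fin.sum_univ_two, nrm_congr (h4 0), nrm_congr (h4 1)]
    linarith [hsq h1, hsq (h2 0), hsq (h2 1)]

/-- Identities against test functions extend by density. -/
theorem MemH10.integral_eq_zero {Ω : Opens (ℝ × ℝ)} {v : ℝ × ℝ → ℝ} (h : MemH10 Ω v)
    {a : ℝ × ℝ → ℝ} {b : Fin 2 → ℝ × ℝ → ℝ} (ha : MemLp a 2 (volume.restrict Ω))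
    (hb : ∀ i, MemLp (b i) 2 (volume.restrict Ω))
    (H : ∀ η, IsTest Ω η → ∫ x in Ω, (a x * η x + ∑ i, b i x * pd i η x) = 0) :
    ∫ x in Ω, (a x * v x + ∑ i, b i x * weakPartial Ω i v x) = 0 := by
  set μ := volume.restrict (Ω : Set (ℝ × ℝ))
  obtain ⟨hv, happ⟩ := memH10_iff.1 h
  set M := nrm μ a + nrm μ (b 0) + nrm μ (b 1)
  have hM : 0 ≤ M := add_nonneg (add_nonneg nrm_nonneg nrm_nonneg) nrm_nonneg
  -- Subtracting the identity for an approximating test function leaves only differences of size δ,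
  -- which Cauchy–Schwarz pairs with the coefficients.
  have key : ∀ δ : ℝ, 0 < δ →
      |∫ x in Ω, (a x * v x + ∑ i, b i x * weakPartial Ω i v x)| ≤ M * δ := by
    intro δ hδ
    obtain ⟨η, ht, h1, h2⟩ := happ δ hδ
    have hη2 : MemLp η 2 μ := (ht.memLp 2 volume).restrict _
    have hpη2 : ∀ i, MemLp (pd i η) 2 μ := fun i => ((ht.der i).memLp 2 volume).restrict _
    have hw : ∀ i, MemLp (weakPartial Ω i v) 2 μ := fun i => (weakPartial_spec hv i).1
    have d0 : MemLp (fun x => v x - η x) 2 μ := hv.1.sub hη2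
    have d : ∀ i, MemLp (fun x => weakPartial Ω i v x - pd i η x) 2 μ :=
      fun i => (hw i).sub (hpη2 i)
    have H' := H η ht
    simp only [Fin.sum_univ_two] at H' ⊢
    have e1 : ∫ x in Ω, (a x * v x + (b 0 x * weakPartial Ω 0 v x + b 1 x * weakPartial Ω 1 v x))
        = (∫ x in Ω, a x * (v x - η x)) + (∫ x in Ω, b 0 x * (weakPartial Ω 0 v x - pd 0 η x))
          + ∫ x in Ω, b 1 x * (weakPartial Ω 1 v x - pd 1 η x) := by
      have I1 := integrable_mul_of_memLp ha d0
      have I2 := integrable_mul_of_memLp (hb 0) (d 0)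
      have I3 := integrable_mul_of_memLp (hb 1) (d 1)
      have J1 := integrable_mul_of_memLp ha hη2
      have J2 := integrable_mul_of_memLp (hb 0) (hpη2 0)
      have J3 := integrable_mul_of_memLp (hb 1) (hpη2 1)
      have I12 : Integrable (fun x => a x * (v x - η x)
        + b 0 x * (weakPartial Ω 0 v x - pd 0 η x)) μ := I1.add I2
      have J : Integrable (fun x => a x * η x + (b 0 x * pd 0 η x + b 1 x * pd 1 η x)) μ :=
        J1.add (J2.add J3)
      rw [← integral_add I1 I2, ← integral_add I12 I3, ← sub_eq_zero, ← H', sub_eq_iff_eq_add,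
        ← integral_add J (integrable_fun_add I12 I3)]
      congr with x; ring
    rw [e1]
    refine (abs_add_three _ _ _).trans ?_
    have c1 := (abs_integral_mul_le ha d0).trans (mul_le_mul_of_nonneg_left h1 nrm_nonneg)
    have c2 := (abs_integral_mul_le (hb 0) (d 0)).trans
      (mul_le_mul_of_nonneg_left (h2 0) nrm_nonneg)
    have c3 := (abs_integral_mul_le (hb 1) (d 1)).trans
      (mul_le_mul_of_nonneg_left (h2 1) nrm_nonneg)
    have : M * δ = nrm μ a * δ + nrm μ (b 0) * δ + nrm μ (b 1) * δ := by ring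
    rw [this]
    exact add_le_add (add_le_add c1 c2) c3
  rw [← abs_eq_zero]
  refine le_antisymm (le_of_forall_pos_le_add fun ε hε => ?_) (abs_nonneg _)
  refine (key (ε / (M + 1)) (by positivity)).trans ?_
  rw [zero_add, mul_div_assoc', div_le_iff₀ (by positivity)]
  nlinarith

/-- The extension by zero of a function in `H¹₀` is in `H¹` of the plane. -/
theorem MemH10.sob {Ω : Opens (ℝ × ℝ)} {v : ℝ × ℝ → ℝ} (h : MemH10 Ω v) :
    Sob univ ((Ω : Set (ℝ × ℝ)).indicator v)
      (fun i => (Ω : Set (ℝ × ℝ)).indicator (weakPartial Ω i v)) := by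
  have hs := h.1.sob
  refine ⟨hs.1, hs.2, fun i η hη => ?_⟩
  have hr : ∀ {f : ℝ × ℝ → ℝ}, IsTest univ f → MemLp f 2 (volume.restrict (Ω : Set (ℝ × ℝ))) :=
    fun hf => (hf.memLp 2 volume).restrict _
  have hv := h.1.1
  have hw := (weakPartial_spec h.1 i).1
  -- When v is a test function of Ω, the claim is classical integration by parts against η, whose
  -- support may leave Ω. Density carries it over to v.
  have key := h.integral_eq_zero (a := pd i η) (b := fun j => if j = i then η else 0)
    (hr (hη.der i)) (fun j => by split_ifs <;> [exact hr hη; exact MemLp.zero]) (fun ζ hζ => ?_)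
  · have e1 : ∀ x, (pd i η x * v x + ∑ j, (if j = i then η else 0) x * weakPartial Ω j v x)
        = v x * pd i η x + weakPartial Ω i v x * η x := fun x => by
      simp only [ite_apply, Pi.zero_apply, ite_mul, zero_mul, Finset.sum_ite_eq', Finset.mem_univ,
        if_true]
      ring
    simp only [e1] at key
    rw [integral_add (integrable_mul_of_memLp hv (hr (hη.der i)))
      (integrable_mul_of_memLp hw (hr hη)), setIntegral_mul_eq Ω.isOpen.measurableSet,
      setIntegral_mul_eq Ω.isOpen.measurableSet] at key
    linarith
  · have e1 : ∀ x, (pd i η x * ζ x + ∑ j, (if j = i then η else 0) x * pd j ζ x)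
        = pd i η x * ζ x + η x * pd i ζ x := fun x => by
      simp [ite_apply, ite_mul]
    simp only [e1]
    have i1 := integrable_mul_of_memLp ((hη.der i).memLp 2 volume) (hζ.memLp 2 volume)
    have i2 := integrable_mul_of_memLp (hη.memLp 2 volume) ((hζ.der i).memLp 2 volume)
    rw [setIntegral_eq_integral_of_forall_compl_eq_zero, integral_add i1 i2,
      (hη.sob (V := univ)).3 i ζ (hζ.mono (subset_univ _))]
    · ring
    · intro x hx
      simp [hζ.eq_zero hx, (hζ.der i).eq_zero hx]

/-- The coordinate functions. -/
def co : Fin 2 → ℝ × ℝ → ℝ := ![Prod.fst, Prod.snd]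

@[simp] theorem co_zero (x : ℝ × ℝ) : co 0 x = x.1 := rfl
@[simp] theorem co_one (x : ℝ × ℝ) : co 1 x = x.2 := rfl

theorem contDiff_co (l : Fin 2) {n : WithTop ℕ∞} : ContDiff ℝ n (co l) := by
  fin_cases l
  · exact contDiff_fst
  · exact contDiff_snd

/-- Derivatives of a function of one coordinate. -/
theorem pd_comp_co (i l : Fin 2) {θ : ℝ → ℝ} {x : ℝ × ℝ} (hθ : DifferentiableAt ℝ θ (co l x)) :
    pd i (fun y => θ (co l y)) x = if i = l then deriv θ (co l x) else 0 := by
  have h : HasFDerivAt (fun y => θ (co l y))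
      (deriv θ (co l x) • fderiv ℝ (co l) x) x :=
    hθ.hasDerivAt.comp_hasFDerivAt x ((contDiff_co l (n := 1)).differentiable (by simp) x).hasFDerivAt
  rw [pd, h.fderiv]
  fin_cases l <;> fin_cases i <;> simp [co, e, fderiv_fst, fderiv_snd]

/-- The bound is linear in δ, which compensates the slope of order 1/δ of the cutoffs used in
`Sob.remove_wall`. -/
theorem volume_box_slab_le (l : Fin 2) (c δ r : ℝ) (hδ : 0 ≤ δ) (hr : 0 ≤ r) :
    volume.real {x : ℝ × ℝ | |co l x - c| ≤ δ ∧ x ∈ Icc (-r) r ×ˢ Icc (-r) r} ≤ 4 * r * δ := by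
  have hI : ∀ s : ℝ, |s - c| ≤ δ → s ∈ Icc (c - δ) (c + δ) := fun s hs => by
    rw [abs_le] at hs; constructor <;> linarith [hs.1, hs.2]
  have hvol : ∀ a b a' b' : ℝ, a ≤ b → a' ≤ b' →
      volume.real (Icc a b ×ˢ Icc a' b') = (b - a) * (b' - a') := fun a b a' b' h h' => by
    rw [Measure.volume_eq_prod, measureReal_prod_prod]; simp [Real.volume_real_Icc, h, h']
  have hfin : ∀ a b a' b' : ℝ, volume (Icc a b ×ˢ Icc a' b' : Set (ℝ × ℝ)) ≠ ⊤ :=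
    fun a b a' b' => (isCompact_Icc.prod isCompact_Icc).measure_lt_top.ne
  fin_cases l
  · refine (measureReal_mono (s₂ := Icc (c - δ) (c + δ) ×ˢ Icc (-r) r)
      (fun x hx => ⟨hI _ hx.1, hx.2.2⟩) (hfin _ _ _ _)).trans_eq ?_
    rw [hvol _ _ _ _ (by linarith) (by linarith)]; ring
  · refine (measureReal_mono (s₂ := Icc (-r) r ×ˢ Icc (c - δ) (c + δ))
      (fun x hx => ⟨hx.2.1, hI _ hx.1⟩) (hfin _ _ _ _)).trans_eq ?_
    rw [hvol _ _ _ _ (by linarith) (by linarith)]; ring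

theorem volume_wall (l : Fin 2) (c : ℝ) : volume {x : ℝ × ℝ | co l x = c} = 0 := by
  fin_cases l
  · have : {x : ℝ × ℝ | co 0 x = c} = {c} ×ˢ univ := by ext x; simp
    simp only [Fin.zero_eta, this]
    rw [Measure.volume_eq_prod, Measure.prod_prod]; simp
  · have : {x : ℝ × ℝ | co 1 x = c} = univ ×ˢ {c} := by ext x; simp
    simp only [Fin.mk_one, this]
    rw [Measure.volume_eq_prod, Measure.prod_prod]; simp

/-- A smooth function that vanishes on `[-1, 1]` and is equal to `1` off `(-2, 2)`. -/
theorem exists_gap_function : ∃ θ : ℝ → ℝ, ContDiff ℝ ∞ θ ∧ (∀ s, |s| ≤ 1 → θ s = 0) ∧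
    (∀ s, 2 ≤ |s| → θ s = 1) ∧ (∀ s, |θ s| ≤ 1) ∧ ∃ M, ∀ s, |deriv θ s| ≤ M := by
  let f : ContDiffBump (0 : ℝ) := ⟨1, 2, one_pos, one_lt_two⟩
  have hd : ∀ s, deriv (fun s => 1 - f s) s = -deriv f s := fun s => by
    rw [deriv_const_sub]
  refine ⟨fun s => 1 - f s, contDiff_const.sub f.contDiff, fun s hs => ?_, fun s hs => ?_,
    fun s => ?_, ?_⟩
  · simp only []; rw [f.one_of_mem_closedBall (by simpa using hs), sub_self]
  · simp only []; rw [f.zero_of_le_dist (by simpa using hs), sub_zero]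
  · rw [abs_le]; constructor <;> linarith [f.nonneg (x := s), f.le_one (x := s)]
  · obtain ⟨M, hM⟩ := ((f.contDiff (n := 1)).continuous_deriv
      (by simp)).bounded_above_of_compact_support f.hasCompactSupport.deriv
    exact ⟨M, fun s => by rw [hd, abs_neg]; exact hM s⟩

/-- A continuous function that vanishes on a coordinate line has no singular derivative there. -/
theorem Sob.remove_wall {U : Set (ℝ × ℝ)} {v : ℝ × ℝ → ℝ} {g : Fin 2 → ℝ × ℝ → ℝ}
    {l : Fin 2} {c : ℝ} (h : Sob (U \ {x | co l x = c}) v g) (hv : ContinuousOn v U)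
    (hz : ∀ x ∈ U, co l x = c → v x = 0) : Sob U v g := by
  refine ⟨h.1, h.2, fun i η hη => ?_⟩
  obtain ⟨θ, hθ, hθ0, hθ1, hθb, M, hM⟩ := exists_gap_function
  have hM0 : 0 ≤ M := (abs_nonneg _).trans (hM 0)
  -- The cutoff `a n` vanishes within distance 1/(n+1) of the wall, equals one beyond distance
  -- 2/(n+1), and has slope at most (n+1) M.
  let sc : ℕ → ℝ → ℝ := fun n s => (n + 1 : ℝ) * (s - c)
  let a : ℕ → ℝ × ℝ → ℝ := fun n x => θ (sc n (co l x))
  have hsc : ∀ n, ContDiff ℝ ∞ (sc n) := fun n => contDiff_const.mul (contDiff_id.sub contDiff_const)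
  have ha : ∀ n, ContDiff ℝ ∞ (a n) := fun n => hθ.comp ((hsc n).comp (contDiff_co l))
  have hθd : Differentiable ℝ θ := hθ.differentiable (by simp)
  have hderiv : ∀ n s, deriv (fun s => θ (sc n s)) s = (n + 1 : ℝ) * deriv θ (sc n s) := by
    intro n s
    have h1 : HasDerivAt (sc n) (n + 1 : ℝ) s := by
      simpa using ((hasDerivAt_id s).sub_const c).const_mul (n + 1 : ℝ)
    have := (hθd (sc n s)).hasDerivAt.comp s h1
    rw [mul_comm]; exact this.deriv
  have hpa : ∀ n x, pd i (a n) x = if i = l then (n + 1 : ℝ) * deriv θ (sc n (co l x)) else 0 := by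
    intro n x
    have := pd_comp_co i l (θ := fun s => θ (sc n s)) (x := x)
      ((hθd _).comp _ ((hsc n).differentiable (by simp) _))
    rw [hderiv] at this
    exact this
  have hcoc : Continuous (co l) := (contDiff_co l (n := 0)).continuous
  -- the cutoff test functions
  have hta : ∀ n, IsTest (U \ {x | co l x = c}) (fun x => a n x * η x) := by
    refine fun n => hη.mul_left (ha n) fun x hx => ⟨hx.2, fun hxc => ?_⟩
    have hev : ∀ᶠ y in 𝓝 x, a n y = 0 := by
      have : ContinuousAt (fun y => |sc n (co l y)|) x :=
        (((hsc n).continuous.comp hcoc).abs).continuousAt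
      have h0 : |sc n (co l x)| < 1 := by
        have : co l x = c := hxc
        simp [sc, this]
      filter_upwards [this.eventually_lt continuousAt_const h0] with y hy
      exact hθ0 _ hy.le
    exact (notMem_tsupport_iff_eventuallyEq.2 hev) hx.1
  have hid : ∀ n, (∫ x, a n x * (v x * pd i η x)) + ∫ x, v x * (pd i (a n) x * η x)
      = -∫ x, a n x * (g i x * η x) := by
    intro n
    have h0 := h.3 i _ (hta n)
    have hpt : IsTest U (fun x => pd i (a n) x * η x) := hη.mul (contDiff_pd (ha n))
    have hpd : ∀ x, v x * pd i (fun y => a n y * η y) x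
        = a n x * (v x * pd i η x) + v x * (pd i (a n) x * η x) := fun x => by
      rw [pd_mul ((ha n).differentiable (by simp) x) (hη.differentiable x)]; ring
    simp only [hpd] at h0
    rw [integral_add] at h0
    · rw [h0]; congr 2; ext x; ring
    · have := integrable_mul_of_memLp h.1 ((((hη.der i).mul (ha n))).memLp 2 volume)
      refine this.congr (ae_of_all _ fun x => ?_)
      ring
    · exact integrable_mul_of_memLp h.1 (hpt.memLp 2 volume)
  have ha1 : ∀ x, co l x ≠ c → Tendsto (fun n => a n x) atTop (𝓝 1) := by
    intro x hx
    refine tendsto_const_nhds.congr' ?_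
    have hpos : 0 < |co l x - c| := abs_pos.2 (sub_ne_zero.2 hx)
    have : Tendsto (fun n : ℕ => (n + 1 : ℝ) * |co l x - c|) atTop atTop :=
      (tendsto_atTop_add_const_right _ _ tendsto_natCast_atTop_atTop).atTop_mul_const hpos
    filter_upwards [this.eventually_ge_atTop 2] with n hn
    refine (hθ1 _ ?_).symm
    rwa [abs_mul, abs_of_nonneg (by positivity : (0 : ℝ) ≤ n + 1)]
  have hlim : ∀ f : ℝ × ℝ → ℝ, Integrable f →
      Tendsto (fun n => ∫ x, a n x * f x) atTop (𝓝 (∫ x, f x)) := by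
    intro f hf
    refine tendsto_integral_of_dominated_convergence (fun x => ‖f x‖)
      (fun n => (ha n).continuous.aestronglyMeasurable.mul hf.1) hf.norm
      (fun n => ae_of_all _ fun x => ?_) ?_
    · rw [norm_mul]
      exact mul_le_of_le_one_left (norm_nonneg _) (hθb _)
    · have : ∀ᵐ x : ℝ × ℝ, co l x ≠ c := by
        rw [ae_iff]; simpa using volume_wall l c
      filter_upwards [this] with x hx
      simpa using (ha1 x hx).mul_const (f x)
  -- The only dangerous term. The derivative of the cutoff is of order n+1, but it lives on a slab
  -- of area O(1/(n+1)), where |v| is small because v is continuous and vanishes on the wall.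
  have hsmall : Tendsto (fun n => ∫ x, v x * (pd i (a n) x * η x)) atTop (𝓝 0) := by
    obtain ⟨Cη, hCη⟩ := hη.bounded
    have hCη0 : 0 ≤ Cη := (abs_nonneg _).trans (hCη 0)
    obtain ⟨r, hr0, hr⟩ : ∃ r : ℝ, 0 ≤ r ∧ tsupport η ⊆ Icc (-r) r ×ˢ Icc (-r) r := by
      obtain ⟨r, hr⟩ := hη.2.isCompact.isBounded.subset_closedBall 0
      refine ⟨max r 0, le_max_right _ _, fun x hx => ?_⟩
      have := hr hx
      rw [mem_closedBall_zero_iff, Prod.norm_def] at this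
      have h1 := (le_max_left _ _).trans (this.trans (le_max_left r 0))
      have h2 := (le_max_right _ _).trans (this.trans (le_max_left r 0))
      exact ⟨abs_le.1 h1, abs_le.1 h2⟩
    rw [Metric.tendsto_atTop]
    intro ε hε
    set K := tsupport η with hK
    have hKc : IsCompact K := hη.2
    obtain ⟨ε', hε', hεε'⟩ : ∃ ε' > 0, ε' * (M * Cη * (8 * r)) < ε :=
      ⟨ε / (M * Cη * (8 * r) + 1), by positivity, by
        rw [div_mul_eq_mul_div, div_lt_iff₀ (by positivity)]; nlinarith [hε]⟩
    -- Uniform smallness of v near the wall, on the compact support of η: counterexamples at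
    -- distances 1/(n+1) would accumulate at a point of the wall, where v is zero.
    obtain ⟨δ, hδ, hδv⟩ : ∃ δ > 0, ∀ x ∈ K, |co l x - c| < δ → |v x| ≤ ε' := by
      by_contra! hcon
      choose! y hyK hyd hyv using fun n : ℕ => hcon (1 / (n + 1 : ℝ)) (by positivity)
      obtain ⟨x, hxK, φ, hφ, hlimφ⟩ := hKc.tendsto_subseq hyK
      have hxc : co l x = c := by
        have h1 : Tendsto (fun n => |co l (y (φ n)) - c|) atTop (𝓝 |co l x - c|) :=
          (((hcoc.tendsto x).comp hlimφ).sub_const c).abs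
        have h2 : Tendsto (fun n => 1 / ((φ n : ℝ) + 1)) atTop (𝓝 0) :=
          tendsto_one_div_add_atTop_nhds_zero_nat.comp hφ.tendsto_atTop
        have := le_of_tendsto_of_tendsto' h1 h2 fun n => (hyd (φ n)).le
        exact sub_eq_zero.1 (abs_eq_zero.1 (le_antisymm this (abs_nonneg _)))
      have hvx := hz x (hη.3 hxK) hxc
      have h3 : Tendsto (fun n => |v (y (φ n))|) atTop (𝓝 |v x|) :=
        (((hv x (hη.3 hxK)).tendsto.comp (tendsto_nhdsWithin_iff.2
          ⟨hlimφ, Eventually.of_forall fun n => hη.3 (hyK _)⟩))).abs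
      have := ge_of_tendsto' h3 fun n => (hyv (φ n)).le
      rw [hvx, abs_zero] at this
      linarith
    obtain ⟨N, hN⟩ := exists_nat_gt (2 / δ)
    refine ⟨N, fun n hn => ?_⟩
    have hn1 : (0 : ℝ) < n + 1 := by positivity
    have hδn : 2 / (n + 1 : ℝ) < δ := by
      rw [div_lt_iff₀ hn1]
      rw [div_lt_iff₀ hδ] at hN
      have : (N : ℝ) ≤ n := by exact_mod_cast hn
      nlinarith
    set S := {x : ℝ × ℝ | |co l x - c| ≤ 2 / (n + 1 : ℝ) ∧ x ∈ Icc (-r) r ×ˢ Icc (-r) r} with hS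
    have hbd : ∀ x, x ∉ S → v x * (pd i (a n) x * η x) = 0 := by
      intro x hx
      by_cases hxK : x ∈ K
      · have hx' : 2 / (n + 1 : ℝ) < |co l x - c| := by
          by_contra! hcon
          exact hx ⟨hcon, hr hxK⟩
        have : pd i (a n) x = 0 := by
          have hev : (a n) =ᶠ[𝓝 x] fun _ => 1 := by
            have hc : ContinuousAt (fun y => |co l y - c|) x :=
              ((hcoc.sub continuous_const).abs).continuousAt
            filter_upwards [continuousAt_const.eventually_lt hc hx'] with y hy
            refine hθ1 _ ?_
            rw [abs_mul, abs_of_nonneg hn1.le]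
            rw [div_lt_iff₀ hn1] at hy
            linarith
          rw [pd, hev.fderiv_eq]; simp
        simp [this]
      · simp [image_eq_zero_of_notMem_tsupport hxK]
    rw [dist_zero_right, ← setIntegral_eq_integral_of_forall_compl_eq_zero hbd]
    have hSfin : volume S < ⊤ := lt_of_le_of_lt (measure_mono fun x hx => hx.2)
      (isCompact_Icc.prod isCompact_Icc).measure_lt_top
    have hle := norm_setIntegral_le_of_norm_le_const (μ := volume) (s := S)
      (f := fun x => v x * (pd i (a n) x * η x)) (C := ε' * ((n + 1) * M * Cη)) hSfin
      (fun x hx => ?_)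
    · refine lt_of_le_of_lt (hle.trans (mul_le_mul_of_nonneg_left
        (volume_box_slab_le l c _ r (by positivity) hr0) (by positivity))) ?_
      have : ε' * ((n + 1) * M * Cη) * (4 * r * (2 / (n + 1 : ℝ))) = ε' * (M * Cη * (8 * r)) := by
        field_simp; ring
      rwa [this]
    · by_cases hxK : x ∈ K
      · rw [norm_mul, norm_mul]
        have h1 : ‖v x‖ ≤ ε' := hδv x hxK (hx.1.trans_lt hδn)
        have h2 : ‖pd i (a n) x‖ ≤ (n + 1) * M := by
          rw [hpa]
          split_ifs
          · rw [norm_mul, Real.norm_of_nonneg hn1.le]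
            exact mul_le_mul_of_nonneg_left (hM _) hn1.le
          · simp; positivity
        exact mul_le_mul h1 (mul_le_mul h2 (hCη x) (norm_nonneg _) (by positivity))
          (by positivity) hε'.le
      · simp [image_eq_zero_of_notMem_tsupport hxK]; positivity
  have l1 := (hlim _ (integrable_mul_of_memLp h.1 ((hη.der i).memLp 2 volume))).add hsmall
  have l2 := (hlim _ (integrable_mul_of_memLp (h.2 i) (hη.memLp 2 volume))).neg
  simp only [hid, add_zero] at l1
  exact tendsto_nhds_unique l1 l2

end ThinChannel

end

noncomputable section

namespace ThinChannel

open Filter Topology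
open scoped Convolution

/-! ### Mollification -/

theorem pd_convolution {f η : ℝ × ℝ → ℝ} (hf : LocallyIntegrable f)
    {U : Set (ℝ × ℝ)} (hη : IsTest U η) (i : Fin 2) (x : ℝ × ℝ) :
    pd i (f ⋆[ContinuousLinearMap.mul ℝ ℝ] η) x
      = (f ⋆[ContinuousLinearMap.mul ℝ ℝ] pd i η) x := by
  have h := hη.2.hasFDerivAt_convolution_right (ContinuousLinearMap.mul ℝ ℝ) hf
    (hη.1.of_le (by simp)) x
  rw [pd, h.fderiv, convolution, convolution, ContinuousLinearMap.integral_apply]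
  · rfl
  · exact (hη.2.fderiv ℝ).convolutionExists_right _ hf
      ((hη.1.of_le (m := 1) (by simp)).continuous_fderiv (by simp)) x

theorem contDiff_convolution {f η : ℝ × ℝ → ℝ} (hf : LocallyIntegrable f)
    {U : Set (ℝ × ℝ)} (hη : IsTest U η) :
    ContDiff ℝ ∞ (f ⋆[ContinuousLinearMap.mul ℝ ℝ] η) :=
  hη.2.contDiff_convolution_right (n := ⊤) _ hf hη.1

theorem IsTest.comp_const_sub {η : ℝ × ℝ → ℝ} (hη : IsTest univ η) (x : ℝ × ℝ) :
    IsTest univ (fun y => η (x - y)) ∧ ∀ i y, ThinChannel.pd i (fun y => η (x - y)) y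
      = -ThinChannel.pd i η (x - y) := by
  refine ⟨⟨hη.1.comp (contDiff_const.sub contDiff_id), ?_, subset_univ _⟩, fun i y => ?_⟩
  · exact hη.2.comp_homeomorph (Homeomorph.subLeft x)
  · have h1 : HasFDerivAt (fun y : ℝ × ℝ => x - y) (-ContinuousLinearMap.id ℝ (ℝ × ℝ)) y :=
      (hasFDerivAt_id y).const_sub x
    have := (hη.differentiable (x - y)).hasFDerivAt.comp y h1
    rw [ThinChannel.pd, show (fun y => η (x - y)) = η ∘ fun y => x - y from rfl, this.fderiv]
    simp [ThinChannel.pd]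

/-- Mollification commutes with weak derivatives. -/
theorem Sob.pd_mollify {v : ℝ × ℝ → ℝ} {g : Fin 2 → ℝ × ℝ → ℝ} (h : Sob univ v g)
    {η : ℝ × ℝ → ℝ} (hη : IsTest univ η) (i : Fin 2) (x : ℝ × ℝ) :
    pd i (v ⋆[ContinuousLinearMap.mul ℝ ℝ] η) x
      = (g i ⋆[ContinuousLinearMap.mul ℝ ℝ] η) x := by
  rw [pd_convolution (h.1.locallyIntegrable (by simp)) hη]
  obtain ⟨h1, h2⟩ := hη.comp_const_sub x
  have := h.3 i _ h1
  simp only [h2, mul_neg, integral_neg, neg_inj] at this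
  exact this

/-- Continuity of translations in L², an instance of the continuity of composition with measure
preserving maps. -/
theorem exists_translate_close {f : ℝ × ℝ → ℝ} (hf : MemLp f 2) {ε : ℝ} (hε : 0 < ε) :
    ∃ δ > 0, ∀ y : ℝ × ℝ, ‖y‖ < δ →
      eLpNorm (fun x => f (x - y) - f x) 2 volume ≤ ENNReal.ofReal ε := by
  have : Fact ((1 : ℝ≥0∞) ≤ 2) := ⟨by simp⟩
  have hmp : ∀ y : ℝ × ℝ, MeasurePreserving (fun x : ℝ × ℝ => x - y) volume volume :=
    fun y => measurePreserving_sub_right volume y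
  let T : ℝ × ℝ → C(ℝ × ℝ, ℝ × ℝ) := fun y => ⟨fun x => x - y, by fun_prop⟩
  have hT : Continuous T := ContinuousMap.continuous_of_continuous_uncurry _
    (show Continuous fun p : (ℝ × ℝ) × (ℝ × ℝ) => p.2 - p.1 by fun_prop)
  have hc : Continuous fun y => Lp.compMeasurePreserving (T y) (hmp y) (hf.toLp f) :=
    continuous_const.compMeasurePreservingLp hT hmp (by simp)
  have h0 := Metric.continuous_iff.1 hc 0 ε hε
  obtain ⟨δ, hδ, h⟩ := h0
  refine ⟨δ, hδ, fun y hy => ?_⟩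
  have h1 := h y (by simpa using hy)
  rw [Lp.toLp_compMeasurePreserving, Lp.toLp_compMeasurePreserving, dist_edist,
    Lp.edist_toLp_toLp] at h1
  have e1 : (f ∘ ⇑(T y) - f ∘ ⇑(T 0)) = fun x => f (x - y) - f x := by
    ext x; simp [T]
  rw [e1] at h1
  have hm : MemLp (fun x => f (x - y) - f x) 2 volume := (hf.comp_measurePreserving (hmp y)).sub hf
  exact (ENNReal.le_ofReal_iff_toReal_le hm.2.ne hε.le).2 h1.le

/-- Jensen's inequality for the square and the probability density w, that is, Cauchy–Schwarz for √w
and √w h. -/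
theorem lintegral_sq_le_of_lintegral_eq_one {α : Type*} [MeasurableSpace α] {μ : Measure α}
    {w h : α → ℝ≥0∞} (hw : AEMeasurable w μ) (hh : AEMeasurable h μ) (h1 : ∫⁻ x, w x ∂μ = 1) :
    (∫⁻ x, w x * h x ∂μ) ^ (2 : ℝ) ≤ ∫⁻ x, w x * h x ^ (2 : ℝ) ∂μ := by
  have key := ENNReal.lintegral_mul_le_Lp_mul_Lq μ Real.HolderConjugate.two_two
    (hw.pow_const (1 / 2 : ℝ)) ((hw.pow_const (1 / 2 : ℝ)).mul hh)
  have e1 : ∀ x, (w x ^ (1 / 2 : ℝ)) ^ (2 : ℝ) = w x := fun x => by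
    rw [← ENNReal.rpow_mul]; simp
  have e2 : ∀ x, w x ^ (1 / 2 : ℝ) * (w x ^ (1 / 2 : ℝ) * h x) = w x * h x := fun x => by
    rw [← mul_assoc, ← ENNReal.rpow_add_of_nonneg _ _ (by norm_num) (by norm_num)]
    norm_num
  have e3 : ∀ x, (w x ^ (1 / 2 : ℝ) * h x) ^ (2 : ℝ) = w x * h x ^ (2 : ℝ) := fun x => by
    rw [ENNReal.mul_rpow_of_nonneg _ _ (by norm_num), e1]
  simp only [Pi.mul_apply, e1, e2, e3, h1, ENNReal.one_rpow, one_mul] at key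
  calc _ ≤ ((∫⁻ x, w x * h x ^ (2 : ℝ) ∂μ) ^ (1 / 2 : ℝ)) ^ (2 : ℝ) :=
        ENNReal.rpow_le_rpow key (by norm_num)
    _ = _ := by rw [← ENNReal.rpow_mul]; simp

theorem eLpNorm_two_rpow {α : Type*} [MeasurableSpace α] (μ : Measure α) (f : α → ℝ) :
    eLpNorm f 2 μ ^ (2 : ℝ) = ∫⁻ x, ‖f x‖ₑ ^ (2 : ℝ) ∂μ := by
  rw [eLpNorm_eq_lintegral_rpow_enorm_toReal (by simp) (by simp), ← ENNReal.rpow_mul]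
  simp

/-- The difference f ⋆ ρ - f is the ρ-average of the functions f(· - y) - f. Jensen's inequality at
each point and Tonelli's theorem bound its squared norm by the average of their squared norms. The
bump may be centred anywhere, which allows mollification to displace supports. -/
theorem eLpNorm_convolution_sub_le {f : ℝ × ℝ → ℝ} (hf : MemLp f 2) {c : ℝ × ℝ}
    (φ : ContDiffBump c) {ε : ℝ≥0∞}
    (hφ : ∀ y ∈ Metric.ball c φ.rOut, eLpNorm (fun x => f (x - y) - f x) 2 volume ≤ ε) :
    eLpNorm (fun x => (f ⋆[ContinuousLinearMap.mul ℝ ℝ] φ.normed volume) x - f x) 2 volume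
      ≤ ε := by
  set ρ := φ.normed volume with hρ
  have hρc : Continuous ρ := φ.continuous_normed
  have hρs : HasCompactSupport ρ := φ.hasCompactSupport_normed
  have hρ0 : ∀ y, 0 ≤ ρ y := fun y => φ.nonneg_normed y
  have hfl : LocallyIntegrable f volume := hf.locallyIntegrable (by simp)
  have hintg : ∀ x, Integrable (fun y => ρ y * f (x - y)) := fun x =>
    hρs.convolutionExists_left (ContinuousLinearMap.mul ℝ ℝ) hρc hfl x
  have hρi : Integrable ρ := hρc.integrable_of_hasCompactSupport hρs
  have hρ1 : ∫ y, ρ y = 1 := φ.integral_normed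
  have hw1 : ∫⁻ y, ENNReal.ofReal (ρ y) = 1 := by
    rw [← ofReal_integral_eq_lintegral_ofReal hρi (ae_of_all _ hρ0), hρ1, ENNReal.ofReal_one]
  have hwm : Measurable fun y => ENNReal.ofReal (ρ y) := hρc.measurable.ennreal_ofReal
  have hmeas : AEStronglyMeasurable (fun p : (ℝ × ℝ) × (ℝ × ℝ) => f (p.1 - p.2) - f p.1)
      (volume.prod volume) :=
    (hf.1.comp_quasiMeasurePreserving
      (quasiMeasurePreserving_sub_of_right_invariant volume volume)).sub hf.1.comp_fst
  have hpt : ∀ᵐ x, ‖(f ⋆[ContinuousLinearMap.mul ℝ ℝ] ρ) x - f x‖ₑ ^ (2 : ℝ)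
      ≤ ∫⁻ y, ENNReal.ofReal (ρ y) * ‖f (x - y) - f x‖ₑ ^ (2 : ℝ) := by
    filter_upwards [hmeas.prodMk_left] with x hx
    have e1 : (f ⋆[ContinuousLinearMap.mul ℝ ℝ] ρ) x - f x
        = ∫ y, ρ y * (f (x - y) - f x) := by
      have : (f ⋆[ContinuousLinearMap.mul ℝ ℝ] ρ) x = ∫ y, ρ y * f (x - y) := by
        rw [convolution_eq_swap]; congr with y; simp [mul_comm]
      rw [this]
      simp only [mul_sub]
      rw [integral_sub (hintg x) (hρi.mul_const _), integral_mul_const, hρ1, one_mul]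
    rw [e1]
    calc _ ≤ (∫⁻ y, ENNReal.ofReal (ρ y) * ‖f (x - y) - f x‖ₑ) ^ (2 : ℝ) := by
          refine ENNReal.rpow_le_rpow ((enorm_integral_le_lintegral_enorm _).trans_eq ?_)
            (by norm_num)
          congr with y
          rw [enorm_mul, Real.enorm_of_nonneg (hρ0 y)]
      _ ≤ _ := lintegral_sq_le_of_lintegral_eq_one hwm.aemeasurable hx.enorm hw1
  rw [← ENNReal.rpow_le_rpow_iff (z := 2) (by norm_num), eLpNorm_two_rpow]
  calc _ ≤ ∫⁻ x, ∫⁻ y, ENNReal.ofReal (ρ y) * ‖f (x - y) - f x‖ₑ ^ (2 : ℝ) := lintegral_mono_ae hpt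
    _ = ∫⁻ y, ∫⁻ x, ENNReal.ofReal (ρ y) * ‖f (x - y) - f x‖ₑ ^ (2 : ℝ) := by
        rw [lintegral_lintegral_swap]
        exact (hwm.comp measurable_snd).aemeasurable.mul (hmeas.enorm.pow_const _)
    _ ≤ ∫⁻ y, ENNReal.ofReal (ρ y) * ε ^ (2 : ℝ) := by
        refine lintegral_mono fun y => ?_
        rw [lintegral_const_mul' _ _ (by simp), ← eLpNorm_two_rpow]
        by_cases hy : y ∈ Metric.ball c φ.rOut
        · gcongr
          exact hφ y hy
        · have : ρ y = 0 := by
            rw [← φ.support_normed_eq (μ := volume)] at hy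
            simpa using hy
          simp [this]
    _ = _ := by rw [lintegral_mul_const _ hwm, hw1, one_mul]

/-- Approximation by smooth functions, with the support pushed in the direction `d`. -/
theorem Sob.exists_smooth_approx {v : ℝ × ℝ → ℝ} {g : Fin 2 → ℝ × ℝ → ℝ} (h : Sob univ v g)
    {F : Set (ℝ × ℝ)} (hF : ∀ x, x ∉ F → v x = 0) (d : ℝ × ℝ) {r δ : ℝ} (hr : 0 < r)
    (hδ : 0 < δ) :
    ∃ t, 0 < t ∧ t < r ∧ ∃ η : ℝ × ℝ → ℝ, ContDiff ℝ ∞ η ∧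
      (∀ z, η z ≠ 0 → ∃ x ∈ F, ‖z - x - t • d‖ ≤ t / 2) ∧
      eLpNorm (fun x => η x - v x) 2 volume ≤ ENNReal.ofReal δ ∧
      ∀ i, eLpNorm (fun x => pd i η x - g i x) 2 volume ≤ ENNReal.ofReal δ := by
  obtain ⟨r0, hr0, hv0⟩ := exists_translate_close h.1 hδ
  obtain ⟨r1, hr1, hv1⟩ := exists_translate_close (h.2 0) hδ
  obtain ⟨r2, hr2, hv2⟩ := exists_translate_close (h.2 1) hδ
  set t := min (r / 2) (min r0 (min r1 r2) / (‖d‖ + 1)) with ht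
  have hm : 0 < min r0 (min r1 r2) := lt_min hr0 (lt_min hr1 hr2)
  have hd : 0 < ‖d‖ + 1 := by positivity
  have ht0 : 0 < t := lt_min (by linarith) (by positivity)
  have htr : t < r := (min_le_left _ _).trans_lt (by linarith)
  have htm : t * (‖d‖ + 1) ≤ min r0 (min r1 r2) := by
    rw [← le_div_iff₀ hd]; exact min_le_right _ _
  -- Centring the bump at t d shifts the support of v by t d, up to a blur t/2. Points of the bump
  -- have norm less than t (‖d‖ + 1), and t was chosen so that translations of that length move v
  -- and its gradient by at most δ.
  let φ : ContDiffBump (t • d) := ⟨t / 4, t / 2, by linarith, by linarith⟩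
  have hball : ∀ y ∈ Metric.ball (t • d) φ.rOut, ‖y‖ < min r0 (min r1 r2) := by
    intro y hy
    rw [mem_ball_iff_norm] at hy
    have h1 : ‖y‖ ≤ ‖y - t • d‖ + ‖t • d‖ := by
      simpa using norm_add_le (y - t • d) (t • d)
    rw [norm_smul, Real.norm_of_nonneg ht0.le] at h1
    have : φ.rOut = t / 2 := rfl
    rw [this] at hy
    nlinarith
  have hρ : IsTest univ (φ.normed volume) :=
    ⟨φ.contDiff_normed, φ.hasCompactSupport_normed, subset_univ _⟩
  refine ⟨t, ht0, htr, v ⋆[ContinuousLinearMap.mul ℝ ℝ] φ.normed volume,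
    contDiff_convolution (h.1.locallyIntegrable (by simp)) hρ, fun z hz => ?_, ?_, fun i => ?_⟩
  · obtain ⟨x, hx, y, hy, rfl⟩ := support_convolution_subset (ContinuousLinearMap.mul ℝ ℝ)
      (Function.mem_support.2 hz)
    refine ⟨x, by_contra fun hxF => hx (hF x hxF), ?_⟩
    rw [φ.support_normed_eq, mem_ball_iff_norm] at hy
    simpa using hy.le
  · exact eLpNorm_convolution_sub_le h.1 φ fun y hy =>
      hv0 y ((hball y hy).trans_le (min_le_left _ _))
  · simp only [h.pd_mollify hρ]
    refine eLpNorm_convolution_sub_le (h.2 i) φ fun y hy => ?_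
    have hy' := (hball y hy).trans_le (min_le_right _ _)
    fin_cases i
    · exact hv1 y (hy'.trans_le (min_le_left _ _))
    · exact hv2 y (hy'.trans_le (min_le_right _ _))

theorem MemH10.congr {Ω : Opens (ℝ × ℝ)} {v w : ℝ × ℝ → ℝ} (h : MemH10 Ω v)
    (hvw : v =ᵐ[volume.restrict Ω] w) : MemH10 Ω w := by
  obtain ⟨h1, h2⟩ := memH10_iff.1 h
  have hvw' := (indicator_ae_eq_restrict (f := v) Ω.isOpen.measurableSet).trans hvw
  have hw := h1.sob.memH1 hvw'
  refine memH10_iff.2 ⟨hw, fun δ hδ => ?_⟩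
  obtain ⟨η, ht, h3, h4⟩ := h2 δ hδ
  refine ⟨η, ht, (nrm_congr ?_).trans_le h3, fun i => (nrm_congr ?_).trans_le (h4 i)⟩
  · filter_upwards [hvw] with x hx; rw [hx]
  · filter_upwards [h1.sob.weakPartial_ae hvw' i,
      indicator_ae_eq_restrict (f := weakPartial Ω i v) Ω.isOpen.measurableSet] with x hx hx'
    rw [hx, hx']

theorem MemH10.add {Ω : Opens (ℝ × ℝ)} {v w : ℝ × ℝ → ℝ} (h : MemH10 Ω v) (h' : MemH10 Ω w) :
    MemH10 Ω (fun x => v x + w x) := by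
  obtain ⟨h1, h2⟩ := memH10_iff.1 h
  obtain ⟨h1', h2'⟩ := memH10_iff.1 h'
  have hs := h1.sob.add h1'.sob
  have hI : ∀ f : ℝ × ℝ → ℝ, (Ω : Set (ℝ × ℝ)).indicator f =ᵐ[volume.restrict Ω] f :=
    fun f => indicator_ae_eq_restrict Ω.isOpen.measurableSet
  have hae : (fun x => (Ω : Set (ℝ × ℝ)).indicator v x + (Ω : Set (ℝ × ℝ)).indicator w x)
      =ᵐ[volume.restrict Ω] fun x => v x + w x := by
    filter_upwards [hI v, hI w] with x hx hx'
    rw [hx, hx']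
  have hm : ∀ {f : ℝ × ℝ → ℝ}, IsTest Ω f → MemLp f 2 (volume.restrict (Ω : Set (ℝ × ℝ))) :=
    fun hf => (hf.memLp 2 volume).restrict _
  refine memH10_iff.2 ⟨hs.memH1 hae, fun δ hδ => ?_⟩
  obtain ⟨η, ht, h3, h4⟩ := h2 (δ / 2) (by linarith)
  obtain ⟨η', ht', h3', h4'⟩ := h2' (δ / 2) (by linarith)
  have hpd : ∀ i x, pd i (fun y => η y + η' y) x = pd i η x + pd i η' x := fun i x => by
    simp only [pd]
    rw [fderiv_fun_add (ht.differentiable x) (ht'.differentiable x)]; rfl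
  refine ⟨fun x => η x + η' x, ⟨ht.1.add ht'.1, ht.2.add ht'.2,
    (tsupport_add _ _).trans (union_subset ht.3 ht'.3)⟩, ?_, fun i => ?_⟩
  · refine le_trans (le_of_eq (nrm_congr (ae_of_all _ fun x => ?_)))
      ((nrm_add_le (h1.1.sub (hm ht)) (h1'.1.sub (hm ht'))).trans (by
        exact (add_le_add h3 h3').trans_eq (by ring)))
    simp only [Pi.sub_apply]; ring
  · refine le_trans (le_of_eq (nrm_congr ?_))
      ((nrm_add_le ((weakPartial_spec h1 i).1.sub (hm (ht.der i)))
        ((weakPartial_spec h1' i).1.sub (hm (ht'.der i)))).trans (by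
        exact (add_le_add (h4 i) (h4' i)).trans_eq (by ring)))
    filter_upwards [hs.weakPartial_ae hae i, hI (weakPartial Ω i v), hI (weakPartial Ω i w)]
      with x hx hx1 hx2
    rw [hx, hx1, hx2, hpd]
    simp only [Pi.sub_apply]; ring

/-- Mollifying with a bump displaced along p yields smooth functions supported in the box shifted by
t p and fattened by t/2. In the maximum norm of the plane this is again a box, and by `hin` it lies
inside Ω even when the original box touches the boundary of Ω. -/
theorem Sob.memH10_of_push {Ω : Opens (ℝ × ℝ)} {v : ℝ × ℝ → ℝ} {g : Fin 2 → ℝ × ℝ → ℝ}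
    (h : Sob univ v g) {a b c d r : ℝ} (hv : ∀ x, x ∉ Icc a b ×ˢ Icc c d → v x = 0) (p : ℝ × ℝ)
    (hr : 0 < r) (hin : ∀ t, 0 < t → t < r → Icc (a + t * p.1 - t / 2) (b + t * p.1 + t / 2) ×ˢ
      Icc (c + t * p.2 - t / 2) (d + t * p.2 + t / 2) ⊆ (Ω : Set (ℝ × ℝ))) : MemH10 Ω v := by
  have hΩ := h.mono (subset_univ (Ω : Set (ℝ × ℝ)))
  refine memH10_iff.2 ⟨hΩ.memH1 (ae_eq_refl _), fun δ hδ => ?_⟩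
  obtain ⟨t, ht0, htr, η, hη, hs, h1, h2⟩ := h.exists_smooth_approx hv p hr hδ
  have hsub : tsupport η ⊆ Icc (a + t * p.1 - t / 2) (b + t * p.1 + t / 2) ×ˢ
      Icc (c + t * p.2 - t / 2) (d + t * p.2 + t / 2) := by
    refine closure_minimal (fun z hz => ?_) (isClosed_Icc.prod isClosed_Icc)
    obtain ⟨x, hx, hxz⟩ := hs z hz
    rw [Prod.norm_def, sup_le_iff] at hxz
    simp only [Prod.fst_sub, Prod.snd_sub, Prod.smul_fst, Prod.smul_snd, smul_eq_mul,
      Real.norm_eq_abs, abs_le] at hxz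
    obtain ⟨⟨h3, h4⟩, h5, h6⟩ := hx
    obtain ⟨⟨h7, h8⟩, h9, h10⟩ := hxz
    constructor <;> constructor <;> linarith
  have ht : IsTest Ω η := ⟨hη, (isCompact_Icc.prod isCompact_Icc).of_isClosed_subset
    (isClosed_tsupport η) hsub, hsub.trans (hin t ht0 htr)⟩
  have hm : ∀ {f k : ℝ × ℝ → ℝ}, MemLp f 2 → MemLp k 2 →
      eLpNorm (fun x => k x - f x) 2 volume ≤ ENNReal.ofReal δ →
      nrm (volume.restrict (Ω : Set (ℝ × ℝ))) (fun x => f x - k x) ≤ δ := fun {f k} hf hk hle => by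
    have hfk : MemLp (fun x => f x - k x) 2 volume := hf.sub hk
    rw [nrm_le_iff (hfk.restrict _) hδ.le]
    refine (eLpNorm_mono_measure _ Measure.restrict_le_self).trans ?_
    rw [← eLpNorm_neg]
    simpa [Pi.neg_def] using hle
  refine ⟨η, ht, hm h.1 (ht.memLp 2 _) h1, fun i => ?_⟩
  refine (nrm_congr ?_).trans_le (hm (h.2 i) ((ht.der i).memLp 2 _) (h2 i))
  filter_upwards [hΩ.weakPartial_ae (ae_eq_refl _) i] with x hx
  rw [hx]

theorem exists_bound_of_eq_zero_off {f : ℝ → ℝ} (hf : Continuous f) {p q : ℝ}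
    (h : ∀ s, s ∉ Icc p q → f s = 0) : ∃ M, ∀ s, |f s| ≤ M :=
  hf.bounded_above_of_compact_support
    (HasCompactSupport.intro isCompact_Icc h)

/-- A smooth decreasing step. -/
theorem exists_step {p q : ℝ} (hpq : p < q) : ∃ θ : ℝ → ℝ, ContDiff ℝ ∞ θ ∧ (∀ s ≤ p, θ s = 1) ∧
    (∀ s, q ≤ s → θ s = 0) ∧ (∀ s, 0 ≤ θ s ∧ θ s ≤ 1) ∧
    ∃ M, ∀ s, |deriv θ s| ≤ M ∧ |deriv (deriv θ) s| ≤ M := by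
  have hq : 0 < q - p := by linarith
  set θ : ℝ → ℝ := fun s => Real.smoothTransition ((q - s) / (q - p)) with hθ
  have hc : ContDiff ℝ ∞ θ := Real.smoothTransition.contDiff.comp
    ((contDiff_const.sub contDiff_id).div_const _)
  have h1 : ∀ s ≤ p, θ s = 1 := fun s hs => Real.smoothTransition.one_of_one_le
    (by rw [le_div_iff₀ hq]; linarith)
  have h0 : ∀ s, q ≤ s → θ s = 0 := fun s hs => Real.smoothTransition.zero_of_nonpos
    (div_nonpos_of_nonpos_of_nonneg (by linarith) hq.le)
  have hd : ∀ s, s ∉ Icc p q → deriv θ s = 0 := fun s hs => by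
    rw [mem_Icc, not_and_or, not_le, not_le] at hs
    rcases hs with hs | hs
    · have : θ =ᶠ[𝓝 s] fun _ => 1 := by
        filter_upwards [Iio_mem_nhds hs] with y hy using h1 y (le_of_lt hy)
      rw [this.deriv_eq]; simp
    · have : θ =ᶠ[𝓝 s] fun _ => 0 := by
        filter_upwards [Ioi_mem_nhds hs] with y hy using h0 y (le_of_lt hy)
      rw [this.deriv_eq]; simp
  have hd2 : ∀ s, s ∉ Icc p q → deriv (deriv θ) s = 0 := fun s hs => by
    have : deriv θ =ᶠ[𝓝 s] fun _ => 0 := by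
      filter_upwards [isClosed_Icc.isOpen_compl.mem_nhds hs] with y hy using hd y hy
    rw [this.deriv_eq]; simp
  have hc1 : ContDiff ℝ ∞ (deriv θ) := (contDiff_infty_iff_deriv.1 hc).2
  have hc2 : ContDiff ℝ ∞ (deriv (deriv θ)) := (contDiff_infty_iff_deriv.1 hc1).2
  obtain ⟨M, hM⟩ := exists_bound_of_eq_zero_off hc1.continuous hd
  obtain ⟨M', hM'⟩ := exists_bound_of_eq_zero_off hc2.continuous hd2
  exact ⟨θ, hc, h1, h0, fun s => ⟨Real.smoothTransition.nonneg _, Real.smoothTransition.le_one _⟩,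
    max M M', fun s => ⟨(hM s).trans (le_max_left _ _), (hM' s).trans (le_max_right _ _)⟩⟩

/-- A function of `H¹` of the plane that vanishes off an open rectangle is in `H¹₀`. -/
theorem Sob.memH10 {Ω : Opens (ℝ × ℝ)} {v : ℝ × ℝ → ℝ} {g : Fin 2 → ℝ × ℝ → ℝ}
    (h : Sob univ v g) {a b c d : ℝ} (hab : a < b) (hcd : c < d)
    (hv : ∀ x, x ∉ Ioo a b ×ˢ Ioo c d → v x = 0)
    (hsub : Ioo a b ×ˢ Ioo c d ⊆ (Ω : Set (ℝ × ℝ))) : MemH10 Ω v := by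
  set l := b - a with hl
  set m := d - c with hm
  obtain ⟨θ, hθ, hθ1, hθ0, hθb, M, hM⟩ :=
    exists_step (p := a + l / 3) (q := a + 2 * l / 3) (by linarith)
  obtain ⟨τ, hτ, hτ1, hτ0, hτb, N, hN⟩ :=
    exists_step (p := c + m / 3) (q := c + 2 * m / 3) (by linarith)
  -- The products of the two cutoffs and their complements form a partition of unity with one piece
  -- per corner. A piece occupies two thirds of the rectangle in each direction and is pushed
  -- diagonally away from its corner. Shift and blur use up less than 3r/2 ≤ l/6, while a third of
  -- the length is available.
  set r := min l m / 9 with hr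
  have hr0 : 0 < r := div_pos (lt_min (by linarith) (by linarith)) (by norm_num)
  have hrl : r ≤ l / 9 := div_le_div_of_nonneg_right (min_le_left _ _) (by norm_num)
  have hrm : r ≤ m / 9 := div_le_div_of_nonneg_right (min_le_right _ _) (by norm_num)
  have hM0 : 0 ≤ M := (abs_nonneg _).trans (hM 0).1
  have hN0 : 0 ≤ N := (abs_nonneg _).trans (hN 0).1
  -- products of bounded functions of the coordinates
  have hprod : ∀ {A B : ℝ → ℝ}, ContDiff ℝ ∞ A → ContDiff ℝ ∞ B → (∀ s, |A s| ≤ 1) →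
      (∀ s, |B s| ≤ 1) → (∀ s, |deriv A s| ≤ M) → (∀ s, |deriv B s| ≤ N) →
      ∃ k, Sob univ (fun x => A x.1 * B x.2 * v x) k := by
    intro A B hA hB hA1 hB1 hAM hBN
    have hcA : ContDiff ℝ ∞ (fun x : ℝ × ℝ => A (co 0 x)) := hA.comp (contDiff_co 0)
    have hcB : ContDiff ℝ ∞ (fun x : ℝ × ℝ => B (co 1 x)) := hB.comp (contDiff_co 1)
    have hsB := h.mul (V := univ) (C := 1 + N) hcB (by simp) (fun x => (hB1 _).trans (by linarith))
      (fun i x => by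
        rw [pd_comp_co i 1 (hB.differentiable (by simp) _)]
        split_ifs
        · exact (hBN _).trans (by linarith)
        · simp; linarith)
    have hsA := hsB.mul (V := univ) (C := 1 + M) hcA (by simp)
      (fun x => (hA1 _).trans (by linarith)) (fun i x => by
        rw [pd_comp_co i 0 (hA.differentiable (by simp) _)]
        split_ifs
        · exact (hAM _).trans (by linarith)
        · simp; linarith)
    simp only [mul_assoc]
    exact ⟨_, hsA⟩
  have hθ' : ContDiff ℝ ∞ (fun s => 1 - θ s) := contDiff_const.sub hθ
  have hτ' : ContDiff ℝ ∞ (fun s => 1 - τ s) := contDiff_const.sub hτ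
  have bθ : ∀ s, |θ s| ≤ 1 := fun s => abs_le.2 ⟨by linarith [hθb s], (hθb s).2⟩
  have bτ : ∀ s, |τ s| ≤ 1 := fun s => abs_le.2 ⟨by linarith [hτb s], (hτb s).2⟩
  have bθ' : ∀ s, |1 - θ s| ≤ 1 := fun s => abs_le.2 ⟨by linarith [hθb s], by linarith [hθb s]⟩
  have bτ' : ∀ s, |1 - τ s| ≤ 1 := fun s => abs_le.2 ⟨by linarith [hτb s], by linarith [hτb s]⟩
  have dθ' : ∀ s, |deriv (fun s => 1 - θ s) s| ≤ M := fun s => by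
    rw [deriv_const_sub, abs_neg]; exact (hM s).1
  have dτ' : ∀ s, |deriv (fun s => 1 - τ s) s| ≤ N := fun s => by
    rw [deriv_const_sub, abs_neg]; exact (hN s).1
  have hvz : ∀ x : ℝ × ℝ, (x.1 < a ∨ b < x.1 ∨ x.2 < c ∨ d < x.2) → v x = 0 := by
    intro x hx
    refine hv x fun hx' => ?_
    obtain ⟨⟨h1, h2⟩, h3, h4⟩ := hx'
    rcases hx with hx | hx | hx | hx <;> linarith
  obtain ⟨k1, s1⟩ := hprod hθ hτ bθ bτ (fun s => (hM s).1) (fun s => (hN s).1)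
  obtain ⟨k2, s2⟩ := hprod hθ hτ' bθ bτ' (fun s => (hM s).1) dτ'
  obtain ⟨k3, s3⟩ := hprod hθ' hτ bθ' bτ dθ' (fun s => (hN s).1)
  obtain ⟨k4, s4⟩ := hprod hθ' hτ' bθ' bτ' dθ' dτ'
  have out : ∀ {a' b' c' d' : ℝ} {x : ℝ × ℝ}, x ∉ Icc a' b' ×ˢ Icc c' d' →
      x.1 < a' ∨ b' < x.1 ∨ x.2 < c' ∨ d' < x.2 := by
    intro a' b' c' d' x hx
    simp only [mem_prod, mem_Icc, not_and_or, not_le] at hx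
    tauto
  have m1 : MemH10 Ω (fun x => θ x.1 * τ x.2 * v x) := by
    refine s1.memH10_of_push (a := a) (b := a + 2 * l / 3) (c := c) (d := c + 2 * m / 3)
      (fun x hx => ?_) (1, 1) hr0 (fun t ht htr x hx => hsub ?_)
    · rcases out hx with h1 | h1 | h1 | h1
      · simp [hvz x (by tauto)]
      · simp [hθ0 _ h1.le]
      · simp [hvz x (by tauto)]
      · simp [hτ0 _ h1.le]
    · obtain ⟨⟨h1, h2⟩, h3, h4⟩ := hx
      constructor <;> constructor <;> dsimp only at * <;> linarith
  have m2 : MemH10 Ω (fun x => θ x.1 * (1 - τ x.2) * v x) := by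
    refine s2.memH10_of_push (a := a) (b := a + 2 * l / 3) (c := c + m / 3) (d := d)
      (fun x hx => ?_) (1, -1) hr0 (fun t ht htr x hx => hsub ?_)
    · rcases out hx with h1 | h1 | h1 | h1
      · simp [hvz x (by tauto)]
      · simp [hθ0 _ h1.le]
      · simp [hτ1 _ h1.le]
      · simp [hvz x (by tauto)]
    · obtain ⟨⟨h1, h2⟩, h3, h4⟩ := hx
      constructor <;> constructor <;> dsimp only at * <;> linarith
  have m3 : MemH10 Ω (fun x => (1 - θ x.1) * τ x.2 * v x) := by
    refine s3.memH10_of_push (a := a + l / 3) (b := b) (c := c) (d := c + 2 * m / 3)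
      (fun x hx => ?_) (-1, 1) hr0 (fun t ht htr x hx => hsub ?_)
    · rcases out hx with h1 | h1 | h1 | h1
      · simp [hθ1 _ h1.le]
      · simp [hvz x (by tauto)]
      · simp [hvz x (by tauto)]
      · simp [hτ0 _ h1.le]
    · obtain ⟨⟨h1, h2⟩, h3, h4⟩ := hx
      constructor <;> constructor <;> dsimp only at * <;> linarith
  have m4 : MemH10 Ω (fun x => (1 - θ x.1) * (1 - τ x.2) * v x) := by
    refine s4.memH10_of_push (a := a + l / 3) (b := b) (c := c + m / 3) (d := d)
      (fun x hx => ?_) (-1, -1) hr0 (fun t ht htr x hx => hsub ?_)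
    · rcases out hx with h1 | h1 | h1 | h1
      · simp [hθ1 _ h1.le]
      · simp [hvz x (by tauto)]
      · simp [hτ1 _ h1.le]
      · simp [hvz x (by tauto)]
    · obtain ⟨⟨h1, h2⟩, h3, h4⟩ := hx
      constructor <;> constructor <;> dsimp only at * <;> linarith
  have := (m1.add m2).add (m3.add m4)
  convert this using 2
  ring

end ThinChannel

end

/-! ### Solenoidal fields on a half-strip: stream function, Poincaré inequality and exponential
decay. -/

noncomputable section

namespace ThinChannel

open Filter Topology
open scoped Convolution

/-! ### Primitives in the second variable -/

/-- The integral of `η` over the vertical half-line above a point. -/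
def tailInt (η : ℝ × ℝ → ℝ) (x : ℝ × ℝ) : ℝ := ∫ t in Ioi x.2, η (x.1, t)

/-- The integral of `v` over the vertical half-line below a point. -/
def prim (v : ℝ × ℝ → ℝ) (x : ℝ × ℝ) : ℝ := ∫ s in Iio x.2, v (x.1, s)

theorem hasCompactSupport_slice {E : Type*} [Zero E] {η : ℝ × ℝ → E} (h : HasCompactSupport η)
    (a : ℝ) : HasCompactSupport fun t => η (a, t) := by
  refine HasCompactSupport.intro (h.isCompact.image continuous_snd) fun t ht => ?_
  exact image_eq_zero_of_notMem_tsupport fun h' => ht ⟨_, h', rfl⟩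

/-- Written as a convolution in x₂ with the indicator of a half-line, x₁ being a parameter, the tail
integral inherits smoothness and differentiation under the integral sign from the theory of
convolutions. -/
theorem tailInt_eq_convolution (η : ℝ × ℝ → ℝ) (x : ℝ × ℝ) :
    tailInt η x = ((Iio (0 : ℝ)).indicator 1 ⋆[ContinuousLinearMap.mul ℝ ℝ]
      (fun t => η (x.1, t))) x.2 := by
  rw [convolution_eq_swap, tailInt, ← integral_indicator measurableSet_Ioi]
  congr with t
  by_cases ht : x.2 < t <;> simp [indicator, ht]

theorem locallyIntegrable_halfLine : LocallyIntegrable ((Iio (0 : ℝ)).indicator (1 : ℝ → ℝ)) :=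
  (locallyIntegrable_const (1 : ℝ)).indicator measurableSet_Iio

theorem slice_eq_zero_of_notMem {η : ℝ × ℝ → ℝ} {p t : ℝ}
    (ht : t ∉ Prod.snd '' tsupport η) : η (p, t) = 0 :=
  image_eq_zero_of_notMem_tsupport fun h' => ht ⟨_, h', rfl⟩

theorem contDiff_tailInt {U : Set (ℝ × ℝ)} {η : ℝ × ℝ → ℝ} (hη : IsTest U η) :
    ContDiff ℝ ∞ (tailInt η) := by
  rw [show tailInt η = _ from funext (tailInt_eq_convolution η), ← contDiffOn_univ,
    ← univ_prod_univ]
  exact contDiffOn_convolution_right_with_param (n := ⊤) (ContinuousLinearMap.mul ℝ ℝ)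
    (g := fun p t => η (p, t)) isOpen_univ (hη.2.isCompact.image continuous_snd)
    (fun p t _ ht => slice_eq_zero_of_notMem ht) locallyIntegrable_halfLine hη.1.contDiffOn

theorem pd_tailInt {U : Set (ℝ × ℝ)} {η : ℝ × ℝ → ℝ} (hη : IsTest U η) (i : Fin 2) (x : ℝ × ℝ) :
    pd i (tailInt η) x = tailInt (pd i η) x := by
  have h := hasFDerivAt_convolution_right_with_param (ContinuousLinearMap.mul ℝ ℝ)
    (g := fun p t => η (p, t)) isOpen_univ (hη.2.isCompact.image continuous_snd)
    (fun p t _ ht => slice_eq_zero_of_notMem ht) locallyIntegrable_halfLine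
    (hη.1.of_le (by simp)).contDiffOn x (mem_univ _)
  rw [tailInt_eq_convolution, pd, show tailInt η = _ from funext (tailInt_eq_convolution η),
    h.fderiv, convolution, convolution, ContinuousLinearMap.integral_apply]
  · rfl
  · have hc : Continuous (fderiv ℝ η) :=
      (hη.1.of_le (m := 1) (by simp)).continuous_fderiv (by simp)
    exact HasCompactSupport.convolutionExists_right _
      (hasCompactSupport_slice (hη.2.fderiv ℝ) x.1) locallyIntegrable_halfLine
      (hc.comp (continuous_const.prodMk continuous_id)) x.2

theorem pd_one_slice {η : ℝ × ℝ → ℝ} (hη : Differentiable ℝ η) (a t : ℝ) :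
    HasDerivAt (fun t => η (a, t)) (pd 1 η (a, t)) t := by
  have h1 : HasDerivAt (fun t : ℝ => (a, t)) (e 1) t :=
    (hasDerivAt_const t a).prodMk (hasDerivAt_id t)
  exact (hη (a, t)).hasFDerivAt.comp_hasDerivAt t h1

theorem tailInt_pd_one {U : Set (ℝ × ℝ)} {η : ℝ × ℝ → ℝ} (hη : IsTest U η) (x : ℝ × ℝ) :
    tailInt (pd 1 η) x = -η x := by
  have hd := pd_one_slice hη.differentiable x.1
  have := HasCompactSupport.integral_Ioi_deriv_eq (f := fun t => η (x.1, t))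
    ((hη.1.of_le (by simp)).comp (contDiff_const.prodMk contDiff_id))
    (hasCompactSupport_slice hη.2 x.1) x.2
  rw [← show (fun t => η (x.1, t)) x.2 = η x from rfl, ← this, tailInt]
  congr with t
  exact (hd t).deriv.symm

/-- Exchange of the last two variables. -/
def swapLast : (ℝ × ℝ) × ℝ ≃ᵐ (ℝ × ℝ) × ℝ where
  toFun p := ((p.1.1, p.2), p.1.2)
  invFun p := ((p.1.1, p.2), p.1.2)
  left_inv _ := rfl
  right_inv _ := rfl
  measurable_toFun := show Measurable fun p : (ℝ × ℝ) × ℝ => ((p.1.1, p.2), p.1.2) by fun_prop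
  measurable_invFun := show Measurable fun p : (ℝ × ℝ) × ℝ => ((p.1.1, p.2), p.1.2) by fun_prop

theorem measurePreserving_swapLast :
    MeasurePreserving swapLast ((volume : Measure (ℝ × ℝ)).prod (volume : Measure ℝ))
      ((volume : Measure (ℝ × ℝ)).prod (volume : Measure ℝ)) := by
  have hA : MeasurePreserving (MeasurableEquiv.prodAssoc : (ℝ × ℝ) × ℝ ≃ᵐ ℝ × ℝ × ℝ)
      (((volume : Measure ℝ).prod (volume : Measure ℝ)).prod (volume : Measure ℝ))
      ((volume : Measure ℝ).prod ((volume : Measure ℝ).prod (volume : Measure ℝ))) :=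
    ⟨MeasurableEquiv.prodAssoc.measurable, Measure.prodAssoc_prod⟩
  have hB : MeasurePreserving (Prod.map id Prod.swap : ℝ × ℝ × ℝ → ℝ × ℝ × ℝ)
      ((volume : Measure ℝ).prod ((volume : Measure ℝ).prod (volume : Measure ℝ)))
      ((volume : Measure ℝ).prod ((volume : Measure ℝ).prod (volume : Measure ℝ))) :=
    (MeasurePreserving.id _).prod Measure.measurePreserving_swap
  exact (hA.symm.comp hB).comp hA

/-- The horizontal strip of width one. -/
def hStrip : Set (ℝ × ℝ) := {x | x.2 ∈ Ioo (-(1 / 2) : ℝ) (1 / 2)}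

theorem measurableSet_hStrip : MeasurableSet hStrip := measurableSet_Ioo.preimage measurable_snd

theorem aestronglyMeasurable_prim_integrand {v : ℝ × ℝ → ℝ} (hv : AEStronglyMeasurable v volume) :
    AEStronglyMeasurable (fun p : (ℝ × ℝ) × ℝ => {p : (ℝ × ℝ) × ℝ | p.2 < p.1.2}.indicator
      (fun p => v (p.1.1, p.2)) p) (volume.prod volume) := by
  refine AEStronglyMeasurable.indicator ?_ (measurableSet_lt (by fun_prop) (by fun_prop))
  exact (hv.comp_fst (ν := (volume : Measure ℝ))).comp_measurePreserving measurePreserving_swapLast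

theorem prim_eq (v : ℝ × ℝ → ℝ) (x : ℝ × ℝ) :
    prim v x = ∫ s, {p : (ℝ × ℝ) × ℝ | p.2 < p.1.2}.indicator (fun p => v (p.1.1, p.2)) (x, s) := by
  rw [prim, ← integral_indicator measurableSet_Iio]
  rfl

theorem aestronglyMeasurable_prim {v : ℝ × ℝ → ℝ} (hv : AEStronglyMeasurable v volume) :
    AEStronglyMeasurable (prim v) volume := by
  rw [show prim v = _ from funext (prim_eq v)]
  exact (aestronglyMeasurable_prim_integrand hv).integral_prod_right'

/-- The primitive is dual to the tail integral. -/
theorem integral_prim_mul {v : ℝ × ℝ → ℝ} (hv : MemLp v 2) (hz : ∀ x, x ∉ hStrip → v x = 0)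
    {η : ℝ × ℝ → ℝ} (hη : Measurable η) {C r : ℝ} (hC : ∀ x, |η x| ≤ C)
    (hη0 : ∀ {a b : ℝ}, (a ∉ Icc (-r) r ∨ b ∉ Icc (-r) r) → η (a, b) = 0) :
    ∫ x, prim v x * η x = ∫ x, v x * tailInt η x := by
  set box : Set (ℝ × ℝ) := Icc (-r) r ×ˢ Icc (-(1 / 2)) (1 / 2) with hbox
  have hboxm : MeasurableSet box := measurableSet_Icc.prod measurableSet_Icc
  have hvi : Integrable (box.indicator v) := by
    rw [integrable_indicator_iff hboxm]
    exact (hv.locallyIntegrable (by simp)).integrableOn_isCompact (isCompact_Icc.prod isCompact_Icc)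
  have hi : Integrable ((Icc (-r) r).indicator (1 : ℝ → ℝ)) := by
    rw [integrable_indicator_iff measurableSet_Icc]
    exact (locallyIntegrable_const (1 : ℝ)).integrableOn_isCompact isCompact_Icc
  -- Domination for Fubini's theorem. The inserted indicators change nothing on the support of η
  -- inside the strip, but they replace v, which need not be integrable, by an integrable function.
  have hK : Integrable (fun p : (ℝ × ℝ) × ℝ => {p : (ℝ × ℝ) × ℝ | p.1.2 < p.2}.indicator
      (fun p => η (p.1.1, p.2)) p * (box.indicator v p.1 * (Icc (-r) r).indicator 1 p.2))
      (volume.prod volume) := by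
    refine (hvi.mul_prod hi).bdd_mul (c := C) ?_ (ae_of_all _ fun p => ?_)
    · refine AEStronglyMeasurable.indicator ?_ (measurableSet_lt (by fun_prop) (by fun_prop))
      exact (hη.comp (by fun_prop)).aestronglyMeasurable
    · exact (norm_indicator_le_norm_self _ _).trans (hC _)
  have hKe : ∀ p : (ℝ × ℝ) × ℝ, {p : (ℝ × ℝ) × ℝ | p.1.2 < p.2}.indicator
      (fun p => η (p.1.1, p.2)) p * (box.indicator v p.1 * (Icc (-r) r).indicator 1 p.2)
      = v p.1 * (Ioi p.1.2).indicator (fun t => η (p.1.1, t)) p.2 := by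
    intro p
    by_cases h1 : p.1.2 < p.2
    swap
    · simp [indicator, h1]
    rw [indicator_of_mem (show p ∈ {p : (ℝ × ℝ) × ℝ | p.1.2 < p.2} from h1),
      indicator_of_mem (show p.2 ∈ Ioi p.1.2 from h1)]
    by_cases h2 : p.2 ∈ Icc (-r) r
    swap
    · simp [hη0 (Or.inr h2)]
    by_cases h3 : p.1 ∈ box
    · rw [indicator_of_mem h3, indicator_of_mem h2, Pi.one_apply]; ring
    · rw [hbox, mem_prod, not_and_or] at h3
      rcases h3 with h3 | h3
      · simp [hη0 (Or.inl h3)]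
      · have : v p.1 = 0 := hz _ fun h => h3 (Ioo_subset_Icc_self h)
        simp [this, indicator]
  simp only [hKe] at hK
  have e1 : ∫ x, v x * tailInt η x = ∫ p : (ℝ × ℝ) × ℝ,
      v p.1 * (Ioi p.1.2).indicator (fun t => η (p.1.1, t)) p.2 ∂(volume.prod volume) := by
    rw [integral_prod _ hK]
    congr with x
    change _ = ∫ y, v x * (Ioi x.2).indicator (fun t => η (x.1, t)) y
    rw [integral_const_mul, integral_indicator measurableSet_Ioi, tailInt]
  -- Exchanging x₂ with the integration variable turns the kernel of the tail integral of η into the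
  -- kernel of the primitive of v.
  have hK' := (measurePreserving_swapLast.integrable_comp_emb swapLast.measurableEmbedding).2 hK
  rw [e1, ← measurePreserving_swapLast.integral_comp' (g := fun p : (ℝ × ℝ) × ℝ =>
    v p.1 * (Ioi p.1.2).indicator (fun t => η (p.1.1, t)) p.2), integral_prod]
  · congr with x
    rw [prim, ← integral_mul_const, ← integral_indicator measurableSet_Iio]
    congr with s
    by_cases hs : s < x.2 <;> simp [swapLast, indicator, hs]
  · exact hK'

/-- Cauchy–Schwarz on the cross-section, whose length is one. -/
theorem enorm_prim_sq_le {v : ℝ × ℝ → ℝ} (hz : ∀ x, x ∉ hStrip → v x = 0) {x : ℝ × ℝ}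
    (hx : AEStronglyMeasurable (fun s => v (x.1, s)) volume) :
    ‖prim v x‖ₑ ^ (2 : ℝ) ≤ ∫⁻ s, ‖v (x.1, s)‖ₑ ^ (2 : ℝ) := by
  have h1 : ∫⁻ s, (Ioo (-(1 / 2) : ℝ) (1 / 2)).indicator (1 : ℝ → ℝ≥0∞) s = 1 := by
    rw [lintegral_indicator_one measurableSet_Ioo]; simp; norm_num
  have h2 := lintegral_sq_le_of_lintegral_eq_one (μ := volume)
    (((measurable_one (β := ℝ) (α := ℝ≥0∞)).indicator measurableSet_Ioo).aemeasurable) hx.enorm h1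
  calc ‖prim v x‖ₑ ^ (2 : ℝ) ≤ (∫⁻ s, (Ioo (-(1 / 2) : ℝ) (1 / 2)).indicator (1 : ℝ → ℝ≥0∞) s
        * ‖v (x.1, s)‖ₑ) ^ (2 : ℝ) := by
        refine ENNReal.rpow_le_rpow ?_ (by norm_num)
        refine (enorm_integral_le_lintegral_enorm _).trans ?_
        refine (setLIntegral_le_lintegral _ _).trans (lintegral_mono fun s => ?_)
        by_cases hs : s ∈ Ioo (-(1 / 2) : ℝ) (1 / 2)
        · rw [indicator_of_mem hs, Pi.one_apply, one_mul]
        · simp [hz (x.1, s) hs]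
    _ ≤ _ := h2
    _ ≤ _ := lintegral_mono fun s => by
        by_cases hs : s ∈ Ioo (-(1 / 2) : ℝ) (1 / 2)
        · rw [indicator_of_mem hs, Pi.one_apply, one_mul]
        · rw [indicator_of_notMem hs, zero_mul]; exact zero_le

/-- The primitive is square integrable on the strip. -/
theorem memLp_prim {v : ℝ × ℝ → ℝ} (hv : MemLp v 2) (hz : ∀ x, x ∉ hStrip → v x = 0) :
    MemLp (hStrip.indicator (prim v)) 2 := by
  refine ⟨(aestronglyMeasurable_prim hv.1).indicator measurableSet_hStrip, ?_⟩
  have hfin : eLpNorm v 2 volume ^ (2 : ℝ) < ⊤ := ENNReal.rpow_lt_top_of_nonneg (by norm_num) hv.2.ne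
  rw [eLpNorm_two_rpow] at hfin
  suffices h : eLpNorm (hStrip.indicator (prim v)) 2 volume ^ (2 : ℝ) < ⊤ by
    by_contra hcon
    rw [not_lt, top_le_iff] at hcon
    rw [hcon] at h
    simp at h
  rw [eLpNorm_two_rpow]
  refine lt_of_le_of_lt ?_ hfin
  have hm : AEMeasurable (fun x => ‖hStrip.indicator (prim v) x‖ₑ ^ (2 : ℝ)) volume :=
    ((aestronglyMeasurable_prim hv.1).indicator measurableSet_hStrip).enorm.pow_const _
  have hm' : AEMeasurable (fun x => ‖v x‖ₑ ^ (2 : ℝ)) volume := hv.1.enorm.pow_const _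
  rw [Measure.volume_eq_prod] at hm hm' ⊢
  rw [lintegral_prod _ hm, lintegral_prod _ hm']
  have hv1 : AEStronglyMeasurable v ((volume : Measure ℝ).prod (volume : Measure ℝ)) := hv.1
  refine lintegral_mono_ae ?_
  filter_upwards [hv1.prodMk_left] with a ha
  calc ∫⁻ y, ‖hStrip.indicator (prim v) (a, y)‖ₑ ^ (2 : ℝ)
      ≤ ∫⁻ y, (Ioo (-(1 / 2) : ℝ) (1 / 2)).indicator
          (fun _ => ∫⁻ s, ‖v (a, s)‖ₑ ^ (2 : ℝ)) y := by
        refine lintegral_mono fun y => ?_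
        by_cases hy : y ∈ Ioo (-(1 / 2) : ℝ) (1 / 2)
        · rw [indicator_of_mem (show (a, y) ∈ hStrip from hy), indicator_of_mem hy]
          exact enorm_prim_sq_le hz ha
        · rw [indicator_of_notMem (show (a, y) ∉ hStrip from hy), indicator_of_notMem hy]
          simp
    _ = _ := by
        rw [lintegral_indicator_const measurableSet_Ioo]; simp; norm_num

/-! ### Stream functions on a half-strip -/

/-- The half-plane `σ x₁ > 0`. -/
def halfPlane (σ : ℝ) : Set (ℝ × ℝ) := {x | 0 < σ * x.1}

theorem isOpen_halfPlane (σ : ℝ) : IsOpen (halfPlane σ) :=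
  isOpen_lt continuous_const (continuous_const.mul continuous_fst)

theorem tendsto_setIntegral_tail {f : ℝ × ℝ → ℝ} (hf : Integrable f) (σ : ℝ) :
    Tendsto (fun n : ℕ => ∫ x in {x : ℝ × ℝ | (n : ℝ) ≤ σ * x.1}, f x) atTop (𝓝 0) := by
  have h := tendsto_setIntegral_of_antitone (μ := volume) (f := f)
    (s := fun n : ℕ => {x : ℝ × ℝ | (n : ℝ) ≤ σ * x.1})
    (fun n => measurableSet_le measurable_const (measurable_const.mul measurable_fst))
    (fun m n hmn x hx => show (m : ℝ) ≤ σ * x.1 from le_trans (by exact_mod_cast hmn)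
      (show (n : ℝ) ≤ σ * x.1 from hx)) ⟨0, hf.integrableOn⟩
  have he : ⋂ n : ℕ, {x : ℝ × ℝ | (n : ℝ) ≤ σ * x.1} = ∅ := by
    ext x
    simp only [mem_iInter, Set.mem_ofPred_eq, mem_empty_iff_false, iff_false, not_forall, not_le]
    exact exists_nat_gt _
  rwa [he, setIntegral_empty] at h

/-- A divergence free field on a half-strip, vanishing on the lateral boundary. -/
structure DivFreeStrip (σ : ℝ) (u₁ u₂ : ℝ × ℝ → ℝ) (g₁ g₂ : Fin 2 → ℝ × ℝ → ℝ) : Prop where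
  sign : σ = 1 ∨ σ = -1
  sob₁ : Sob (halfPlane σ) u₁ g₁
  sob₂ : Sob (halfPlane σ) u₂ g₂
  zero₁ : ∀ x, x ∉ hStrip → u₁ x = 0
  zero₂ : ∀ x, x ∉ hStrip → u₂ x = 0
  div : ∀ᵐ x, x ∈ halfPlane σ → g₁ 0 x + g₂ 1 x = 0

/-- A cutoff in the second variable that is equal to one on the strip. -/
theorem exists_strip_cutoff : ∃ ζ : ℝ → ℝ, ContDiff ℝ ∞ ζ ∧ (∀ s, s ∉ Icc (-1 : ℝ) 1 → ζ s = 0) ∧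
    (∀ s ∈ Ioo (-(1 / 2) : ℝ) (1 / 2), ζ s = 1) ∧
    ∀ s ∈ Ioo (-(1 / 2) : ℝ) (1 / 2), deriv ζ s = 0 := by
  let f : ContDiffBump (0 : ℝ) := ⟨1 / 2, 1, by norm_num, by norm_num⟩
  have h1 : ∀ s ∈ Ioo (-(1 / 2) : ℝ) (1 / 2), f s = 1 := fun s hs =>
    f.one_of_mem_closedBall (by
      rw [mem_closedBall_zero_iff, Real.norm_eq_abs, abs_le]; exact ⟨hs.1.le, hs.2.le⟩)
  refine ⟨f, f.contDiff, fun s hs => f.zero_of_le_dist ?_, h1, fun s hs => ?_⟩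
  · rw [dist_zero_right, Real.norm_eq_abs]
    by_contra hcon
    exact hs (abs_le.1 (le_of_not_ge hcon))
  · have : f =ᶠ[𝓝 s] fun _ => 1 := by
      filter_upwards [isOpen_Ioo.mem_nhds hs] with y hy using h1 y hy
    rw [this.deriv_eq]; simp

namespace DivFreeStrip

variable {σ : ℝ} {u₁ u₂ : ℝ × ℝ → ℝ} {g₁ g₂ : Fin 2 → ℝ × ℝ → ℝ}

/-- The weak form of the divergence equation. -/
theorem integral_pd (h : DivFreeStrip σ u₁ u₂ g₁ g₂) {N : ℝ × ℝ → ℝ} (hN : ContDiff ℝ ∞ N)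
    {p q : ℝ} (hp : 0 < σ * p) (hq : 0 < σ * q) (hN0 : ∀ x : ℝ × ℝ, x.1 ∉ Icc p q → N x = 0) :
    ∫ x, u₁ x * pd 0 N x = -∫ x, u₂ x * pd 1 N x := by
  -- The weight N has bounded support in x₁ only. The factor ζ(x₂) makes it a test function and
  -- leaves the integrals unchanged, because ζ = 1 and ζ' = 0 on the strip, where the fields live.
  obtain ⟨ζ, hζ, hζ0, hζ1, hζ'⟩ := exists_strip_cutoff
  have hσs : ∀ s ∈ Icc p q, 0 < σ * s := fun s hs => by
    rcases h.sign with rfl | rfl <;> linarith [hs.1, hs.2]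
  have hsub : tsupport (fun x : ℝ × ℝ => ζ (co 1 x) * N x) ⊆ Icc p q ×ˢ Icc (-1) 1 := by
    refine closure_minimal (fun x hx => ?_) (isClosed_Icc.prod isClosed_Icc)
    refine ⟨by_contra fun h1 => hx (by simp [hN0 x h1]), by_contra fun h1 => hx (by
      simp only [co_one, hζ0 _ h1, zero_mul])⟩
  have ht : IsTest (halfPlane σ) (fun x => ζ (co 1 x) * N x) :=
    ⟨(hζ.comp (contDiff_co 1)).mul hN, (isCompact_Icc.prod isCompact_Icc).of_isClosed_subset
      (isClosed_tsupport _) hsub, fun x hx => hσs _ (hsub hx).1⟩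
  have hpd : ∀ i, ∀ x ∈ hStrip, pd i (fun x => ζ (co 1 x) * N x) x = pd i N x := by
    intro i x hx
    rw [pd_mul (a := fun x => ζ (co 1 x)) ((hζ.comp (contDiff_co 1)).differentiable (by simp) x)
      (hN.differentiable (by simp) x), pd_comp_co i 1 (hζ.differentiable (by simp) _),
      co_one, hζ1 _ hx, hζ' _ hx]
    simp
  have e1 := h.sob₁.3 0 _ ht
  have e2 := h.sob₂.3 1 _ ht
  have c1 : ∀ x, u₁ x * pd 0 (fun x => ζ (co 1 x) * N x) x = u₁ x * pd 0 N x := fun x => by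
    by_cases hx : x ∈ hStrip
    · rw [hpd 0 x hx]
    · simp [h.zero₁ x hx]
  have c2 : ∀ x, u₂ x * pd 1 (fun x => ζ (co 1 x) * N x) x = u₂ x * pd 1 N x := fun x => by
    by_cases hx : x ∈ hStrip
    · rw [hpd 1 x hx]
    · simp [h.zero₂ x hx]
  simp only [c1] at e1
  simp only [c2] at e2
  rw [e1, e2, neg_neg, eq_comm, ← sub_eq_zero, sub_neg_eq_add, ← integral_add
    (integrable_mul_of_memLp (h.sob₂.2 1) (ht.memLp 2 _))
    (integrable_mul_of_memLp (h.sob₁.2 0) (ht.memLp 2 _))]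
  refine integral_eq_zero_of_ae ?_
  filter_upwards [h.div] with x hx
  by_cases hxH : x ∈ halfPlane σ
  · have := hx hxH
    simp only [Pi.zero_apply, ← add_mul]
    rw [add_comm, this, zero_mul]
  · simp only [ht.eq_zero hxH, mul_zero, add_zero, Pi.zero_apply]

/-- The zero integral makes the primitive A of b vanish off [p, q]. As a weight in `integral_pd`,
A(x₁) has x₂-derivative zero and x₁-derivative b. This expresses that the flux is constant along the
strip. -/
theorem integral_flux_of_integral_eq_zero (h : DivFreeStrip σ u₁ u₂ g₁ g₂) {b : ℝ → ℝ}
    (hb : ContDiff ℝ ∞ b) {p q : ℝ} (hpq : p ≤ q) (hp : 0 < σ * p) (hq : 0 < σ * q)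
    (hb0 : ∀ s, s ∉ Icc p q → b s = 0) (hbi : ∫ s, b s = 0) : ∫ x, u₁ x * b x.1 = 0 := by
  set A : ℝ → ℝ := fun t => ∫ s in p..t, b s with hA
  have hd : ∀ t, HasDerivAt A (b t) t := fun t =>
    intervalIntegral.integral_hasDerivAt_right (hb.continuous.intervalIntegrable _ _)
      (hb.continuous.stronglyMeasurableAtFilter _ _) hb.continuous.continuousAt
  have hAd : deriv A = b := funext fun t => (hd t).deriv
  have hAs : ContDiff ℝ ∞ A := contDiff_infty_iff_deriv.2
    ⟨fun t => (hd t).differentiableAt, by rw [hAd]; exact hb⟩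
  have hpq0 : ∫ s in p..q, b s = 0 := by
    rw [intervalIntegral.integral_of_le hpq, ← integral_Icc_eq_integral_Ioc,
      setIntegral_eq_integral_of_forall_compl_eq_zero hb0, hbi]
  have hbp : b p = 0 := by
    have : Tendsto b (𝓝[<] p) (𝓝 (b p)) := hb.continuous.continuousAt.tendsto.mono_left
      nhdsWithin_le_nhds
    refine tendsto_nhds_unique this (tendsto_const_nhds.congr' ?_)
    filter_upwards [self_mem_nhdsWithin] with s hs
    exact (hb0 s fun h => absurd h.1 (not_le.2 hs)).symm
  have hA0 : ∀ t, t ∉ Icc p q → A t = 0 := by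
    intro t ht
    rw [mem_Icc, not_and_or, not_le, not_le] at ht
    rcases ht with ht | ht
    · refine intervalIntegral.integral_zero_ae (ae_of_all _ fun s hs => ?_)
      rw [uIoc_of_ge ht.le] at hs
      rcases hs.2.lt_or_eq with h1 | h1
      · exact hb0 s fun h => absurd h.1 (not_le.2 h1)
      · rw [h1, hbp]
    · rw [hA]
      simp only
      rw [← intervalIntegral.integral_add_adjacent_intervals (b := q)
        (hb.continuous.intervalIntegrable _ _) (hb.continuous.intervalIntegrable _ _), hpq0,
        zero_add]
      refine intervalIntegral.integral_zero_ae (ae_of_all _ fun s hs => ?_)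
      rw [uIoc_of_le ht.le] at hs
      exact hb0 s fun h => absurd h.2 (not_le.2 hs.1)
  have key := h.integral_pd (N := fun x => A (co 0 x)) (hAs.comp (contDiff_co 0)) hp hq
    (fun x hx => hA0 _ hx)
  have e0 : ∀ i x, pd i (fun x => A (co 0 x)) x = if i = 0 then b x.1 else 0 := fun i x => by
    rw [pd_comp_co i 0 (hAs.differentiable (by simp) _), hAd, co_zero]
  simp only [e0] at key
  simpa using key

/-- The flux of a square integrable divergence free field vanishes. -/
theorem integral_flux (h : DivFreeStrip σ u₁ u₂ g₁ g₂) {a : ℝ → ℝ}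
    (ha : ContDiff ℝ ∞ a) {p q : ℝ} (hpq : p ≤ q) (hp : 0 < σ * p) (hq : 0 < σ * q)
    (ha0 : ∀ s, s ∉ Icc p q → a s = 0) : ∫ x, u₁ x * a x.1 = 0 := by
  have hac : HasCompactSupport a := HasCompactSupport.intro isCompact_Icc ha0
  have hai : Integrable a := ha.continuous.integrable_of_hasCompactSupport hac
  -- the shifted weights
  let w : ℕ → ℝ × ℝ → ℝ := fun n x => hStrip.indicator (fun x => a (x.1 - σ * n)) x
  have hw0 : MemLp (w 0) 2 := by
    have hm : MemLp (fun x : ℝ × ℝ => a (co 0 x) * ((Ioo (-(1 / 2) : ℝ) (1 / 2)).indicator 1 x.2)) 2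
        volume := by
      obtain ⟨C, hC⟩ := ha.continuous.bounded_above_of_compact_support hac
      have hbox : MemLp ((Icc p q ×ˢ Ioo (-(1 / 2) : ℝ) (1 / 2)).indicator fun _ : ℝ × ℝ => (1 : ℝ))
          2 volume := memLp_indicator_const 2 (measurableSet_Icc.prod measurableSet_Ioo) 1 (Or.inr
            ((measure_mono (Set.prod_mono le_rfl Ioo_subset_Icc_self)).trans_lt
              (isCompact_Icc.prod isCompact_Icc).measure_lt_top).ne)
      refine (memLp_bdd_mul (b := fun x : ℝ × ℝ => a x.1) (C := C)
        (ha.continuous.comp continuous_fst).aestronglyMeasurable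
        (ae_of_all _ fun x => hC _) hbox).congr_norm ?_ (ae_of_all _ fun x => ?_)
      · exact ((ha.continuous.comp continuous_fst).aestronglyMeasurable).mul
          ((measurable_one.indicator measurableSet_Ioo).comp measurable_snd).aestronglyMeasurable
      · congr 1
        by_cases h1 : x.1 ∈ Icc p q <;> by_cases h2 : x.2 ∈ Ioo (-(1 / 2) : ℝ) (1 / 2)
        · rw [indicator_of_mem (show x ∈ Icc p q ×ˢ Ioo (-(1 / 2) : ℝ) (1 / 2) from ⟨h1, h2⟩),
            indicator_of_mem h2]; rfl
        · rw [indicator_of_notMem (fun h => h2 h.2), indicator_of_notMem h2]; simp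
        · simp [ha0 _ h1]
        · simp [ha0 _ h1]
    refine hm.congr_norm ?_ (ae_of_all _ fun x => ?_)
    · refine AEStronglyMeasurable.indicator ?_ measurableSet_hStrip
      exact (ha.continuous.comp (by fun_prop)).aestronglyMeasurable
    · congr 1
      by_cases h2 : x.2 ∈ Ioo (-(1 / 2) : ℝ) (1 / 2)
      · simp only [w]
        rw [indicator_of_mem (show x ∈ hStrip from h2), indicator_of_mem h2]; simp
      · simp only [w]
        rw [indicator_of_notMem (show x ∉ hStrip from h2), indicator_of_notMem h2]; simp
  have hwn : ∀ n, MemLp (w n) 2 ∧ nrm volume (w n) = nrm volume (w 0) := by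
    intro n
    have hmp : MeasurePreserving (fun x : ℝ × ℝ => x - (σ * n, 0)) volume volume :=
      measurePreserving_sub_right volume _
    have e1 : w n = w 0 ∘ fun x : ℝ × ℝ => x - (σ * n, 0) := by
      ext x
      by_cases h2 : x.2 ∈ Ioo (-(1 / 2) : ℝ) (1 / 2)
      · simp only [w, Function.comp_apply]
        rw [indicator_of_mem (show x ∈ hStrip from h2), indicator_of_mem (show x - (σ * n, 0) ∈ hStrip
          by simpa [hStrip] using h2)]
        simp
      · simp only [w, Function.comp_apply]
        rw [indicator_of_notMem (show x ∉ hStrip from h2), indicator_of_notMem (show x - (σ * n, 0) ∉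
          hStrip by simpa [hStrip] using h2)]
    rw [e1]
    exact ⟨hw0.comp_measurePreserving hmp, by
      rw [nrm, nrm, eLpNorm_comp_measurePreserving hw0.1 hmp]⟩
  -- A weight minus its translate has zero integral, so translation does not change the flux.
  have hshift : ∀ n : ℕ, ∫ x, u₁ x * a x.1 = ∫ x, u₁ x * w n x := by
    intro n
    have hσσ : σ * σ = 1 := by rcases h.sign with rfl | rfl <;> norm_num
    have e1 : ∀ x, u₁ x * w n x = u₁ x * a (x.1 - σ * n) := fun x => by
      by_cases hx : x ∈ hStrip
      · simp only [w]; rw [indicator_of_mem hx]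
      · simp [h.zero₁ x hx]
    have e2 : ∀ x, u₁ x * w 0 x = u₁ x * a x.1 := fun x => by
      by_cases hx : x ∈ hStrip
      · simp only [w]; rw [indicator_of_mem hx]; simp
      · simp [h.zero₁ x hx]
    have hn0 : (0 : ℝ) ≤ n := n.cast_nonneg
    have key := h.integral_flux_of_integral_eq_zero (b := fun s => a s - a (s - σ * n))
      (ha.sub (ha.comp (contDiff_id.sub contDiff_const))) (p := min p (p + σ * n))
      (q := max q (q + σ * n)) ((min_le_left _ _).trans (hpq.trans (le_max_left _ _)))
      (by rcases min_choice p (p + σ * n) with h1 | h1 <;> rw [h1] <;> nlinarith)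
      (by rcases max_choice q (q + σ * n) with h1 | h1 <;> rw [h1] <;> nlinarith) ?_ ?_
    · simp only [mul_sub, ← e1, ← e2] at key ⊢
      rw [integral_sub (integrable_mul_of_memLp h.sob₁.1 hw0)
        (integrable_mul_of_memLp h.sob₁.1 (hwn n).1)] at key
      linarith
    · intro s hs
      have h1 : s ∉ Icc p q := fun hs' => hs ⟨(min_le_left _ _).trans hs'.1,
        hs'.2.trans (le_max_left _ _)⟩
      have h2 : s - σ * n ∉ Icc p q := fun hs' => hs ⟨(min_le_right _ _).trans (by linarith [hs'.1]),
        le_trans (by linarith [hs'.2]) (le_max_right _ _)⟩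
      simp [ha0 _ h1, ha0 _ h2]
    · rw [integral_sub hai (hai.comp_sub_right _), integral_sub_right_eq_self, sub_self]
  have hsq : Integrable fun x => u₁ x * u₁ x := integrable_mul_of_memLp h.sob₁.1 h.sob₁.1
  have htail := tendsto_setIntegral_tail hsq σ
  -- The translated weights keep their L² norm but live beyond σ x₁ = n, where the square integrable
  -- u₁ carries less and less mass. The constant flux is therefore zero.
  have hbound : ∀ n : ℕ, |∫ x, u₁ x * a x.1| ≤
      Real.sqrt (∫ x in {x : ℝ × ℝ | (n : ℝ) ≤ σ * x.1}, u₁ x * u₁ x) * nrm volume (w 0) := by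
    intro n
    rw [hshift n, ← (hwn n).2]
    set T := {x : ℝ × ℝ | (n : ℝ) ≤ σ * x.1} with hT
    have hTm : MeasurableSet T := measurableSet_le measurable_const
      (measurable_const.mul measurable_fst)
    have hz : ∀ x, x ∉ T → u₁ x * w n x = 0 := by
      intro x hx
      have : w n x = 0 := by
        by_cases hs : x ∈ hStrip
        · simp only [w]
          rw [indicator_of_mem hs]
          refine ha0 _ fun h1 => hx ?_
          rw [hT, Set.mem_ofPred_eq]
          rcases h.sign with rfl | rfl <;> linarith [h1.1, h1.2]
        · simp only [w]
          rw [indicator_of_notMem hs]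
      simp [this]
    rw [← setIntegral_eq_integral_of_forall_compl_eq_zero hz]
    refine (abs_integral_mul_le (h.sob₁.1.restrict T) ((hwn n).1.restrict T)).trans ?_
    refine mul_le_mul (le_of_eq ?_) (ENNReal.toReal_mono (hwn n).1.2.ne
      (eLpNorm_mono_measure _ Measure.restrict_le_self)) nrm_nonneg (Real.sqrt_nonneg _)
    rw [← Real.sqrt_sq (nrm_nonneg (μ := volume.restrict T) (f := u₁)),
      nrm_sq (h.sob₁.1.restrict T)]
    simp [sq]
  have hlim : Tendsto (fun n : ℕ => Real.sqrt (∫ x in {x : ℝ × ℝ | (n : ℝ) ≤ σ * x.1}, u₁ x * u₁ x)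
      * nrm volume (w 0)) atTop (𝓝 0) := by
    have := (Real.continuous_sqrt.tendsto 0).comp htail
    simpa using this.mul_const (nrm volume (w 0))
  have := ge_of_tendsto' hlim hbound
  exact abs_eq_zero.1 (le_antisymm this (abs_nonneg _))

theorem integrable_mul (h : DivFreeStrip σ u₁ u₂ g₁ g₂) {N : ℝ × ℝ → ℝ} (hN : ContDiff ℝ ∞ N)
    {p q : ℝ} (hN0 : ∀ x : ℝ × ℝ, x.1 ∉ Icc p q → N x = 0) : Integrable fun x => u₁ x * N x := by
  obtain ⟨ζ, hζ, hζ0, hζ1, -⟩ := exists_strip_cutoff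
  have hc : HasCompactSupport fun x : ℝ × ℝ => ζ (co 1 x) * N x := by
    refine HasCompactSupport.intro (isCompact_Icc.prod isCompact_Icc (s := Icc p q)
      (t := Icc (-1) 1)) fun x hx => ?_
    rw [mem_prod, not_and_or] at hx
    rcases hx with hx | hx
    · rw [hN0 x hx, mul_zero]
    · rw [co_one, hζ0 _ hx, zero_mul]
  have hm : MemLp (fun x : ℝ × ℝ => ζ (co 1 x) * N x) 2 :=
    ((hζ.comp (contDiff_co 1)).mul hN).continuous.memLp_of_hasCompactSupport hc
  refine (integrable_mul_of_memLp h.sob₁.1 hm).congr (ae_of_all _ fun x => ?_)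
  by_cases hx : x ∈ hStrip
  · simp only [co_one, hζ1 _ hx, one_mul]
  · simp only [h.zero₁ x hx, zero_mul]

/-- The stream function of a divergence free field on a half-strip. -/
theorem exists_stream (h : DivFreeStrip σ u₁ u₂ g₁ g₂) : ∃ Ψ : ℝ × ℝ → ℝ,
    (∀ x, x ∉ hStrip → Ψ x = 0) ∧ Sob (halfPlane σ) Ψ ![fun x => -u₂ x, u₁] := by
  -- The primitive of u₁ from the lower wall. Vanishing flux makes it vanish at the upper wall as
  -- well, so truncation to the strip creates no singular x₂-derivative. This is proved by duality,
  -- without traces.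
  refine ⟨hStrip.indicator (prim u₁), fun x hx => indicator_of_notMem hx _,
    memLp_prim h.sob₁.1 h.zero₁, fun i => ?_, fun i η hη => ?_⟩
  · fin_cases i
    · exact h.sob₂.1.neg
    · exact h.sob₁.1
  obtain ⟨p, q, hpq, hp, hq, hsupp⟩ : ∃ p q : ℝ, p ≤ q ∧ 0 < σ * p ∧ 0 < σ * q ∧
      ∀ x ∈ tsupport η, x.1 ∈ Icc p q := by
    have hK : IsCompact (Prod.fst '' tsupport η) := hη.2.isCompact.image continuous_fst
    rcases (tsupport η).eq_empty_or_nonempty with he | hne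
    · refine ⟨σ, σ, le_rfl, ?_, ?_, by simp [he]⟩ <;> rcases h.sign with rfl | rfl <;> norm_num
    · obtain ⟨p, hp⟩ := hK.exists_isLeast (hne.image _)
      obtain ⟨q, hq⟩ := hK.exists_isGreatest (hne.image _)
      refine ⟨p, q, hp.2 hq.1, ?_, ?_, fun x hx => ⟨hp.2 ⟨x, hx, rfl⟩, hq.2 ⟨x, hx, rfl⟩⟩⟩
      · obtain ⟨x, hx, rfl⟩ := hp.1; exact hη.3 hx
      · obtain ⟨x, hx, rfl⟩ := hq.1; exact hη.3 hx
  -- integration against a test function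
  have key : ∀ ζ : ℝ × ℝ → ℝ, IsTest (halfPlane σ) ζ → tsupport ζ ⊆ tsupport η →
      ∫ x, hStrip.indicator (prim u₁) x * ζ x = ∫ x, u₁ x * tailInt ζ x := by
    intro ζ hζ hζη
    obtain ⟨C, hC⟩ := hζ.bounded
    obtain ⟨r, hr⟩ : ∃ r : ℝ, tsupport ζ ⊆ Icc (-r) r ×ˢ Icc (-r) r := by
      obtain ⟨r, hr⟩ := hζ.2.isCompact.isBounded.subset_closedBall 0
      refine ⟨r, fun x hx => ?_⟩
      have := hr hx
      rw [mem_closedBall_zero_iff, Prod.norm_def] at this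
      exact ⟨abs_le.1 ((le_max_left _ _).trans this), abs_le.1 ((le_max_right _ _).trans this)⟩
    have hζ0 : ∀ {a b : ℝ}, (a ∉ Icc (-r) r ∨ b ∉ Icc (-r) r) → ζ (a, b) = 0 := fun h =>
      image_eq_zero_of_notMem_tsupport fun h' => by
        rcases h with h | h
        · exact h (hr h').1
        · exact h (hr h').2
    -- Below the strip the primitive is zero by itself, so only the truncation at the upper wall has
    -- to be transferred to the test function.
    set B : Set (ℝ × ℝ) := {x | x.2 < 1 / 2} with hB
    have hBm : MeasurableSet B := measurableSet_lt measurable_snd measurable_const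
    have e1 : ∀ x, hStrip.indicator (prim u₁) x * ζ x = prim u₁ x * B.indicator ζ x := by
      intro x
      by_cases hx : x ∈ hStrip
      · rw [indicator_of_mem hx, indicator_of_mem (show x ∈ B from hx.2)]
      · rw [indicator_of_notMem hx, zero_mul]
        by_cases hxB : x ∈ B
        · have : prim u₁ x = 0 := by
            refine setIntegral_eq_zero_of_forall_eq_zero fun s hs => h.zero₁ _ fun hs' => hx ?_
            exact ⟨hs'.1.trans hs, hxB⟩
          rw [this, zero_mul]
        · rw [indicator_of_notMem hxB, mul_zero]
    simp only [e1]
    rw [integral_prim_mul h.sob₁.1 h.zero₁ (hζ.continuous.measurable.indicator hBm) (C := C) (r := r)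
      (fun x => (Real.norm_eq_abs _).symm.le.trans ((norm_indicator_le_norm_self _ _).trans (hC x)))
      (fun {a b} hab => by simp [indicator, hζ0 hab])]
    have hJ : ContDiff ℝ ∞ (fun t : ℝ => tailInt ζ (t, 1 / 2)) :=
      (contDiff_tailInt hζ).comp (contDiff_id.prodMk contDiff_const)
    have h0 : ∀ s, s ∉ Icc p q → ∀ b, tailInt ζ (s, b) = 0 := fun s hs b => by
      refine setIntegral_eq_zero_of_forall_eq_zero fun t _ => ?_
      exact image_eq_zero_of_notMem_tsupport fun h' => hs (hsupp _ (hζη h'))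
    -- Truncating ζ at the upper wall changes its tail integral at points of the strip by a function
    -- of x₁ alone, against which u₁ integrates to zero.
    have hflux := h.integral_flux hJ hpq hp hq (fun s hs => h0 s hs _)
    have e2 : ∀ x, u₁ x * tailInt (B.indicator ζ) x
        = u₁ x * tailInt ζ x - u₁ x * tailInt ζ (x.1, 1 / 2) := by
      intro x
      by_cases hx : x ∈ hStrip
      · rw [← mul_sub]
        congr 1
        have hi : Integrable (fun t => ζ (x.1, t)) :=
          (hζ.continuous.comp (by fun_prop)).integrable_of_hasCompactSupport
            (hasCompactSupport_slice hζ.2 _)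
        have hsplit : ∫ t in Ioi x.2, ζ (x.1, t)
            = (∫ t in Ioo x.2 (1 / 2), ζ (x.1, t)) + ∫ t in Ioi (1 / 2), ζ (x.1, t) := by
          rw [← integral_Ico_eq_integral_Ioo, ← Ioc_union_Ioi_eq_Ioi hx.2.le,
            setIntegral_union (Ioc_disjoint_Ioi le_rfl) measurableSet_Ioi hi.integrableOn
            hi.integrableOn, integral_Ioc_eq_integral_Ioo, integral_Ico_eq_integral_Ioo]
        have hB' : ∫ t in Ioi x.2, B.indicator ζ (x.1, t) = ∫ t in Ioo x.2 (1 / 2), ζ (x.1, t) := by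
          rw [← integral_indicator measurableSet_Ioi, ← integral_indicator measurableSet_Ioo]
          congr with t
          by_cases h1 : x.2 < t <;> by_cases h2 : t < 1 / 2 <;>
            simp only [indicator, mem_Ioi, mem_Ioo, h1, h2, hB, Set.mem_ofPred_eq] <;> simp
        simp only [tailInt]
        rw [hB', hsplit]; ring
      · simp [h.zero₁ x hx]
    simp only [e2]
    rw [integral_sub, hflux, sub_zero]
    · exact h.integrable_mul (contDiff_tailInt hζ) fun x hx => h0 x.1 hx _
    · exact h.integrable_mul (hJ.comp contDiff_fst) fun x hx => h0 x.1 hx _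
  have hN0 : ∀ x : ℝ × ℝ, x.1 ∉ Icc p q → tailInt η x = 0 := fun x hx =>
    setIntegral_eq_zero_of_forall_eq_zero fun t _ =>
      image_eq_zero_of_notMem_tsupport fun h' => hx (hsupp (x.1, t) h')
  rw [key _ (hη.der i) (tsupport_pd_subset i η)]
  fin_cases i
  · simp only [Fin.zero_eta, Matrix.cons_val_zero, neg_mul, integral_neg, neg_neg]
    -- The divergence equation with the tail integral of η as weight: its x₂-derivative is -η, which
    -- leaves the integral of u₂ η and gives ∂₁Ψ = -u₂.
    have := h.integral_pd (contDiff_tailInt hη) hp hq hN0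
    simp only [pd_tailInt hη, tailInt_pd_one hη] at this
    rw [this, ← integral_neg]
    simp
  · simp only [Fin.mk_one, tailInt_pd_one hη, mul_neg, integral_neg]
    simp

end DivFreeStrip

end ThinChannel

end

noncomputable section

namespace ThinChannel

open Filter Topology

/-! ### The Poincaré inequality -/

theorem nrm_restrict_eq {U : Set (ℝ × ℝ)} {f : ℝ × ℝ → ℝ} (hf : ∀ x, x ∉ U → f x = 0) :
    nrm (volume.restrict U) f = nrm volume f := by
  rw [nrm, nrm, eLpNorm_restrict_eq_of_support_subset]
  exact fun x hx => by_contra fun h => hx (hf x h)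

theorem nrm_restrict_le {U : Set (ℝ × ℝ)} {f : ℝ × ℝ → ℝ} (hf : MemLp f 2) :
    nrm (volume.restrict U) f ≤ nrm volume f :=
  ENNReal.toReal_mono hf.2.ne (eLpNorm_mono_measure _ Measure.restrict_le_self)

/-- Integrating by parts with the multiplier x₂ gives ∫ η² = -2 ∫ x₂ η ∂₂η, and |x₂| ≤ h on the
support. For the strip of width one the constant 2h equals one. -/
theorem IsTest.poincare {U : Set (ℝ × ℝ)} {η : ℝ × ℝ → ℝ} (hη : IsTest U η) {h : ℝ} (hh : 0 ≤ h)
    (hU : ∀ x ∈ U, |x.2| ≤ h) : nrm volume η ≤ 2 * h * nrm volume (pd 1 η) := by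
  have hs : ContDiff ℝ ∞ fun x : ℝ × ℝ => x.2 := contDiff_snd
  have ht : IsTest U fun x => x.2 * η x := hη.mul hs
  have hp : ∀ x, ThinChannel.pd 1 (fun x => x.2 * η x) x = x.2 * ThinChannel.pd 1 η x + η x := by
    intro x
    rw [pd_mul (hs.differentiable (by simp) x) (hη.differentiable x)]
    have := pd_comp_co 1 1 (θ := fun s => s) (x := x) differentiableAt_id
    simp only [co_one, if_true, deriv_id''] at this
    rw [this, one_mul]
  have hm := hη.memLp 2 volume
  have hm1 := (hη.der 1).memLp 2 volume
  have hmt := ht.memLp 2 volume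
  have e1 := (hη.sob (V := U)).weak 1 _ ht
  simp only [hp, mul_add] at e1
  have e2 : ∀ x, η x * (x.2 * ThinChannel.pd 1 η x) = ThinChannel.pd 1 η x * (x.2 * η x) :=
    fun x => by ring
  simp only [e2] at e1
  rw [integral_add (integrable_mul_of_memLp hm1 hmt) (integrable_mul_of_memLp hm hm)] at e1
  have e3 := abs_integral_mul_le hm1 hmt
  have e4 : nrm volume (fun x => x.2 * η x) ≤ h * nrm volume η := by
    rw [← abs_of_nonneg hh, ← nrm_const_mul]
    refine nrm_le_of_abs_le (hm.const_mul h) (ae_of_all _ fun x => ?_)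
    by_cases hx : x ∈ U
    · rw [abs_mul, abs_mul, abs_of_nonneg hh]
      exact mul_le_mul_of_nonneg_right (hU x hx) (abs_nonneg _)
    · simp [hη.eq_zero hx]
  have e5 : nrm volume η ^ 2 = ∫ x, η x * η x := by rw [nrm_sq hm]; simp [sq]
  have e6 : nrm volume (ThinChannel.pd 1 η) * nrm volume (fun x => x.2 * η x)
      ≤ nrm volume (ThinChannel.pd 1 η) * (h * nrm volume η) :=
    mul_le_mul_of_nonneg_left e4 nrm_nonneg
  rw [abs_le] at e3
  rcases (nrm_nonneg (μ := volume) (f := η)).eq_or_lt with h0 | h0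
  · rw [← h0]; exact mul_nonneg (by positivity) nrm_nonneg
  · refine le_of_mul_le_mul_right (a := nrm volume η) ?_ h0
    nlinarith

theorem MemH10.poincare {Ω : Opens (ℝ × ℝ)} {v : ℝ × ℝ → ℝ} (hv : MemH10 Ω v) {h : ℝ}
    (hh : 0 ≤ h) (hU : ∀ x ∈ Ω, |x.2| ≤ h) :
    nrm (volume.restrict Ω) v ≤ 2 * h * nrm (volume.restrict Ω) (weakPartial Ω 1 v) := by
  obtain ⟨h1, h2⟩ := memH10_iff.1 hv
  refine le_of_forall_pos_le_add fun τ hτ => ?_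
  obtain ⟨η, hη, e1, e2⟩ := h2 (τ / (1 + 2 * h)) (by positivity)
  have hm := (hη.memLp 2 volume).restrict (Ω : Set (ℝ × ℝ))
  have hm1 := ((hη.der 1).memLp 2 volume).restrict (Ω : Set (ℝ × ℝ))
  have hw := (weakPartial_spec h1 1).1
  have a1 := nrm_add_le (f := fun x => v x - η x) (h1.1.sub hm : MemLp (fun x => v x - η x) 2 (volume.restrict Ω)) hm
  rw [show (fun x => v x - η x + η x) = v from funext fun x => sub_add_cancel _ _] at a1
  have a2 := nrm_sub_le (g := fun x => weakPartial Ω 1 v x - pd 1 η x) hw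
    (hw.sub hm1 : MemLp (fun x => weakPartial Ω 1 v x - pd 1 η x) 2 (volume.restrict Ω))
  rw [show (fun x => weakPartial Ω 1 v x - (weakPartial Ω 1 v x - pd 1 η x)) = pd 1 η from
    funext fun x => sub_sub_cancel _ _] at a2
  have a3 := hη.poincare hh hU
  rw [← nrm_restrict_eq fun x hx => hη.eq_zero hx,
    ← nrm_restrict_eq fun x hx => (hη.der 1).eq_zero hx] at a3
  have a4 := e2 1
  have a5 : (τ / (1 + 2 * h)) * (1 + 2 * h) = τ := by field_simp
  nlinarith

theorem Sob.poincare {v : ℝ × ℝ → ℝ} {g : Fin 2 → ℝ × ℝ → ℝ} (h : Sob univ v g) {a b : ℝ}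
    (hab : a < b) (hv : ∀ x, x ∉ Ioo a b ×ˢ Ioo (-(1 / 2) : ℝ) (1 / 2) → v x = 0) :
    nrm volume v ≤ nrm volume (g 1) := by
  let Ω : Opens (ℝ × ℝ) := ⟨Ioo a b ×ˢ Ioo (-(1 / 2) : ℝ) (1 / 2), isOpen_Ioo.prod isOpen_Ioo⟩
  have hm : MemH10 Ω v := h.memH10 hab (by norm_num) hv le_rfl
  have hp := hm.poincare (h := 1 / 2) (by norm_num) fun x hx => abs_le.2 ⟨hx.2.1.le, hx.2.2.le⟩
  rw [nrm_congr ((h.mono (subset_univ _)).weakPartial_ae (ae_eq_refl _) 1),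
    nrm_restrict_eq (U := Ω) hv] at hp
  refine hp.trans ?_
  rw [mul_one_div_cancel two_ne_zero, one_mul]
  exact nrm_restrict_le (h.memLp_grad 1)

/-! ### Fields on a half-strip, cut off in the axial direction -/

section Slab

variable {σ : ℝ} {v : ℝ × ℝ → ℝ} {g : Fin 2 → ℝ × ℝ → ℝ} {c : ℝ → ℝ} {p q : ℝ}

theorem mem_halfPlane_of_mem_Icc (hp : 0 < σ * p) (hq : 0 < σ * q) {s : ℝ}
    (hs : s ∈ Icc p q) : 0 < σ * s := by
  rcases le_total 0 σ with h | h
  · exact hp.trans_le (mul_le_mul_of_nonneg_left hs.1 h)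
  · exact hq.trans_le (mul_le_mul_of_nonpos_left hs.2 h)

theorem deriv_eq_zero_off (hc0 : ∀ s, s ∉ Icc p q → c s = 0) : ∀ s, s ∉ Icc p q → deriv c s = 0 := by
  intro s hs
  have : c =ᶠ[𝓝 s] fun _ => 0 := by
    filter_upwards [isClosed_Icc.isOpen_compl.mem_nhds hs] with y hy using hc0 y hy
  rw [this.deriv_eq]; simp

theorem Sob.slab_mul (h : Sob (halfPlane σ) v g) (hc : ContDiff ℝ ∞ c) (hp : 0 < σ * p)
    (hq : 0 < σ * q) (hc0 : ∀ s, s ∉ Icc p q → c s = 0) :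
    Sob univ (fun x => c x.1 * v x)
      (fun i x => c x.1 * g i x + (if i = 0 then deriv c x.1 else 0) * v x) := by
  have hd : ContDiff ℝ ∞ (deriv c) := (contDiff_infty_iff_deriv.1 hc).2
  obtain ⟨M, hM⟩ := exists_bound_of_eq_zero_off hc.continuous hc0
  obtain ⟨M', hM'⟩ := exists_bound_of_eq_zero_off hd.continuous (deriv_eq_zero_off hc0)
  have hpd : ∀ i x, pd i (fun y => c (co 0 y)) x = if i = 0 then deriv c x.1 else 0 := fun i x => by
    rw [pd_comp_co i 0 (hc.differentiable (by simp) _), co_zero]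
  have := h.mul (V := univ) (a := fun x => c (co 0 x)) (hc.comp (contDiff_co 0)) ?_ (C := max M M')
    (fun x => (hM _).trans (le_max_left _ _)) (fun i x => ?_)
  · simp only [hpd] at this
    exact this
  · rintro x ⟨hx, -⟩
    have : tsupport (fun x => c (co 0 x)) ⊆ {x | x.1 ∈ Icc p q} :=
      closure_minimal (fun x hx => by_contra fun h1 => hx (hc0 _ h1))
        (isClosed_Icc.preimage continuous_fst)
    exact mem_halfPlane_of_mem_Icc hp hq (this hx)
  · rw [hpd]
    split_ifs
    · exact (hM' _).trans (le_max_right _ _)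
    · rw [abs_zero]; exact (abs_nonneg _).trans ((hM 0).trans (le_max_left _ _))

theorem slab_eq_zero (hc0 : ∀ s, s ∉ Icc p q → c s = 0) (hv : ∀ x, x ∉ hStrip → v x = 0)
    (x : ℝ × ℝ) (hx : x ∉ Ioo (p - 1) (q + 1) ×ˢ Ioo (-(1 / 2) : ℝ) (1 / 2)) :
    c x.1 * v x = 0 := by
  rw [mem_prod, not_and_or] at hx
  rcases hx with hx | hx
  · rw [hc0 x.1 fun h => hx ⟨by linarith [h.1], by linarith [h.2]⟩, zero_mul]
  · rw [hv x hx, mul_zero]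

/-- A factor depending on x₁ only commutes with ∂₂, so the same weight appears on both sides. This
localizes Poincaré's inequality to the region where c does not vanish. -/
theorem Sob.slab_poincare (h : Sob (halfPlane σ) v g) (hv : ∀ x, x ∉ hStrip → v x = 0)
    (hc : ContDiff ℝ ∞ c) (hpq : p ≤ q) (hp : 0 < σ * p)
    (hq : 0 < σ * q) (hc0 : ∀ s, s ∉ Icc p q → c s = 0) :
    nrm volume (fun x => c x.1 * v x) ≤ nrm volume (fun x => c x.1 * g 1 x) := by
  have := (h.slab_mul hc hp hq hc0).poincare (a := p - 1) (b := q + 1) (by linarith)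
    (slab_eq_zero hc0 hv)
  simpa using this

end Slab

/-- A weak solution of the Stokes equations on a half-strip, together with its stream function. -/
structure StripFlow (σ : ℝ) (u : Fin 2 → ℝ × ℝ → ℝ) (g : Fin 2 → Fin 2 → ℝ × ℝ → ℝ)
    (Ψ : ℝ × ℝ → ℝ) : Prop where
  sign : σ = 1 ∨ σ = -1
  sob : ∀ i, Sob (halfPlane σ) (u i) (g i)
  zero : ∀ i x, x ∉ hStrip → u i x = 0
  div : ∀ᵐ x, x ∈ halfPlane σ → g 0 0 x + g 1 1 x = 0
  stream : Sob (halfPlane σ) Ψ ![fun x => -u 1 x, u 0]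
  stream_zero : ∀ x, x ∉ hStrip → Ψ x = 0
  weak : ∀ (ψ : Fin 2 → ℝ × ℝ → ℝ) (k : Fin 2 → Fin 2 → ℝ × ℝ → ℝ) (p q : ℝ), p < q →
    (∀ i, Sob univ (ψ i) (k i)) → 0 ≤ σ * p → 0 ≤ σ * q →
    (∀ i x, x ∉ Ioo p q ×ˢ Ioo (-(1 / 2) : ℝ) (1 / 2) → ψ i x = 0) →
    (∀ᵐ x, k 0 0 x + k 1 1 x = 0) → ∫ x, ∑ i, ∑ j, g i j x * k i j x = 0

/-- The energy density of a matrix field. -/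
def dens (g : Fin 2 → Fin 2 → ℝ × ℝ → ℝ) (x : ℝ × ℝ) : ℝ := ∑ i, ∑ j, g i j x ^ 2

theorem dens_nonneg (g : Fin 2 → Fin 2 → ℝ × ℝ → ℝ) (x : ℝ × ℝ) : 0 ≤ dens g x :=
  Finset.sum_nonneg fun _ _ => Finset.sum_nonneg fun _ _ => sq_nonneg _

theorem sq_le_dens (g : Fin 2 → Fin 2 → ℝ × ℝ → ℝ) (i j : Fin 2) (x : ℝ × ℝ) :
    g i j x ^ 2 ≤ dens g x :=
  (Finset.single_le_sum (f := fun j => g i j x ^ 2) (fun _ _ => sq_nonneg _)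
    (Finset.mem_univ j)).trans (Finset.single_le_sum (f := fun i => ∑ j, g i j x ^ 2)
    (fun _ _ => Finset.sum_nonneg fun _ _ => sq_nonneg _) (Finset.mem_univ i))

namespace StripFlow

variable {σ : ℝ} {u : Fin 2 → ℝ × ℝ → ℝ} {g : Fin 2 → Fin 2 → ℝ × ℝ → ℝ} {Ψ : ℝ × ℝ → ℝ}

theorem integrable_dens (h : StripFlow σ u g Ψ) : Integrable (dens g) :=
  integrable_finsetSum _ fun i _ => integrable_finsetSum _ fun j _ =>
    ((h.sob i).memLp_grad j).integrable_sq

theorem nrm_le_sqrt (h : StripFlow σ u g Ψ) (S : Set (ℝ × ℝ)) (i j : Fin 2) :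
    nrm (volume.restrict S) (g i j) ≤ Real.sqrt (∫ x in S, dens g x) := by
  refine Real.le_sqrt_of_sq_le ?_
  rw [nrm_sq (((h.sob i).memLp_grad j).restrict S)]
  exact integral_mono (((h.sob i).memLp_grad j).restrict S).integrable_sq
    h.integrable_dens.integrableOn fun x => sq_le_dens g i j x

theorem cutoff_energy_le (h : StripFlow σ u g Ψ) {c : ℝ → ℝ} (hc : ContDiff ℝ ∞ c) {p q : ℝ}
    (hpq : p ≤ q) (hp : 0 < σ * p) (hq : 0 < σ * q) (hc0 : ∀ s, s ∉ Icc p q → c s = 0)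
    {M : ℝ} (hM : 0 ≤ M) (h1 : ∀ s, |deriv c s| ≤ M) (h2 : ∀ s, |deriv (deriv c) s| ≤ M)
    {S : Set (ℝ × ℝ)}
    (hS1 : ∀ x, x ∉ S → deriv c x.1 = 0) (hS2 : ∀ x, x ∉ S → deriv (deriv c) x.1 = 0) :
    ∫ x, c x.1 * dens g x ≤ 5 * M * ∫ x in S, dens g x := by
  have hd : ContDiff ℝ ∞ (deriv c) := (contDiff_infty_iff_deriv.1 hc).2
  have hdd : ContDiff ℝ ∞ (deriv (deriv c)) := (contDiff_infty_iff_deriv.1 hd).2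
  have hd0 := deriv_eq_zero_off hc0
  have hdd0 := deriv_eq_zero_off hd0
  have hu := fun i => (h.sob i).slab_mul hc hp hq hc0
  have hΨ := h.stream.slab_mul hd hp hq hd0
  have hΨ1 := h.stream.slab_mul hdd hp hq hdd0
  have hu1 := fun i => (h.sob i).slab_mul hd hp hq hd0
  -- the test field
  let ψ : Fin 2 → ℝ × ℝ → ℝ :=
    ![fun x => c x.1 * u 0 x, fun x => c x.1 * u 1 x - deriv c x.1 * Ψ x]
  let k : Fin 2 → Fin 2 → ℝ × ℝ → ℝ :=
    ![fun j x => c x.1 * g 0 j x + (if j = 0 then deriv c x.1 else 0) * u 0 x,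
      fun j x => (c x.1 * g 1 j x + (if j = 0 then deriv c x.1 else 0) * u 1 x) -
        (deriv c x.1 * (![fun x => -u 1 x, u 0] : Fin 2 → ℝ × ℝ → ℝ) j x +
          (if j = 0 then deriv (deriv c) x.1 else 0) * Ψ x)]
  have hψ : ∀ i, Sob univ (ψ i) (k i) := by
    intro i
    fin_cases i
    · exact hu 0
    · exact (hu 1).sub hΨ
  obtain ⟨P, Q, hPQ, hP, hQ, hin⟩ : ∃ P Q : ℝ, P < Q ∧ 0 ≤ σ * P ∧ 0 ≤ σ * Q ∧ Icc p q ⊆ Ioo P Q := by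
    rcases h.sign with rfl | rfl
    · exact ⟨p / 2, q + 1, by linarith, by linarith, by linarith,
        fun s hs => ⟨by linarith [hs.1], by linarith [hs.2]⟩⟩
    · exact ⟨p - 1, q / 2, by linarith, by linarith, by linarith,
        fun s hs => ⟨by linarith [hs.1], by linarith [hs.2]⟩⟩
  have hz : ∀ i x, x ∉ Ioo P Q ×ˢ Ioo (-(1 / 2) : ℝ) (1 / 2) → ψ i x = 0 := by
    intro i x hx
    rw [mem_prod, not_and_or] at hx
    rcases hx with hx | hx
    · have hx' : x.1 ∉ Icc p q := fun h' => hx (hin h')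
      fin_cases i <;> simp [ψ, hc0 _ hx', hd0 _ hx']
    · have e1 : ∀ i, u i x = 0 := fun i => h.zero i x hx
      have e2 : Ψ x = 0 := h.stream_zero x hx
      fin_cases i <;> simp [ψ, e1, e2]
  have hdiv : ∀ᵐ x, k 0 0 x + k 1 1 x = 0 := by
    filter_upwards [h.div] with x hx
    by_cases hxH : x ∈ halfPlane σ
    · have := hx hxH
      simp [k]
      linear_combination c x.1 * this
    · have hx' : x.1 ∉ Icc p q := fun h' => hxH (mem_halfPlane_of_mem_Icc hp hq h')
      simp [k, hc0 _ hx', hd0 _ hx']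
  have key := h.weak ψ k P Q hPQ hψ hP hQ hz hdiv
  -- the remainder terms
  let r : Fin 4 → ℝ × ℝ → ℝ := ![fun x => g 0 0 x * (deriv c x.1 * u 0 x),
    fun x => 2 * (g 1 0 x * (deriv c x.1 * u 1 x)), fun x => -(g 1 0 x * (deriv (deriv c) x.1 * Ψ x)),
    fun x => -(g 1 1 x * (deriv c x.1 * u 0 x))]
  have hexp : ∀ x, ∑ i, ∑ j, g i j x * k i j x = c x.1 * dens g x + (r 0 x + r 1 x + r 2 x + r 3 x) := by
    intro x
    simp only [Fin.sum_univ_two, k, r, dens]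
    simp
    ring
  simp only [hexp] at key
  have hG := fun i j => (h.sob i).memLp_grad j
  have hr0 : Integrable (r 0) := integrable_mul_of_memLp (hG 0 0) (hu1 0).memLp
  have hr1 : Integrable (r 1) := (integrable_mul_of_memLp (hG 1 0) (hu1 1).memLp).const_mul 2
  have hr2 : Integrable (r 2) := (integrable_mul_of_memLp (hG 1 0) hΨ1.memLp).neg
  have hr3 : Integrable (r 3) := (integrable_mul_of_memLp (hG 1 1) (hu1 0).memLp).neg
  have hcG : Integrable fun x => c x.1 * dens g x := by
    obtain ⟨C, hC⟩ := exists_bound_of_eq_zero_off hc.continuous hc0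
    exact h.integrable_dens.bdd_mul (c := C)
      (hc.continuous.comp continuous_fst).aestronglyMeasurable (ae_of_all _ fun x => hC _)
  have hr01 := integrable_fun_add hr0 hr1
  have hr012 := integrable_fun_add hr01 hr2
  rw [integral_add hcG (integrable_fun_add hr012 hr3), integral_add hr012 hr3,
    integral_add hr01 hr2, integral_add hr0 hr1] at key
  -- bounds
  set E := ∫ x in S, dens g x with hE
  have hE0 : 0 ≤ E := integral_nonneg fun x => dens_nonneg g x
  -- Each remainder is a gradient entry times a derivative of c times a field, and Poincaré's
  -- inequality turns the field into a gradient entry with the same weight. For Ψ it is applied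
  -- twice, through ∂₂Ψ = u₁. Four such terms, one of them with coefficient two, account for the
  -- factor 5.
  have hbd : ∀ (d : ℝ → ℝ) (w : ℝ × ℝ → ℝ) (i j a : Fin 2), (∀ x, x ∉ S → d x.1 = 0) →
      (∀ s, |d s| ≤ M) → MemLp (fun x => d x.1 * w x) 2 →
      nrm volume (fun x => d x.1 * w x) ≤ nrm volume (fun x => d x.1 * g a 1 x) →
      |∫ x, g i j x * (d x.1 * w x)| ≤ M * E := by
    intro d w i j a hdS hdM hm hn
    have z1 : ∀ x, x ∉ S → g i j x * (d x.1 * w x) = 0 := fun x hx => by simp [hdS x hx]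
    have z2 : ∀ x, x ∉ S → d x.1 * g a 1 x = 0 := fun x hx => by simp [hdS x hx]
    rw [← setIntegral_eq_integral_of_forall_compl_eq_zero z1]
    refine (abs_integral_mul_le ((hG i j).restrict S) (hm.restrict S)).trans ?_
    have b1 := h.nrm_le_sqrt S i j
    have b2 := h.nrm_le_sqrt S a 1
    have b3 : nrm (volume.restrict S) (fun x => d x.1 * w x) ≤ M * Real.sqrt E := by
      refine (nrm_restrict_le hm).trans (hn.trans ?_)
      rw [← nrm_restrict_eq z2]
      exact (nrm_bdd_mul_le hM (ae_of_all _ fun x => hdM _) ((hG a 1).restrict S)).trans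
        (mul_le_mul_of_nonneg_left b2 hM)
    calc _ ≤ Real.sqrt E * (M * Real.sqrt E) := mul_le_mul b1 b3 nrm_nonneg (Real.sqrt_nonneg _)
      _ = M * (Real.sqrt E * Real.sqrt E) := by ring
      _ = M * E := by rw [Real.mul_self_sqrt hE0]
  have hP0 := fun i => (h.sob i).slab_poincare (h.zero i) hd hpq hp hq hd0
  have b0 := hbd (deriv c) (u 0) 0 0 0 hS1 h1 (hu1 0).memLp (hP0 0)
  have b1 := hbd (deriv c) (u 1) 1 0 1 hS1 h1 (hu1 1).memLp (hP0 1)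
  have b3 := hbd (deriv c) (u 0) 1 1 0 hS1 h1 (hu1 0).memLp (hP0 0)
  have b2 := hbd (deriv (deriv c)) Ψ 1 0 0 hS2 h2 hΨ1.memLp
    ((h.stream.slab_poincare h.stream_zero hdd hpq hp hq hdd0).trans
      (by simpa using (h.sob 0).slab_poincare (h.zero 0) hdd hpq hp hq hdd0))
  have i1 : ∫ x, r 1 x = 2 * ∫ x, g 1 0 x * (deriv c x.1 * u 1 x) := integral_const_mul _ _
  have i2 : ∫ x, r 2 x = -∫ x, g 1 0 x * (deriv (deriv c) x.1 * Ψ x) := integral_neg _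
  have i3 : ∫ x, r 3 x = -∫ x, g 1 1 x * (deriv c x.1 * u 0 x) := integral_neg _
  have i0 : ∫ x, r 0 x = ∫ x, g 0 0 x * (deriv c x.1 * u 0 x) := rfl
  rw [i0, i1, i2, i3] at key
  rw [abs_le] at b0 b1 b2 b3
  linarith [b0.1, b1.1, b2.2, b3.2]

end StripFlow

end ThinChannel

end

noncomputable section

namespace ThinChannel

open Filter Topology

/-! ### Exponential decay on a half-strip -/

/-- The part of the plane beyond the cross-section `σ x₁ = t`. -/
def tail (σ t : ℝ) : Set (ℝ × ℝ) := {x | t ≤ σ * x.1}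

theorem measurableSet_tail (σ t : ℝ) : MeasurableSet (tail σ t) :=
  measurableSet_le measurable_const (measurable_const.mul measurable_fst)

theorem tail_anti (σ : ℝ) {s t : ℝ} (h : s ≤ t) : tail σ t ⊆ tail σ s := fun _ hx => h.trans hx

/-- Cutoff functions to a slab with uniformly bounded derivatives. -/
theorem exists_slab_cutoff : ∃ M : ℝ, 0 ≤ M ∧ ∀ σ t T : ℝ, (σ = 1 ∨ σ = -1) → 0 < t → t + 1 ≤ T →
    ∃ (c : ℝ → ℝ) (p q : ℝ), ContDiff ℝ ∞ c ∧ p ≤ q ∧ 0 < σ * p ∧ 0 < σ * q ∧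
      (∀ s, s ∉ Icc p q → c s = 0) ∧ (∀ s, 0 ≤ c s ∧ c s ≤ 1) ∧
      (∀ s, t + 1 ≤ σ * s → σ * s ≤ T → c s = 1) ∧ (∀ s, σ * s < t → c s = 0) ∧
      (∀ s, |deriv c s| ≤ M) ∧ (∀ s, |deriv (deriv c) s| ≤ M) ∧
      ∀ s, ¬(t ≤ σ * s ∧ σ * s ≤ t + 1 ∨ T ≤ σ * s) → deriv c s = 0 ∧ deriv (deriv c) s = 0 := by
  obtain ⟨θ, hθ, hθ1, hθ0, hθb, M, hM⟩ := exists_step (p := 0) (q := 1) one_pos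
  have hM0 : 0 ≤ M := (abs_nonneg _).trans (hM 0).1
  -- The cutoff is a product of a rising factor a and a falling factor b, both bounded by one. Its
  -- first derivative is at most 2M, and its second at most 2M + 2M², the square coming from 2a'b'.
  refine ⟨2 * M + 2 * M ^ 2, by positivity, fun σ t T hσ ht hT => ?_⟩
  have hσσ : σ * σ = 1 := by rcases hσ with rfl | rfl <;> norm_num
  have hσa : |σ| = 1 := by rcases hσ with rfl | rfl <;> norm_num
  set a : ℝ → ℝ := fun s => 1 - θ (σ * s - t) with ha
  set b : ℝ → ℝ := fun s => θ (σ * s - T) with hb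
  have hθd : Differentiable ℝ θ := hθ.differentiable (by simp)
  have hθdd : Differentiable ℝ (deriv θ) :=
    ((contDiff_infty_iff_deriv.1 hθ).2).differentiable (by simp)
  have hlin : ∀ r s : ℝ, HasDerivAt (fun s => σ * s - r) σ s := fun r s => by
    simpa using ((hasDerivAt_id s).const_mul σ).sub_const r
  have hda : ∀ s, HasDerivAt a (-(deriv θ (σ * s - t) * σ)) s := fun s => by
    have := (hθd _).hasDerivAt.comp s (hlin t s)
    simpa using this.const_sub 1
  have hdb : ∀ s, HasDerivAt b (deriv θ (σ * s - T) * σ) s := fun s =>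
    (hθd _).hasDerivAt.comp s (hlin T s)
  have hda' : ∀ s, HasDerivAt (fun s => -(deriv θ (σ * s - t) * σ))
      (-(deriv (deriv θ) (σ * s - t) * σ * σ)) s := fun s =>
    (((hθdd _).hasDerivAt.comp s (hlin t s)).mul_const σ).neg
  have hdb' : ∀ s, HasDerivAt (fun s => deriv θ (σ * s - T) * σ)
      (deriv (deriv θ) (σ * s - T) * σ * σ) s := fun s =>
    ((hθdd _).hasDerivAt.comp s (hlin T s)).mul_const σ
  have hdc : ∀ s, HasDerivAt (fun s => a s * b s)
      (-(deriv θ (σ * s - t) * σ) * b s + a s * (deriv θ (σ * s - T) * σ)) s := fun s =>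
    (hda s).mul (hdb s)
  have hdc' := fun s => ((hda' s).mul (hdb s)).add ((hda s).mul (hdb' s))
  have hd1 : deriv (fun s => a s * b s) = fun s =>
      -(deriv θ (σ * s - t) * σ) * b s + a s * (deriv θ (σ * s - T) * σ) :=
    funext fun s => (hdc s).deriv
  have habs : ∀ x y B D : ℝ, |x| ≤ B → |y| ≤ D → |x * y| ≤ B * D := fun x y B D hx hy => by
    rw [abs_mul]; exact mul_le_mul hx hy (abs_nonneg _) ((abs_nonneg _).trans hx)
  have ha1 : ∀ s, |a s| ≤ 1 := fun s => by
    rw [abs_le]; constructor <;> simp only [ha] <;> linarith [(hθb (σ * s - t)).1, (hθb (σ * s - t)).2]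
  have hb1 : ∀ s, |b s| ≤ 1 := fun s => by
    rw [abs_le]; constructor <;> simp only [hb] <;> linarith [(hθb (σ * s - T)).1, (hθb (σ * s - T)).2]
  have hlocal : ∀ {s v : ℝ} {U : Set ℝ}, IsOpen U → s ∈ U → (∀ y ∈ U, a y * b y = v) →
      deriv (fun s => a s * b s) s = 0 ∧ deriv (deriv fun s => a s * b s) s = 0 := by
    intro s v U hU hs hv
    have e1 : ∀ y ∈ U, deriv (fun s => a s * b s) y = 0 := fun y hy => by
      have : (fun s => a s * b s) =ᶠ[𝓝 y] fun _ => v := by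
        filter_upwards [hU.mem_nhds hy] with z hz using hv z hz
      rw [this.deriv_eq]; simp
    refine ⟨e1 s hs, ?_⟩
    have : deriv (fun s => a s * b s) =ᶠ[𝓝 s] fun _ => 0 := by
      filter_upwards [hU.mem_nhds hs] with z hz using e1 z hz
    rw [this.deriv_eq]; simp
  have hcont : Continuous fun s : ℝ => σ * s := continuous_const.mul continuous_id
  have hz1 : ∀ s, σ * s < t → a s * b s = 0 := fun s hs => by
    simp only [ha]; rw [hθ1 _ (by linarith)]; simp
  have hz2 : ∀ s, T + 1 ≤ σ * s → a s * b s = 0 := fun s hs => by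
    simp only [hb]; rw [hθ0 _ (by linarith)]; simp
  have hone : ∀ s, t + 1 ≤ σ * s → σ * s ≤ T → a s * b s = 1 := fun s h1 h2 => by
    simp only [ha, hb]; rw [hθ0 _ (by linarith), hθ1 _ (by linarith)]; simp
  have hsm : ∀ r : ℝ, ContDiff ℝ ∞ fun s : ℝ => θ (σ * s - r) := fun r =>
    hθ.comp ((contDiff_const.mul contDiff_id).sub contDiff_const)
  refine ⟨fun s => a s * b s, min (σ * t) (σ * (T + 1)), max (σ * t) (σ * (T + 1)),
    (contDiff_const.sub (hsm t)).mul (hsm T), min_le_max, ?_, ?_, ?_, ?_, hone, hz1, ?_, ?_, ?_⟩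
  · rcases min_choice (σ * t) (σ * (T + 1)) with h | h <;> rw [h, ← mul_assoc, hσσ] <;> linarith
  · rcases max_choice (σ * t) (σ * (T + 1)) with h | h <;> rw [h, ← mul_assoc, hσσ] <;> linarith
  · intro s hs
    by_contra hne
    refine hs ?_
    have h1 : t ≤ σ * s := not_lt.1 fun h => hne (hz1 s h)
    have h2 : σ * s ≤ T + 1 := le_of_not_ge fun h => hne (hz2 s h)
    rcases hσ with rfl | rfl
    · exact ⟨(min_le_left _ _).trans (by linarith), le_trans (by linarith) (le_max_right _ _)⟩
    · exact ⟨(min_le_right _ _).trans (by linarith), le_trans (by linarith) (le_max_left _ _)⟩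
  · intro s
    have h1 := hθb (σ * s - t)
    have h2 := hθb (σ * s - T)
    exact ⟨mul_nonneg (by simp only [ha]; linarith) h2.1,
      mul_le_one₀ (by simp only [ha]; linarith) h2.1 h2.2⟩
  · intro s
    rw [hd1]
    have k1 : |-(deriv θ (σ * s - t) * σ) * b s| ≤ M * 1 * 1 := habs _ _ _ _ (by
      rw [abs_neg]; exact habs _ _ _ _ (hM _).1 hσa.le) (hb1 s)
    have k2 : |a s * (deriv θ (σ * s - T) * σ)| ≤ 1 * (M * 1) :=
      habs _ _ _ _ (ha1 s) (habs _ _ _ _ (hM _).1 hσa.le)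
    refine (abs_add_le _ _).trans ?_
    nlinarith [sq_nonneg M]
  · intro s
    rw [hd1, show deriv (fun s => -(deriv θ (σ * s - t) * σ) * b s + a s * (deriv θ (σ * s - T) * σ)) s
      = _ from (hdc' s).deriv]
    have n1 : |-(deriv θ (σ * s - t) * σ)| ≤ M * 1 := by
      rw [abs_neg]; exact habs _ _ _ _ (hM _).1 hσa.le
    have n2 : |deriv θ (σ * s - T) * σ| ≤ M * 1 := habs _ _ _ _ (hM _).1 hσa.le
    have k1 : |-(deriv (deriv θ) (σ * s - t) * σ * σ) * b s| ≤ M * 1 * 1 * 1 := habs _ _ _ _ (by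
      rw [abs_neg]; exact habs _ _ _ _ (habs _ _ _ _ (hM _).2 hσa.le) hσa.le) (hb1 s)
    have k2 := habs _ _ _ _ n1 n2
    have k3 : |a s * (deriv (deriv θ) (σ * s - T) * σ * σ)| ≤ 1 * (M * 1 * 1) :=
      habs _ _ _ _ (ha1 s) (habs _ _ _ _ (habs _ _ _ _ (hM _).2 hσa.le) hσa.le)
    refine (abs_add_le _ _).trans ((add_le_add (abs_add_le _ _) (abs_add_le _ _)).trans ?_)
    nlinarith [sq_nonneg M]
  · intro s hs
    rw [not_or, not_and_or, not_le, not_le, not_le] at hs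
    obtain ⟨h1 | h1, h2⟩ := hs
    · exact hlocal (U := {y | σ * y < t}) (isOpen_lt hcont continuous_const) h1 fun y hy => hz1 y hy
    · exact hlocal (U := {y | t + 1 < σ * y ∧ σ * y < T}) (IsOpen.inter
        (isOpen_lt continuous_const hcont) (isOpen_lt hcont continuous_const)) ⟨h1, h2⟩
        fun y hy => hone y hy.1.le hy.2.le

theorem tendsto_integral_tail {f : ℝ × ℝ → ℝ} (hf : Integrable f) (σ : ℝ) :
    Tendsto (fun n : ℕ => ∫ x in tail σ n, f x) atTop (𝓝 0) := tendsto_setIntegral_tail hf σ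

theorem integral_indicator_sub {A B : Set (ℝ × ℝ)} (hA : MeasurableSet A) (hB : MeasurableSet B)
    {f : ℝ × ℝ → ℝ} (hf : Integrable f) :
    ∫ x, (A.indicator f x - B.indicator f x) = (∫ x in A, f x) - ∫ x in B, f x := by
  rw [integral_sub (hf.indicator hA) (hf.indicator hB), integral_indicator hA, integral_indicator hB]

/-- Poincaré's inequality on the tails of a half-strip. -/
theorem Sob.tail_poincare {σ : ℝ} (hσ : σ = 1 ∨ σ = -1) {v : ℝ × ℝ → ℝ} {g : Fin 2 → ℝ × ℝ → ℝ}
    (h : Sob (halfPlane σ) v g) (hv : ∀ x, x ∉ hStrip → v x = 0) {t : ℝ} (ht : 0 < t) :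
    ∫ x in tail σ (t + 1), v x ^ 2 ≤ ∫ x in tail σ t, g 1 x ^ 2 := by
  obtain ⟨M, -, hM⟩ := exists_slab_cutoff
  have hv2 := h.memLp.integrable_sq
  have hg2 := (h.memLp_grad 1).integrable_sq
  have key : ∀ n : ℕ, t + 1 ≤ n → (∫ x in tail σ (t + 1), v x ^ 2) - ∫ x in tail σ n, v x ^ 2
      ≤ ∫ x in tail σ t, g 1 x ^ 2 := by
    intro n hn
    obtain ⟨c, p, q, hc, hpq, hp, hq, hc0, hcb, hc1, hct, -⟩ := hM σ t n hσ ht hn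
    have hcm : AEStronglyMeasurable (fun x : ℝ × ℝ => c x.1) volume :=
      (hc.continuous.comp continuous_fst).aestronglyMeasurable
    have hcb' : ∀ x : ℝ × ℝ, |c x.1| ≤ 1 := fun x => abs_le.2 ⟨by linarith [(hcb x.1).1], (hcb x.1).2⟩
    have m1 := memLp_bdd_mul hcm (ae_of_all _ hcb') h.memLp
    have m2 := memLp_bdd_mul hcm (ae_of_all _ hcb') (h.memLp_grad 1)
    have hP := pow_le_pow_left₀ nrm_nonneg (h.slab_poincare hv hc hpq hp hq hc0) 2
    rw [nrm_sq m1, nrm_sq m2] at hP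
    rw [← integral_indicator_sub (measurableSet_tail _ _) (measurableSet_tail _ _) hv2,
      ← integral_indicator (measurableSet_tail _ _)]
    refine le_trans (integral_mono ((hv2.indicator (measurableSet_tail _ _)).sub
      (hv2.indicator (measurableSet_tail _ _))) m1.integrable_sq fun x => ?_) (hP.trans
      (integral_mono m2.integrable_sq (hg2.indicator (measurableSet_tail _ _)) fun x => ?_))
    · by_cases h1 : x ∈ tail σ n
      · rw [indicator_of_mem h1, indicator_of_mem (tail_anti σ hn h1), sub_self]
        positivity
      · rw [indicator_of_notMem h1, sub_zero]
        by_cases h2 : x ∈ tail σ (t + 1)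
        · rw [indicator_of_mem h2, hc1 _ h2 (le_of_not_ge h1), one_mul]
        · rw [indicator_of_notMem h2]; positivity
    · by_cases h2 : x ∈ tail σ t
      · rw [indicator_of_mem h2, mul_pow]
        exact mul_le_of_le_one_left (sq_nonneg _) (pow_le_one₀ (hcb _).1 (hcb _).2)
      · simp only [indicator_of_notMem h2, hct _ (not_le.1 h2)]; simp
  have hlim := (tendsto_const_nhds (x := ∫ x in tail σ (t + 1), v x ^ 2)).sub
    (tendsto_integral_tail hv2 σ)
  rw [sub_zero] at hlim
  refine le_of_tendsto hlim ?_
  filter_upwards [eventually_ge_atTop ⌈t + 1⌉₊] with n hn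
  exact key n (Nat.ceil_le.1 hn)

/-- Geometric decay of the square of the `L²` norm of the tails. -/
def GeomDecay (σ : ℝ) (f : ℝ × ℝ → ℝ) : Prop :=
  ∃ C θ a : ℝ, 0 < θ ∧ θ < 1 ∧ 0 < a ∧ ∀ m : ℕ, ∫ x in tail σ (a + 2 * m), f x ^ 2 ≤ C * θ ^ m

theorem GeomDecay.poincare {σ : ℝ} (hσ : σ = 1 ∨ σ = -1) {v : ℝ × ℝ → ℝ} {g : Fin 2 → ℝ × ℝ → ℝ}
    (h : Sob (halfPlane σ) v g) (hv : ∀ x, x ∉ hStrip → v x = 0) (hg : GeomDecay σ (g 1)) :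
    GeomDecay σ v := by
  obtain ⟨C, θ, a, h0, h1, ha, H⟩ := hg
  refine ⟨C, θ, a + 1, h0, h1, by linarith, fun m => ?_⟩
  have := h.tail_poincare hσ hv (t := a + 2 * m) (by positivity)
  rw [show a + 1 + 2 * (m : ℝ) = a + 2 * m + 1 by ring]
  exact this.trans (H m)

/-- Saint-Venant's principle by hole filling: the energy beyond a section is bounded by a multiple
of the energy in a slab of bounded length before it. Adding that multiple of the far energy to both
sides gives a contraction. -/
theorem StripFlow.geomDecay_grad {σ : ℝ} {u : Fin 2 → ℝ × ℝ → ℝ} {g : Fin 2 → Fin 2 → ℝ × ℝ → ℝ}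
    {Ψ : ℝ × ℝ → ℝ} (h : StripFlow σ u g Ψ) (i j : Fin 2) : GeomDecay σ (g i j) := by
  obtain ⟨M, hM0, hM⟩ := exists_slab_cutoff
  set E : ℝ → ℝ := fun t => ∫ x in tail σ t, dens g x with hE
  have hd := h.integrable_dens
  have hE0 : ∀ t, 0 ≤ E t := fun t => integral_nonneg fun x => dens_nonneg g x
  have hm := fun t => measurableSet_tail σ t
  -- The cutoff rises for t ≤ σ x₁ ≤ t+1, a slab disjoint from the tail beyond t+2. Its energy is
  -- therefore at most E t - E (t + 2).
  have step : ∀ t, 0 < t → E (t + 2) ≤ 5 * M * (E t - E (t + 2)) := by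
    intro t ht
    -- Test fields must have bounded support, so the cutoff falls again beyond distance n. The extra
    -- terms E n disappear as n tends to infinity.
    have key : ∀ n : ℕ, t + 2 ≤ n → E (t + 2) - E n ≤ 5 * M * (E t - (E (t + 2) - E n)) := by
      intro n hn
      obtain ⟨c, p, q, hc, hpq, hp, hq, hc0, hcb, hc1, hct, hd1, hd2, hdS⟩ :=
        hM σ t n h.sign ht (by linarith)
      set S : Set (ℝ × ℝ) := {x | t ≤ σ * x.1 ∧ σ * x.1 ≤ t + 1 ∨ (n : ℝ) ≤ σ * x.1} with hS
      have hcl : Continuous fun x : ℝ × ℝ => σ * x.1 := continuous_const.mul continuous_fst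
      have hSm : MeasurableSet S := MeasurableSet.union (MeasurableSet.inter
        (measurableSet_le measurable_const hcl.measurable)
        (measurableSet_le hcl.measurable measurable_const))
        (measurableSet_le measurable_const hcl.measurable)
      have hen := h.cutoff_energy_le hc hpq hp hq hc0 hM0 hd1 hd2 (S := S)
        (fun x hx => (hdS _ hx).1) (fun x hx => (hdS _ hx).2)
      have hcG : Integrable fun x => c x.1 * dens g x :=
        hd.bdd_mul (c := 1) (hc.continuous.comp continuous_fst).aestronglyMeasurable
          (ae_of_all _ fun x => abs_le.2 ⟨by linarith [(hcb x.1).1], (hcb x.1).2⟩)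
      have low : E (t + 2) - E n ≤ ∫ x, c x.1 * dens g x := by
        rw [hE, ← integral_indicator_sub (hm _) (hm _) hd]
        refine integral_mono ((hd.indicator (hm _)).sub (hd.indicator (hm _))) hcG fun x => ?_
        have hx0 := dens_nonneg g x
        by_cases h1 : x ∈ tail σ n
        · rw [indicator_of_mem h1, indicator_of_mem (tail_anti σ hn h1), sub_self]
          exact mul_nonneg (hcb _).1 hx0
        · rw [indicator_of_notMem h1, sub_zero]
          by_cases h2 : x ∈ tail σ (t + 2)
          · rw [indicator_of_mem h2, hc1 _ (le_trans (by linarith) h2) (le_of_not_ge h1), one_mul]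
          · rw [indicator_of_notMem h2]; exact mul_nonneg (hcb _).1 hx0
      have up : ∫ x in S, dens g x ≤ E t - (E (t + 2) - E n) := by
        have hsub : Integrable fun x => (tail σ (t + 2)).indicator (dens g) x
            - (tail σ n).indicator (dens g) x := (hd.indicator (hm _)).sub (hd.indicator (hm _))
        simp only [hE]
        rw [← integral_indicator_sub (hm _) (hm _) hd, ← integral_indicator (hm t),
          ← integral_sub (hd.indicator (hm _)) hsub,
          ← integral_indicator hSm]
        refine integral_mono (hd.indicator hSm) ((hd.indicator (hm _)).sub
          ((hd.indicator (hm _)).sub (hd.indicator (hm _)))) fun x => ?_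
        have hx0 := dens_nonneg g x
        have i1 : x ∈ tail σ n → x ∈ tail σ (t + 2) := fun h => tail_anti σ hn h
        have i2 : x ∈ tail σ (t + 2) → x ∈ tail σ t := fun h => tail_anti σ (by linarith) h
        by_cases h1 : x ∈ tail σ n
        · simp only [indicator_of_mem h1, indicator_of_mem (i1 h1), indicator_of_mem (i2 (i1 h1)),
            sub_self, sub_zero]
          exact indicator_le_self' (fun _ _ => hx0) x
        · by_cases h2 : x ∈ tail σ (t + 2)
          · have : x ∉ S := by
              rintro (hh | hh)
              · have : t + 2 ≤ σ * x.1 := h2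
                linarith [hh.2]
              · exact h1 hh
            simp only [indicator_of_notMem h1, indicator_of_mem h2, indicator_of_mem (i2 h2),
              indicator_of_notMem this, sub_zero, sub_self, le_refl]
          · simp only [indicator_of_notMem h1, indicator_of_notMem h2, sub_zero]
            by_cases h3 : x ∈ S
            · have h4 : x ∈ tail σ t := h3.elim (fun hh => hh.1) fun hh => absurd hh h1
              rw [indicator_of_mem h3, indicator_of_mem h4]
            · rw [indicator_of_notMem h3]
              exact indicator_nonneg (fun y _ => dens_nonneg g y) x
      exact low.trans (hen.trans (mul_le_mul_of_nonneg_left up (by positivity)))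
    have l0 := tendsto_integral_tail hd σ
    have l1 : Tendsto (fun n : ℕ => E (t + 2) - E n) atTop (𝓝 (E (t + 2) - 0)) :=
      tendsto_const_nhds.sub l0
    have l2 : Tendsto (fun n : ℕ => 5 * M * (E t - (E (t + 2) - E n))) atTop
        (𝓝 (5 * M * (E t - (E (t + 2) - 0)))) := (tendsto_const_nhds.sub l1).const_mul _
    rw [sub_zero] at l1 l2
    refine le_of_tendsto_of_tendsto l1 l2 ?_
    filter_upwards [eventually_ge_atTop ⌈t + 2⌉₊] with n hn
    exact key n (Nat.ceil_le.1 hn)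
  -- Hole filling gives the ratio 5M/(5M+1). Adding the monotonicity E (t + 2) ≤ E t gives this
  -- larger ratio, which is positive even when M = 0.
  set θ := (5 * M + 1) / (5 * M + 2) with hθ
  have hθ0 : 0 < θ := by positivity
  have hθ1 : θ < 1 := by rw [hθ, div_lt_one (by positivity)]; linarith
  have hgeo : ∀ m : ℕ, E (1 + 2 * m) ≤ E 1 * θ ^ m := by
    intro m
    induction m with
    | zero => simp
    | succ m ih =>
      have h1 := step (1 + 2 * m) (by positivity)
      rw [show (1 : ℝ) + 2 * ((m + 1 : ℕ) : ℝ) = 1 + 2 * m + 2 by push_cast; ring]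
      have h2 : E (1 + 2 * m + 2) ≤ θ * E (1 + 2 * m) := by
        rw [hθ, div_mul_eq_mul_div, le_div_iff₀ (by positivity)]
        have : E (1 + 2 * m + 2) ≤ E (1 + 2 * m) :=
          setIntegral_mono_set hd.integrableOn (ae_of_all _ fun x => dens_nonneg g x)
            (ae_of_all _ (tail_anti σ (by linarith)))
        nlinarith
      calc _ ≤ θ * (E 1 * θ ^ m) := h2.trans (mul_le_mul_of_nonneg_left ih hθ0.le)
        _ = _ := by ring
  refine ⟨E 1, θ, 1, hθ0, hθ1, one_pos, fun m => le_trans ?_ (hgeo m)⟩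
  exact integral_mono (((h.sob i).memLp_grad j).restrict _).integrable_sq hd.integrableOn
    fun x => sq_le_dens g i j x

/-- Decay of the tails faster than any power. -/
def RapidDecay (σ : ℝ) (f : ℝ × ℝ → ℝ) : Prop :=
  ∀ r : ℝ, 0 < r → ∀ N : ℕ, ∃ C : ℝ, 0 ≤ C ∧ ∀ n : ℕ, 0 < n →
    nrm (volume.restrict (tail σ (r * n))) f ≤ C * (1 / (n : ℝ)) ^ N

/-- The tail beyond r n is bounded by a multiple of β^n with β < 1, which beats every power of n.
The exponent 2N below appears because the decay is stated for squared norms. -/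
theorem GeomDecay.rapid {σ : ℝ} {f : ℝ × ℝ → ℝ} (h : GeomDecay σ f) (hf : MemLp f 2) :
    RapidDecay σ f := by
  obtain ⟨C, θ, a, h0, h1, ha, H⟩ := h
  intro r hr N
  -- When r n < a the decay hypothesis gives nothing. The exponent of θ is then negative, so the
  -- power is at least one and the full norm serves as a bound.
  set K := max C (nrm volume f ^ 2) with hK
  have hK0 : 0 ≤ K := (sq_nonneg _).trans (le_max_right _ _)
  have hf2 := hf.integrable_sq
  have hexp : ∀ n : ℕ, nrm (volume.restrict (tail σ (r * n))) f ^ 2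
      ≤ K * θ ^ ((r * n - a) / 2 - 1) := by
    intro n
    rw [nrm_sq (hf.restrict _)]
    by_cases hn : r * n < a
    · have e1 : 1 ≤ θ ^ ((r * n - a) / 2 - 1) :=
        Real.one_le_rpow_of_pos_of_le_one_of_nonpos h0 h1.le (by linarith)
      calc ∫ x in tail σ (r * n), f x ^ 2 ≤ ∫ x, f x ^ 2 :=
            setIntegral_le_integral hf2 (ae_of_all _ fun x => sq_nonneg _)
        _ ≤ K * 1 := by rw [mul_one, ← nrm_sq hf]; exact le_max_right _ _
        _ ≤ _ := mul_le_mul_of_nonneg_left e1 hK0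
    · rw [not_lt] at hn
      set m := ⌊(r * n - a) / 2⌋₊ with hm
      have m1 : (m : ℝ) ≤ (r * n - a) / 2 := Nat.floor_le (by linarith)
      have m2 : (r * n - a) / 2 < m + 1 := Nat.lt_floor_add_one _
      calc ∫ x in tail σ (r * n), f x ^ 2 ≤ ∫ x in tail σ (a + 2 * m), f x ^ 2 :=
            setIntegral_mono_set hf2.integrableOn (ae_of_all _ fun x => sq_nonneg _)
              (ae_of_all _ (tail_anti σ (by linarith)))
        _ ≤ C * θ ^ m := H m
        _ ≤ K * θ ^ m := mul_le_mul_of_nonneg_right (le_max_left _ _) (by positivity)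
        _ ≤ _ := by
          refine mul_le_mul_of_nonneg_left ?_ hK0
          rw [← Real.rpow_natCast]
          exact Real.rpow_le_rpow_of_exponent_ge h0 h1.le (by linarith)
  set β := θ ^ (r / 2) with hβ
  have hβ0 : 0 < β := Real.rpow_pos_of_pos h0 _
  have hβ1 : β < 1 := Real.rpow_lt_one h0.le h1 (by linarith)
  have hsplit : ∀ n : ℕ, θ ^ ((r * n - a) / 2 - 1) = θ ^ (-a / 2 - 1) * β ^ n := by
    intro n
    rw [hβ, ← Real.rpow_natCast, ← Real.rpow_mul h0.le, ← Real.rpow_add h0]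
    congr 1; ring
  obtain ⟨B, hB⟩ := (tendsto_pow_const_mul_const_pow_of_abs_lt_one (2 * N) (r := β)
    (by rwa [abs_of_pos hβ0])).bddAbove_range
  have hB' : ∀ n : ℕ, (n : ℝ) ^ (2 * N) * β ^ n ≤ B := fun n => hB ⟨n, rfl⟩
  have hθa : 0 < θ ^ (-a / 2 - 1) := Real.rpow_pos_of_pos h0 _
  refine ⟨Real.sqrt (K * θ ^ (-a / 2 - 1) * B), Real.sqrt_nonneg _, fun n hn => ?_⟩
  have hn' : (0 : ℝ) < n := by exact_mod_cast hn
  rw [one_div, inv_pow, ← div_eq_mul_inv, le_div_iff₀ (by positivity)]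
  refine Real.le_sqrt_of_sq_le ?_
  rw [mul_pow, ← pow_mul, mul_comm N 2]
  calc _ ≤ K * (θ ^ (-a / 2 - 1) * β ^ n) * (n : ℝ) ^ (2 * N) := by
        rw [← hsplit]; exact mul_le_mul_of_nonneg_right (hexp n) (by positivity)
    _ = K * θ ^ (-a / 2 - 1) * ((n : ℝ) ^ (2 * N) * β ^ n) := by ring
    _ ≤ _ := mul_le_mul_of_nonneg_left (hB' n) (by positivity)

namespace StripFlow

variable {σ : ℝ} {u : Fin 2 → ℝ × ℝ → ℝ} {g : Fin 2 → Fin 2 → ℝ × ℝ → ℝ} {Ψ : ℝ × ℝ → ℝ}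

theorem rapid_grad (h : StripFlow σ u g Ψ) (i j : Fin 2) : RapidDecay σ (g i j) :=
  (h.geomDecay_grad i j).rapid ((h.sob i).memLp_grad j)

theorem geomDecay (h : StripFlow σ u g Ψ) (i : Fin 2) : GeomDecay σ (u i) :=
  GeomDecay.poincare h.sign (h.sob i) (h.zero i) (h.geomDecay_grad i 1)

theorem rapid (h : StripFlow σ u g Ψ) (i : Fin 2) : RapidDecay σ (u i) :=
  (h.geomDecay i).rapid (h.sob i).memLp

theorem rapid_stream (h : StripFlow σ u g Ψ) : RapidDecay σ Ψ :=
  (GeomDecay.poincare h.sign h.stream h.stream_zero (h.geomDecay 0)).rapid h.stream.memLp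

end StripFlow

end ThinChannel

end

/-! ### From the layer problems to flows on half-strips, their rescaling, and the cutoff at the far
end. -/

noncomputable section

namespace ThinChannel

open Filter Topology

/-! ### Extension by zero -/

/-- The extension by zero of a function that vanishes on a part of the boundary is continuous
there. -/
theorem continuousOn_indicator_of_frontier {Ω U : Set (ℝ × ℝ)} (hΩ : IsOpen Ω) {G : ℝ × ℝ → ℝ}
    (hG : ContinuousOn G (closure Ω)) (hz : ∀ x ∈ frontier Ω, x ∈ U → G x = 0) :
    ContinuousOn (Ω.indicator G) U := by
  intro x hxU
  refine ContinuousAt.continuousWithinAt ?_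
  by_cases hx : x ∈ Ω
  · have h1 : ContinuousAt G x :=
      hG.continuousAt (mem_of_superset (hΩ.mem_nhds hx) subset_closure)
    refine h1.congr ?_
    filter_upwards [hΩ.mem_nhds hx] with y hy
    rw [indicator_of_mem hy]
  by_cases hc : x ∈ closure Ω
  · have h0 : G x = 0 := hz x (by rw [hΩ.frontier_eq]; exact ⟨hc, hx⟩) hxU
    have h1 : Tendsto G (𝓝[Ω] x) (𝓝 0) := by
      rw [← h0]; exact (hG x hc).mono_left (nhdsWithin_mono _ subset_closure)
    rw [ContinuousAt, indicator_of_notMem hx, Metric.tendsto_nhds]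
    intro δ hδ
    have h2 := Metric.tendsto_nhds.1 h1 δ hδ
    rw [eventually_nhdsWithin_iff] at h2
    filter_upwards [h2] with y hy
    by_cases hyΩ : y ∈ Ω
    · rw [indicator_of_mem hyΩ]; exact hy hyΩ
    · rw [indicator_of_notMem hyΩ, dist_self]; exact hδ
  · have : Ω.indicator G =ᶠ[𝓝 x] fun _ => 0 := by
      filter_upwards [isClosed_closure.isOpen_compl.mem_nhds hc] with y hy
      exact indicator_of_notMem (fun h => hy (subset_closure h)) _
    exact (continuousAt_const.congr this.symm)

/-- A weak gradient on `U` of a function supported in `U` is a weak gradient away from the boundary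
of `U`. -/
theorem Sob.union_exterior {U : Set (ℝ × ℝ)} (hU : IsOpen U) {v : ℝ × ℝ → ℝ}
    {g : Fin 2 → ℝ × ℝ → ℝ} (h : Sob U v g) (hv : ∀ x, x ∉ U → v x = 0)
    (hg : ∀ i x, x ∉ U → g i x = 0) : Sob (U ∪ (closure U)ᶜ) v g := by
  refine ⟨h.1, h.2, fun i η hη => ?_⟩
  have hsupp : tsupport (U.indicator η) ⊆ tsupport η ∩ closure U := by
    refine closure_minimal (fun x hx => ?_) ((isClosed_tsupport _).inter isClosed_closure)
    have hxU : x ∈ U := by_contra fun h' => hx (indicator_of_notMem h' _)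
    refine ⟨subset_tsupport _ fun h0 => hx ?_, subset_closure hxU⟩
    rw [indicator_of_mem hxU, h0]
  have hloc : ∀ x ∈ U, U.indicator η =ᶠ[𝓝 x] η := fun x hx => by
    filter_upwards [hU.mem_nhds hx] with y hy using indicator_of_mem hy _
  have hin : tsupport η ∩ closure U ⊆ U := fun x hx =>
    (hη.3 hx.1).elim id fun h' => absurd hx.2 h'
  -- The support of η avoids the boundary of U, so restricting η to U keeps it smooth. The part of η
  -- in the exterior pairs with zero.
  have ht : IsTest U (U.indicator η) := by
    refine ⟨contDiff_iff_contDiffAt.2 fun x => ?_, ?_, hsupp.trans hin⟩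
    · by_cases hx : x ∈ U
      · exact hη.1.contDiffAt.congr_of_eventuallyEq (hloc x hx)
      · have : U.indicator η =ᶠ[𝓝 x] fun _ => 0 := by
          filter_upwards [(isClosed_tsupport (U.indicator η)).isOpen_compl.mem_nhds
            fun h' => hx (hin (hsupp h'))] with y hy using image_eq_zero_of_notMem_tsupport hy
        exact contDiffAt_const.congr_of_eventuallyEq this
    · exact hη.2.isCompact.of_isClosed_subset (isClosed_tsupport _)
        (hsupp.trans inter_subset_left)
  have key := h.3 i _ ht
  have e1 : ∀ x, v x * pd i (U.indicator η) x = v x * pd i η x := fun x => by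
    by_cases hx : x ∈ U
    · rw [pd, pd, (hloc x hx).fderiv_eq]
    · rw [hv x hx, zero_mul, zero_mul]
  have e2 : ∀ x, g i x * U.indicator η x = g i x * η x := fun x => by
    by_cases hx : x ∈ U
    · rw [indicator_of_mem hx]
    · rw [hg i x hx, zero_mul, zero_mul]
  simpa only [e1, e2] using key

/-- Induction on the list: all other lines are first removed in the complement of the line at hand,
which is then removed across the whole of U. Crossings of lines thus need no separate treatment. -/
theorem Sob.remove_walls {v : ℝ × ℝ → ℝ} {g : Fin 2 → ℝ × ℝ → ℝ} (L : List (Fin 2 × ℝ)) :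
    ∀ {U : Set (ℝ × ℝ)}, Sob (U \ {x | ∃ w ∈ L, co w.1 x = w.2}) v g → ContinuousOn v U →
    (∀ x ∈ U, ∀ w ∈ L, co w.1 x = w.2 → v x = 0) → Sob U v g := by
  induction L with
  | nil => intro U h _ _; simpa using h
  | cons w L ih =>
    intro U h hv hz
    refine Sob.remove_wall (l := w.1) (c := w.2) (ih (h.mono fun x hx => ⟨hx.1.1, ?_⟩)
      (hv.mono sdiff_subset) fun x hx w' hw' => hz x hx.1 w' (List.mem_cons_of_mem _ hw')) hv
      fun x hx => hz x hx w List.mem_cons_self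
    rintro ⟨w', hw', he⟩
    rcases List.mem_cons.1 hw' with rfl | hw'
    · exact hx.1.2 he
    · exact hx.2 ⟨w', hw', he⟩

/-- Extension by zero across flat pieces of the boundary. -/
theorem MemH1.sob_of_walls {Ω : Opens (ℝ × ℝ)} {U : Set (ℝ × ℝ)} {G : ℝ × ℝ → ℝ} (hm : MemH1 Ω G)
    (hG : ContinuousOn G (closure Ω)) (hz : ∀ x ∈ frontier (Ω : Set (ℝ × ℝ)), x ∈ U → G x = 0)
    (L : List (Fin 2 × ℝ)) (hL : ∀ x ∈ frontier (Ω : Set (ℝ × ℝ)), x ∈ U → ∃ w ∈ L, co w.1 x = w.2)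
    (hL' : ∀ x ∈ Ω, ∀ w ∈ L, co w.1 x ≠ w.2) :
    Sob U ((Ω : Set (ℝ × ℝ)).indicator G)
      (fun i => (Ω : Set (ℝ × ℝ)).indicator (weakPartial Ω i G)) := by
  have h1 := hm.sob.union_exterior Ω.isOpen (fun x hx => indicator_of_notMem hx _)
    (fun i x hx => indicator_of_notMem hx _)
  refine Sob.remove_walls L (h1.mono fun x hx => ?_)
    (continuousOn_indicator_of_frontier Ω.isOpen hG hz) fun x _ w hw he =>
      indicator_of_notMem (fun hx => hL' x hx w hw he) _
  by_contra hcon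
  rw [mem_union, not_or, notMem_compl_iff] at hcon
  exact hx.2 (hL x (by rw [Ω.isOpen.frontier_eq]; exact ⟨hcon.2, hcon.1⟩) hx.1)

/-- Vanishing on the four sides permits extension by zero to an H¹ function of the plane. This
extension vanishes off the open rectangle, so `Sob.memH10` applies. -/
theorem MemH1.memH10_of_frontier {Ω : Opens (ℝ × ℝ)} {a b c d : ℝ} (hab : a < b) (hcd : c < d)
    (hΩ : (Ω : Set (ℝ × ℝ)) = Ioo a b ×ˢ Ioo c d) {G : ℝ × ℝ → ℝ} (hm : MemH1 Ω G)
    (hG : ContinuousOn G (closure Ω)) (hz : ∀ x ∈ frontier (Ω : Set (ℝ × ℝ)), G x = 0) :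
    MemH10 Ω G := by
  have hs := hm.sob_of_walls (U := univ) hG (fun x hx _ => hz x hx)
    [(0, a), (0, b), (1, c), (1, d)] (fun x hx _ => ?_) (fun x hx w hw => ?_)
  · exact (hs.memH10 hab hcd (fun x hx => indicator_of_notMem (by rwa [hΩ]) _) hΩ.ge).congr
      (indicator_ae_eq_restrict Ω.isOpen.measurableSet)
  · rw [Ω.isOpen.frontier_eq, hΩ, closure_prod_eq, closure_Ioo hab.ne, closure_Ioo hcd.ne] at hx
    obtain ⟨⟨⟨h1, h2⟩, h3, h4⟩, h5⟩ := hx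
    by_contra hcon
    simp only [List.mem_cons, List.not_mem_nil, or_false, not_exists, not_and, forall_eq_or_imp,
      forall_eq, co_zero, co_one] at hcon
    exact h5 ⟨⟨lt_of_le_of_ne h1 (Ne.symm hcon.1), lt_of_le_of_ne h2 hcon.2.1⟩,
      lt_of_le_of_ne h3 (Ne.symm hcon.2.2.1), lt_of_le_of_ne h4 hcon.2.2.2⟩
  · have hx' : x ∈ Ioo a b ×ˢ Ioo c d := hΩ ▸ hx
    simp only [List.mem_cons, List.not_mem_nil, or_false] at hw
    rcases hw with rfl | rfl | rfl | rfl
    · exact hx'.1.1.ne'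
    · exact hx'.1.2.ne
    · exact hx'.2.1.ne'
    · exact hx'.2.2.ne

/-! ### Boundary layers as flows on a half-strip -/

theorem toDistribution_apply {Ω : Opens (ℝ × ℝ)} {p : ℝ × ℝ → ℝ} (hp : LocallyIntegrableOn p Ω)
    (η : 𝓓(Ω, ℝ)) : toDistribution Ω p η = ∫ x, p x * η x := by
  have := TestFunction.integralAgainstBilinCLM_eq_integral (B := ContinuousLinearMap.mul ℝ ℝ) hp
    (f := η)
  refine Eq.trans this ?_
  simp [mul_comm]

theorem grad_toDistribution_apply {Ω : Opens (ℝ × ℝ)} {p : ℝ × ℝ → ℝ}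
    (hp : LocallyIntegrableOn p Ω) (i : Fin 2) (η : 𝓓(Ω, ℝ)) :
    grad (toDistribution Ω p) i η = -∫ x, p x * pd i η x := by
  rw [grad, Distribution.lineDerivOp_apply_apply, map_neg, toDistribution_apply hp]
  simp only [lineDeriv_eq_pd]

/-- Split v as (v - G) + G, with G the continuous representative of the boundary values. The first
term is in H¹₀ and extends by zero to the whole plane. The second vanishes on the lateral walls and
extends across them. Only the end x₁ = 0 remains a genuine boundary, and it is not in the open
half-plane. -/
theorem HasBoundaryValue.sob_halfPlane {σ : ℝ} {Ω : Opens (ℝ × ℝ)}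
    (hΩ : (Ω : Set (ℝ × ℝ)) = halfPlane σ ∩ hStrip) {v b : ℝ × ℝ → ℝ} (hm : MemH1 Ω v)
    (hb : HasBoundaryValue Ω v b) (hb0 : ∀ x : ℝ × ℝ, x.1 ≠ 0 → b x = 0) :
    Sob (halfPlane σ) ((Ω : Set (ℝ × ℝ)).indicator v)
      (fun i => (Ω : Set (ℝ × ℝ)).indicator (weakPartial Ω i v)) := by
  obtain ⟨G, hGc, hGm, hGb, hG0⟩ := hb
  have h1 := hG0.sob.mono (subset_univ (halfPlane σ))
  have h2 := hGm.sob_of_walls (U := halfPlane σ) hGc (fun x hx hxU => ?_)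
    [(1, -(1 / 2)), (1, 1 / 2)] (fun x hx hxU => ?_) (fun x hx w hw => ?_)
  · have h3 := h1.add h2
    have hv : ∀ x, (Ω : Set (ℝ × ℝ)).indicator (fun x => v x - G x) x
        + (Ω : Set (ℝ × ℝ)).indicator G x = (Ω : Set (ℝ × ℝ)).indicator v x := fun x => by
      by_cases hx : x ∈ (Ω : Set (ℝ × ℝ)) <;> simp [hx]
    simp only [hv] at h3
    have hsub : (Ω : Set (ℝ × ℝ)) ⊆ halfPlane σ := by rw [hΩ]; exact inter_subset_left
    refine h3.congr (isOpen_halfPlane σ).measurableSet (ae_eq_refl _) (fun i => ?_)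
      (memLp_indicator Ω.isOpen.measurableSet hm.1) hm.sob.memLp_grad
    have h4 := (h3.mono hsub).weakPartial_ae (indicator_ae_eq_restrict Ω.isOpen.measurableSet) i
    rw [EventuallyEq, ae_restrict_iff' Ω.isOpen.measurableSet] at h4
    refine ae_restrict_of_ae ?_
    filter_upwards [h4] with x hx
    by_cases hxΩ : x ∈ (Ω : Set (ℝ × ℝ))
    · rw [indicator_of_mem hxΩ (weakPartial Ω i v), hx hxΩ]
    · simp only [indicator_of_notMem hxΩ, add_zero]
  · rw [hGb hx]
    refine hb0 x fun h0 => ?_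
    have : 0 < σ * x.1 := hxU
    rw [h0, mul_zero] at this
    exact lt_irrefl _ this
  · rw [Ω.isOpen.frontier_eq] at hx
    have hcl : closure (Ω : Set (ℝ × ℝ)) ⊆ {x | x.2 ∈ Icc (-(1 / 2) : ℝ) (1 / 2)} := by
      refine closure_minimal ?_ (isClosed_Icc.preimage continuous_snd)
      rw [hΩ]
      exact fun x hx => Ioo_subset_Icc_self hx.2
    have h1 := hcl hx.1
    by_contra hcon
    simp only [List.mem_cons, List.not_mem_nil, or_false, not_exists, not_and, forall_eq_or_imp,
      forall_eq, co_one] at hcon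
    refine hx.2 ?_
    rw [hΩ]
    exact ⟨hxU, lt_of_le_of_ne h1.1 (Ne.symm hcon.1), lt_of_le_of_ne h1.2 hcon.2⟩
  · have hx' : x ∈ halfPlane σ ∩ hStrip := hΩ ▸ hx
    simp only [List.mem_cons, List.not_mem_nil, or_false] at hw
    rcases hw with rfl | rfl
    · exact hx'.2.1.ne'
    · exact hx'.2.2.ne

theorem box_subset_halfPlane {σ p q : ℝ} (hp : 0 ≤ σ * p) (hq : 0 ≤ σ * q)
    (hσ : σ = 1 ∨ σ = -1) :
    Ioo p q ×ˢ Ioo (-(1 / 2) : ℝ) (1 / 2) ⊆ halfPlane σ ∩ hStrip := by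
  refine fun x hx => ⟨?_, hx.2⟩
  have h1 := hx.1
  rw [halfPlane, Set.mem_ofPred_eq]
  rcases hσ with rfl | rfl
  · linarith [h1.1]
  · linarith [h1.2]

/-- The no slip condition makes the extension by zero an H¹ field on the half-plane, still
divergence free, whence the stream function. A test field supported in a box of the half-strip lies
in H(Ω), so the weak equation of the layer applies to it, and the nonzero factor ν₀/2 is divided
out. -/
theorem IsLayer.exists_stripFlow {σ : ℝ} (hσ : σ = 1 ∨ σ = -1) {Ω : Opens (ℝ × ℝ)}
    (hΩ : (Ω : Set (ℝ × ℝ)) = halfPlane σ ∩ hStrip) {ν₀ : ℝ} (hν : ν₀ ≠ 0)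
    {b u : Fin 2 → ℝ × ℝ → ℝ} {p : ℝ × ℝ → ℝ} (h : IsLayer Ω ν₀ b u p)
    (hb0 : ∀ i, ∀ x : ℝ × ℝ, x.1 ≠ 0 → b i x = 0) :
    ∃ Ψ, StripFlow σ (fun i => (Ω : Set (ℝ × ℝ)).indicator (u i))
      (fun i j => (Ω : Set (ℝ × ℝ)).indicator (weakPartial Ω j (u i))) Ψ := by
  have hΩm := Ω.isOpen.measurableSet
  have hsob := fun i => (h.boundary i).sob_halfPlane hΩ (h.memH1 i) (hb0 i)
  have hzero : ∀ i x, x ∉ hStrip → (Ω : Set (ℝ × ℝ)).indicator (u i) x = 0 := fun i x hx =>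
    indicator_of_notMem (fun h' => hx ((hΩ ▸ h' : x ∈ halfPlane σ ∩ hStrip).2)) _
  have hdiv : ∀ᵐ x, x ∈ halfPlane σ → (Ω : Set (ℝ × ℝ)).indicator (weakPartial Ω 0 (u 0)) x
      + (Ω : Set (ℝ × ℝ)).indicator (weakPartial Ω 1 (u 1)) x = 0 := by
    have := h.divFree
    rw [DivFree, ae_restrict_iff' hΩm] at this
    filter_upwards [this] with x hx _
    by_cases hxΩ : x ∈ (Ω : Set (ℝ × ℝ))
    · have := hx hxΩ
      rw [Fin.sum_univ_two] at this
      rwa [indicator_of_mem hxΩ, indicator_of_mem hxΩ]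
    · rw [indicator_of_notMem hxΩ, indicator_of_notMem hxΩ, add_zero]
  have hD : DivFreeStrip σ _ _ _ _ := ⟨hσ, hsob 0, hsob 1, hzero 0, hzero 1, hdiv⟩
  obtain ⟨Ψ, hΨ0, hΨ⟩ := hD.exists_stream
  refine ⟨Ψ, hσ, hsob, hzero, hdiv, hΨ, hΨ0, fun ψ k P Q hPQ hψ hP hQ hz hk => ?_⟩
  have hbox : Ioo P Q ×ˢ Ioo (-(1 / 2) : ℝ) (1 / 2) ⊆ (Ω : Set (ℝ × ℝ)) := by
    rw [hΩ]; exact box_subset_halfPlane hP hQ hσ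
  have hψ0 : ∀ i, MemH10 Ω (ψ i) := fun i => (hψ i).memH10 hPQ (by norm_num) (hz i) hbox
  have hwp : ∀ i j, weakPartial Ω j (ψ i) =ᵐ[volume.restrict Ω] k i j := fun i j =>
    ((hψ i).mono (subset_univ _)).weakPartial_ae (ae_eq_refl _) j
  have hH : MemH Ω ψ := by
    refine ⟨hψ0, ?_⟩
    filter_upwards [hwp 0 0, hwp 1 1, ae_restrict_of_ae hk] with x h1 h2 h3
    rw [Fin.sum_univ_two, h1, h2, h3]
  have key := h.weak ψ hH
  rw [integral_const_mul] at key
  have key' := (mul_eq_zero.1 key).resolve_left (div_ne_zero hν two_ne_zero)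
  rw [← key', ← setIntegral_eq_integral_of_forall_compl_eq_zero (s := (Ω : Set (ℝ × ℝ)))
    fun x hx => by simp [hx]]
  refine integral_congr_ae ?_
  filter_upwards [hwp 0 0, hwp 0 1, hwp 1 0, hwp 1 1, ae_restrict_mem hΩm] with x h1 h2 h3 h4 hx
  simp only [Fin.sum_univ_two, h1, h2, h3, h4, indicator_of_mem hx]

/-- Linearity allows the correctors of all orders, with their powers of ε, to be treated as a single
flow with a single stream function. -/
theorem StripFlow.sum {σ : ℝ} (hσ : σ = 1 ∨ σ = -1) {ι : Type*} (s : Finset ι) (c : ι → ℝ)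
    {u : ι → Fin 2 → ℝ × ℝ → ℝ} {g : ι → Fin 2 → Fin 2 → ℝ × ℝ → ℝ} {Ψ : ι → ℝ × ℝ → ℝ}
    (h : ∀ n ∈ s, StripFlow σ (u n) (g n) (Ψ n)) :
    StripFlow σ (fun i x => ∑ n ∈ s, c n * u n i x) (fun i j x => ∑ n ∈ s, c n * g n i j x)
      (fun x => ∑ n ∈ s, c n * Ψ n x) where
  sign := hσ
  sob i := Sob.sum s fun n hn => ((h n hn).sob i).const_mul (c n)
  zero i x hx := Finset.sum_eq_zero fun n hn => by rw [(h n hn).zero i x hx, mul_zero]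
  div := by
    have : ∀ᵐ x, ∀ n ∈ s, x ∈ halfPlane σ → g n 0 0 x + g n 1 1 x = 0 :=
      (ae_ball_iff s.countable_toSet).2 fun n hn => (h n hn).div
    filter_upwards [this] with x hx hxH
    rw [← Finset.sum_add_distrib]
    exact Finset.sum_eq_zero fun n hn => by rw [← mul_add, hx n hn hxH, mul_zero]
  stream := by
    have := Sob.sum s fun n hn => ((h n hn).stream).const_mul (c n)
    convert this using 1
    funext i x
    fin_cases i <;> simp [Finset.sum_neg_distrib]
  stream_zero x hx := Finset.sum_eq_zero fun n hn => by rw [(h n hn).stream_zero x hx, mul_zero]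
  weak ψ k p q hpq hψ hp hq hz hk := by
    have e1 : ∀ x, ∑ i, ∑ j, (∑ n ∈ s, c n * g n i j x) * k i j x
        = ∑ n ∈ s, c n * ∑ i, ∑ j, g n i j x * k i j x := fun x => by
      simp only [Fin.sum_univ_two, Finset.sum_mul, ← Finset.sum_add_distrib]
      exact Finset.sum_congr rfl fun n _ => by ring
    simp only [e1]
    have hintg : ∀ n ∈ s, Integrable fun x => ∑ i, ∑ j, g n i j x * k i j x := fun n hn =>
      integrable_finsetSum _ fun i _ => integrable_finsetSum _ fun j _ =>
        integrable_mul_of_memLp (((h n hn).sob i).memLp_grad j) ((hψ i).memLp_grad j)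
    rw [integral_finsetSum _ fun n hn => (hintg n hn).const_mul (c n)]
    refine Finset.sum_eq_zero fun n hn => ?_
    rw [integral_const_mul, (h n hn).weak ψ k p q hpq hψ hp hq hz hk, mul_zero]

/-- The momentum equation of a boundary layer, tested with smooth fields. -/
theorem IsLayer.integral_pressure {Ω : Opens (ℝ × ℝ)} {ν₀ : ℝ}
    {b u : Fin 2 → ℝ × ℝ → ℝ} {p : ℝ × ℝ → ℝ} (h : IsLayer Ω ν₀ b u p)
    {ψ : Fin 2 → ℝ × ℝ → ℝ} (hψ : ∀ i, IsTest Ω (ψ i)) :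
    ν₀ / 2 * ∫ x, ∑ i, ∑ j, (Ω : Set (ℝ × ℝ)).indicator (weakPartial Ω j (u i)) x * pd j (ψ i) x
      = ∑ i, ∫ x, p x * pd i (ψ i) x := by
  have key := h.momentum fun i => (hψ i).bundle
  simp only [grad_toDistribution_apply h.locallyIntegrable, lineDeriv_eq_pd, IsTest.coe_bundle,
    Finset.sum_neg_distrib] at key
  rw [integral_const_mul] at key
  rw [← setIntegral_eq_integral_of_forall_compl_eq_zero (s := (Ω : Set (ℝ × ℝ)))
    fun x hx => by simp [hx]]
  rw [← sub_eq_zero, ← key, ← sub_eq_add_neg]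
  congr 2
  refine integral_congr_ae ?_
  filter_upwards [ae_restrict_mem Ω.isOpen.measurableSet] with x hx
  simp only [Fin.sum_univ_two, indicator_of_mem hx]

end ThinChannel

end

noncomputable section

namespace ThinChannel

open Filter Topology

/-! ### Change of scale -/

/-- The fast variables near the end `x₁ = a`. -/
def zoom (a ε : ℝ) (x : ℝ × ℝ) : ℝ × ℝ := ((x.1 - a) / ε, x.2 / ε)

theorem zoom_eq (a ε : ℝ) : zoom a ε = fun x => ε⁻¹ • (x - (a, 0)) := by
  funext x
  ext <;> simp [zoom, div_eq_inv_mul]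

theorem continuous_zoom (a ε : ℝ) : Continuous (zoom a ε) := by
  rw [zoom_eq]; fun_prop

theorem contDiff_zoom (a ε : ℝ) {n : WithTop ℕ∞} : ContDiff ℝ n (zoom a ε) := by
  rw [zoom_eq]; fun_prop

section

variable {a ε : ℝ}

theorem zoom_zoom (hε : ε ≠ 0) (x : ℝ × ℝ) : zoom a ε (zoom (-a / ε) ε⁻¹ x) = x := by
  ext
  · simp only [zoom]; field_simp; ring
  · simp only [zoom]; field_simp

theorem zoom_zoom' (hε : ε ≠ 0) (x : ℝ × ℝ) : zoom (-a / ε) ε⁻¹ (zoom a ε x) = x := by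
  ext
  · simp only [zoom]; field_simp; ring
  · simp only [zoom]; field_simp

/-- The fast variables as a homeomorphism of the plane. -/
def zoomHomeomorph (a : ℝ) (hε : ε ≠ 0) : (ℝ × ℝ) ≃ₜ (ℝ × ℝ) where
  toFun := zoom a ε
  invFun := zoom (-a / ε) ε⁻¹
  left_inv := zoom_zoom' hε
  right_inv := zoom_zoom hε
  continuous_toFun := continuous_zoom _ _
  continuous_invFun := continuous_zoom _ _

theorem integral_zoom (hε : 0 < ε) (f : ℝ × ℝ → ℝ) :
    ∫ x, f (zoom a ε x) = ε ^ 2 * ∫ x, f x := by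
  rw [zoom_eq, integral_sub_right_eq_self (fun x => f (ε⁻¹ • x)) (a, 0),
    Measure.integral_comp_smul volume f]
  simp [abs_of_pos hε]

theorem measurePreserving_zoom (hε : 0 < ε) :
    MeasurePreserving (zoom a ε) volume (ENNReal.ofReal (ε ^ 2) • volume) := by
  have h1 : MeasurePreserving (fun x : ℝ × ℝ => ε⁻¹ • x) volume (ENNReal.ofReal (ε ^ 2) • volume) := by
    refine ⟨by fun_prop, ?_⟩
    rw [show (fun x : ℝ × ℝ => ε⁻¹ • x) = (ε⁻¹ • ·) from rfl,
      Measure.map_addHaar_smul volume (inv_ne_zero hε.ne')]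
    congr 2
    simp
  rw [zoom_eq]
  exact h1.comp (measurePreserving_sub_right volume _)

theorem MemLp.zoom (hε : 0 < ε) {f : ℝ × ℝ → ℝ} (hf : MemLp f 2) :
    MemLp (fun x => f (zoom a ε x)) 2 :=
  (hf.smul_measure ENNReal.ofReal_ne_top).comp_measurePreserving (measurePreserving_zoom hε)

theorem nrm_zoom (hε : 0 < ε) {f : ℝ × ℝ → ℝ} (hf : MemLp f 2) :
    nrm volume (fun x => f (zoom a ε x)) = ε * nrm volume f := by
  have h1 : nrm volume (fun x => f (zoom a ε x)) ^ 2 = (ε * nrm volume f) ^ 2 := by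
    rw [nrm_sq (MemLp.zoom hε hf), mul_pow, nrm_sq hf, integral_zoom hε fun x => f x ^ 2]
  exact (pow_left_inj₀ nrm_nonneg (mul_nonneg hε.le nrm_nonneg) two_ne_zero).1 h1

theorem nrm_indicator {A : Set (ℝ × ℝ)} (hA : MeasurableSet A) (f : ℝ × ℝ → ℝ) :
    nrm volume (A.indicator f) = nrm (volume.restrict A) f := by
  rw [nrm, nrm, eLpNorm_indicator_eq_eLpNorm_restrict hA]

theorem pd_zoom {η : ℝ × ℝ → ℝ} (hη : Differentiable ℝ η) (i : Fin 2) (x : ℝ × ℝ) :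
    pd i (fun x => η (zoom a ε x)) x = ε⁻¹ * pd i η (zoom a ε x) := by
  have h1 : HasFDerivAt (zoom a ε) (ε⁻¹ • ContinuousLinearMap.id ℝ (ℝ × ℝ)) x := by
    rw [zoom_eq]
    exact ((hasFDerivAt_id x).sub_const _).const_smul ε⁻¹
  have h2 := (hη (zoom a ε x)).hasFDerivAt.comp x h1
  rw [pd, show (fun x => η (zoom a ε x)) = η ∘ zoom a ε from rfl, h2.fderiv]
  simp [pd]

theorem IsTest.zoom (hε : ε ≠ 0) {U : Set (ℝ × ℝ)} {η : ℝ × ℝ → ℝ} (hη : IsTest U η) :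
    IsTest (ThinChannel.zoom a ε ⁻¹' U) (fun x => η (ThinChannel.zoom a ε x)) :=
  ⟨hη.1.comp (contDiff_zoom a ε), hη.2.comp_homeomorph (zoomHomeomorph a hε), fun _ hx =>
    hη.3 (tsupport_comp_subset_preimage η (continuous_zoom a ε) hx)⟩

theorem IsTest.unzoom (hε : ε ≠ 0) {U : Set (ℝ × ℝ)} {η : ℝ × ℝ → ℝ}
    (hη : IsTest (ThinChannel.zoom a ε ⁻¹' U) η) :
    IsTest U (fun x => η (ThinChannel.zoom (-a / ε) ε⁻¹ x)) := by
  refine (hη.zoom (inv_ne_zero hε)).mono fun x hx => ?_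
  simpa only [mem_preimage, zoom_zoom hε] using hx

theorem pd_unzoom (hε : ε ≠ 0) {η : ℝ × ℝ → ℝ} (hη : Differentiable ℝ η) (i : Fin 2) (x : ℝ × ℝ) :
    pd i (fun x => η (zoom (-a / ε) ε⁻¹ x)) (zoom a ε x) = ε * pd i η x := by
  rw [pd_zoom hη, zoom_zoom' hε, inv_inv]

theorem Sob.zoom (hε : 0 < ε) {U : Set (ℝ × ℝ)} {v : ℝ × ℝ → ℝ} {g : Fin 2 → ℝ × ℝ → ℝ}
    (h : Sob U v g) : Sob (ThinChannel.zoom a ε ⁻¹' U) (fun x => v (ThinChannel.zoom a ε x))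
      (fun i x => ε⁻¹ * g i (ThinChannel.zoom a ε x)) := by
  refine ⟨MemLp.zoom hε h.1, fun i => (MemLp.zoom hε (h.2 i)).const_mul _, fun i η hη => ?_⟩
  have key := h.3 i _ (hη.unzoom hε.ne')
  have e1 : ∀ x, v (ThinChannel.zoom a ε x) * pd i η x = ε⁻¹ * (v (ThinChannel.zoom a ε x) *
      pd i (fun x => η (ThinChannel.zoom (-a / ε) ε⁻¹ x)) (ThinChannel.zoom a ε x)) := fun x => by
    rw [pd_unzoom hε.ne' hη.differentiable]
    field_simp
  have e2 : ∀ x, ε⁻¹ * g i (ThinChannel.zoom a ε x) * η x = ε⁻¹ * (g i (ThinChannel.zoom a ε x) *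
      η (ThinChannel.zoom (-a / ε) ε⁻¹ (ThinChannel.zoom a ε x))) := fun x => by
    rw [zoom_zoom' hε.ne']; ring
  simp only [e1, e2]
  rw [integral_const_mul, integral_const_mul, integral_zoom hε fun x => v x * pd i
    (fun x => η (ThinChannel.zoom (-a / ε) ε⁻¹ x)) x, integral_zoom hε fun x => g i x *
      η (ThinChannel.zoom (-a / ε) ε⁻¹ x), key]
  ring

end

/-- The end `x₁ = a` of the channel, with the inward direction `σ`. -/
def IsEnd (a σ : ℝ) : Prop := a = 0 ∧ σ = 1 ∨ a = 1 ∧ σ = -1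

namespace StripFlow

variable {σ a ε : ℝ} {u : Fin 2 → ℝ × ℝ → ℝ} {g : Fin 2 → Fin 2 → ℝ × ℝ → ℝ} {Ψ : ℝ × ℝ → ℝ}

/-- The weak equation of a flow, in the slow variables. -/
theorem weak_zoom (h : StripFlow σ u g Ψ) (he : IsEnd a σ) (hε : 0 < ε)
    {ψ : Fin 2 → ℝ × ℝ → ℝ} {k : Fin 2 → Fin 2 → ℝ × ℝ → ℝ} (hψ : ∀ i, Sob univ (ψ i) (k i))
    (hz : ∀ i x, x ∉ channel ε → ψ i x = 0) (hk : ∀ᵐ x, k 0 0 x + k 1 1 x = 0) :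
    ∫ x, ∑ i, ∑ j, ε⁻¹ * g i j (zoom a ε x) * k i j x = 0 := by
  have hε' : 0 < ε⁻¹ := inv_pos.2 hε
  have hψ' := fun i => (hψ i).zoom (a := -a / ε) hε'
  -- In the fast variables the channel is a box between the images -a/ε and (1-a)/ε of its two ends,
  -- both on the closed side of the half-strip.
  have key := h.weak (fun i x => ψ i (zoom (-a / ε) ε⁻¹ x))
    (fun i j x => ε⁻¹⁻¹ * k i j (zoom (-a / ε) ε⁻¹ x)) (-a / ε) ((1 - a) / ε)
    (by rw [div_lt_div_iff_of_pos_right hε]; linarith) hψ' ?_ ?_ ?_ ?_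
  · have e1 : ∀ x, ∑ i, ∑ j, g i j x * (ε⁻¹⁻¹ * k i j (zoom (-a / ε) ε⁻¹ x))
        = ε * ∑ i, ∑ j, g i j x * k i j (zoom (-a / ε) ε⁻¹ x) := fun x => by
      simp only [inv_inv, Fin.sum_univ_two]; ring
    simp only [e1] at key
    rw [integral_const_mul] at key
    have key' := (mul_eq_zero.1 key).resolve_left hε.ne'
    have e2 : ∀ x, ∑ i, ∑ j, ε⁻¹ * g i j (zoom a ε x) * k i j x
        = ε⁻¹ * ∑ i, ∑ j, g i j (zoom a ε x) * k i j (zoom (-a / ε) ε⁻¹ (zoom a ε x)) := fun x => by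
      simp only [zoom_zoom' hε.ne', Fin.sum_univ_two]; ring
    simp only [e2]
    rw [integral_const_mul, integral_zoom hε fun x => ∑ i, ∑ j, g i j x *
      k i j (zoom (-a / ε) ε⁻¹ x), key']
    simp
  · rcases he with ⟨rfl, rfl⟩ | ⟨rfl, rfl⟩
    · simp
    · have : -1 * (-1 / ε) = ε⁻¹ := by field_simp
      rw [this]; exact hε'.le
  · rcases he with ⟨rfl, rfl⟩ | ⟨rfl, rfl⟩
    · have : 1 * ((1 - 0) / ε) = ε⁻¹ := by field_simp; norm_num
      rw [this]; exact hε'.le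
    · simp
  · intro i x hx
    refine hz i _ fun hx' => hx ?_
    obtain ⟨⟨h1, h2⟩, h3, h4⟩ := hx'
    have e1 : (zoom (-a / ε) ε⁻¹ x).1 = ε * x.1 + a := by simp only [zoom]; field_simp; ring
    have e2 : (zoom (-a / ε) ε⁻¹ x).2 = ε * x.2 := by simp only [zoom]; field_simp
    rw [e1] at h1 h2
    rw [e2] at h3 h4
    refine ⟨⟨?_, ?_⟩, ?_, ?_⟩
    · rw [div_lt_iff₀ hε]; linarith
    · rw [lt_div_iff₀ hε]; linarith
    · nlinarith
    · nlinarith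
  · have hq := (measurePreserving_zoom (a := -a / ε) hε').quasiMeasurePreserving.ae
      (p := fun x => k 0 0 x + k 1 1 x = 0) (by
        exact Measure.ae_smul_measure hk _)
    filter_upwards [hq] with x hx
    rw [← mul_add, hx, mul_zero]

end StripFlow

/-- The momentum equation of a boundary layer, in the slow variables. -/
theorem IsLayer.integral_pressure_zoom {Ω : Opens (ℝ × ℝ)} {ν₀ a ε : ℝ}
    {b u : Fin 2 → ℝ × ℝ → ℝ} {p : ℝ × ℝ → ℝ} (h : IsLayer Ω ν₀ b u p) (hε : 0 < ε)
    {ψ : Fin 2 → ℝ × ℝ → ℝ} (hψ : ∀ i, IsTest (zoom a ε ⁻¹' Ω) (ψ i)) :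
    ν₀ / 2 * ∫ x, ∑ i, ∑ j, ε⁻¹ * (Ω : Set (ℝ × ℝ)).indicator (weakPartial Ω j (u i)) (zoom a ε x)
        * pd j (ψ i) x
      = ∑ i, ∫ x, ε⁻¹ * p (zoom a ε x) * pd i (ψ i) x := by
  have key := h.integral_pressure fun i => (hψ i).unzoom hε.ne'
  have e1 : ∀ x, ∑ i, ∑ j, ε⁻¹ * (Ω : Set (ℝ × ℝ)).indicator (weakPartial Ω j (u i)) (zoom a ε x)
        * pd j (ψ i) x = ε⁻¹ * ε⁻¹ * ∑ i, ∑ j, (Ω : Set (ℝ × ℝ)).indicator (weakPartial Ω j (u i))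
          (zoom a ε x) * pd j (fun x => ψ i (zoom (-a / ε) ε⁻¹ x)) (zoom a ε x) := fun x => by
    simp only [Fin.sum_univ_two, fun i j => pd_unzoom (a := a) hε.ne' (hψ i).differentiable j x]
    field_simp
  have e2 : ∀ i x, ε⁻¹ * p (zoom a ε x) * pd i (ψ i) x = ε⁻¹ * ε⁻¹ * (p (zoom a ε x) *
      pd i (fun x => ψ i (zoom (-a / ε) ε⁻¹ x)) (zoom a ε x)) := fun i x => by
    rw [pd_unzoom hε.ne' (hψ i).differentiable]
    field_simp
  simp only [e1, e2, integral_const_mul]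
  rw [integral_zoom hε fun x => ∑ i, ∑ j, (Ω : Set (ℝ × ℝ)).indicator (weakPartial Ω j (u i))
          x * pd j (fun x => ψ i (zoom (-a / ε) ε⁻¹ x)) x]
  simp only [fun i => integral_zoom (a := a) hε fun x => p x *
    pd i (fun x => ψ i (zoom (-a / ε) ε⁻¹ x)) x, ← Finset.mul_sum]
  rw [← key]
  ring

end ThinChannel

end

noncomputable section

namespace ThinChannel

open Filter Topology

/-! ### Cutting off a boundary layer at the other end of the channel -/

/-- `χ` is a cutoff function, equal to one near the end `x₁ = a` and to zero near the other end. -/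
structure EndCutoff (a σ M : ℝ) (χ : ℝ → ℝ) : Prop where
  isEnd : IsEnd a σ
  smooth : ContDiff ℝ ∞ χ
  nonneg : ∀ s, 0 ≤ χ s
  le_one : ∀ s, χ s ≤ 1
  one : ∀ s, σ * (s - a) ≤ 1 / 3 → χ s = 1
  zero : ∀ s, 2 / 3 ≤ σ * (s - a) → χ s = 0
  bound : ∀ s, |deriv χ s| ≤ M
  bound' : ∀ s, |deriv (deriv χ) s| ≤ M
  deriv_zero : ∀ s, σ * (s - a) ∉ Icc (1 / 3 : ℝ) (2 / 3) → deriv χ s = 0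
  deriv_zero' : ∀ s, σ * (s - a) ∉ Icc (1 / 3 : ℝ) (2 / 3) → deriv (deriv χ) s = 0

theorem IsEnd.sign {a σ : ℝ} (h : IsEnd a σ) : σ = 1 ∨ σ = -1 := h.imp And.right And.right

theorem exists_endCutoff {a σ : ℝ} (he : IsEnd a σ) : ∃ M χ, EndCutoff a σ M χ := by
  obtain ⟨θ, hθ, hθ1, hθ0, hθb, M, hM⟩ := exists_step (p := 1 / 3) (q := 2 / 3) (by norm_num)
  have hσa : |σ| = 1 := by rcases he.sign with rfl | rfl <;> norm_num
  have hlin : ∀ s : ℝ, HasDerivAt (fun s => σ * (s - a)) σ s := fun s => by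
    simpa using ((hasDerivAt_id s).sub_const a).const_mul σ
  have hcont : Continuous fun s : ℝ => σ * (s - a) := by fun_prop
  have hθd : Differentiable ℝ θ := hθ.differentiable (by simp)
  have hθdd : Differentiable ℝ (deriv θ) :=
    ((contDiff_infty_iff_deriv.1 hθ).2).differentiable (by simp)
  have h1 : ∀ s, HasDerivAt (fun s => θ (σ * (s - a))) (deriv θ (σ * (s - a)) * σ) s := fun s =>
    (hθd _).hasDerivAt.comp s (hlin s)
  have hd : deriv (fun s => θ (σ * (s - a))) = fun s => deriv θ (σ * (s - a)) * σ :=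
    funext fun s => (h1 s).deriv
  have h2 : ∀ s, HasDerivAt (fun s => deriv θ (σ * (s - a)) * σ)
      (deriv (deriv θ) (σ * (s - a)) * σ * σ) s := fun s =>
    ((hθdd _).hasDerivAt.comp s (hlin s)).mul_const σ
  have hz : ∀ s, s ∉ Icc (1 / 3 : ℝ) (2 / 3) → deriv θ s = 0 ∧ deriv (deriv θ) s = 0 := by
    have hloc : ∀ {s v : ℝ} {U : Set ℝ}, IsOpen U → s ∈ U → (∀ y ∈ U, θ y = v) →
        deriv θ s = 0 ∧ deriv (deriv θ) s = 0 := by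
      intro s v U hU hs hv
      have e1 : ∀ y ∈ U, deriv θ y = 0 := fun y hy => by
        have : θ =ᶠ[𝓝 y] fun _ => v := by
          filter_upwards [hU.mem_nhds hy] with z hz using hv z hz
        rw [this.deriv_eq]; simp
      refine ⟨e1 s hs, ?_⟩
      have : deriv θ =ᶠ[𝓝 s] fun _ => 0 := by
        filter_upwards [hU.mem_nhds hs] with z hz using e1 z hz
      rw [this.deriv_eq]; simp
    intro s hs
    rw [mem_Icc, not_and_or, not_le, not_le] at hs
    rcases hs with hs | hs
    · exact hloc isOpen_Iio hs fun y hy => hθ1 y (le_of_lt hy)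
    · exact hloc isOpen_Ioi hs fun y hy => hθ0 y (le_of_lt hy)
  refine ⟨M, fun s => θ (σ * (s - a)), he, hθ.comp (by fun_prop), fun s => (hθb _).1,
    fun s => (hθb _).2, fun s hs => hθ1 _ hs, fun s hs => hθ0 _ hs, fun s => ?_, fun s => ?_,
    fun s hs => ?_, fun s hs => ?_⟩
  · rw [hd, abs_mul, hσa, mul_one]; exact (hM _).1
  · rw [hd, (h2 s).deriv, abs_mul, abs_mul, hσa, mul_one, mul_one]; exact (hM _).2
  · rw [hd]; simp only; rw [(hz _ hs).1, zero_mul]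
  · rw [hd, (h2 s).deriv, (hz _ hs).2, zero_mul, zero_mul]

/-- Product with a bounded smooth function of the first variable. -/
theorem Sob.mul_axial {U V : Set (ℝ × ℝ)} {v : ℝ × ℝ → ℝ} {g : Fin 2 → ℝ × ℝ → ℝ} (h : Sob U v g)
    {c : ℝ → ℝ} (hc : ContDiff ℝ ∞ c) (hV : tsupport (fun x : ℝ × ℝ => c x.1) ∩ V ⊆ U) {C : ℝ}
    (hC : ∀ s, |c s| ≤ C) (hC' : ∀ s, |deriv c s| ≤ C) :
    Sob V (fun x => c x.1 * v x)
      (fun i x => c x.1 * g i x + (if i = 0 then deriv c x.1 else 0) * v x) := by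
  have hpd : ∀ i x, pd i (fun y => c (co 0 y)) x = if i = 0 then deriv c x.1 else 0 := fun i x => by
    rw [pd_comp_co i 0 (hc.differentiable (by simp) _), co_zero]
  have := h.mul (V := V) (a := fun x => c (co 0 x)) (hc.comp (contDiff_co 0)) hV (C := C)
    (fun x => hC _) (fun i x => ?_)
  · simp only [hpd] at this
    exact this
  · rw [hpd]
    split_ifs
    · exact hC' _
    · rw [abs_zero]; exact (abs_nonneg _).trans (hC 0)

/-- The cut off velocity, made divergence free by means of the stream function. -/
def cutVel (χ : ℝ → ℝ) (a ε : ℝ) (u : Fin 2 → ℝ × ℝ → ℝ) (Ψ : ℝ × ℝ → ℝ) : Fin 2 → ℝ × ℝ → ℝ :=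
  ![fun x => χ x.1 * u 0 (zoom a ε x),
    fun x => χ x.1 * u 1 (zoom a ε x) - ε * (deriv χ x.1 * Ψ (zoom a ε x))]

/-- The gradient of the cut off velocity. -/
def cutGrad (χ : ℝ → ℝ) (a ε : ℝ) (u : Fin 2 → ℝ × ℝ → ℝ) (g : Fin 2 → Fin 2 → ℝ × ℝ → ℝ)
    (Ψ : ℝ × ℝ → ℝ) : Fin 2 → Fin 2 → ℝ × ℝ → ℝ :=
  ![fun j x => χ x.1 * (ε⁻¹ * g 0 j (zoom a ε x))
      + (if j = 0 then deriv χ x.1 else 0) * u 0 (zoom a ε x),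
    fun j x => (χ x.1 * (ε⁻¹ * g 1 j (zoom a ε x))
      + (if j = 0 then deriv χ x.1 else 0) * u 1 (zoom a ε x)) -
      ε * (deriv χ x.1 * (ε⁻¹ * (![fun x => -u 1 x, u 0] : Fin 2 → ℝ × ℝ → ℝ) j (zoom a ε x))
        + (if j = 0 then deriv (deriv χ) x.1 else 0) * Ψ (zoom a ε x))]

namespace EndCutoff

variable {a σ M : ℝ} {χ : ℝ → ℝ}

theorem nonneg_bound (hc : EndCutoff a σ M χ) : 0 ≤ M := (abs_nonneg _).trans (hc.bound 0)

theorem abs_le_one (hc : EndCutoff a σ M χ) (s : ℝ) : |χ s| ≤ 1 := by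
  rw [abs_of_nonneg (hc.nonneg s)]; exact hc.le_one s

theorem smooth_deriv (hc : EndCutoff a σ M χ) : ContDiff ℝ ∞ (deriv χ) :=
  (contDiff_infty_iff_deriv.1 hc.smooth).2

variable {ε : ℝ} {u : Fin 2 → ℝ × ℝ → ℝ} {g : Fin 2 → Fin 2 → ℝ × ℝ → ℝ} {Ψ : ℝ × ℝ → ℝ}

theorem sob (hc : EndCutoff a σ M χ) (hε : 0 < ε) (h : StripFlow σ u g Ψ) (i : Fin 2) :
    Sob (zoom a ε ⁻¹' halfPlane σ) (cutVel χ a ε u Ψ i) (cutGrad χ a ε u g Ψ i) := by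
  have hM := hc.nonneg_bound
  have h1 := fun i => ((h.sob i).zoom (a := a) hε).mul_axial (V := zoom a ε ⁻¹' halfPlane σ)
    hc.smooth inter_subset_right (C := 1 + M) (fun s => (hc.abs_le_one s).trans (by linarith))
    (fun s => (hc.bound s).trans (by linarith))
  have h2 := (h.stream.zoom (a := a) hε).mul_axial (V := zoom a ε ⁻¹' halfPlane σ)
    hc.smooth_deriv inter_subset_right (C := M) hc.bound hc.bound'
  fin_cases i
  · exact h1 0
  · exact (h1 1).sub (h2.const_mul ε)

/-- The cut off field is (∂₂, -∂₁) applied to ε χ(x₁) Ψ in the fast variables, the factor ε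
compensating the ε⁻¹ of differentiation. Hence the terms with χ' cancel in the divergence, and only
χ times the divergence of the flow remains. -/
theorem _root_.ThinChannel.StripFlow.cutGrad_div (h : StripFlow σ u g Ψ) (hε : 0 < ε) :
    ∀ᵐ x, zoom a ε x ∈ halfPlane σ → cutGrad χ a ε u g Ψ 0 0 x + cutGrad χ a ε u g Ψ 1 1 x = 0 := by
  have hq := (measurePreserving_zoom (a := a) hε).quasiMeasurePreserving.ae
    (p := fun x => x ∈ halfPlane σ → g 0 0 x + g 1 1 x = 0) (Measure.ae_smul_measure h.div _)
  filter_upwards [hq] with x hx hxH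
  have := hx hxH
  simp [cutGrad]
  field_simp
  linear_combination χ x.1 * this

/-- A coefficient that vanishes up to distance r from the end sees only the part of the flow beyond
r/ε. The change of variables in the plane contributes the factor ε to the L² norm. -/
theorem axial_zoom_le (hε : 0 < ε) {r D : ℝ} (hD : 0 ≤ D)
    {d f : ℝ × ℝ → ℝ} (hf : MemLp f 2) {B : Set (ℝ × ℝ)} (hB : MeasurableSet B)
    (hd : ∀ x ∈ B, |d x| ≤ D) (hd0 : ∀ x ∈ B, σ * (x.1 - a) < r → d x = 0) :
    nrm (volume.restrict B) (fun x => d x * f (zoom a ε x))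
      ≤ D * (ε * nrm (volume.restrict (tail σ (r / ε))) f) := by
  have hA := measurableSet_tail σ (r / ε)
  have hi := hf.indicator hA
  rw [← nrm_indicator hA, ← nrm_zoom (a := a) hε hi, ← abs_of_nonneg hD, ← nrm_const_mul]
  have hm := (MemLp.zoom (a := a) hε hi).const_mul D
  refine (nrm_le_of_abs_le (hm.restrict B) ?_).trans (nrm_restrict_le ?_)
  · filter_upwards [ae_restrict_mem hB] with x hx
    by_cases hr : σ * (x.1 - a) < r
    · rw [hd0 x hx hr, zero_mul, abs_zero]; exact abs_nonneg _
    · have : zoom a ε x ∈ tail σ (r / ε) := by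
        change r / ε ≤ σ * ((x.1 - a) / ε)
        rw [← mul_div_assoc, div_le_div_iff_of_pos_right hε]
        exact not_lt.1 hr
      rw [indicator_of_mem this, abs_mul, abs_mul, abs_of_nonneg hD]
      exact mul_le_mul_of_nonneg_right (hd x hx) (abs_nonneg _)
  · exact hm

/-- All the tails of a flow beyond `σ ξ₁ = r / ε` are bounded by `K`. -/
structure _root_.ThinChannel.TailBound (σ t K : ℝ) (u : Fin 2 → ℝ × ℝ → ℝ)
    (g : Fin 2 → Fin 2 → ℝ × ℝ → ℝ) (Ψ : ℝ × ℝ → ℝ) : Prop where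
  vel : ∀ i, nrm (volume.restrict (tail σ t)) (u i) ≤ K
  grad : ∀ i j, nrm (volume.restrict (tail σ t)) (g i j) ≤ K
  stream : nrm (volume.restrict (tail σ t)) Ψ ≤ K

/-- Every difference contains χ - 1, χ' or χ'', which vanish up to distance 1/3 ≥ r from the end, so
only the tail bounded by K enters. The ε⁻¹ of a gradient is absorbed by the ε of the change of
variables. In the worst entry, χ - 1 contributes K, and the terms with χ'u, χ'∇Ψ and χ''Ψ contribute
MK each. -/
theorem close (hc : EndCutoff a σ M χ) (hε : 0 < ε) (hε1 : ε ≤ 1) (h : StripFlow σ u g Ψ)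
    {r K : ℝ} (hr : r ≤ 1 / 3) (hK0 : 0 ≤ K) (hK : TailBound σ (r / ε) K u g Ψ)
    {B : Set (ℝ × ℝ)} (hB : MeasurableSet B) :
    (∀ i, nrm (volume.restrict B) (fun x => cutVel χ a ε u Ψ i x - u i (zoom a ε x))
      ≤ (1 + 3 * M) * K) ∧
    ∀ i j, nrm (volume.restrict B) (fun x => cutGrad χ a ε u g Ψ i j x - ε⁻¹ * g i j (zoom a ε x))
      ≤ (1 + 3 * M) * K := by
  have hM := hc.nonneg_bound
  have hu := fun i => (h.sob i).memLp
  have hg := fun i j => (h.sob i).memLp_grad j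
  have hΨ := h.stream.memLp
  -- the elementary terms
  have cm : ∀ {c : ℝ → ℝ} {D : ℝ} {f : ℝ × ℝ → ℝ}, Continuous c → (∀ s, |c s| ≤ D) → MemLp f 2 →
      MemLp (fun x => c x.1 * f (zoom a ε x)) 2 (volume.restrict B) := fun hcc hcD hf =>
    (memLp_bdd_mul (hcc.comp continuous_fst).aestronglyMeasurable (ae_of_all _ fun x => hcD _)
      (MemLp.zoom hε hf)).restrict B
  have tm : ∀ {c : ℝ → ℝ} {D : ℝ} {f : ℝ × ℝ → ℝ}, (∀ s, |c s| ≤ D) → 0 ≤ D →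
      (∀ s, σ * (s - a) < r → c s = 0) → MemLp f 2 → nrm (volume.restrict (tail σ (r / ε))) f ≤ K →
      nrm (volume.restrict B) (fun x => c x.1 * f (zoom a ε x)) ≤ D * (ε * K) :=
    fun {c D f} hcD hD0 hc0 hf hfK =>
    (axial_zoom_le hε hD0 hf hB (d := fun x => c x.1) (fun x _ => hcD _)
      fun x _ hx => hc0 _ hx).trans (mul_le_mul_of_nonneg_left
        (mul_le_mul_of_nonneg_left hfK hε.le) hD0)
  have c1 : ∀ s, |χ s - 1| ≤ 1 := fun s => by
    rw [abs_le]; constructor <;> linarith [hc.nonneg s, hc.le_one s]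
  have c1' : Continuous fun s => χ s - 1 := hc.smooth.continuous.sub continuous_const
  have z1 : ∀ s, σ * (s - a) < r → χ s - 1 = 0 := fun s hs => by
    rw [hc.one s (by linarith), sub_self]
  have z2 : ∀ s, σ * (s - a) < r → deriv χ s = 0 := fun s hs =>
    hc.deriv_zero s fun h' => by linarith [h'.1]
  have z3 : ∀ s, σ * (s - a) < r → deriv (deriv χ) s = 0 := fun s hs =>
    hc.deriv_zero' s fun h' => by linarith [h'.1]
  have d1' := hc.smooth_deriv.continuous
  have d2' := ((contDiff_infty_iff_deriv.1 hc.smooth_deriv).2).continuous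
  have hεK : ε * K ≤ K := mul_le_of_le_one_left hK0 hε1
  have hεK0 : 0 ≤ ε * K := mul_nonneg hε.le hK0
  have hMK : M * (ε * K) ≤ M * K := mul_le_mul_of_nonneg_left hεK hM
  have hMK0 : 0 ≤ M * (ε * K) := mul_nonneg hM hεK0
  -- the gradient of the cutoff acting on the velocity
  have dif : ∀ (j i : Fin 2), MemLp (fun x => (if j = 0 then deriv χ x.1 else 0) * u i (zoom a ε x)) 2
      (volume.restrict B) ∧ nrm (volume.restrict B)
        (fun x => (if j = 0 then deriv χ x.1 else 0) * u i (zoom a ε x)) ≤ M * K := fun j i => by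
    by_cases hj : j = 0
    · simp only [hj, if_true]
      exact ⟨cm d1' hc.bound (hu i), (tm hc.bound hM z2 (hu i) (hK.vel i)).trans hMK⟩
    · simp only [hj, if_false, zero_mul]
      exact ⟨MemLp.zero, by simp [nrm]; positivity⟩
  have main : ∀ i j, MemLp (fun x => (χ x.1 - 1) * (ε⁻¹ * g i j (zoom a ε x))) 2
      (volume.restrict B) ∧ nrm (volume.restrict B)
        (fun x => (χ x.1 - 1) * (ε⁻¹ * g i j (zoom a ε x))) ≤ K := fun i j => by
    have e1 : ∀ x, (χ x.1 - 1) * (ε⁻¹ * g i j (zoom a ε x))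
        = ε⁻¹ * ((χ x.1 - 1) * g i j (zoom a ε x)) := fun x => by ring
    simp only [e1]
    refine ⟨(cm c1' c1 (hg i j)).const_mul _, ?_⟩
    rw [nrm_const_mul, abs_of_pos (inv_pos.2 hε)]
    calc _ ≤ ε⁻¹ * (1 * (ε * K)) := mul_le_mul_of_nonneg_left
          (tm c1 zero_le_one z1 (hg i j) (hK.grad i j)) (inv_pos.2 hε).le
      _ = K := by field_simp
  refine ⟨fun i => ?_, fun i j => ?_⟩
  · have b1 := tm c1 zero_le_one z1 (hu i) (hK.vel i)
    fin_cases i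
    · simp only [Fin.zero_eta] at b1 ⊢
      rw [show (fun x => cutVel χ a ε u Ψ 0 x - u 0 (zoom a ε x))
        = fun x => (χ x.1 - 1) * u 0 (zoom a ε x) by funext x; simp [cutVel]; ring]
      nlinarith
    · simp only [Fin.mk_one] at b1 ⊢
      rw [show (fun x => cutVel χ a ε u Ψ 1 x - u 1 (zoom a ε x))
        = fun x => (χ x.1 - 1) * u 1 (zoom a ε x) - ε * (deriv χ x.1 * Ψ (zoom a ε x)) by
          funext x; simp [cutVel]; ring]
      have b2 := tm hc.bound hM z2 hΨ hK.stream
      have b3 := nrm_sub_le (cm c1' c1 (hu 1)) ((cm d1' hc.bound hΨ).const_mul ε)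
      rw [nrm_const_mul, abs_of_pos hε] at b3
      have b4 : ε * nrm (volume.restrict B) (fun x => deriv χ x.1 * Ψ (zoom a ε x)) ≤ M * (ε * K) :=
        (mul_le_of_le_one_left nrm_nonneg hε1).trans b2
      nlinarith
  · obtain ⟨m1, b1⟩ := main i j
    obtain ⟨m2, b2⟩ := dif j i
    fin_cases i
    · simp only [Fin.zero_eta] at m1 b1 m2 b2 ⊢
      rw [show (fun x => cutGrad χ a ε u g Ψ 0 j x - ε⁻¹ * g 0 j (zoom a ε x))
        = fun x => (χ x.1 - 1) * (ε⁻¹ * g 0 j (zoom a ε x))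
          + (if j = 0 then deriv χ x.1 else 0) * u 0 (zoom a ε x) by
          funext x; simp [cutGrad]; ring]
      have := nrm_add_le m1 m2
      nlinarith
    · simp only [Fin.mk_one] at m1 b1 m2 b2 ⊢
      have hs : MemLp ((![fun x => -u 1 x, u 0] : Fin 2 → ℝ × ℝ → ℝ) j) 2 := h.stream.memLp_grad j
      have hsK : nrm (volume.restrict (tail σ (r / ε)))
          ((![fun x => -u 1 x, u 0] : Fin 2 → ℝ × ℝ → ℝ) j) ≤ K := by
        fin_cases j
        · have := nrm_const_mul (μ := volume.restrict (tail σ (r / ε))) (f := u 1) (-1)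
          simp only [neg_one_mul, abs_neg, abs_one, one_mul] at this
          simp only [Fin.zero_eta, Matrix.cons_val_zero]
          rw [this]; exact hK.vel 1
        · exact hK.vel 0
      have m3 := cm d1' hc.bound hs
      have b3 := (tm hc.bound hM z2 hs hsK).trans hMK
      have m4 : MemLp (fun x => (if j = 0 then deriv (deriv χ) x.1 else 0) * Ψ (zoom a ε x)) 2
          (volume.restrict B) ∧ nrm (volume.restrict B)
          (fun x => (if j = 0 then deriv (deriv χ) x.1 else 0) * Ψ (zoom a ε x)) ≤ M * K := by
        by_cases hj : j = 0
        · simp only [hj, if_true]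
          exact ⟨cm d2' hc.bound' hΨ, (tm hc.bound' hM z3 hΨ hK.stream).trans hMK⟩
        · simp only [hj, if_false, zero_mul]
          exact ⟨MemLp.zero, by simp [nrm]; positivity⟩
      rw [show (fun x => cutGrad χ a ε u g Ψ 1 j x - ε⁻¹ * g 1 j (zoom a ε x))
        = fun x => ((χ x.1 - 1) * (ε⁻¹ * g 1 j (zoom a ε x))
          + (if j = 0 then deriv χ x.1 else 0) * u 1 (zoom a ε x)) -
          (deriv χ x.1 * (![fun x => -u 1 x, u 0] : Fin 2 → ℝ × ℝ → ℝ) j (zoom a ε x)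
            + ε * ((if j = 0 then deriv (deriv χ) x.1 else 0) * Ψ (zoom a ε x))) by
          funext x
          have : ε * ε⁻¹ = 1 := mul_inv_cancel₀ hε.ne'
          simp only [cutGrad, Matrix.cons_val_one, Matrix.cons_val_zero]
          linear_combination (-deriv χ x.1 *
            (![fun x => -u 1 x, u 0] : Fin 2 → ℝ × ℝ → ℝ) j (zoom a ε x)) * this]
      have t1 := nrm_add_le m1 m2
      have t2 := nrm_add_le m3 (m4.1.const_mul ε)
      rw [nrm_const_mul, abs_of_pos hε] at t2
      have t3 := nrm_sub_le (m1.add m2) (m3.add (m4.1.const_mul ε))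
      simp only [Pi.add_apply] at t3
      have t4 : ε * nrm (volume.restrict B)
          (fun x => (if j = 0 then deriv (deriv χ) x.1 else 0) * Ψ (zoom a ε x)) ≤ M * K :=
        (mul_le_of_le_one_left nrm_nonneg hε1).trans m4.2
      refine t3.trans ?_
      refine (add_le_add t1 t2).trans ?_
      linarith

theorem _root_.ThinChannel.channel_subset_zoom (he : IsEnd a σ) (hε : 0 < ε) {x : ℝ × ℝ}
    (hx : x ∈ channel ε) : zoom a ε x ∈ halfPlane σ ∩ hStrip := by
  obtain ⟨⟨h1, h2⟩, h3, h4⟩ := hx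
  refine ⟨?_, ?_, ?_⟩
  · change 0 < σ * ((x.1 - a) / ε)
    rw [← mul_div_assoc]
    refine div_pos ?_ hε
    rcases he with ⟨rfl, rfl⟩ | ⟨rfl, rfl⟩ <;> linarith
  · change -(1 / 2) < x.2 / ε
    rw [lt_div_iff₀ hε]; linarith
  · change x.2 / ε < 1 / 2
    rw [div_lt_iff₀ hε]; linarith

/-- A point of the rescaled half-strip outside of the channel is beyond the other end. -/
theorem _root_.ThinChannel.one_le_of_notMem_channel (he : IsEnd a σ) (hε : 0 < ε) {x : ℝ × ℝ}
    (hx : x ∉ channel ε) (hz : zoom a ε x ∈ halfPlane σ ∩ hStrip) : 1 ≤ σ * (x.1 - a) := by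
  obtain ⟨h1, h2, h3⟩ := hz
  change -(1 / 2) < x.2 / ε at h2
  change x.2 / ε < 1 / 2 at h3
  change 0 < σ * ((x.1 - a) / ε) at h1
  rw [← mul_div_assoc] at h1
  have h1' : 0 < σ * (x.1 - a) := by
    have := mul_pos h1 hε
    rwa [div_mul_cancel₀ _ hε.ne'] at this
  rw [lt_div_iff₀ hε] at h2
  rw [div_lt_iff₀ hε] at h3
  by_contra hcon
  refine hx ⟨?_, by linarith, by linarith⟩
  rw [not_le] at hcon
  rcases he with ⟨rfl, rfl⟩ | ⟨rfl, rfl⟩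
  · exact ⟨by linarith, by linarith⟩
  · exact ⟨by linarith, by linarith⟩

/-- The continuous comparison function is χ times the rescaled representative G of the boundary
values of the layer. Near its own end χ = 1. On the lateral walls the data are zero. The far end,
although interior to the rescaled half-strip, is reached only where χ = 0. -/
theorem boundary (hc : EndCutoff a σ M χ) (hε : 0 < ε) (h : StripFlow σ u g Ψ)
    {Ω : Opens (ℝ × ℝ)} (hΩ : (Ω : Set (ℝ × ℝ)) = halfPlane σ ∩ hStrip) {b : Fin 2 → ℝ × ℝ → ℝ}
    (hb : ∀ i, HasBoundaryValue Ω (u i) (b i)) (hb0 : ∀ i, ∀ x : ℝ × ℝ, x.1 ≠ 0 → b i x = 0)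
    (i : Fin 2) :
    HasBoundaryValue (channel ε) (cutVel χ a ε u Ψ i) (fun x => b i (zoom a ε x)) := by
  have hM := hc.nonneg_bound
  have he := hc.isEnd
  obtain ⟨G, hGc, hGm, hGb, hG0⟩ := hb i
  have hmap : MapsTo (zoom a ε) (channel ε) Ω := fun x hx => by
    rw [hΩ]; exact channel_subset_zoom he hε hx
  have hout : ∀ x, x ∉ channel ε → zoom a ε x ∈ Ω → 1 ≤ σ * (x.1 - a) := fun x hx hz =>
    one_le_of_notMem_channel he hε hx (by rw [← hΩ]; exact hz)
  have hax : ∀ {U V : Set (ℝ × ℝ)} {v : ℝ × ℝ → ℝ} {g : Fin 2 → ℝ × ℝ → ℝ}, Sob U v g → V ⊆ U →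
      Sob V (fun x => χ x.1 * v x)
        (fun i x => χ x.1 * g i x + (if i = 0 then deriv χ x.1 else 0) * v x) :=
    fun hs hVU => hs.mul_axial hc.smooth (inter_subset_right.trans hVU) (C := 1 + M)
      (fun s => (hc.abs_le_one s).trans (by linarith)) (fun s => (hc.bound s).trans (by linarith))
  have h0 : (0 : ℝ) < 1 := one_pos
  have hεε : -(ε / 2) < ε / 2 := by linarith
  -- the part in `H¹₀`
  have hA : MemH10 (channel ε) (fun x => χ x.1 * (u i (zoom a ε x) - G (zoom a ε x))) := by
    have hs := hax (hG0.sob.zoom (a := a) hε) (V := univ) (by simp)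
    refine (hs.memH10 (Ω := channel ε) h0 hεε (fun x hx => ?_) le_rfl).congr ?_
    · by_cases hz : zoom a ε x ∈ (Ω : Set (ℝ × ℝ))
      · have := hout x hx hz
        rw [hc.zero _ (by linarith), zero_mul]
      · rw [indicator_of_notMem hz, mul_zero]
    · filter_upwards [ae_restrict_mem (channel ε).isOpen.measurableSet] with x hx
      rw [indicator_of_mem (hmap hx)]
  -- The correction by the stream function does not affect the boundary values: χ' lives at
  -- distances between 1/3 and 2/3 from the end, and Ψ vanishes outside the strip.
  have hB : MemH10 (channel ε) (fun x => -ε * (deriv χ x.1 * Ψ (zoom a ε x))) := by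
    have hs := ((h.stream.zoom (a := a) hε).mul_axial (V := univ) hc.smooth_deriv ?_ (C := M) hc.bound
      hc.bound').const_mul (-ε)
    · refine hs.memH10 (Ω := channel ε) h0 hεε (fun x hx => ?_) le_rfl
      by_cases hz : zoom a ε x ∈ halfPlane σ ∩ hStrip
      · have := one_le_of_notMem_channel he hε hx hz
        rw [hc.deriv_zero _ fun h' => by linarith [h'.2], zero_mul, mul_zero]
      · by_cases hz' : zoom a ε x ∈ hStrip
        · have hn : ¬0 < σ * ((x.1 - a) / ε) := fun h' => hz ⟨h', hz'⟩
          rw [hc.deriv_zero _ fun h' => hn ?_, zero_mul, mul_zero]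
          rw [← mul_div_assoc]
          exact div_pos (by linarith [h'.1]) hε
        · rw [h.stream_zero _ hz', mul_zero, mul_zero]
    · rintro x ⟨hx, -⟩
      have hcl : IsClosed {x : ℝ × ℝ | σ * (x.1 - a) ∈ Icc (1 / 3 : ℝ) (2 / 3)} :=
        isClosed_Icc.preimage (by fun_prop)
      have : tsupport (fun x : ℝ × ℝ => deriv χ x.1) ⊆ {x | σ * (x.1 - a) ∈ Icc (1 / 3 : ℝ) (2 / 3)} :=
        closure_minimal (fun x hx => by_contra fun h1 => hx (hc.deriv_zero _ h1)) hcl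
      have h1 := this hx
      change 0 < σ * ((x.1 - a) / ε)
      rw [← mul_div_assoc]
      exact div_pos (by linarith [h1.1]) hε
  have hmem : ∀ w : ℝ × ℝ → ℝ, (∀ x, cutVel χ a ε u Ψ i x = w x) →
      MemH10 (channel ε) (fun x => w x - χ x.1 * G (zoom a ε x)) →
      HasBoundaryValue (channel ε) (cutVel χ a ε u Ψ i) (fun x => b i (zoom a ε x)) := by
    intro w hw hw0
    refine ⟨fun x => χ x.1 * G (zoom a ε x), ?_, ?_, ?_, by simpa only [hw] using hw0⟩
    · refine ContinuousOn.mul (hc.smooth.continuous.comp continuous_fst).continuousOn ?_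
      exact hGc.comp (continuous_zoom a ε).continuousOn (hmap.closure (continuous_zoom a ε))
    · have hs := hax (hGm.sob.zoom (a := a) hε) (V := channel ε) hmap
      refine hs.memH1 ?_
      filter_upwards [ae_restrict_mem (channel ε).isOpen.measurableSet] with x hx
      rw [indicator_of_mem (hmap hx)]
    · intro x hx
      rw [(channel ε).isOpen.frontier_eq] at hx
      have hzc : zoom a ε x ∈ closure (Ω : Set (ℝ × ℝ)) := hmap.closure (continuous_zoom a ε) hx.1
      by_cases hz : zoom a ε x ∈ (Ω : Set (ℝ × ℝ))
      · have h1 := hout x hx.2 hz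
        have h2 : (zoom a ε x).1 ≠ 0 := by
          intro h'
          simp only [zoom, div_eq_zero_iff, hε.ne', or_false] at h'
          rw [h', mul_zero] at h1
          linarith
        simp only [hb0 i _ h2, hc.zero _ (by linarith : 2 / 3 ≤ σ * (x.1 - a)), zero_mul]
      · have h1 := hGb (show zoom a ε x ∈ frontier (Ω : Set (ℝ × ℝ)) by
          rw [Ω.isOpen.frontier_eq]; exact ⟨hzc, hz⟩)
        simp only [h1]
        by_cases hx0 : (zoom a ε x).1 = 0
        · simp only [zoom, div_eq_zero_iff, hε.ne', or_false] at hx0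
          rw [hc.one _ (by rw [hx0, mul_zero]; norm_num), one_mul]
        · rw [hb0 i _ hx0, mul_zero]
  fin_cases i
  · refine hmem (fun x => χ x.1 * u 0 (zoom a ε x)) (fun x => rfl) ?_
    simp only [mul_sub] at hA
    exact hA
  · refine hmem (fun x => χ x.1 * u 1 (zoom a ε x) - ε * (deriv χ x.1 * Ψ (zoom a ε x)))
      (fun x => rfl) ?_
    refine (hA.add hB).congr (ae_of_all _ fun x => ?_)
    simp only [Fin.mk_one]; ring

end EndCutoff

end ThinChannel

end

/-! ### Calculus in the channel, the residual of the regular ansatz and the lifting of the end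
values. -/

noncomputable section

namespace ThinChannel

open Filter Topology

/-! ### Functions in `H¹` with a given gradient -/

/-- `v ∈ H¹(Ω)`, with gradient `g`. -/
structure HasGrad (Ω : Opens (ℝ × ℝ)) (v : ℝ × ℝ → ℝ) (g : Fin 2 → ℝ × ℝ → ℝ) : Prop where
  memH1 : MemH1 Ω v
  grad : ∀ i, weakPartial Ω i v =ᵐ[volume.restrict Ω] g i

section HasGrad

variable {Ω : Opens (ℝ × ℝ)} {v w : ℝ × ℝ → ℝ} {g k : Fin 2 → ℝ × ℝ → ℝ}

theorem Sob.hasGrad {v' : ℝ × ℝ → ℝ} (h : Sob Ω v' g) (hv : v' =ᵐ[volume.restrict Ω] v) :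
    HasGrad Ω v g := ⟨h.memH1 hv, h.weakPartial_ae hv⟩

theorem MemH1.hasGrad (h : MemH1 Ω v) : HasGrad Ω v (fun i => weakPartial Ω i v) :=
  ⟨h, fun _ => ae_eq_refl _⟩

namespace HasGrad

theorem memLp (h : HasGrad Ω v g) : MemLp v 2 (volume.restrict Ω) := h.memH1.1

theorem memLp_grad (h : HasGrad Ω v g) (i : Fin 2) : MemLp (g i) 2 (volume.restrict Ω) :=
  (memLp_congr_ae (h.grad i)).1 (weakPartial_spec h.memH1 i).1

theorem sob (h : HasGrad Ω v g) : Sob Ω ((Ω : Set (ℝ × ℝ)).indicator v)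
    (fun i => (Ω : Set (ℝ × ℝ)).indicator (g i)) := by
  have hm := Ω.isOpen.measurableSet
  refine h.memH1.sob.congr hm (ae_eq_refl _) (fun i => ?_) h.memH1.sob.memLp
    fun i => memLp_indicator hm (h.memLp_grad i)
  exact (indicator_ae_eq_restrict hm).trans ((h.grad i).trans (indicator_ae_eq_restrict hm).symm)

theorem of_sob (h : Sob Ω ((Ω : Set (ℝ × ℝ)).indicator v)
    (fun i => (Ω : Set (ℝ × ℝ)).indicator (g i))) : HasGrad Ω v g := by
  have hm := Ω.isOpen.measurableSet
  have := h.hasGrad (indicator_ae_eq_restrict hm)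
  exact ⟨this.1, fun i => (this.2 i).trans (indicator_ae_eq_restrict hm)⟩

theorem add (h : HasGrad Ω v g) (h' : HasGrad Ω w k) :
    HasGrad Ω (fun x => v x + w x) (fun i x => g i x + k i x) := by
  have := h.sob.add h'.sob
  refine of_sob ?_
  convert this using 1
  · exact indicator_add _ _ _
  · funext i; exact indicator_add _ _ _

theorem const_mul (h : HasGrad Ω v g) (c : ℝ) :
    HasGrad Ω (fun x => c * v x) (fun i x => c * g i x) := by
  have := h.sob.const_mul c
  refine of_sob ?_
  convert this using 1
  · funext x; exact indicator_const_mul _ _ _ x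
  · funext i x; exact indicator_const_mul _ _ _ x

theorem sub (h : HasGrad Ω v g) (h' : HasGrad Ω w k) :
    HasGrad Ω (fun x => v x - w x) (fun i x => g i x - k i x) := by
  have := h.add (h'.const_mul (-1))
  simpa [sub_eq_add_neg] using this

theorem zero : HasGrad Ω (fun _ => 0) (fun _ _ => 0) := Sob.zero.hasGrad (ae_eq_refl _)

theorem sum {ι : Type*} (s : Finset ι) {v : ι → ℝ × ℝ → ℝ} {g : ι → Fin 2 → ℝ × ℝ → ℝ}
    (h : ∀ j ∈ s, HasGrad Ω (v j) (g j)) :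
    HasGrad Ω (fun x => ∑ j ∈ s, v j x) (fun i x => ∑ j ∈ s, g j i x) := by
  classical
  induction s using Finset.induction_on with
  | empty => simpa using zero
  | insert a s ha ih =>
    simp only [Finset.sum_insert ha]
    exact (h a (by simp)).add (ih fun j hj => h j (by simp [hj]))

theorem congr (h : HasGrad Ω v g) (hv : ∀ x ∈ Ω, v x = w x) (hg : ∀ i, ∀ x ∈ Ω, g i x = k i x) :
    HasGrad Ω w k := by
  have hm := ae_restrict_mem (μ := volume) Ω.isOpen.measurableSet
  have := h.sob.hasGrad (v := w) (by
    filter_upwards [hm] with x hx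
    rw [indicator_of_mem hx, hv x hx])
  refine ⟨this.1, fun i => (this.2 i).trans ?_⟩
  filter_upwards [hm] with x hx
  rw [indicator_of_mem hx, hg i x hx]

end HasGrad

theorem MemH10.const_mul (h : MemH10 Ω v) (c : ℝ) : MemH10 Ω (fun x => c * v x) := by
  have hg := h.1.hasGrad.const_mul c
  refine memH10_iff.2 ⟨hg.memH1, fun δ hδ => ?_⟩
  obtain ⟨η, hη, e1, e2⟩ := (memH10_iff.1 h).2 (δ / (|c| + 1)) (by positivity)
  have hcδ : |c| * (δ / (|c| + 1)) ≤ δ := by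
    rw [← mul_div_assoc, div_le_iff₀ (by positivity)]
    nlinarith [abs_nonneg c]
  refine ⟨fun x => c * η x, hη.mul contDiff_const, ?_, fun i => ?_⟩
  · simp only [← mul_sub]
    rw [nrm_const_mul]
    exact (mul_le_mul_of_nonneg_left e1 (abs_nonneg c)).trans hcδ
  · have hp : ∀ x, pd i (fun x => c * η x) x = c * pd i η x := fun x => by
      rw [pd, fderiv_const_mul (hη.differentiable x)]; rfl
    rw [nrm_congr (g := fun x => c * (weakPartial Ω i v x - pd i η x)), nrm_const_mul]
    · exact (mul_le_mul_of_nonneg_left (e2 i) (abs_nonneg c)).trans hcδ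
    · filter_upwards [hg.grad i] with x hx
      rw [hx, hp, mul_sub]

/-! ### Boundary values -/

namespace HasBoundaryValue

variable {b c : ℝ × ℝ → ℝ}

theorem congr_frontier (h : HasBoundaryValue Ω v b) (hbc : EqOn b c (frontier Ω)) :
    HasBoundaryValue Ω v c := by
  obtain ⟨G, h1, h2, h3, h4⟩ := h
  exact ⟨G, h1, h2, h3.trans hbc, h4⟩

theorem congr (h : HasBoundaryValue Ω v b) (hvw : ∀ x ∈ Ω, v x = w x) :
    HasBoundaryValue Ω w b := by
  obtain ⟨G, h1, h2, h3, h4⟩ := h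
  refine ⟨G, h1, h2, h3, h4.congr ?_⟩
  filter_upwards [ae_restrict_mem (μ := volume) Ω.isOpen.measurableSet] with x hx
  rw [hvw x hx]

theorem add (h : HasBoundaryValue Ω v b) (h' : HasBoundaryValue Ω w c) :
    HasBoundaryValue Ω (fun x => v x + w x) (fun x => b x + c x) := by
  obtain ⟨G, h1, h2, h3, h4⟩ := h
  obtain ⟨G', h1', h2', h3', h4'⟩ := h'
  refine ⟨fun x => G x + G' x, h1.add h1', (h2.hasGrad.add h2'.hasGrad).memH1,
    fun x hx => by simp only [h3 hx, h3' hx], ?_⟩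
  refine (h4.add h4').congr (ae_of_all _ fun x => ?_)
  simp only; ring

theorem const_mul (h : HasBoundaryValue Ω v b) (t : ℝ) :
    HasBoundaryValue Ω (fun x => t * v x) (fun x => t * b x) := by
  obtain ⟨G, h1, h2, h3, h4⟩ := h
  refine ⟨fun x => t * G x, continuousOn_const.mul h1, (h2.hasGrad.const_mul t).memH1,
    fun x hx => by simp only [h3 hx], ?_⟩
  refine (h4.const_mul t).congr (ae_of_all _ fun x => ?_)
  simp only; ring

theorem sub (h : HasBoundaryValue Ω v b) (h' : HasBoundaryValue Ω w c) :
    HasBoundaryValue Ω (fun x => v x - w x) (fun x => b x - c x) := by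
  simpa [sub_eq_add_neg] using h.add (h'.const_mul (-1))

theorem of_continuousOn (h : MemH1 Ω v) (hc : ContinuousOn v (closure Ω)) :
    HasBoundaryValue Ω v v := by
  refine ⟨v, hc, h, fun _ _ => rfl, ?_⟩
  have := IsTest.sob (U := (Ω : Set (ℝ × ℝ))) (V := (Ω : Set (ℝ × ℝ))) (η := fun _ => 0)
    ⟨contDiff_const, HasCompactSupport.zero, by simp⟩
  refine memH10_iff.2 ⟨this.memH1 (ae_of_all _ fun x => by simp), fun δ hδ =>
    ⟨fun _ => 0, ⟨contDiff_const, HasCompactSupport.zero, by simp⟩, ?_, fun i => ?_⟩⟩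
  · simp [nrm, hδ.le]
  · have h0 := this.weakPartial_ae (v := fun x => v x - v x) (ae_of_all _ fun x => by simp) i
    rw [nrm_congr (g := fun _ => 0)]
    · simp [nrm, hδ.le]
    · filter_upwards [h0] with x hx
      rw [hx, sub_self]

theorem zero : HasBoundaryValue Ω (fun _ => 0) (fun _ => 0) :=
  of_continuousOn HasGrad.zero.memH1 continuousOn_const

theorem sum {ι : Type*} (s : Finset ι) {v b : ι → ℝ × ℝ → ℝ}
    (h : ∀ j ∈ s, HasBoundaryValue Ω (v j) (b j)) :
    HasBoundaryValue Ω (fun x => ∑ j ∈ s, v j x) (fun x => ∑ j ∈ s, b j x) := by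
  classical
  induction s using Finset.induction_on with
  | empty => simpa using zero
  | insert a s ha ih =>
    simp only [Finset.sum_insert ha]
    exact (h a (by simp)).add (ih fun j hj => h j (by simp [hj]))

/-- With zero data the continuous representative vanishes on the whole boundary, so it belongs to
H¹₀ itself, and so does its sum with v - G. -/
theorem memH10 {a₁ a₂ c₁ c₂ : ℝ} (ha : a₁ < a₂) (hc : c₁ < c₂)
    (hΩ : (Ω : Set (ℝ × ℝ)) = Ioo a₁ a₂ ×ˢ Ioo c₁ c₂) (h : HasBoundaryValue Ω v b)
    (hb : ∀ x ∈ frontier (Ω : Set (ℝ × ℝ)), b x = 0) : MemH10 Ω v := by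
  obtain ⟨G, h1, h2, h3, h4⟩ := h
  have := h2.memH10_of_frontier ha hc hΩ h1 fun x hx => by rw [h3 hx, hb x hx]
  refine (h4.add this).congr (ae_of_all _ fun x => ?_)
  simp

end HasBoundaryValue

/-! ### Integration by parts -/

theorem pd_comm {U : Set (ℝ × ℝ)} {η : ℝ × ℝ → ℝ} (hη : IsTest U η) (i j : Fin 2) (x : ℝ × ℝ) :
    pd i (pd j η) x = pd j (pd i η) x := by
  have hd : DifferentiableAt ℝ (fderiv ℝ η) x :=
    ((hη.1.fderiv_right (m := ∞) (by simp)).differentiable (by simp)) x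
  have h1 : ∀ i j, pd i (pd j η) x = fderiv ℝ (fderiv ℝ η) x (e i) (e j) := fun i j => by
    change fderiv ℝ (fun y => fderiv ℝ η y (e j)) x (e i) = _
    rw [fderiv_clm_apply hd (differentiableAt_const _)]
    simp
  have hs : IsSymmSndFDerivAt ℝ η x := hη.1.contDiffAt.isSymmSndFDerivAt (by
    rw [minSmoothness_of_isRCLikeNormedField]; exact WithTop.coe_le_coe.2 le_top)
  rw [h1, h1, hs.eq]

theorem setIntegral_test {η : ℝ × ℝ → ℝ} (hη : ∀ x, x ∉ Ω → η x = 0) (f : ℝ × ℝ → ℝ) :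
    ∫ x in Ω, f x * η x = ∫ x, f x * η x :=
  setIntegral_eq_integral_of_forall_compl_eq_zero fun x hx => by rw [hη x hx, mul_zero]

theorem HasGrad.weak (h : HasGrad Ω v g) (i : Fin 2) {η : ℝ × ℝ → ℝ} (hη : IsTest Ω η) :
    ∫ x in Ω, v x * pd i η x = -∫ x in Ω, g i x * η x := by
  have := h.sob.weak i η hη
  rwa [← setIntegral_mul_eq Ω.isOpen.measurableSet, ← setIntegral_mul_eq Ω.isOpen.measurableSet]
    at this

theorem IsTest.memLp_restrict {U : Set (ℝ × ℝ)} {η : ℝ × ℝ → ℝ} (hη : IsTest U η) :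
    MemLp η 2 (volume.restrict Ω) := (hη.memLp 2 volume).restrict _

/-- For test functions w this is the definition of the weak derivative, and density extends it to
H¹₀. The other factor needs no boundary condition, which matters because the stresses do not vanish
at the walls. -/
theorem HasGrad.integral_by_parts (h : HasGrad Ω v g) (hw : MemH10 Ω w) (i : Fin 2) :
    ∫ x in Ω, v x * weakPartial Ω i w x = -∫ x in Ω, g i x * w x := by
  have h0 : MemLp (fun _ : ℝ × ℝ => (0 : ℝ)) 2 (volume.restrict Ω) := MemLp.zero
  have key := hw.integral_eq_zero (a := g i) (b := fun j => if j = i then v else fun _ => 0)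
    (h.memLp_grad i) (fun j => by by_cases hj : j = i <;> simp [hj, h.memLp]) ?_
  · have e1 : ∀ x, ∑ j, (if j = i then v else fun _ => 0) x * weakPartial Ω j w x
        = v x * weakPartial Ω i w x := fun x => by
      rw [Finset.sum_eq_single i] <;> simp +contextual
    simp only [e1] at key
    rw [integral_add (integrable_mul_of_memLp (h.memLp_grad i) hw.1.1)
      (integrable_mul_of_memLp h.memLp (weakPartial_spec hw.1 i).1)] at key
    linarith
  · intro η hη
    have e1 : ∀ x, ∑ j, (if j = i then v else fun _ => 0) x * pd j η x
        = v x * pd i η x := fun x => by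
      rw [Finset.sum_eq_single i] <;> simp +contextual
    simp only [e1]
    rw [integral_add (integrable_mul_of_memLp (h.memLp_grad i) hη.memLp_restrict)
      (integrable_mul_of_memLp h.memLp (hη.der i).memLp_restrict), h.weak i hη]
    ring

/-- Exchange of two derivatives. -/
theorem HasGrad.integral_exchange (h : HasGrad Ω v g) (hw : MemH10 Ω w) (i j : Fin 2) :
    ∫ x in Ω, g j x * weakPartial Ω i w x = ∫ x in Ω, g i x * weakPartial Ω j w x := by
  by_cases hij : i = j
  · rw [hij]
  have h0 : MemLp (fun _ : ℝ × ℝ => (0 : ℝ)) 2 (volume.restrict Ω) := MemLp.zero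
  have es : ∀ (f : Fin 2 → ℝ) (x : ℝ × ℝ), ∑ l, (if l = i then g j else fun x => -g i x) x * f l
      = g j x * f i - g i x * f j := fun f x => by
    fin_cases i <;> fin_cases j <;> simp_all [Fin.sum_univ_two] <;> ring
  have key := hw.integral_eq_zero (a := fun _ => 0)
    (b := fun l => if l = i then g j else fun x => -g i x) h0
    (fun l => by
      by_cases hl : l = i
      · simp only [hl, if_true]; exact h.memLp_grad j
      · simp only [hl, if_false]; exact (h.memLp_grad i).neg) ?_
  · simp only [es, zero_mul, zero_add] at key
    rw [integral_sub (integrable_mul_of_memLp (h.memLp_grad j) (weakPartial_spec hw.1 i).1)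
      (integrable_mul_of_memLp (h.memLp_grad i) (weakPartial_spec hw.1 j).1)] at key
    linarith
  · intro η hη
    simp only [fun x => es (fun l => pd l η x) x, zero_mul, zero_add]
    rw [integral_sub (integrable_mul_of_memLp (h.memLp_grad j) (hη.der i).memLp_restrict)
      (integrable_mul_of_memLp (h.memLp_grad i) (hη.der j).memLp_restrict)]
    -- For test functions both sides equal -∫ v ∂ᵢ∂ⱼη, so second derivatives of v are never needed.
    have k1 := h.weak j (hη.der i)
    have k2 := h.weak i (hη.der j)
    simp only [pd_comm hη j i] at k1
    linarith

end HasGrad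

end ThinChannel

end

noncomputable section

namespace ThinChannel

open Filter Topology

/-! ### Functions of the slow axial and the fast transversal variable -/

/-- The closed reference rectangle. -/
def rect : Set (ℝ × ℝ) := Icc 0 1 ×ˢ Icc (-(1 / 2)) (1 / 2)

/-- The open reference rectangle. -/
def rectInt : Set (ℝ × ℝ) := Ioo 0 1 ×ˢ Ioo (-(1 / 2)) (1 / 2)

theorem isOpen_rectInt : IsOpen rectInt := isOpen_Ioo.prod isOpen_Ioo

theorem rectInt_subset : rectInt ⊆ rect := Set.prod_mono Ioo_subset_Icc_self Ioo_subset_Icc_self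

theorem closure_rectInt : closure rectInt = rect := by
  rw [rectInt, rect, closure_prod_eq, closure_Ioo (by norm_num), closure_Ioo (by norm_num)]

theorem isCompact_rect : IsCompact rect := isCompact_Icc.prod isCompact_Icc

theorem uniqueDiffOn_rect : UniqueDiffOn ℝ rect :=
  (uniqueDiffOn_Icc one_pos).prod (uniqueDiffOn_Icc (by norm_num))

theorem rect_mem_nhds {x : ℝ × ℝ} (hx : x ∈ rectInt) : rect ∈ 𝓝 x :=
  mem_of_superset (isOpen_rectInt.mem_nhds hx) rectInt_subset

/-- The partial derivatives, up to the boundary of the reference rectangle. -/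
def dr (i : Fin 2) (F : ℝ × ℝ → ℝ) (x : ℝ × ℝ) : ℝ := fderivWithin ℝ F rect x (e i)

theorem dr_eq_pd (i : Fin 2) (F : ℝ × ℝ → ℝ) {x : ℝ × ℝ} (hx : x ∈ rectInt) :
    dr i F x = pd i F x := by
  rw [dr, pd, fderivWithin_of_mem_nhds (rect_mem_nhds hx)]

theorem contDiffOn_dr {n m : WithTop ℕ∞} {F : ℝ × ℝ → ℝ} (hF : ContDiffOn ℝ n F rect)
    (hmn : m + 1 ≤ n) (i : Fin 2) : ContDiffOn ℝ m (dr i F) rect :=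
  (hF.fderivWithin uniqueDiffOn_rect hmn).clm_apply contDiffOn_const

theorem differentiableAt_of_rectInt {F : ℝ × ℝ → ℝ} (hF : ContDiffOn ℝ 1 F rect) {x : ℝ × ℝ}
    (hx : x ∈ rectInt) : DifferentiableAt ℝ F x :=
  (hF.differentiableOn (by simp)).differentiableAt (rect_mem_nhds hx)

theorem d₁_eq_pd {F : ℝ × ℝ → ℝ} {x : ℝ × ℝ} (h : DifferentiableAt ℝ F x) : d₁ F x = pd 0 F x := by
  have h1 : HasDerivAt (fun t : ℝ => (t, x.2)) (e 0) x.1 :=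
    (hasDerivAt_id x.1).prodMk (hasDerivAt_const x.1 x.2)
  exact (HasFDerivAt.comp_hasDerivAt (l := F) x.1 h.hasFDerivAt h1).deriv

theorem d₂_eq_pd {F : ℝ × ℝ → ℝ} {x : ℝ × ℝ} (h : DifferentiableAt ℝ F x) : d₂ F x = pd 1 F x := by
  have h1 : HasDerivAt (fun t : ℝ => (x.1, t)) (e 1) x.2 :=
    (hasDerivAt_const x.2 x.1).prodMk (hasDerivAt_id x.2)
  exact (HasFDerivAt.comp_hasDerivAt (l := F) x.2 h.hasFDerivAt h1).deriv

theorem d₁_eq_dr {F : ℝ × ℝ → ℝ} (hF : ContDiffOn ℝ 1 F rect) {x : ℝ × ℝ} (hx : x ∈ rectInt) :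
    d₁ F x = dr 0 F x := by
  rw [d₁_eq_pd (differentiableAt_of_rectInt hF hx), dr_eq_pd 0 F hx]

theorem d₂_eq_dr {F : ℝ × ℝ → ℝ} (hF : ContDiffOn ℝ 1 F rect) {x : ℝ × ℝ} (hx : x ∈ rectInt) :
    d₂ F x = dr 1 F x := by
  rw [d₂_eq_pd (differentiableAt_of_rectInt hF hx), dr_eq_pd 1 F hx]

/-- `d₁` only depends on the values in the open rectangle. -/
theorem d₁_congr {F G : ℝ × ℝ → ℝ} (h : ∀ x ∈ rectInt, F x = G x) {x : ℝ × ℝ} (hx : x ∈ rectInt) :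
    d₁ F x = d₁ G x := by
  refine Filter.EventuallyEq.deriv_eq ?_
  filter_upwards [isOpen_Ioo.mem_nhds hx.1] with t ht using h (t, x.2) ⟨ht, hx.2⟩

theorem d₂_congr {F G : ℝ × ℝ → ℝ} (h : ∀ x ∈ rectInt, F x = G x) {x : ℝ × ℝ} (hx : x ∈ rectInt) :
    d₂ F x = d₂ G x := by
  refine Filter.EventuallyEq.deriv_eq ?_
  filter_upwards [isOpen_Ioo.mem_nhds hx.2] with t ht using h (x.1, t) ⟨hx.1, ht⟩

theorem dr_add (i : Fin 2) {F G : ℝ × ℝ → ℝ} (hF : ContDiffOn ℝ 1 F rect)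
    (hG : ContDiffOn ℝ 1 G rect) {x : ℝ × ℝ} (hx : x ∈ rectInt) :
    dr i (fun y => F y + G y) x = dr i F x + dr i G x := by
  rw [dr_eq_pd i _ hx, dr_eq_pd i _ hx, dr_eq_pd i _ hx, pd, pd, pd, fderiv_fun_add
    (differentiableAt_of_rectInt hF hx) (differentiableAt_of_rectInt hG hx)]
  rfl

theorem dr_mul (i : Fin 2) {F G : ℝ × ℝ → ℝ} (hF : ContDiffOn ℝ 1 F rect)
    (hG : ContDiffOn ℝ 1 G rect) {x : ℝ × ℝ} (hx : x ∈ rectInt) :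
    dr i (fun y => F y * G y) x = F x * dr i G x + dr i F x * G x := by
  rw [dr_eq_pd i _ hx, dr_eq_pd i _ hx, dr_eq_pd i _ hx, pd_mul
    (differentiableAt_of_rectInt hF hx) (differentiableAt_of_rectInt hG hx)]

theorem dr_one_axial (a : ℝ → ℝ) {x : ℝ × ℝ} (hx : x ∈ rectInt)
    (ha : ContDiffOn ℝ 1 (fun y : ℝ × ℝ => a y.1) rect) : dr 1 (fun y => a y.1) x = 0 := by
  rw [← d₂_eq_dr ha hx, d₂]
  simp

theorem contDiffOn_axial {n : WithTop ℕ∞} {a : ℝ → ℝ} (ha : ContDiffOn ℝ n a (Icc 0 1)) :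
    ContDiffOn ℝ n (fun y : ℝ × ℝ => a y.1) rect :=
  ha.comp contDiffOn_fst fun _ hx => hx.1

/-- A function on the reference rectangle, transported to the channel. -/
def stretch (ε : ℝ) (F : ℝ × ℝ → ℝ) (x : ℝ × ℝ) : ℝ := F (x.1, x.2 / ε)

section stretch

variable {ε : ℝ} {F : ℝ × ℝ → ℝ}

theorem mapsTo_channel (hε : 0 < ε) : MapsTo (fun x : ℝ × ℝ => (x.1, x.2 / ε)) (channel ε) rectInt := by
  rintro x ⟨h1, h2, h3⟩
  refine ⟨h1, ?_, ?_⟩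
  · change -(1 / 2) < x.2 / ε
    rw [lt_div_iff₀ hε]; linarith
  · change x.2 / ε < 1 / 2
    rw [div_lt_iff₀ hε]; linarith

theorem continuous_stretch_map (ε : ℝ) : Continuous fun x : ℝ × ℝ => (x.1, x.2 / ε) := by fun_prop

theorem mapsTo_closure_channel (hε : 0 < ε) :
    MapsTo (fun x : ℝ × ℝ => (x.1, x.2 / ε)) (closure (channel ε)) rect := by
  rw [← closure_rectInt]
  exact (mapsTo_channel hε).closure (continuous_stretch_map ε)

theorem continuousOn_stretch (hε : 0 < ε) (hF : ContinuousOn F rect) :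
    ContinuousOn (stretch ε F) (closure (channel ε)) :=
  hF.comp (continuous_stretch_map ε).continuousOn (mapsTo_closure_channel hε)

theorem volume_channel (ε : ℝ) : volume (channel ε : Set (ℝ × ℝ)) = ENNReal.ofReal ε := by
  change volume (Ioo (0 : ℝ) 1 ×ˢ Ioo (-(ε / 2)) (ε / 2)) = _
  rw [Measure.volume_eq_prod, Measure.prod_prod, Real.volume_Ioo, Real.volume_Ioo]
  simp

theorem memLp_of_bound {f : ℝ × ℝ → ℝ} {C : ℝ}
    (hm : AEStronglyMeasurable f (volume.restrict (channel ε)))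
    (hC : ∀ x ∈ channel ε, |f x| ≤ C) : MemLp f 2 (volume.restrict (channel ε)) := by
  have : IsFiniteMeasure (volume.restrict (channel ε : Set (ℝ × ℝ))) :=
    ⟨by rw [Measure.restrict_apply_univ, volume_channel ε]; exact ENNReal.ofReal_lt_top⟩
  exact MemLp.of_bound hm C (by
    filter_upwards [ae_restrict_mem (channel ε).isOpen.measurableSet] with x hx using hC x hx)

theorem nrm_le_of_bound (hε : 0 < ε) {f : ℝ × ℝ → ℝ} {C : ℝ} (hC0 : 0 ≤ C)
    (hC : ∀ x ∈ channel ε, |f x| ≤ C) :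
    nrm (volume.restrict (channel ε)) f ≤ C * Real.sqrt ε := by
  have h1 := eLpNorm_le_of_ae_bound (p := 2) (μ := volume.restrict (channel ε : Set (ℝ × ℝ)))
    (f := f) (C := C) (by
      filter_upwards [ae_restrict_mem (channel ε).isOpen.measurableSet] with x hx using hC x hx)
  rw [Measure.restrict_apply_univ, volume_channel ε,
    ENNReal.ofReal_rpow_of_pos hε, ← ENNReal.ofReal_mul (by positivity)] at h1
  refine (ENNReal.toReal_mono ENNReal.ofReal_ne_top h1).trans ?_
  rw [ENNReal.toReal_ofReal (by positivity), mul_comm, Real.sqrt_eq_rpow]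
  norm_num

theorem exists_bound_rect (hF : ContinuousOn F rect) : ∃ C, 0 ≤ C ∧ ∀ x ∈ rect, |F x| ≤ C := by
  obtain ⟨C, hC⟩ := isCompact_rect.exists_bound_of_continuousOn hF
  exact ⟨max C 0, le_max_right _ _, fun x hx => (hC x hx).trans (le_max_left _ _)⟩

theorem aestronglyMeasurable_stretch (hε : 0 < ε) (hF : ContinuousOn F rect) :
    AEStronglyMeasurable (stretch ε F) (volume.restrict (channel ε)) :=
  ((continuousOn_stretch hε hF).mono subset_closure).aestronglyMeasurable
    (channel ε).isOpen.measurableSet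

theorem memLp_stretch (hε : 0 < ε) (hF : ContinuousOn F rect) :
    MemLp (stretch ε F) 2 (volume.restrict (channel ε)) := by
  obtain ⟨C, -, hC⟩ := exists_bound_rect hF
  exact memLp_of_bound (aestronglyMeasurable_stretch hε hF)
    fun x hx => hC _ (rectInt_subset (mapsTo_channel hε hx))

theorem nrm_stretch_le (hε : 0 < ε) {C : ℝ} (hC0 : 0 ≤ C) (hC : ∀ x ∈ rect, |F x| ≤ C) :
    nrm (volume.restrict (channel ε)) (stretch ε F) ≤ C * Real.sqrt ε :=
  nrm_le_of_bound hε hC0 fun _ hx => hC _ (rectInt_subset (mapsTo_channel hε hx))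

/-- The weight of a derivative under `stretch`. -/
def wt (ε : ℝ) (i : Fin 2) : ℝ := if i = 0 then 1 else ε⁻¹

theorem hasFDerivAt_stretch (hε : 0 < ε) (hF : ContDiffOn ℝ 1 F rect) {x : ℝ × ℝ}
    (hx : x ∈ channel ε) :
    DifferentiableAt ℝ (stretch ε F) x ∧
      ∀ i, pd i (stretch ε F) x = wt ε i * stretch ε (dr i F) x := by
  have hr := mapsTo_channel hε hx
  have hd := (differentiableAt_of_rectInt hF hr).hasFDerivAt
  have h1 : HasFDerivAt (fun x : ℝ × ℝ => (x.1, x.2 / ε))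
      ((ContinuousLinearMap.fst ℝ ℝ ℝ).prod (ε⁻¹ • ContinuousLinearMap.snd ℝ ℝ ℝ)) x := by
    refine hasFDerivAt_fst.prodMk ?_
    have := (hasFDerivAt_snd (𝕜 := ℝ) (p := x)).const_mul ε⁻¹
    refine this.congr_of_eventuallyEq (Eventually.of_forall fun y => ?_)
    simp only [div_eq_inv_mul]
  have h2 := hd.comp x h1
  refine ⟨h2.differentiableAt, fun i => ?_⟩
  rw [pd, show stretch ε F = F ∘ fun x : ℝ × ℝ => (x.1, x.2 / ε) from rfl, h2.fderiv, stretch,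
    dr_eq_pd i F hr, pd]
  have he : ((ContinuousLinearMap.fst ℝ ℝ ℝ).prod (ε⁻¹ • ContinuousLinearMap.snd ℝ ℝ ℝ)) (e i)
      = wt ε i • e i := by
    fin_cases i <;> simp [e, wt]
  rw [ContinuousLinearMap.comp_apply, he, map_smul, smul_eq_mul]

/-- Derivatives of a C¹ function are bounded on the compact rectangle, so the classical gradient is
square integrable on the channel and is the weak one. Each derivative in x₂ costs a factor ε⁻¹. -/
theorem hasGrad_stretch (hε : 0 < ε) (hF : ContDiffOn ℝ 1 F rect) :
    HasGrad (channel ε) (stretch ε F) (fun i x => wt ε i * stretch ε (dr i F) x) := by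
  have hm := (channel ε).isOpen.measurableSet
  have hD := fun i => (contDiffOn_dr (m := 0) hF (by simp) i).continuousOn
  have m0 := memLp_stretch hε hF.continuousOn
  have m1 := fun i => (memLp_stretch hε (hD i)).const_mul (wt ε i)
  refine HasGrad.of_sob ⟨memLp_indicator hm m0, fun i => memLp_indicator hm (m1 i),
    fun i η hη => ?_⟩
  rw [← setIntegral_mul_eq hm, ← setIntegral_mul_eq hm,
    setIntegral_test (fun x hx => (hη.der i).eq_zero hx), setIntegral_test (fun x hx => hη.eq_zero hx)]
  have hintg : ∀ {f ζ : ℝ × ℝ → ℝ}, MemLp f 2 (volume.restrict (channel ε)) → IsTest (channel ε) ζ →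
      Integrable fun x => f x * ζ x := by
    intro f ζ hf hζ
    have := integrable_mul_of_memLp hf ((hζ.memLp 2 volume).restrict (channel ε : Set (ℝ × ℝ)))
    have h2 := (integrable_indicator_iff hm).2 this
    refine h2.congr (ae_of_all _ fun x => ?_)
    by_cases hx : x ∈ (channel ε : Set (ℝ × ℝ))
    · rw [indicator_of_mem hx]
    · simp only [indicator_of_notMem hx, hζ.eq_zero hx, mul_zero]
  have e1 : ∀ x, wt ε i * stretch ε (dr i F) x * η x = fderiv ℝ (stretch ε F) x (e i) * η x := by
    intro x
    by_cases hx : x ∈ channel ε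
    · rw [← (hasFDerivAt_stretch hε hF hx).2 i, pd]
    · rw [hη.eq_zero hx, mul_zero, mul_zero]
  have hi1 : Integrable fun x => fderiv ℝ (stretch ε F) x (e i) * η x := by
    simp only [← e1]; exact hintg (m1 i) hη
  simp only [e1]
  exact integral_mul_fderiv_eq_neg_fderiv_mul_of_integrable hi1 (hintg m0 (hη.der i)) (hintg m0 hη)
    (fun x hx => (hasFDerivAt_stretch hε hF (hη.3 hx)).1) (fun x _ => hη.differentiable x)

end stretch

end ThinChannel

end

noncomputable section

namespace ThinChannel

open Filter Topology

/-! ### The residual of the regular ansatz -/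

/-- The shifted sequence `X_{j-s}`. -/
def lagv (X : ℕ → ℝ) (s j : ℕ) : ℝ := if s ≤ j then X (j - s) else 0

/-- Both sums contain the same terms as long as the total power of ε is at most k. What is left of
the first one has powers at least k+1. This truncation is the only source of the residual of the
regular ansatz. -/
theorem abs_sum_lag_le {ε : ℝ} (hε : 0 ≤ ε) (hε1 : ε ≤ 1) (X : ℕ → ℝ) (s k : ℕ) :
    |∑ j ∈ Finset.range (k + 1), (ε ^ (j + s) * X j - ε ^ j * lagv X s j)|
      ≤ ε ^ (k + 1) * ∑ j ∈ Finset.range (k + 1), |X j| := by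
  have h1 : ∑ j ∈ Finset.range (k + 1), ε ^ j * lagv X s j
      = ∑ m ∈ Finset.range (k + 1), if m + s ≤ k then ε ^ (m + s) * X m else 0 := by
    simp only [lagv, mul_ite, mul_zero]
    rw [← Finset.sum_filter, ← Finset.sum_filter]
    refine Finset.sum_nbij' (fun j => j - s) (fun m => m + s) ?_ ?_ ?_ ?_ ?_
    · intro j hj
      simp only [Finset.mem_filter, Finset.mem_range] at hj ⊢
      omega
    · intro j hj
      simp only [Finset.mem_filter, Finset.mem_range] at hj ⊢
      omega
    · intro j hj
      simp only [Finset.mem_filter, Finset.mem_range] at hj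
      omega
    · intro j hj
      simp
    · intro j hj
      simp only [Finset.mem_filter, Finset.mem_range] at hj
      rw [Nat.sub_add_cancel hj.2]
  rw [Finset.sum_sub_distrib, h1, ← Finset.sum_sub_distrib, Finset.mul_sum]
  refine (Finset.abs_sum_le_sum_abs _ _).trans (Finset.sum_le_sum fun m _ => ?_)
  split_ifs with h
  · rw [sub_self, abs_zero]; positivity
  · rw [sub_zero, abs_mul, abs_of_nonneg (by positivity)]
    exact mul_le_mul_of_nonneg_right (pow_le_pow_of_le_one hε hε1 (by omega)) (abs_nonneg _)

theorem exists_bound_sum {k : ℕ} {X : ℕ → ℝ × ℝ → ℝ} (hX : ∀ j ≤ k, ContinuousOn (X j) rect) :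
    ∃ C, 0 ≤ C ∧ ∀ y ∈ rect, ∑ j ∈ Finset.range (k + 1), |X j y| ≤ C := by
  obtain ⟨C, hC0, hC⟩ := exists_bound_rect (F := fun y => ∑ j ∈ Finset.range (k + 1), |X j y|)
    (continuousOn_finsetSum _ fun j hj => (hX j (by simpa [Nat.lt_succ_iff] using hj)).abs)
  exact ⟨C, hC0, fun y hy => (le_abs_self _).trans (hC y hy)⟩

section Coefficients

variable (ν : ℝ → ℝ) (R : RegularCoeffs)

/-- Coefficients of the axial normal stress. -/
def c₁₁ (j : ℕ) (y : ℝ × ℝ) : ℝ := ν y.1 * dr 0 (R.u₁ j) y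

/-- Coefficients of the shear stress due to the axial velocity. -/
def c₁₂ (j : ℕ) (y : ℝ × ℝ) : ℝ := ν y.1 / 2 * dr 1 (R.u₁ j) y

/-- Coefficients of the shear stress due to the transversal velocity. -/
def c₂₁ (j : ℕ) (y : ℝ × ℝ) : ℝ := ν y.1 / 2 * dr 0 (R.u₂ j) y

/-- Coefficients of the transversal normal stress. -/
def c₂₂ (j : ℕ) (y : ℝ × ℝ) : ℝ := ν y.1 * dr 1 (R.u₂ j) y

end Coefficients

section Residual

variable {ν f₁ φ₀ : ℝ → ℝ} {k : ℕ} {R : RegularCoeffs}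

theorem contDiffOn_half (hν : ContDiffOn ℝ 1 ν (Icc 0 1)) :
    ContDiffOn ℝ 1 (fun y : ℝ × ℝ => ν y.1 / 2) rect :=
  contDiffOn_axial (a := fun t => ν t / 2) (hν.div_const 2)

theorem contDiffOn_c₁₁ (hν : ContDiffOn ℝ 1 ν (Icc 0 1)) (hR : IsRegularAnsatz ν f₁ φ₀ k R) {j : ℕ}
    (hj : j ≤ k) : ContDiffOn ℝ 1 (c₁₁ ν R j) rect :=
  (contDiffOn_axial hν).mul (contDiffOn_dr (hR.contDiff_u₁ j hj) (by norm_num) 0)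

theorem contDiffOn_c₁₂ (hν : ContDiffOn ℝ 1 ν (Icc 0 1)) (hR : IsRegularAnsatz ν f₁ φ₀ k R) {j : ℕ}
    (hj : j ≤ k) : ContDiffOn ℝ 1 (c₁₂ ν R j) rect :=
  (contDiffOn_half hν).mul (contDiffOn_dr (hR.contDiff_u₁ j hj) (by norm_num) 1)

theorem contDiffOn_c₂₁ (hν : ContDiffOn ℝ 1 ν (Icc 0 1)) (hR : IsRegularAnsatz ν f₁ φ₀ k R) {j : ℕ}
    (hj : j ≤ k) : ContDiffOn ℝ 1 (c₂₁ ν R j) rect :=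
  (contDiffOn_half hν).mul (contDiffOn_dr (hR.contDiff_u₂ j hj) (by norm_num) 0)

theorem contDiffOn_c₂₂ (hν : ContDiffOn ℝ 1 ν (Icc 0 1)) (hR : IsRegularAnsatz ν f₁ φ₀ k R) {j : ℕ}
    (hj : j ≤ k) : ContDiffOn ℝ 1 (c₂₂ ν R j) rect :=
  (contDiffOn_axial hν).mul (contDiffOn_dr (hR.contDiff_u₂ j hj) (by norm_num) 1)

theorem dr_one_axial_mul {a : ℝ → ℝ} (ha : ContDiffOn ℝ 1 (fun y : ℝ × ℝ => a y.1) rect)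
    {F : ℝ × ℝ → ℝ} (hF : ContDiffOn ℝ 1 F rect) {x : ℝ × ℝ} (hx : x ∈ rectInt) :
    dr 1 (fun y => a y.1 * F y) x = a x.1 * dr 1 F x := by
  rw [dr_mul 1 ha hF hx, dr_one_axial a hx ha, zero_mul, add_zero]

theorem of_two {F : ℝ × ℝ → ℝ} (hF : ContDiffOn ℝ 2 F rect) : ContDiffOn ℝ 1 F rect :=
  hF.of_le (by norm_num)

theorem d₂_d₂ {F : ℝ × ℝ → ℝ} (hF : ContDiffOn ℝ 2 F rect) {x : ℝ × ℝ} (hx : x ∈ rectInt) :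
    d₂ (d₂ F) x = dr 1 (dr 1 F) x := by
  rw [d₂_congr (fun y hy => d₂_eq_dr (of_two hF) hy) hx,
    d₂_eq_dr (contDiffOn_dr hF (by norm_num) 1) hx]

theorem d₂_d₁ {F : ℝ × ℝ → ℝ} (hF : ContDiffOn ℝ 2 F rect) {x : ℝ × ℝ} (hx : x ∈ rectInt) :
    d₂ (d₁ F) x = dr 1 (dr 0 F) x := by
  rw [d₂_congr (fun y hy => d₁_eq_dr (of_two hF) hy) hx,
    d₂_eq_dr (contDiffOn_dr hF (by norm_num) 0) hx]

theorem d₁_zero (x : ℝ × ℝ) : d₁ 0 x = 0 := by simp [d₁]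

theorem d₂_zero (x : ℝ × ℝ) : d₂ 0 x = 0 := by simp [d₂]

/-- The equation in divergence form. Since ν depends on x₁ only, it can be moved under ∂₂, so that
every viscous term becomes a derivative of a C¹ stress coefficient, as integration by parts
requires. -/
theorem IsRegularAnsatz.axial (hν : ContDiffOn ℝ 1 ν (Icc 0 1)) (hR : IsRegularAnsatz ν f₁ φ₀ k R)
    {j : ℕ} (hj : j ≤ k) {x : ℝ × ℝ} (hx : x ∈ rectInt) :
    -lagv (fun m => dr 0 (c₁₁ ν R m) x) 2 j - dr 1 (c₁₂ ν R j) x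
      - lagv (fun m => dr 1 (c₂₁ ν R m) x) 2 j + lagv (fun m => dr 0 (R.p m) x) 1 j
      + deriv (R.q j) x.1 = if j = 0 then f₁ x.1 else 0 := by
  rw [← hR.momentum₁ j hj x hx]
  have t1 : d₁ (fun y => ν y.1 * d₁ (lag R.u₁ 2 j) y) x = lagv (fun m => dr 0 (c₁₁ ν R m) x) 2 j := by
    by_cases h : 2 ≤ j
    · simp only [lag, lagv, h, if_true]
      have hm : j - 2 ≤ k := by omega
      rw [← d₁_eq_dr (contDiffOn_c₁₁ hν hR hm) hx]
      exact d₁_congr (fun y hy => by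
        rw [d₁_eq_dr (of_two (hR.contDiff_u₁ _ hm)) hy, c₁₁]) hx
    · simp only [lag, lagv, h, if_false, d₁_zero, mul_zero]
      exact d₁_zero x
  have t2 : ν x.1 / 2 * d₂ (d₂ (R.u₁ j)) x = dr 1 (c₁₂ ν R j) x := by
    rw [d₂_d₂ (hR.contDiff_u₁ j hj) hx]
    exact (dr_one_axial_mul (a := fun t => ν t / 2) (contDiffOn_half hν)
      (contDiffOn_dr (hR.contDiff_u₁ j hj) (by norm_num) 1) hx).symm
  have t3 : ν x.1 / 2 * d₂ (d₁ (lag R.u₂ 2 j)) x = lagv (fun m => dr 1 (c₂₁ ν R m) x) 2 j := by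
    by_cases h : 2 ≤ j
    · simp only [lag, lagv, h, if_true]
      have hm : j - 2 ≤ k := by omega
      rw [d₂_d₁ (hR.contDiff_u₂ _ hm) hx]
      exact (dr_one_axial_mul (a := fun t => ν t / 2) (contDiffOn_half hν)
        (contDiffOn_dr (hR.contDiff_u₂ _ hm) (by norm_num) 0) hx).symm
    · simp only [lag, lagv, h, if_false]
      rw [show d₁ (0 : ℝ × ℝ → ℝ) = 0 from funext d₁_zero, d₂_zero, mul_zero]
  have t4 : d₁ (lag R.p 1 j) x = lagv (fun m => dr 0 (R.p m) x) 1 j := by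
    by_cases h : 1 ≤ j
    · simp only [lag, lagv, h, if_true]
      exact d₁_eq_dr (hR.contDiff_p _ (by omega)) hx
    · simp only [lag, lagv, h, if_false]
      exact d₁_zero x
  rw [t1, t2, t3, t4]

/-- As for the axial equation. The factor 1/2 in front of ∂₁ is absorbed by writing ν(∂₂u₁ + ∂₁u₂)
as twice the sum of the two shear coefficients. -/
theorem IsRegularAnsatz.transversal (hν : ContDiffOn ℝ 1 ν (Icc 0 1))
    (hR : IsRegularAnsatz ν f₁ φ₀ k R) {j : ℕ} (hj : j ≤ k) {x : ℝ × ℝ} (hx : x ∈ rectInt) :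
    lagv (fun m => dr 0 (c₁₂ ν R m) x) 1 j + lagv (fun m => dr 0 (c₂₁ ν R m) x) 3 j
      + lagv (fun m => dr 1 (c₂₂ ν R m) x) 1 j - dr 1 (R.p j) x = 0 := by
  rw [← hR.momentum₂ j hj x hx]
  have t1 : 1 / 2 * d₁ (fun y => ν y.1 * (d₂ (lag R.u₁ 1 j) y + d₁ (lag R.u₂ 3 j) y)) x
      = lagv (fun m => dr 0 (c₁₂ ν R m) x) 1 j + lagv (fun m => dr 0 (c₂₁ ν R m) x) 3 j := by
    set A : ℝ × ℝ → ℝ := if 1 ≤ j then c₁₂ ν R (j - 1) else fun _ => 0 with hA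
    set B : ℝ × ℝ → ℝ := if 3 ≤ j then c₂₁ ν R (j - 3) else fun _ => 0 with hB
    have hAc : ContDiffOn ℝ 1 A rect := by
      rw [hA]; split_ifs
      · exact contDiffOn_c₁₂ hν hR (by omega)
      · exact contDiffOn_const
    have hBc : ContDiffOn ℝ 1 B rect := by
      rw [hB]; split_ifs
      · exact contDiffOn_c₂₁ hν hR (by omega)
      · exact contDiffOn_const
    have dz : dr 0 (fun _ => (0 : ℝ)) x = 0 := by
      rw [dr_eq_pd 0 _ hx, pd]; simp
    have hA' : dr 0 A x = lagv (fun m => dr 0 (c₁₂ ν R m) x) 1 j := by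
      rw [hA, lagv]; split_ifs
      · rfl
      · exact dz
    have hB' : dr 0 B x = lagv (fun m => dr 0 (c₂₁ ν R m) x) 3 j := by
      rw [hB, lagv]; split_ifs
      · rfl
      · exact dz
    have hAB : ContDiffOn ℝ 1 (fun y => A y + B y) rect := hAc.add hBc
    have hcong : ∀ y ∈ rectInt, ν y.1 * (d₂ (lag R.u₁ 1 j) y + d₁ (lag R.u₂ 3 j) y)
        = (A y + B y) + (A y + B y) := by
      intro y hy
      have a1 : ν y.1 / 2 * d₂ (lag R.u₁ 1 j) y = A y := by
        by_cases h : 1 ≤ j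
        · simp only [lag, hA, h, if_true]
          rw [d₂_eq_dr (of_two (hR.contDiff_u₁ _ (by omega))) hy, c₁₂]
        · simp only [lag, hA, h, if_false, d₂_zero, mul_zero]
      have a2 : ν y.1 / 2 * d₁ (lag R.u₂ 3 j) y = B y := by
        by_cases h : 3 ≤ j
        · simp only [lag, hB, h, if_true]
          rw [d₁_eq_dr (of_two (hR.contDiff_u₂ _ (by omega))) hy, c₂₁]
        · simp only [lag, hB, h, if_false, d₁_zero, mul_zero]
      rw [← a1, ← a2]; ring
    rw [d₁_congr hcong hx, d₁_eq_dr (hAB.add hAB) hx, dr_add 0 hAB hAB hx, dr_add 0 hAc hBc hx, hA',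
      hB']
    ring
  have t2 : ν x.1 * d₂ (d₂ (lag R.u₂ 1 j)) x = lagv (fun m => dr 1 (c₂₂ ν R m) x) 1 j := by
    by_cases h : 1 ≤ j
    · simp only [lag, lagv, h, if_true]
      have hm : j - 1 ≤ k := by omega
      rw [d₂_d₂ (hR.contDiff_u₂ _ hm) hx]
      exact (dr_one_axial_mul (a := ν) (contDiffOn_axial hν)
        (contDiffOn_dr (hR.contDiff_u₂ _ hm) (by norm_num) 1) hx).symm
    · simp only [lag, lagv, h, if_false]
      rw [show d₂ (0 : ℝ × ℝ → ℝ) = 0 from funext d₂_zero, d₂_zero, mul_zero]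
  rw [t1, t2, d₂_eq_dr (hR.contDiff_p j hj) hx]

/-- The gradient of the regular part of the velocity. -/
def regGrad (ε : ℝ) (k : ℕ) (R : RegularCoeffs) : Fin 2 → Fin 2 → ℝ × ℝ → ℝ :=
  ![fun i x => ∑ j ∈ Finset.range (k + 1), ε ^ (j + 2) * (wt ε i * stretch ε (dr i (R.u₁ j)) x),
    fun i x => ∑ j ∈ Finset.range (k + 1), ε ^ (j + 3) * (wt ε i * stretch ε (dr i (R.u₂ j)) x)]

theorem mem_le {j : ℕ} (hj : j ∈ Finset.range (k + 1)) : j ≤ k := by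
  simpa [Nat.lt_succ_iff] using hj

theorem IsRegularAnsatz.hasGrad {ε : ℝ} (hε : 0 < ε) (hR : IsRegularAnsatz ν f₁ φ₀ k R) (i : Fin 2) :
    HasGrad (channel ε) (regularVelocity ε k R i) (regGrad ε k R i) := by
  fin_cases i
  · exact HasGrad.sum _ fun j hj =>
      (hasGrad_stretch hε (of_two (hR.contDiff_u₁ j (mem_le hj)))).const_mul (ε ^ (j + 2))
  · exact HasGrad.sum _ fun j hj =>
      (hasGrad_stretch hε (of_two (hR.contDiff_u₂ j (mem_le hj)))).const_mul (ε ^ (j + 3))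

/-- The regular part of the velocity leaves a small residual in the momentum equation. -/
theorem IsRegularAnsatz.exists_residual (hν : ContDiffOn ℝ 1 ν (Icc 0 1))
    (hf : ContinuousOn f₁ (Icc 0 1)) (hR : IsRegularAnsatz ν f₁ φ₀ k R) :
    ∃ C, 0 ≤ C ∧ ∀ ε, 0 < ε → ε ≤ 1 → ∃ r : Fin 2 → ℝ × ℝ → ℝ,
      (∀ i, MemLp (r i) 2 (volume.restrict (channel ε))) ∧
      (∀ i, nrm (volume.restrict (channel ε)) (r i) ≤ C * ε ^ (k + 1) * Real.sqrt ε) ∧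
      ∀ ψ : Fin 2 → ℝ × ℝ → ℝ, (∀ i, MemH10 (channel ε) (ψ i)) →
        (∫ x in channel ε, ν x.1 * ∑ i, ∑ j, (regGrad ε k R i j x + regGrad ε k R j i x) / 2
            * weakPartial (channel ε) j (ψ i) x)
          - ∑ i, ∫ x in channel ε, regularPressure ε k R x * weakPartial (channel ε) i (ψ i) x
        = (∫ x in channel ε, f₁ x.1 * ψ 0 x) + ∑ i, ∫ x in channel ε, r i x * ψ i x := by
  have cont : ∀ {X : ℕ → ℝ × ℝ → ℝ} (i : Fin 2), (∀ j ≤ k, ContDiffOn ℝ 1 (X j) rect) →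
      ∀ j ≤ k, ContinuousOn (dr i (X j)) rect := fun i hX j hj =>
    (contDiffOn_dr (m := 0) (hX j hj) (by simp) i).continuousOn
  have h11 := fun j (hj : j ≤ k) => contDiffOn_c₁₁ hν hR hj
  have h12 := fun j (hj : j ≤ k) => contDiffOn_c₁₂ hν hR hj
  have h21 := fun j (hj : j ≤ k) => contDiffOn_c₂₁ hν hR hj
  have h22 := fun j (hj : j ≤ k) => contDiffOn_c₂₂ hν hR hj
  obtain ⟨C1, hC1, b1⟩ := exists_bound_sum (cont 0 h11)
  obtain ⟨C2, hC2, b2⟩ := exists_bound_sum (cont 1 h21)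
  obtain ⟨C3, hC3, b3⟩ := exists_bound_sum (cont 0 hR.contDiff_p)
  obtain ⟨C4, hC4, b4⟩ := exists_bound_sum (cont 0 h12)
  obtain ⟨C5, hC5, b5⟩ := exists_bound_sum (cont 0 h21)
  obtain ⟨C6, hC6, b6⟩ := exists_bound_sum (cont 1 h22)
  refine ⟨C1 + C2 + C3 + C4 + C5 + C6, by positivity, fun ε hε hε1 => ?_⟩
  have hεε : ε * ε⁻¹ = 1 := mul_inv_cancel₀ hε.ne'
  set s := Finset.range (k + 1) with hs
  set Ω := channel ε with hΩ
  -- the stresses and their gradients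
  have gs : ∀ (n : ℕ) {X : ℕ → ℝ × ℝ → ℝ}, (∀ j ≤ k, ContDiffOn ℝ 1 (X j) rect) →
      HasGrad Ω (fun x => ∑ j ∈ s, ε ^ (j + n) * stretch ε (X j) x)
        (fun i x => ∑ j ∈ s, ε ^ (j + n) * (wt ε i * stretch ε (dr i (X j)) x)) :=
    fun n X hX => HasGrad.sum _ fun j hj => (hasGrad_stretch hε (hX j (mem_le hj))).const_mul _
  have g00 := gs 2 h11
  have g01 := (gs 1 h12).add (gs 3 h21)
  have g11 := gs 2 h22
  have hq : ∀ j ≤ k, ContDiffOn ℝ 1 (fun y : ℝ × ℝ => R.q j y.1) rect := fun j hj =>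
    contDiffOn_axial (hR.contDiff_q j hj)
  have gp := (gs 1 hR.contDiff_p).add (gs 0 hq)
  have hfm : MemLp (fun x : ℝ × ℝ => f₁ x.1) 2 (volume.restrict Ω) :=
    memLp_stretch (F := fun y => f₁ y.1) hε (hf.comp continuousOn_fst fun _ hx => hx.1)
  have hP : ∀ x, regularPressure ε k R x = (∑ j ∈ s, ε ^ (j + 1) * stretch ε (R.p j) x)
      + ∑ j ∈ s, ε ^ (j + 0) * stretch ε (fun y => R.q j y.1) x := fun x => rfl
  set P := fun x => (∑ j ∈ s, ε ^ (j + 1) * stretch ε (R.p j) x)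
      + ∑ j ∈ s, ε ^ (j + 0) * stretch ε (fun y => R.q j y.1) x with hPdef
  set A00 := fun x => ∑ j ∈ s, ε ^ (j + 2) * stretch ε (c₁₁ ν R j) x with hA00
  set A01 := fun x => (∑ j ∈ s, ε ^ (j + 1) * stretch ε (c₁₂ ν R j) x)
      + ∑ j ∈ s, ε ^ (j + 3) * stretch ε (c₂₁ ν R j) x with hA01
  set A11 := fun x => ∑ j ∈ s, ε ^ (j + 2) * stretch ε (c₂₂ ν R j) x with hA11
  set G00 : Fin 2 → ℝ × ℝ → ℝ := fun i x => ∑ j ∈ s, ε ^ (j + 2) *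
    (wt ε i * stretch ε (dr i (c₁₁ ν R j)) x) with hG00
  set G01 : Fin 2 → ℝ × ℝ → ℝ := fun i x => (∑ j ∈ s, ε ^ (j + 1) *
    (wt ε i * stretch ε (dr i (c₁₂ ν R j)) x)) + ∑ j ∈ s, ε ^ (j + 3) *
    (wt ε i * stretch ε (dr i (c₂₁ ν R j)) x) with hG01
  set G11 : Fin 2 → ℝ × ℝ → ℝ := fun i x => ∑ j ∈ s, ε ^ (j + 2) *
    (wt ε i * stretch ε (dr i (c₂₂ ν R j)) x) with hG11
  set Gp : Fin 2 → ℝ × ℝ → ℝ := fun i x => (∑ j ∈ s, ε ^ (j + 1) *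
    (wt ε i * stretch ε (dr i (R.p j)) x)) + ∑ j ∈ s, ε ^ (j + 0) *
    (wt ε i * stretch ε (dr i (fun y => R.q j y.1)) x) with hGp
  -- The residual is the pressure gradient minus the divergence of the symmetric stress with entries
  -- `A00`, `A01`, `A11`, minus the force.
  let r : Fin 2 → ℝ × ℝ → ℝ := ![fun x => Gp 0 x - G00 0 x - G01 1 x - f₁ x.1,
    fun x => Gp 1 x - G01 0 x - G11 1 x]
  have hr : ∀ i, MemLp (r i) 2 (volume.restrict Ω) := by
    intro i
    fin_cases i
    · exact (((gp.memLp_grad 0).sub (g00.memLp_grad 0)).sub (g01.memLp_grad 1)).sub hfm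
    · exact ((gp.memLp_grad 1).sub (g01.memLp_grad 0)).sub (g11.memLp_grad 1)
  have w0 : wt ε 0 = 1 := rfl
  have w1 : wt ε 1 = ε⁻¹ := rfl
  have pw : ∀ (n : ℕ) (y : ℝ), ε ^ (n + 1) * (ε⁻¹ * y) = ε ^ n * y := fun n y => by
    rw [pow_succ]; linear_combination (ε ^ n * y) * hεε
  have hbound : ∀ i, ∀ x ∈ Ω, |r i x| ≤ (C1 + C2 + C3 + C4 + C5 + C6) * ε ^ (k + 1) := by
    intro i x hx
    have hy := mapsTo_channel hε hx
    have hyr := rectInt_subset hy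
    set y : ℝ × ℝ := (x.1, x.2 / ε) with hydef
    have hst : ∀ F, stretch ε F x = F y := fun F => rfl
    have hpow : 0 < ε ^ (k + 1) := by positivity
    have L := fun (X : ℕ → ℝ) (n : ℕ) => abs_sum_lag_le hε.le hε1 X n k
    have L' : ∀ (X : ℕ → ℝ) (n : ℕ) (D : ℝ), ∑ j ∈ s, |X j| ≤ D →
        |∑ j ∈ s, (ε ^ (j + n) * X j - ε ^ j * lagv X n j)| ≤ D * ε ^ (k + 1) := fun X n D hD =>
      (L X n).trans (by rw [mul_comm]; exact mul_le_mul_of_nonneg_right hD hpow.le)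
    fin_cases i
    · have hsum : f₁ x.1 = ∑ j ∈ s, ε ^ j * (-lagv (fun m => dr 0 (c₁₁ ν R m) y) 2 j
          - dr 1 (c₁₂ ν R j) y - lagv (fun m => dr 1 (c₂₁ ν R m) y) 2 j
          + lagv (fun m => dr 0 (R.p m) y) 1 j + deriv (R.q j) y.1) := by
        rw [Finset.sum_congr rfl fun j hj => by rw [hR.axial hν (mem_le hj) hy]]
        simp [hs]
      -- The terms that enter the j-th equation without a shift, the derivative of `c₁₂` and that of
      -- `R.q`, cancel exactly. Only the shifted families leave truncation errors.
      have e1 : r 0 x = (∑ j ∈ s, (ε ^ (j + 1) * dr 0 (R.p j) y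
            - ε ^ j * lagv (fun m => dr 0 (R.p m) y) 1 j))
          - (∑ j ∈ s, (ε ^ (j + 2) * dr 0 (c₁₁ ν R j) y
            - ε ^ j * lagv (fun m => dr 0 (c₁₁ ν R m) y) 2 j))
          - ∑ j ∈ s, (ε ^ (j + 2) * dr 1 (c₂₁ ν R j) y
            - ε ^ j * lagv (fun m => dr 1 (c₂₁ ν R m) y) 2 j) := by
        change Gp 0 x - G00 0 x - G01 1 x - f₁ x.1 = _
        rw [hsum, hGp, hG00, hG01]
        simp only [w0, w1, hst, pw, one_mul, add_zero, ← Finset.sum_add_distrib,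
          ← Finset.sum_sub_distrib]
        refine Finset.sum_congr rfl fun j hj => ?_
        have hdq : dr 0 (fun y => R.q j y.1) y = deriv (R.q j) y.1 := by
          rw [← d₁_eq_dr (hq j (mem_le hj)) hy, d₁]
        rw [hdq]
        ring
      have k1 := L' (fun j => dr 0 (R.p j) y) 1 C3 (b3 y hyr)
      have k2 := L' (fun j => dr 0 (c₁₁ ν R j) y) 2 C1 (b1 y hyr)
      have k3 := L' (fun j => dr 1 (c₂₁ ν R j) y) 2 C2 (b2 y hyr)
      simp only [Fin.zero_eta]
      rw [e1]
      refine (abs_sub _ _).trans ((add_le_add (abs_sub _ _) le_rfl).trans ?_)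
      nlinarith [mul_nonneg hC4 hpow.le, mul_nonneg hC5 hpow.le, mul_nonneg hC6 hpow.le]
    · have hsum : 0 = ∑ j ∈ s, ε ^ j * (lagv (fun m => dr 0 (c₁₂ ν R m) y) 1 j
          + lagv (fun m => dr 0 (c₂₁ ν R m) y) 3 j + lagv (fun m => dr 1 (c₂₂ ν R m) y) 1 j
          - dr 1 (R.p j) y) := by
        rw [Finset.sum_congr rfl fun j hj => by rw [hR.transversal hν (mem_le hj) hy]]
        simp
      have e1 : r 1 x = -(∑ j ∈ s, (ε ^ (j + 1) * dr 0 (c₁₂ ν R j) y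
            - ε ^ j * lagv (fun m => dr 0 (c₁₂ ν R m) y) 1 j))
          - (∑ j ∈ s, (ε ^ (j + 3) * dr 0 (c₂₁ ν R j) y
            - ε ^ j * lagv (fun m => dr 0 (c₂₁ ν R m) y) 3 j))
          - ∑ j ∈ s, (ε ^ (j + 1) * dr 1 (c₂₂ ν R j) y
            - ε ^ j * lagv (fun m => dr 1 (c₂₂ ν R m) y) 1 j) := by
        change Gp 1 x - G01 0 x - G11 1 x = _
        rw [← add_zero (Gp 1 x - G01 0 x - G11 1 x), hsum, hGp, hG11, hG01]
        simp only [w0, w1, hst, pw, one_mul, add_zero, ← Finset.sum_add_distrib,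
          ← Finset.sum_sub_distrib, ← Finset.sum_neg_distrib]
        refine Finset.sum_congr rfl fun j hj => ?_
        have hdq : dr 1 (fun y => R.q j y.1) y = 0 := dr_one_axial (R.q j) hy (hq j (mem_le hj))
        rw [hdq]
        ring
      have k1 := L' (fun j => dr 0 (c₁₂ ν R j) y) 1 C4 (b4 y hyr)
      have k2 := L' (fun j => dr 0 (c₂₁ ν R j) y) 3 C5 (b5 y hyr)
      have k3 := L' (fun j => dr 1 (c₂₂ ν R j) y) 1 C6 (b6 y hyr)
      simp only [Fin.mk_one]
      rw [e1]
      refine (abs_sub _ _).trans ((add_le_add (abs_sub _ _) le_rfl).trans ?_)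
      rw [abs_neg]
      nlinarith [mul_nonneg hC1 hpow.le, mul_nonneg hC2 hpow.le, mul_nonneg hC3 hpow.le]
  -- The pointwise bound of order ε^(k+1) on a domain of area ε yields the factor √ε.
  refine ⟨r, hr, fun i => nrm_le_of_bound hε (by positivity) (hbound i), fun ψ hψ => ?_⟩
  have hw := fun i j => (weakPartial_spec (hψ i).1 j).1
  have hψm := fun i => (hψ i).1.1
  have I00 := g00.integral_by_parts (hψ 0) 0
  have I01 := g01.integral_by_parts (hψ 0) 1
  have I10 := g01.integral_by_parts (hψ 1) 0
  have I11 := g11.integral_by_parts (hψ 1) 1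
  have Ip0 := gp.integral_by_parts (hψ 0) 0
  have Ip1 := gp.integral_by_parts (hψ 1) 1
  have hstress : ∫ x in Ω, ν x.1 * ∑ i, ∑ j, (regGrad ε k R i j x + regGrad ε k R j i x) / 2
      * weakPartial Ω j (ψ i) x = ∫ x in Ω, ((A00 x * weakPartial Ω 0 (ψ 0) x
        + A01 x * weakPartial Ω 1 (ψ 0) x) + (A01 x * weakPartial Ω 0 (ψ 1) x
        + A11 x * weakPartial Ω 1 (ψ 1) x)) := by
    congr with x
    have a00 : A00 x = ν x.1 * regGrad ε k R 0 0 x := by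
      rw [hA00]
      simp only [regGrad, Matrix.cons_val_zero, Finset.mul_sum]
      refine Finset.sum_congr rfl fun j _ => ?_
      rw [w0, stretch, c₁₁, stretch]; ring
    have a11 : A11 x = ν x.1 * regGrad ε k R 1 1 x := by
      rw [hA11]
      simp only [regGrad, Matrix.cons_val_one, Matrix.cons_val_fin_one, Finset.mul_sum]
      refine Finset.sum_congr rfl fun j _ => ?_
      rw [w1, show j + 3 = (j + 2) + 1 by ring, pw, stretch, c₂₂, stretch]; ring
    have a01 : A01 x = ν x.1 * ((regGrad ε k R 0 1 x + regGrad ε k R 1 0 x) / 2) := by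
      rw [hA01]
      simp only [regGrad, Matrix.cons_val_zero, Matrix.cons_val_one]
      rw [← Finset.sum_add_distrib, ← Finset.sum_add_distrib, Finset.sum_div, Finset.mul_sum]
      refine Finset.sum_congr rfl fun j _ => ?_
      rw [w1, w0, show j + 2 = (j + 1) + 1 by ring, pw]
      simp only [stretch, c₁₂, c₂₁]; ring
    rw [a00, a11, a01]
    simp only [Fin.sum_univ_two]
    ring
  rw [hstress]
  have i00 := integrable_mul_of_memLp g00.memLp (hw 0 0)
  have i01 := integrable_mul_of_memLp g01.memLp (hw 0 1)
  have i10 := integrable_mul_of_memLp g01.memLp (hw 1 0)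
  have i11 := integrable_mul_of_memLp g11.memLp (hw 1 1)
  rw [integral_add (integrable_fun_add i00 i01) (integrable_fun_add i10 i11), integral_add i00 i01,
    integral_add i10 i11]
  have hr0 : ∫ x in Ω, r 0 x * ψ 0 x = (∫ x in Ω, Gp 0 x * ψ 0 x) - (∫ x in Ω, G00 0 x * ψ 0 x)
      - (∫ x in Ω, G01 1 x * ψ 0 x) - ∫ x in Ω, f₁ x.1 * ψ 0 x := by
    have j1 := integrable_mul_of_memLp (gp.memLp_grad 0) (hψm 0)
    have j2 := integrable_mul_of_memLp (g00.memLp_grad 0) (hψm 0)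
    have j3 := integrable_mul_of_memLp (g01.memLp_grad 1) (hψm 0)
    have j4 := integrable_mul_of_memLp hfm (hψm 0)
    have j12 : Integrable (fun x => Gp 0 x * ψ 0 x - G00 0 x * ψ 0 x) (volume.restrict Ω) :=
      j1.sub j2
    have j123 : Integrable (fun x => Gp 0 x * ψ 0 x - G00 0 x * ψ 0 x - G01 1 x * ψ 0 x)
        (volume.restrict Ω) := j12.sub j3
    rw [← integral_sub j1 j2, ← integral_sub j12 j3, ← integral_sub j123 j4]
    congr with x
    simp only [r, Matrix.cons_val_zero]
    ring
  have hr1 : ∫ x in Ω, r 1 x * ψ 1 x = (∫ x in Ω, Gp 1 x * ψ 1 x) - (∫ x in Ω, G01 0 x * ψ 1 x)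
      - ∫ x in Ω, G11 1 x * ψ 1 x := by
    have j1 := integrable_mul_of_memLp (gp.memLp_grad 1) (hψm 1)
    have j2 := integrable_mul_of_memLp (g01.memLp_grad 0) (hψm 1)
    have j3 := integrable_mul_of_memLp (g11.memLp_grad 1) (hψm 1)
    have j12 : Integrable (fun x => Gp 1 x * ψ 1 x - G01 0 x * ψ 1 x) (volume.restrict Ω) :=
      j1.sub j2
    rw [← integral_sub j1 j2, ← integral_sub j12 j3]
    congr with x
    simp only [r, Matrix.cons_val_one, Matrix.cons_val_fin_one]
    ring
  rw [Fin.sum_univ_two, Fin.sum_univ_two, hr0, hr1]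
  simp only [hP]
  linarith

end Residual

end ThinChannel

end

noncomputable section

namespace ThinChannel

open Filter Topology

/-! ### Solenoidal lifting of the transversal velocity at the ends -/

theorem frontier_channel_cases {ε : ℝ} (hε : 0 < ε) {x : ℝ × ℝ}
    (hx : x ∈ frontier (channel ε : Set (ℝ × ℝ))) :
    (x.1, x.2 / ε) ∈ rect ∧
      (x.1 = 0 ∨ x.1 = 1 ∨ x.2 / ε = -(1 / 2) ∨ x.2 / ε = 1 / 2) := by
  have hr := mapsTo_closure_channel hε hx.1
  refine ⟨hr, ?_⟩
  have hn : x ∉ (channel ε : Set (ℝ × ℝ)) := fun h => hx.2 (by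
    rwa [(channel ε).isOpen.interior_eq])
  by_contra! hcon
  obtain ⟨h1, h2, h3, h4⟩ := hcon
  obtain ⟨⟨a1, a2⟩, a3, a4⟩ := hr
  have b3 := lt_of_le_of_ne a3 (Ne.symm h3)
  have b4 := lt_of_le_of_ne a4 h4
  refine hn ⟨⟨lt_of_le_of_ne a1 (Ne.symm h1), lt_of_le_of_ne a2 h2⟩, ?_, ?_⟩
  · have : -(1 / 2) < x.2 / ε := b3
    rw [lt_div_iff₀ hε] at this; linarith
  · have : x.2 / ε < 1 / 2 := b4
    rw [div_lt_iff₀ hε] at this; linarith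

/-- The trace of a function on a vertical line, as a function on the plane. -/
def slice (F : ℝ × ℝ → ℝ) (a : ℝ) (y : ℝ × ℝ) : ℝ := F (a, y.2)

theorem mapsTo_slice {a : ℝ} (ha : a ∈ Icc (0 : ℝ) 1) :
    MapsTo (fun y : ℝ × ℝ => (a, y.2)) rect rect := fun _ hy => ⟨ha, hy.2⟩

theorem contDiffOn_slice {n : WithTop ℕ∞} {F : ℝ × ℝ → ℝ} (hF : ContDiffOn ℝ n F rect) {a : ℝ}
    (ha : a ∈ Icc (0 : ℝ) 1) : ContDiffOn ℝ n (slice F a) rect :=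
  hF.comp (contDiff_const.prodMk contDiff_snd).contDiffOn (mapsTo_slice ha)

theorem dr_slice {F : ℝ × ℝ → ℝ} (hF : ContDiffOn ℝ 1 F rect) {a : ℝ} (ha : a ∈ Icc (0 : ℝ) 1)
    {y : ℝ × ℝ} (hy : y ∈ rect) : dr 0 (slice F a) y = 0 ∧ dr 1 (slice F a) y = slice (dr 1 F) a y := by
  have h1 := ((hF.differentiableOn (by simp)) (a, y.2) (mapsTo_slice ha hy)).hasFDerivWithinAt
  have h2 : HasFDerivWithinAt (fun y : ℝ × ℝ => (a, y.2))
      ((0 : ℝ × ℝ →L[ℝ] ℝ).prod (ContinuousLinearMap.snd ℝ ℝ ℝ)) rect y :=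
    (hasFDerivWithinAt_const a y rect).prodMk hasFDerivWithinAt_snd
  have h3 := (h1.comp y h2 (mapsTo_slice ha)).fderivWithin (uniqueDiffOn_rect y hy)
  have h4 : ∀ i, dr i (slice F a) y = fderivWithin ℝ F rect (a, y.2) (0, (e i).2) := fun i => by
    rw [dr]
    exact congrArg (fun L => L (e i)) h3
  exact ⟨by rw [h4]; exact map_zero _, by rw [h4]; rfl⟩

theorem dr_zero_eq_zero {F : ℝ × ℝ → ℝ} (hF : ContDiffOn ℝ 1 F rect) {c : ℝ}
    (hc : c ∈ Icc (-(1 / 2) : ℝ) (1 / 2)) (h0 : ∀ t ∈ Icc (0 : ℝ) 1, F (t, c) = 0) {t : ℝ}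
    (ht : t ∈ Icc (0 : ℝ) 1) : dr 0 F (t, c) = 0 := by
  have h1 := ((hF.differentiableOn (by simp)) (t, c) ⟨ht, hc⟩).hasFDerivWithinAt
  have h2 : HasDerivWithinAt (fun s : ℝ => (s, c)) (e 0) (Icc 0 1) t :=
    (hasDerivWithinAt_id t _).prodMk (hasDerivWithinAt_const t _ c)
  have h3 := h1.comp_hasDerivWithinAt t h2 (t := rect) (show MapsTo (fun s : ℝ => (s, c)) (Icc 0 1) rect from
    fun s hs => ⟨hs, hc⟩)
  have h4 : HasDerivWithinAt (F ∘ fun s : ℝ => (s, c)) 0 (Icc 0 1) t :=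
    (hasDerivWithinAt_const t (Icc (0 : ℝ) 1) (0 : ℝ)).congr (fun s hs => h0 s hs) (h0 t ht)
  exact (uniqueDiffOn_Icc one_pos t ht).eq_deriv _ h3 h4

variable {ν f₁ φ₀ : ℝ → ℝ} {k : ℕ} {R : RegularCoeffs}

/-- The equation holds in the interior, and first derivatives are continuous up to the boundary of
the rectangle. -/
theorem IsRegularAnsatz.div_rect (hR : IsRegularAnsatz ν f₁ φ₀ k R) {j : ℕ} (hj : j ≤ k) {y : ℝ × ℝ}
    (hy : y ∈ rect) : dr 0 (R.u₁ j) y + dr 1 (R.u₂ j) y = 0 := by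
  have c1 := (contDiffOn_dr (m := 0) (of_two (hR.contDiff_u₁ j hj)) (by simp) 0).continuousOn
  have c2 := (contDiffOn_dr (m := 0) (of_two (hR.contDiff_u₂ j hj)) (by simp) 1).continuousOn
  have h : EqOn (fun y => dr 0 (R.u₁ j) y + dr 1 (R.u₂ j) y) (fun _ => 0) rectInt := fun x hx => by
    have := hR.incompressible j hj x hx
    rwa [d₁_eq_dr (of_two (hR.contDiff_u₁ j hj)) hx, d₂_eq_dr (of_two (hR.contDiff_u₂ j hj)) hx]
      at this
  exact h.of_subset_closure (c1.add c2) continuousOn_const rectInt_subset closure_rectInt.ge hy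

/-- Along a wall u₁ is identically zero, hence so is its tangential derivative, and the divergence
equation leaves no normal derivative of u₂. This makes the axial component of the lift vanish on the
walls. -/
theorem IsRegularAnsatz.dr_one_wall (hR : IsRegularAnsatz ν f₁ φ₀ k R) {j : ℕ} (hj : j ≤ k) {t c : ℝ}
    (ht : t ∈ Icc (0 : ℝ) 1) (hc : c = -(1 / 2) ∨ c = 1 / 2) : dr 1 (R.u₂ j) (t, c) = 0 := by
  have hcm : c ∈ Icc (-(1 / 2) : ℝ) (1 / 2) := by rcases hc with rfl | rfl <;> norm_num
  have h0 : dr 0 (R.u₁ j) (t, c) = 0 := by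
    refine dr_zero_eq_zero (of_two (hR.contDiff_u₁ j hj)) hcm (fun s hs => ?_) ht
    obtain ⟨h1, h2, -, -⟩ := hR.noSlip j hj s hs
    rcases hc with rfl | rfl
    exacts [h1, h2]
  have := hR.div_rect hj (y := (t, c)) ⟨ht, hcm⟩
  rwa [h0, zero_add] at this

/-- The layer of index j corrects the transversal velocity of index j-1, so the last one, of index
k, remains uncorrected at both ends. The lift carries exactly these values. On the reference
rectangle, up to sign, it is the rotated gradient of a₀(x₁) u₂(0,ξ₂) + a₁(x₁) u₂(1,ξ₂), hence
solenoidal. -/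
theorem IsRegularAnsatz.exists_lift (hR : IsRegularAnsatz ν f₁ φ₀ k R) :
    ∃ C, 0 ≤ C ∧ ∀ ε, 0 < ε → ε ≤ 1 → ∃ (w : Fin 2 → ℝ × ℝ → ℝ) (G : Fin 2 → Fin 2 → ℝ × ℝ → ℝ),
      (∀ i, HasGrad (channel ε) (w i) (G i)) ∧ (∀ x ∈ channel ε, G 0 0 x + G 1 1 x = 0) ∧
      (∀ i, HasBoundaryValue (channel ε) (w i) (fun x =>
        if i = 1 ∧ (x.1 = 0 ∨ x.1 = 1) then ε ^ (k + 3) * R.u₂ k (x.1, x.2 / ε) else 0)) ∧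
      (∀ i, nrm (volume.restrict (channel ε)) (w i) ≤ C * (ε ^ (k + 1) * Real.sqrt ε)) ∧
      ∀ i j, nrm (volume.restrict (channel ε)) (G i j) ≤ C * (ε ^ (k + 1) * Real.sqrt ε) := by
  have i0 : (0 : ℝ) ∈ Icc (0 : ℝ) 1 := by simp
  have i1 : (1 : ℝ) ∈ Icc (0 : ℝ) 1 := by simp
  have hu := hR.contDiff_u₂ k le_rfl
  have hd := contDiffOn_dr (m := 1) hu (by norm_num) 1
  -- Cubic Hermite polynomials: both vanish at both ends, and their derivatives b₀ and b₁ equal one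
  -- at the ends 0 and 1 respectively and zero at the opposite end.
  let a₀ : ℝ → ℝ := fun t => t * (1 - t) ^ 2
  let a₁ : ℝ → ℝ := fun t => t ^ 2 * (t - 1)
  let b₀ : ℝ → ℝ := fun t => 1 - 4 * t + 3 * t ^ 2
  let b₁ : ℝ → ℝ := fun t => 3 * t ^ 2 - 2 * t
  have ca₀ : ContDiffOn ℝ 1 (fun y : ℝ × ℝ => a₀ y.1) rect := by
    simp only [a₀]; exact ContDiff.contDiffOn (by fun_prop)
  have ca₁ : ContDiffOn ℝ 1 (fun y : ℝ × ℝ => a₁ y.1) rect := by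
    simp only [a₁]; exact ContDiff.contDiffOn (by fun_prop)
  have cb₀ : ContDiffOn ℝ 1 (fun y : ℝ × ℝ => b₀ y.1) rect := by
    simp only [b₀]; exact ContDiff.contDiffOn (by fun_prop)
  have cb₁ : ContDiffOn ℝ 1 (fun y : ℝ × ℝ => b₁ y.1) rect := by
    simp only [b₁]; exact ContDiff.contDiffOn (by fun_prop)
  have cg₀ := contDiffOn_slice (of_two hu) i0
  have cg₁ := contDiffOn_slice (of_two hu) i1
  have ch₀ := contDiffOn_slice hd i0
  have ch₁ := contDiffOn_slice hd i1
  have da₀ : ∀ y ∈ rectInt, dr 0 (fun y : ℝ × ℝ => a₀ y.1) y = b₀ y.1 := fun y hy => by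
    rw [← d₁_eq_dr ca₀ hy, d₁]
    have h1 := ((hasDerivAt_id y.1).const_sub 1).pow 2
    have h2 := (hasDerivAt_id y.1).mul h1
    refine (h2.congr_deriv ?_).deriv
    simp [b₀]; ring
  have da₁ : ∀ y ∈ rectInt, dr 0 (fun y : ℝ × ℝ => a₁ y.1) y = b₁ y.1 := fun y hy => by
    rw [← d₁_eq_dr ca₁ hy, d₁]
    have h1 := (hasDerivAt_id y.1).pow 2
    have h2 := h1.mul ((hasDerivAt_id y.1).sub_const 1)
    refine (h2.congr_deriv ?_).deriv
    simp [b₁]; ring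
  let F : Fin 2 → ℝ × ℝ → ℝ :=
    ![fun y => a₀ y.1 * (-1 * slice (dr 1 (R.u₂ k)) 0 y) + a₁ y.1 * (-1 * slice (dr 1 (R.u₂ k)) 1 y),
      fun y => b₀ y.1 * slice (R.u₂ k) 0 y + b₁ y.1 * slice (R.u₂ k) 1 y]
  have neg1 : ContDiffOn ℝ 1 (fun _ : ℝ × ℝ => (-1 : ℝ)) rect := contDiffOn_const
  have hF : ∀ i, ContDiffOn ℝ 1 (F i) rect := by
    intro i
    fin_cases i
    · exact (ca₀.mul (neg1.mul ch₀)).add (ca₁.mul (neg1.mul ch₁))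
    · exact (cb₀.mul cg₀).add (cb₁.mul cg₁)
  have hdiv : ∀ y ∈ rectInt, dr 0 (F 0) y + dr 1 (F 1) y = 0 := by
    intro y hy
    have hyr := rectInt_subset hy
    have n0 : dr 0 (fun _ : ℝ × ℝ => (-1 : ℝ)) y = 0 := by simp [dr]
    have e0 : dr 0 (F 0) y = -(b₀ y.1 * slice (dr 1 (R.u₂ k)) 0 y
        + b₁ y.1 * slice (dr 1 (R.u₂ k)) 1 y) := by
      have := dr_add 0 (ca₀.mul (neg1.mul ch₀)) (ca₁.mul (neg1.mul ch₁)) hy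
      refine this.trans ?_
      rw [dr_mul 0 ca₀ (neg1.mul ch₀) hy, dr_mul 0 ca₁ (neg1.mul ch₁) hy, dr_mul 0 neg1 ch₀ hy,
        dr_mul 0 neg1 ch₁ hy, (dr_slice hd i0 hyr).1, (dr_slice hd i1 hyr).1, da₀ y hy, da₁ y hy, n0]
      ring
    have e1 : dr 1 (F 1) y = b₀ y.1 * slice (dr 1 (R.u₂ k)) 0 y
        + b₁ y.1 * slice (dr 1 (R.u₂ k)) 1 y := by
      have := dr_add 1 (cb₀.mul cg₀) (cb₁.mul cg₁) hy
      refine this.trans ?_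
      rw [dr_one_axial_mul cb₀ cg₀ hy, dr_one_axial_mul cb₁ cg₁ hy, (dr_slice (of_two hu) i0 hyr).2,
        (dr_slice (of_two hu) i1 hyr).2]
    rw [e0, e1, neg_add_cancel]
  have hFc := fun i => (hF i).continuousOn
  have hDc := fun i j => (contDiffOn_dr (m := 0) (hF i) (by simp) j).continuousOn
  choose C hC0 hC using fun i => exists_bound_rect (hFc i)
  choose D hD0 hD using fun i j => exists_bound_rect (hDc i j)
  have hCle : ∀ i, C i ≤ ∑ i, C i := fun i =>
    Finset.single_le_sum (f := C) (fun i _ => hC0 i) (Finset.mem_univ i)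
  have hDle : ∀ i j, D i j ≤ ∑ i, ∑ j, D i j := fun i j =>
    (Finset.single_le_sum (f := D i) (fun j _ => hD0 i j) (Finset.mem_univ j)).trans
      (Finset.single_le_sum (f := fun i => ∑ j, D i j)
        (fun i _ => Finset.sum_nonneg fun j _ => hD0 i j) (Finset.mem_univ i))
  have hCs : 0 ≤ ∑ i, C i := Finset.sum_nonneg fun i _ => hC0 i
  have hDs : 0 ≤ ∑ i, ∑ j, D i j := Finset.sum_nonneg fun i _ => Finset.sum_nonneg fun j _ => hD0 i j
  refine ⟨(∑ i, C i) + ∑ i, ∑ j, D i j, add_nonneg hCs hDs, fun ε hε hε1 => ?_⟩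
  -- The transversal component carries one more power of ε than the axial one, because ∂₂ brings a
  -- factor ε⁻¹. This keeps the stretched field solenoidal.
  let m : Fin 2 → ℕ := ![k + 2, k + 3]
  have hm : ∀ i, k + 2 ≤ m i := fun i => by fin_cases i <;> simp [m]
  have hpm : ∀ i, ε ^ m i ≤ ε ^ (k + 2) := fun i => pow_le_pow_of_le_one hε.le hε1 (hm i)
  have hpk : ε ^ (k + 2) ≤ ε ^ (k + 1) := pow_le_pow_of_le_one hε.le hε1 (by omega)
  have hεε : ε * ε⁻¹ = 1 := mul_inv_cancel₀ hε.ne'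
  have hwt0 : ∀ j, 0 ≤ wt ε j := fun j => by
    rw [wt]; split_ifs; exacts [zero_le_one, (inv_pos.2 hε).le]
  have hwt : ∀ j, ε * wt ε j ≤ 1 := fun j => by
    rw [wt]; split_ifs
    · rwa [mul_one]
    · exact hεε.le
  refine ⟨fun i x => ε ^ m i * stretch ε (F i) x,
    fun i j x => ε ^ m i * (wt ε j * stretch ε (dr j (F i)) x),
    fun i => (hasGrad_stretch hε (hF i)).const_mul _, fun x hx => ?_, fun i => ?_, fun i => ?_,
    fun i j => ?_⟩
  · have := hdiv _ (mapsTo_channel hε hx)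
    simp only [m, wt, stretch, Matrix.cons_val_zero, Matrix.cons_val_one, Matrix.cons_val_fin_one,
      if_true, one_ne_zero, if_false]
    rw [show k + 3 = (k + 2) + 1 by ring, pow_succ]
    linear_combination ε ^ (k + 2) * this
      + ε ^ (k + 2) * dr 1 (F 1) (x.1, x.2 / ε) * hεε
  · refine (HasBoundaryValue.of_continuousOn ((hasGrad_stretch hε (hF i)).const_mul _).memH1
      (continuousOn_const.mul (continuousOn_stretch hε (hFc i)))).congr_frontier fun x hx => ?_
    obtain ⟨hr, hx'⟩ := frontier_channel_cases hε hx
    have wall : x.2 / ε = -(1 / 2) ∨ x.2 / ε = 1 / 2 → ∀ t ∈ Icc (0 : ℝ) 1,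
        R.u₂ k (t, x.2 / ε) = 0 ∧ dr 1 (R.u₂ k) (t, x.2 / ε) = 0 := fun hc t ht => by
      refine ⟨?_, hR.dr_one_wall le_rfl ht hc⟩
      obtain ⟨-, -, h1, h2⟩ := hR.noSlip k le_rfl t ht
      rcases hc with hc | hc <;> rw [hc]
      exacts [h1, h2]
    fin_cases i
    · have : F 0 (x.1, x.2 / ε) = 0 := by
        change a₀ x.1 * (-1 * dr 1 (R.u₂ k) (0, x.2 / ε))
          + a₁ x.1 * (-1 * dr 1 (R.u₂ k) (1, x.2 / ε)) = 0
        rcases hx' with h | h | h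
        · simp [a₀, a₁, h]
        · simp [a₀, a₁, h]
        · rw [(wall h 0 i0).2, (wall h 1 i1).2]; ring
      have h01 : ¬ ((0 : Fin 2) = 1 ∧ (x.1 = 0 ∨ x.1 = 1)) := by simp
      simp only [Fin.zero_eta, stretch, this, mul_zero, h01, if_false]
    · have : F 1 (x.1, x.2 / ε) = if x.1 = 0 ∨ x.1 = 1 then R.u₂ k (x.1, x.2 / ε) else 0 := by
        change b₀ x.1 * R.u₂ k (0, x.2 / ε) + b₁ x.1 * R.u₂ k (1, x.2 / ε) = _
        by_cases h0 : x.1 = 0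
        · simp [h0, b₀, b₁]
        by_cases h1 : x.1 = 1
        · simp [h1, b₀, b₁]; norm_num
        · have h := (hx'.resolve_left h0).resolve_left h1
          rw [(wall h 0 i0).1, (wall h 1 i1).1]
          simp [h0, h1]
      simp only [Fin.mk_one, stretch, this, true_and, mul_ite, mul_zero]
      rfl
  · rw [nrm_const_mul, abs_of_pos (by positivity)]
    have h1 := nrm_stretch_le hε (hC0 i) (hC i)
    calc ε ^ m i * nrm _ (stretch ε (F i)) ≤ ε ^ (k + 1) * (C i * Real.sqrt ε) :=
          mul_le_mul ((hpm i).trans hpk) h1 nrm_nonneg (by positivity)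
      _ = C i * (ε ^ (k + 1) * Real.sqrt ε) := by ring
      _ ≤ _ := mul_le_mul_of_nonneg_right ((hCle i).trans (le_add_of_nonneg_right hDs))
          (by positivity)
  · rw [nrm_const_mul, nrm_const_mul, abs_of_pos (by positivity), abs_of_nonneg (hwt0 j), ← mul_assoc]
    have h1 := nrm_stretch_le hε (hD0 i j) (hD i j)
    -- Both components are O(ε^(k+2)), and a derivative costs at most one power of ε.
    have h2 : ε ^ m i * wt ε j ≤ ε ^ (k + 1) := by
      refine (mul_le_mul_of_nonneg_right (hpm i) (hwt0 j)).trans ?_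
      rw [show k + 2 = (k + 1) + 1 by ring, pow_succ, mul_assoc]
      exact mul_le_of_le_one_right (by positivity) (hwt j)
    calc ε ^ m i * wt ε j * nrm _ (stretch ε (dr j (F i))) ≤ ε ^ (k + 1) * (D i j * Real.sqrt ε) :=
          mul_le_mul h2 h1 nrm_nonneg (by positivity)
      _ = D i j * (ε ^ (k + 1) * Real.sqrt ε) := by ring
      _ ≤ _ := mul_le_mul_of_nonneg_right ((hDle i j).trans (le_add_of_nonneg_left hCs))
          (by positivity)

end ThinChannel

end

/-! ### The two boundary layers as approximate solutions in the channel. -/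

noncomputable section

namespace ThinChannel

open Filter Topology

/-! ### The boundary layers in the channel -/

theorem LocallyIntegrableOn.zoom {a ε : ℝ} (hε : 0 < ε) {p : ℝ × ℝ → ℝ} {U V : Set (ℝ × ℝ)}
    (hp : LocallyIntegrableOn p U) (hV : MapsTo (zoom a ε) V U) :
    LocallyIntegrableOn (fun x => p (ThinChannel.zoom a ε x)) V := by
  intro x hx
  obtain ⟨s, hs, hi⟩ := hp _ (hV hx)
  refine ⟨ThinChannel.zoom a ε ⁻¹' s,
    ((continuous_zoom a ε).continuousWithinAt.tendsto_nhdsWithin hV) hs, ?_⟩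
  refine ((measurePreserving_zoom hε).integrableOn_comp_preimage
    (zoomHomeomorph a hε.ne').measurableEmbedding (f := p)).2 ?_
  rw [IntegrableOn, Measure.restrict_smul]
  exact hi.smul_measure ENNReal.ofReal_ne_top

theorem IsTest.integrable_mul {Ω : Opens (ℝ × ℝ)} {η p : ℝ × ℝ → ℝ} (hη : IsTest Ω η)
    (hp : LocallyIntegrableOn p Ω) : Integrable fun x => p x * η x := by
  have := TestFunction.integrable_bilin (B := ContinuousLinearMap.mul ℝ ℝ) hp hη.bundle
  refine this.congr (ae_of_all _ fun x => ?_)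
  simp [mul_comm, hη.coe_bundle]

/-- An approximation, up to errors of size `A`, of the velocity field `U` of a boundary layer by a
solenoidal field `V` with boundary values `b`. Here `G` and `H` are the gradients of `U` and `V`,
and `P` is the pressure of the boundary layer. -/
structure EndApprox (ε ν₀ : ℝ) (ν₁ : ℝ → ℝ) (A : ℝ) (U : Fin 2 → ℝ × ℝ → ℝ) (P : ℝ × ℝ → ℝ)
    (b V : Fin 2 → ℝ × ℝ → ℝ) (G H : Fin 2 → Fin 2 → ℝ × ℝ → ℝ) : Prop where
  grad : ∀ i, HasGrad (channel ε) (U i) (G i)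
  grad_cut : ∀ i, HasGrad (channel ε) (V i) (H i)
  div : ∀ᵐ x ∂volume.restrict (channel ε : Set (ℝ × ℝ)), G 0 0 x + G 1 1 x = 0
  div_cut : ∀ᵐ x ∂volume.restrict (channel ε : Set (ℝ × ℝ)), H 0 0 x + H 1 1 x = 0
  boundary : ∀ i, HasBoundaryValue (channel ε) (V i) (b i)
  close : ∀ i, nrm (volume.restrict (channel ε)) (fun x => V i x - U i x) ≤ A
  close_grad : ∀ i j, nrm (volume.restrict (channel ε)) (fun x => H i j x - G i j x) ≤ A
  small : ∀ i j, nrm (volume.restrict (channel ε)) (fun x => ν₁ x.1 * G i j x) ≤ A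
  weak : ∀ ψ, MemH (channel ε) ψ →
    ∫ x in channel ε, ∑ i, ∑ j, G i j x * weakPartial (channel ε) j (ψ i) x = 0
  locallyIntegrable : LocallyIntegrableOn P (channel ε)
  pressure : ∀ ψ : Fin 2 → ℝ × ℝ → ℝ, (∀ i, IsTest (channel ε) (ψ i)) →
    ν₀ / 2 * ∫ x in channel ε, ∑ i, ∑ j, G i j x * pd j (ψ i) x
      = ∑ i, ∫ x, P x * pd i (ψ i) x

variable {a σ ν₀ ρ D : ℝ} {ν₁ : ℝ → ℝ} {k : ℕ} {B : LayerCoeffs} {Ω : Opens (ℝ × ℝ)}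
  {b : ℕ → Fin 2 → ℝ × ℝ → ℝ}

/-- One constant serves the whole finite family and all coefficients bounded by one. This uniformity
is needed because the coefficients are the powers of ε. -/
theorem exists_tailBound {σ : ℝ} {s : Finset ℕ} {u : ℕ → Fin 2 → ℝ × ℝ → ℝ}
    {g : ℕ → Fin 2 → Fin 2 → ℝ × ℝ → ℝ} {Ψ : ℕ → ℝ × ℝ → ℝ}
    (h : ∀ j ∈ s, StripFlow σ (u j) (g j) (Ψ j)) {r : ℝ} (hr : 0 < r) (N : ℕ) :
    ∃ C, 0 ≤ C ∧ ∀ (c : ℕ → ℝ), (∀ j, |c j| ≤ 1) → ∀ n : ℕ, 0 < n →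
      TailBound σ (r * n) (C * (1 / (n : ℝ)) ^ N) (fun i x => ∑ j ∈ s, c j * u j i x)
        (fun i l x => ∑ j ∈ s, c j * g j i l x) (fun x => ∑ j ∈ s, c j * Ψ j x) := by
  have key : ∀ {f : ℕ → ℝ × ℝ → ℝ}, (∀ j ∈ s, MemLp (f j) 2) → (∀ j ∈ s, RapidDecay σ (f j)) →
      ∃ C, 0 ≤ C ∧ ∀ (c : ℕ → ℝ), (∀ j, |c j| ≤ 1) → ∀ n : ℕ, 0 < n →
        nrm (volume.restrict (tail σ (r * n))) (fun x => ∑ j ∈ s, c j * f j x)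
          ≤ C * (1 / (n : ℝ)) ^ N := by
    intro f hm hf
    choose! C hC0 hC using fun j (hj : j ∈ s) => hf j hj r hr N
    refine ⟨∑ j ∈ s, C j, Finset.sum_nonneg hC0, fun c hc n hn => ?_⟩
    refine (nrm_sum_le s fun j hj => ((hm j hj).const_mul (c j)).restrict _).trans ?_
    rw [Finset.sum_mul]
    refine Finset.sum_le_sum fun j hj => ?_
    rw [nrm_const_mul]
    exact (mul_le_of_le_one_left nrm_nonneg (hc j)).trans (hC j hj n hn)
  choose C1 h1 hC1 using fun i => key (f := fun j => u j i) (fun j hj => ((h j hj).sob i).memLp)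
    (fun j hj => (h j hj).rapid i)
  choose C2 h2 hC2 using fun i l => key (f := fun j => g j i l)
    (fun j hj => ((h j hj).sob i).memLp_grad l) (fun j hj => (h j hj).rapid_grad i l)
  obtain ⟨C3, h3, hC3⟩ := key (f := Ψ) (fun j hj => (h j hj).stream.memLp)
    (fun j hj => (h j hj).rapid_stream)
  have s1 : 0 ≤ ∑ i, C1 i := Finset.sum_nonneg fun i _ => h1 i
  have s2 : 0 ≤ ∑ i, ∑ l, C2 i l := Finset.sum_nonneg fun i _ => Finset.sum_nonneg fun l _ => h2 i l
  have le1 : ∀ i, C1 i ≤ ∑ i, C1 i := fun i =>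
    Finset.single_le_sum (f := C1) (fun i _ => h1 i) (Finset.mem_univ i)
  have le2 : ∀ i l, C2 i l ≤ ∑ i, ∑ l, C2 i l := fun i l =>
    (Finset.single_le_sum (f := C2 i) (fun l _ => h2 i l) (Finset.mem_univ l)).trans
      (Finset.single_le_sum (f := fun i => ∑ l, C2 i l)
        (fun i _ => Finset.sum_nonneg fun l _ => h2 i l) (Finset.mem_univ i))
  refine ⟨(∑ i, C1 i) + (∑ i, ∑ l, C2 i l) + C3, by positivity, fun c hc n hn => ⟨fun i => ?_,
    fun i l => ?_, ?_⟩⟩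
  · exact (hC1 i c hc n hn).trans (mul_le_mul_of_nonneg_right (by linarith [le1 i]) (by positivity))
  · exact (hC2 i l c hc n hn).trans
      (mul_le_mul_of_nonneg_right (by linarith [le2 i l]) (by positivity))
  · exact (hC3 c hc n hn).trans (mul_le_mul_of_nonneg_right (by linarith) (by positivity))

/-- The rescaled layer still satisfies its own equation exactly in the channel. Replacing it by its
cut off version, and replacing ν₀ by ν₀ + ν₁, introduces only terms supported at a fixed distance
from the end, where the decay makes them smaller than any prescribed power of ε. -/
theorem exists_endApprox (he : IsEnd a σ) (hΩ : (Ω : Set (ℝ × ℝ)) = halfPlane σ ∩ hStrip)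
    (hν₀ : ν₀ ≠ 0) (hρ : 0 < ρ) (hD : 0 ≤ D) (hν₁ : ∀ t ∈ Ioo (0 : ℝ) 1, |ν₁ t| ≤ D)
    (hν₁0 : ∀ t ∈ Ioo (0 : ℝ) 1, σ * (t - a) < ρ → ν₁ t = 0)
    (hB : ∀ j ≤ k, IsLayer Ω ν₀ (b j) (B.u j) (B.p j))
    (hb0 : ∀ j i, ∀ x : ℝ × ℝ, x.1 ≠ 0 → b j i x = 0) :
    ∃ C, 0 ≤ C ∧ ∀ n : ℕ, 0 < n → ∀ ε : ℝ, ε = 1 / (n : ℝ) → ∃ V G H,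
      EndApprox ε ν₀ ν₁ (C * (ε ^ (k + 1) * Real.sqrt ε))
        (fun i x => layerVelocity ε k B i (zoom a ε x)) (fun x => layerPressure ε k B (zoom a ε x))
        (fun i x => ∑ j ∈ Finset.range (k + 1), ε ^ (j + 2) * b j i (zoom a ε x)) V G H := by
  have hσ := he.sign
  have hΩm := Ω.isOpen.measurableSet
  set s := Finset.range (k + 1) with hs
  choose! Ψ hΨ using fun j (hj : j ∈ s) => (hB j (mem_le hj)).exists_stripFlow hσ hΩ hν₀ (hb0 j)
  obtain ⟨M, χ, hc⟩ := exists_endCutoff he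
  have hM := hc.nonneg_bound
  -- Up to this distance from the end both the cutoff is equal to one and ν₁ vanishes, so a single
  -- tail bound controls all the errors.
  set r := min (1 / 3) ρ with hr
  have hr0 : 0 < r := lt_min (by norm_num) hρ
  obtain ⟨C, hC0, hC⟩ := exists_tailBound hΨ hr0 (k + 2)
  refine ⟨(1 + 3 * M + D) * C, by positivity, fun n hn ε hεn => ?_⟩
  have hn' : (0 : ℝ) < n := by exact_mod_cast hn
  have hε : 0 < ε := by rw [hεn]; positivity
  have hε1 : ε ≤ 1 := by
    rw [hεn, div_le_one hn']; exact_mod_cast hn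
  have hcj : ∀ j : ℕ, |ε ^ (j + 2)| ≤ 1 := fun j => by
    rw [abs_of_pos (by positivity)]; exact pow_le_one₀ hε.le hε1
  have hF := StripFlow.sum hσ s (fun j => ε ^ (j + 2)) hΨ
  have hT := hC _ hcj n hn
  -- Since 1/ε = n, the tails indexed by integers are those met in the fast variables.
  rw [show r * (n : ℝ) = r / ε by rw [hεn]; field_simp, ← hεn] at hT
  set u : Fin 2 → ℝ × ℝ → ℝ := fun i x =>
    ∑ j ∈ s, ε ^ (j + 2) * (Ω : Set (ℝ × ℝ)).indicator (B.u j i) x with hu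
  set g : Fin 2 → Fin 2 → ℝ × ℝ → ℝ := fun i l x =>
    ∑ j ∈ s, ε ^ (j + 2) * (Ω : Set (ℝ × ℝ)).indicator (weakPartial Ω l (B.u j i)) x with hg
  set Φ : ℝ × ℝ → ℝ := fun x => ∑ j ∈ s, ε ^ (j + 2) * Ψ j x
  set K := C * ε ^ (k + 2) with hK
  have hK0 : 0 ≤ K := by positivity
  -- Decay of order k+2 suffices, because ε ≤ √ε for ε ≤ 1.
  have hKle : K ≤ C * (ε ^ (k + 1) * Real.sqrt ε) := by
    rw [hK, pow_succ]
    refine mul_le_mul_of_nonneg_left (mul_le_mul_of_nonneg_left ?_ (by positivity)) hC0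
    exact Real.le_sqrt_of_sq_le (by nlinarith)
  have hle : ∀ {c : ℝ}, 0 ≤ c → c ≤ 1 + 3 * M + D →
      c * K ≤ (1 + 3 * M + D) * C * (ε ^ (k + 1) * Real.sqrt ε) := fun hc0 hcle => by
    rw [mul_assoc]; exact mul_le_mul hcle hKle hK0 (by positivity)
  have hBm := (channel ε).isOpen.measurableSet
  have hmem : ∀ {x}, x ∈ channel ε → zoom a ε x ∈ (Ω : Set (ℝ × ℝ)) := fun hx => by
    rw [hΩ]; exact channel_subset_zoom he hε hx
  have hsub : (channel ε : Set (ℝ × ℝ)) ⊆ zoom a ε ⁻¹' halfPlane σ := fun x hx =>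
    (channel_subset_zoom he hε hx).1
  have huU : ∀ i, ∀ x ∈ channel ε, u i (zoom a ε x) = layerVelocity ε k B i (zoom a ε x) :=
    fun i x hx => Finset.sum_congr rfl fun j _ => by rw [indicator_of_mem (hmem hx)]
  obtain ⟨hcl1, hcl2⟩ := hc.close hε hε1 hF (min_le_left _ _) hK0 hT hBm
  refine ⟨cutVel χ a ε u Φ, fun i l x => ε⁻¹ * g i l (zoom a ε x), cutGrad χ a ε u g Φ, ?_⟩
  refine ⟨fun i => ?_, fun i => ?_, ?_, ?_, fun i => ?_, fun i => ?_, fun i l => ?_, fun i l => ?_,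
    fun ψ hψ => ?_, ?_, fun ψ hψ => ?_⟩
  · exact ((((hF.sob i).zoom hε).mono hsub).hasGrad (ae_eq_refl _)).congr (huU i) fun _ _ _ => rfl
  · exact ((hc.sob hε hF i).mono hsub).hasGrad (ae_eq_refl _)
  · have hq := (measurePreserving_zoom (a := a) hε).quasiMeasurePreserving.ae
      (p := fun x => x ∈ halfPlane σ → g 0 0 x + g 1 1 x = 0) (Measure.ae_smul_measure hF.div _)
    filter_upwards [ae_restrict_of_ae hq, ae_restrict_mem hBm] with x hx hxc
    rw [← mul_add, hx (hsub hxc), mul_zero]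
  · filter_upwards [ae_restrict_of_ae (hF.cutGrad_div (χ := χ) (a := a) hε), ae_restrict_mem hBm]
      with x hx hxc using hx (hsub hxc)
  · refine hc.boundary hε hF hΩ (b := fun i x => ∑ j ∈ s, ε ^ (j + 2) * b j i x) (fun i => ?_)
      (fun i x hx => Finset.sum_eq_zero fun j _ => by rw [hb0 j i x hx, mul_zero]) i
    refine HasBoundaryValue.sum s fun j hj => HasBoundaryValue.const_mul ?_ _
    exact ((hB j (mem_le hj)).boundary i).congr fun x hx => (indicator_of_mem hx _).symm
  · refine le_trans (le_of_eq (nrm_congr ?_)) ((hcl1 i).trans (hle (by positivity) (by linarith)))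
    filter_upwards [ae_restrict_mem hBm] with x hx
    rw [huU i x hx]
  · exact (hcl2 i l).trans (hle (by positivity) (by linarith))
  · have h1 := EndCutoff.axial_zoom_le (a := a) (σ := σ) hε (r := r) hD
      (d := fun x => ν₁ x.1) ((hF.sob i).memLp_grad l) hBm (fun x hx => hν₁ _ hx.1)
      (fun x hx h => hν₁0 _ hx.1 (h.trans_le (min_le_right _ _)))
    have e1 : ∀ x : ℝ × ℝ, ν₁ x.1 * (ε⁻¹ * g i l (zoom a ε x))
        = ε⁻¹ * (ν₁ x.1 * g i l (zoom a ε x)) := fun x => by ring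
    simp only [e1]
    rw [nrm_const_mul, abs_of_pos (inv_pos.2 hε)]
    refine le_trans ?_ (hle hD (by linarith))
    refine (mul_le_mul_of_nonneg_left h1 (inv_pos.2 hε).le).trans ?_
    have h2 := hT.grad i l
    calc ε⁻¹ * (D * (ε * nrm (volume.restrict (tail σ (r / ε))) (g i l)))
        = D * nrm (volume.restrict (tail σ (r / ε))) (g i l) := by field_simp
      _ ≤ D * K := mul_le_mul_of_nonneg_left h2 hD
  · have hk : ∀ᵐ x, (channel ε : Set (ℝ × ℝ)).indicator (weakPartial (channel ε) 0 (ψ 0)) x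
        + (channel ε : Set (ℝ × ℝ)).indicator (weakPartial (channel ε) 1 (ψ 1)) x = 0 := by
      have := hψ.2
      rw [DivFree, ae_restrict_iff' hBm] at this
      filter_upwards [this] with x hx
      by_cases hxΩ : x ∈ (channel ε : Set (ℝ × ℝ))
      · have := hx hxΩ
        rw [Fin.sum_univ_two] at this
        rwa [indicator_of_mem hxΩ, indicator_of_mem hxΩ]
      · rw [indicator_of_notMem hxΩ, indicator_of_notMem hxΩ, add_zero]
    have key := hF.weak_zoom he hε (fun i => (hψ.1 i).sob)
      (fun i x hx => indicator_of_notMem hx _) hk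
    rw [← key, ← integral_indicator hBm]
    congr with x
    by_cases hx : x ∈ (channel ε : Set (ℝ × ℝ))
    · simp only [indicator_of_mem hx]
    · simp [hx]
  · refine (LocallyIntegrableOn.zoom hε (p := layerPressure ε k B) (U := Ω) ?_ fun x hx => hmem hx)
    have : ∀ t ⊆ s, LocallyIntegrableOn (fun x => ∑ j ∈ t, ε ^ (j + 1) * B.p j x) Ω := by
      intro t
      induction t using Finset.induction_on with
      | empty =>
        intro _
        simpa using (locallyIntegrable_const (0 : ℝ)).locallyIntegrableOn _
      | insert j t hj ih =>
        intro ht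
        simp only [Finset.sum_insert hj]
        have h1 := (hB j (mem_le (ht (Finset.mem_insert_self j t)))).locallyIntegrable
        have h2 : LocallyIntegrableOn (fun x => ε ^ (j + 1) * B.p j x) Ω := by
          intro x hx
          obtain ⟨w, hw, hi⟩ := h1 x hx
          exact ⟨w, hw, hi.const_mul _⟩
        exact h2.add (ih ((Finset.subset_insert j t).trans ht))
    exact this s subset_rfl
  · have hψ' : ∀ i, IsTest (zoom a ε ⁻¹' Ω) (ψ i) := fun i => (hψ i).mono fun x hx => hmem hx
    have hj := fun j (hj : j ∈ s) => (hB j (mem_le hj)).integral_pressure_zoom hε hψ'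
    have hp := fun j (hj : j ∈ s) => LocallyIntegrableOn.zoom (a := a) (V := channel ε) hε
      (hB j (mem_le hj)).locallyIntegrable fun x hx => hmem hx
    have hl : ∀ j ∈ s, Integrable fun x => ∑ i, ∑ l, ε⁻¹ * (Ω : Set (ℝ × ℝ)).indicator
        (weakPartial Ω l (B.u j i)) (zoom a ε x) * pd l (ψ i) x := fun j hj =>
      integrable_finsetSum _ fun i _ => integrable_finsetSum _ fun l _ =>
        integrable_mul_of_memLp ((MemLp.zoom hε (((hΨ j hj).sob i).memLp_grad l)).const_mul _)
          (((hψ i).der l).memLp 2 volume)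
    have e1 : ∀ x, ∑ i, ∑ l, ε⁻¹ * g i l (zoom a ε x) * pd l (ψ i) x
        = ∑ j ∈ s, ε ^ (j + 2) * ∑ i, ∑ l, ε⁻¹ * (Ω : Set (ℝ × ℝ)).indicator
          (weakPartial Ω l (B.u j i)) (zoom a ε x) * pd l (ψ i) x := fun x => by
      simp only [hg, Fin.sum_univ_two, Finset.sum_mul, Finset.mul_sum, ← Finset.sum_add_distrib]
      exact Finset.sum_congr rfl fun n _ => by ring
    -- The layer pressure has one power of ε less than the velocity. This matches the ε⁻¹ gained by
    -- the velocity gradient in the fast variables.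
    have e2 : ∀ i x, layerPressure ε k B (zoom a ε x) * pd i (ψ i) x
        = ∑ j ∈ s, ε ^ (j + 2) * (ε⁻¹ * B.p j (zoom a ε x) * pd i (ψ i) x) := fun i x => by
      rw [layerPressure, Finset.sum_mul]
      refine Finset.sum_congr rfl fun j _ => ?_
      rw [pow_succ ε (j + 1)]
      field_simp
    rw [setIntegral_eq_integral_of_forall_compl_eq_zero fun x hx =>
      Finset.sum_eq_zero fun i _ => Finset.sum_eq_zero fun l _ => by
        rw [((hψ i).der l).eq_zero hx, mul_zero]]
    simp only [e1, e2]
    rw [integral_finsetSum _ fun j hj => (hl j hj).const_mul _]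
    have e3 : ∀ i, ∫ x, ∑ j ∈ s, ε ^ (j + 2) * (ε⁻¹ * B.p j (zoom a ε x) * pd i (ψ i) x)
        = ∑ j ∈ s, ε ^ (j + 2) * ∫ x, ε⁻¹ * B.p j (zoom a ε x) * pd i (ψ i) x := fun i => by
      rw [integral_finsetSum _ fun j hj => ?_]
      · simp only [integral_const_mul]
      · refine Integrable.const_mul ?_ _
        simp only [mul_assoc]
        exact (((hψ i).der i).integrable_mul (hp j hj)).const_mul _
    simp only [e3, integral_const_mul]
    rw [Finset.sum_comm, Finset.mul_sum]
    refine Finset.sum_congr rfl fun j hjs => ?_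
    rw [← Finset.mul_sum, ← hj j hjs]
    ring

end ThinChannel

end

/-! ### The viscous form and the energy estimate for the error. -/

noncomputable section

namespace ThinChannel

open Filter Topology

/-! ### The viscous form -/

section Form

variable {Ω : Opens (ℝ × ℝ)} {S T K : Fin 2 → Fin 2 → ℝ × ℝ → ℝ}

/-- The matrix field is in `L²(Ω)`. -/
def MatL2 (Ω : Opens (ℝ × ℝ)) (T : Fin 2 → Fin 2 → ℝ × ℝ → ℝ) : Prop :=
  ∀ i j, MemLp (T i j) 2 (volume.restrict Ω)

/-- The integral of the product of the symmetric part of `T` with `K`. -/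
def sform (Ω : Opens (ℝ × ℝ)) (T K : Fin 2 → Fin 2 → ℝ × ℝ → ℝ) : ℝ :=
  ∫ x in Ω, ∑ i, ∑ j, (T i j x + T j i x) / 2 * K i j x

/-- The sum of the `L²` norms of the entries of a matrix field. -/
def matNrm (Ω : Opens (ℝ × ℝ)) (K : Fin 2 → Fin 2 → ℝ × ℝ → ℝ) : ℝ :=
  ∑ i, ∑ j, nrm (volume.restrict Ω) (K i j)

theorem matNrm_nonneg : 0 ≤ matNrm Ω K :=
  Finset.sum_nonneg fun _ _ => Finset.sum_nonneg fun _ _ => nrm_nonneg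

theorem nrm_le_matNrm (i j : Fin 2) : nrm (volume.restrict Ω) (K i j) ≤ matNrm Ω K := by
  rw [matNrm]
  have h' : ∀ f : Fin 2 → Fin 2 → ℝ, (∀ i j, 0 ≤ f i j) → f i j ≤ ∑ i, ∑ j, f i j := fun f hf =>
    (Finset.single_le_sum (f := f i) (fun l _ => hf i l) (Finset.mem_univ j)).trans
      (Finset.single_le_sum (f := fun m => ∑ l, f m l)
        (fun m _ => Finset.sum_nonneg fun l _ => hf m l) (Finset.mem_univ i))
  exact h' (fun i j => nrm (volume.restrict (Ω : Set (ℝ × ℝ))) (K i j)) fun i j => nrm_nonneg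

theorem MatL2.add (hS : MatL2 Ω S) (hT : MatL2 Ω T) : MatL2 Ω (fun i j x => S i j x + T i j x) :=
  fun i j => (hS i j).add (hT i j)

theorem MatL2.sub (hS : MatL2 Ω S) (hT : MatL2 Ω T) : MatL2 Ω (fun i j x => S i j x - T i j x) :=
  fun i j => (hS i j).sub (hT i j)

theorem MatL2.sym (hT : MatL2 Ω T) (i j : Fin 2) :
    MemLp (fun x => (T i j x + T j i x) / 2) 2 (volume.restrict Ω) := by
  have := ((hT i j).add (hT j i)).const_mul (1 / 2)
  refine this.ae_eq (ae_of_all _ fun x => ?_)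
  simp only [Pi.add_apply]; ring

theorem MatL2.integrable_dot (hT : MatL2 Ω T) (hK : MatL2 Ω K) :
    Integrable (fun x => ∑ i, ∑ j, T i j x * K i j x) (volume.restrict Ω) :=
  integrable_finsetSum _ fun i _ => integrable_finsetSum _ fun j _ =>
    integrable_mul_of_memLp (hT i j) (hK i j)

theorem MatL2.integrable_sform (hT : MatL2 Ω T) (hK : MatL2 Ω K) :
    Integrable (fun x => ∑ i, ∑ j, (T i j x + T j i x) / 2 * K i j x) (volume.restrict Ω) :=
  MatL2.integrable_dot (T := fun i j x => (T i j x + T j i x) / 2) hT.sym hK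

theorem sform_add (hS : MatL2 Ω S) (hT : MatL2 Ω T) (hK : MatL2 Ω K) :
    sform Ω (fun i j x => S i j x + T i j x) K = sform Ω S K + sform Ω T K := by
  rw [sform, sform, sform, ← integral_add (hS.integrable_sform hK) (hT.integrable_sform hK)]
  congr with x
  simp only [Fin.sum_univ_two]; ring

theorem sform_sub (hS : MatL2 Ω S) (hT : MatL2 Ω T) (hK : MatL2 Ω K) :
    sform Ω (fun i j x => S i j x - T i j x) K = sform Ω S K - sform Ω T K := by
  rw [sform, sform, sform, ← integral_sub (hS.integrable_sform hK) (hT.integrable_sform hK)]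
  congr with x
  simp only [Fin.sum_univ_two]; ring

theorem abs_sform_le (hT : MatL2 Ω T) (hK : MatL2 Ω K) {A : ℝ}
    (hA : ∀ i j, nrm (volume.restrict Ω) (T i j) ≤ A) : |sform Ω T K| ≤ A * matNrm Ω K := by
  have hi := fun i j => integrable_mul_of_memLp (hT.sym i j) (hK i j)
  rw [sform, integral_finsetSum _ fun i _ => integrable_finsetSum _ fun j _ => hi i j, matNrm,
    Finset.mul_sum]
  refine (Finset.abs_sum_le_sum_abs _ _).trans (Finset.sum_le_sum fun i _ => ?_)
  rw [integral_finsetSum _ fun j _ => hi i j, Finset.mul_sum]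
  refine (Finset.abs_sum_le_sum_abs _ _).trans (Finset.sum_le_sum fun j _ => ?_)
  refine (abs_integral_mul_le (hT.sym i j) (hK i j)).trans
    (mul_le_mul_of_nonneg_right ?_ nrm_nonneg)
  have e1 : ∀ x, (T i j x + T j i x) / 2 = 1 / 2 * (T i j x + T j i x) := fun x => by ring
  simp only [e1]
  rw [nrm_const_mul, abs_of_pos (by norm_num)]
  have := nrm_add_le (f := T i j) (g := T j i) (hT i j) (hT j i)
  linarith [hA i j, hA j i]

/-- Integration by parts in the transposed part of the viscous form. -/
theorem integral_transpose {U ψ : Fin 2 → ℝ × ℝ → ℝ} (hU : ∀ i, HasGrad Ω (U i) (T i))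
    (hψ : ∀ i, MemH10 Ω (ψ i))
    (hdiv : ∀ᵐ x ∂volume.restrict (Ω : Set (ℝ × ℝ)), T 0 0 x + T 1 1 x = 0) :
    ∫ x in Ω, ∑ i, ∑ j, T j i x * weakPartial Ω j (ψ i) x = 0 := by
  have hT := fun i j => (hU i).memLp_grad j
  have hK := fun i j => (weakPartial_spec (hψ i).1 j).1
  have hi := fun a b i j => integrable_mul_of_memLp (hT a b) (hK i j)
  simp only [Fin.sum_univ_two]
  -- Exchanging the derivatives in the two mixed terms gathers everything into the integral of (div
  -- U)(div ψ).
  rw [integral_add (integrable_fun_add (hi 0 0 0 0) (hi 1 0 0 1))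
    (integrable_fun_add (hi 0 1 1 0) (hi 1 1 1 1)), integral_add (hi 0 0 0 0) (hi 1 0 0 1),
    integral_add (hi 0 1 1 0) (hi 1 1 1 1), (hU 1).integral_exchange (hψ 0) 1 0,
    (hU 0).integral_exchange (hψ 1) 0 1, ← integral_add (hi 0 0 0 0) (hi 1 1 0 0),
    ← integral_add (hi 0 0 1 1) (hi 1 1 1 1)]
  have e : ∀ i j, ∫ x in Ω, (T 0 0 x * weakPartial Ω i (ψ j) x + T 1 1 x * weakPartial Ω i (ψ j) x)
      = 0 := fun i j => by
    rw [integral_congr_ae (g := fun _ => 0), integral_zero]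
    filter_upwards [hdiv] with x hx
    rw [← add_mul, hx, zero_mul]
  rw [e, e, add_zero]

/-- For a solenoidal field tested with H¹₀ the transposed gradient contributes nothing, so with
constant viscosity the symmetric form is half of the Dirichlet form. The layer equation with
viscosity ν₀/2 is therefore the exact Stokes equation wherever ν = ν₀. -/
theorem sform_const {U ψ : Fin 2 → ℝ × ℝ → ℝ} (hU : ∀ i, HasGrad Ω (U i) (T i))
    (hψ : ∀ i, MemH10 Ω (ψ i))
    (hdiv : ∀ᵐ x ∂volume.restrict (Ω : Set (ℝ × ℝ)), T 0 0 x + T 1 1 x = 0) (c : ℝ) :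
    sform Ω (fun i j x => c * T i j x) (fun i j => weakPartial Ω j (ψ i))
      = c / 2 * ∫ x in Ω, ∑ i, ∑ j, T i j x * weakPartial Ω j (ψ i) x := by
  have hT : MatL2 Ω T := fun i j => (hU i).memLp_grad j
  have hT' : MatL2 Ω (fun i j => T j i) := fun i j => hT j i
  have hK : MatL2 Ω (fun i j => weakPartial Ω j (ψ i)) := fun i j => (weakPartial_spec (hψ i).1 j).1
  have e1 : ∀ x, ∑ i, ∑ j, (c * T i j x + c * T j i x) / 2 * weakPartial Ω j (ψ i) x
      = c / 2 * ((∑ i, ∑ j, T i j x * weakPartial Ω j (ψ i) x)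
        + ∑ i, ∑ j, T j i x * weakPartial Ω j (ψ i) x) := fun x => by
    simp only [Fin.sum_univ_two]; ring
  rw [sform]
  simp only [e1]
  rw [integral_const_mul, integral_add (hT.integrable_dot hK) (hT'.integrable_dot hK),
    integral_transpose hU hψ hdiv, add_zero]

theorem MemH10.matL2 {ψ : Fin 2 → ℝ × ℝ → ℝ} (hψ : ∀ i, MemH10 Ω (ψ i)) :
    MatL2 Ω (fun i j => weakPartial Ω j (ψ i)) := fun i j => (weakPartial_spec (hψ i).1 j).1

theorem MatL2.axial_mul {ν : ℝ → ℝ} {N : ℝ} (hT : MatL2 Ω T)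
    (hm : AEStronglyMeasurable (fun x : ℝ × ℝ => ν x.1) (volume.restrict Ω))
    (hN : ∀ x ∈ Ω, |ν x.1| ≤ N) : MatL2 Ω (fun i j x => ν x.1 * T i j x) := fun i j =>
  memLp_bdd_mul hm (by
    filter_upwards [ae_restrict_mem Ω.isOpen.measurableSet] with x hx using hN x hx) (hT i j)

/-- Korn's inequality for solenoidal fields with zero boundary values. -/
theorem MemH.korn {z : Fin 2 → ℝ × ℝ → ℝ} (hz : MemH Ω z) {ν : ℝ → ℝ} {κ N : ℝ}
    (hm : AEStronglyMeasurable (fun x : ℝ × ℝ => ν x.1) (volume.restrict Ω))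
    (hN : ∀ x ∈ Ω, |ν x.1| ≤ N) (hκ : ∀ x ∈ Ω, κ ≤ ν x.1) :
    κ / 2 * ∑ i, ∑ j, nrm (volume.restrict Ω) (weakPartial Ω j (z i)) ^ 2
      ≤ sform Ω (fun i j x => ν x.1 * weakPartial Ω j (z i) x)
          (fun i j => weakPartial Ω j (z i)) := by
  have hK := MemH10.matL2 hz.1
  have hdiv : ∀ᵐ x ∂volume.restrict (Ω : Set (ℝ × ℝ)),
      weakPartial Ω 0 (z 0) x + weakPartial Ω 1 (z 1) x = 0 := by
    filter_upwards [hz.2] with x hx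
    rwa [Fin.sum_univ_two] at hx
  -- With the constant κ in place of ν the relation to the Dirichlet integral is an equality.
  -- Passing from κ to ν is then pointwise monotonicity, the integrand being the viscosity times the
  -- square of the symmetric gradient.
  have h1 := sform_const (fun i => (hz.1 i).1.hasGrad) hz.1 hdiv κ
  have h2 : ∫ x in Ω, ∑ i, ∑ j, weakPartial Ω j (z i) x * weakPartial Ω j (z i) x
      = ∑ i, ∑ j, nrm (volume.restrict Ω) (weakPartial Ω j (z i)) ^ 2 := by
    have hi := fun i j => integrable_mul_of_memLp (hK i j) (hK i j)
    rw [integral_finsetSum _ fun i _ => integrable_finsetSum _ fun j _ => hi i j]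
    refine Finset.sum_congr rfl fun i _ => ?_
    rw [integral_finsetSum _ fun j _ => hi i j]
    refine Finset.sum_congr rfl fun j _ => ?_
    rw [nrm_sq (hK i j)]
    simp only [sq]
  rw [h2] at h1
  rw [← h1]
  refine integral_mono_ae (MatL2.integrable_sform (fun i j => (hK i j).const_mul κ) hK)
    ((hK.axial_mul hm hN).integrable_sform hK) ?_
  filter_upwards [ae_restrict_mem Ω.isOpen.measurableSet] with x hx
  simp only [Fin.sum_univ_two]
  nlinarith [mul_nonneg (sub_nonneg.2 (hκ x hx)) (sq_nonneg (weakPartial Ω 0 (z 0) x)),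
    mul_nonneg (sub_nonneg.2 (hκ x hx)) (sq_nonneg (weakPartial Ω 1 (z 1) x)),
    mul_nonneg (sub_nonneg.2 (hκ x hx))
      (sq_nonneg (weakPartial Ω 1 (z 0) x + weakPartial Ω 0 (z 1) x))]

/-- Korn's inequality bounds κ/2 times the sum of the four squared norms, while the square of their
sum is at most four times that. One factor of the sum is then divided out, which leaves 8/κ. -/
theorem MemH.matNrm_le {z : Fin 2 → ℝ × ℝ → ℝ} (hz : MemH Ω z) {ν : ℝ → ℝ} {κ N A : ℝ}
    (hκ0 : 0 < κ)
    (hm : AEStronglyMeasurable (fun x : ℝ × ℝ => ν x.1) (volume.restrict Ω))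
    (hN : ∀ x ∈ Ω, |ν x.1| ≤ N) (hκ : ∀ x ∈ Ω, κ ≤ ν x.1)
    (hA0 : 0 ≤ A) (hA : sform Ω (fun i j x => ν x.1 * weakPartial Ω j (z i) x)
          (fun i j => weakPartial Ω j (z i)) ≤ A * matNrm Ω (fun i j => weakPartial Ω j (z i))) :
    matNrm Ω (fun i j => weakPartial Ω j (z i)) ≤ 8 / κ * A := by
  have h1 := (hz.korn hm hN hκ).trans hA
  set s := matNrm Ω (fun i j => weakPartial Ω j (z i)) with hs
  have h2 : s ^ 2 ≤ 4 * ∑ i, ∑ j, nrm (volume.restrict Ω) (weakPartial Ω j (z i)) ^ 2 := by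
    rw [hs, matNrm]
    simp only [Fin.sum_univ_two]
    generalize nrm (volume.restrict (Ω : Set (ℝ × ℝ))) (weakPartial Ω 0 (z 0)) = a
    generalize nrm (volume.restrict (Ω : Set (ℝ × ℝ))) (weakPartial Ω 1 (z 0)) = b
    generalize nrm (volume.restrict (Ω : Set (ℝ × ℝ))) (weakPartial Ω 0 (z 1)) = c
    generalize nrm (volume.restrict (Ω : Set (ℝ × ℝ))) (weakPartial Ω 1 (z 1)) = d
    nlinarith [sq_nonneg (a - b), sq_nonneg (a - c), sq_nonneg (a - d), sq_nonneg (b - c),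
      sq_nonneg (b - d), sq_nonneg (c - d)]
  have hs0 : 0 ≤ s := matNrm_nonneg
  rw [div_mul_eq_mul_div, le_div_iff₀ hκ0]
  rcases hs0.eq_or_lt with h0 | h0
  · rw [← h0]; nlinarith
  · have h3 : s * (s * κ) ≤ s * (8 * A) := by nlinarith
    exact le_of_mul_le_mul_left h3 h0

end Form

end ThinChannel

end

noncomputable section

namespace ThinChannel

open Filter Topology

/-! ### The error estimate -/

theorem IsTest.memH10 {Ω : Opens (ℝ × ℝ)} {η : ℝ × ℝ → ℝ} (h : IsTest Ω η) : MemH10 Ω η := by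
  have hs : Sob Ω η (fun i => pd i η) := h.sob
  refine memH10_iff.2 ⟨hs.memH1 (ae_eq_refl _), fun δ hδ => ⟨η, h, ?_, fun i => ?_⟩⟩
  · simp [nrm, hδ.le]
  · rw [nrm_congr (g := fun _ => 0)]
    · simp [nrm, hδ.le]
    · filter_upwards [hs.weakPartial_ae (ae_eq_refl _) i] with x hx
      rw [hx, sub_self]

theorem IsTest.weakPartial_ae {Ω : Opens (ℝ × ℝ)} {η : ℝ × ℝ → ℝ} (h : IsTest Ω η) (i : Fin 2) :
    weakPartial Ω i η =ᵐ[volume.restrict Ω] pd i η :=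
  Sob.weakPartial_ae (Ω := Ω) h.sob (ae_eq_refl _) i

theorem sform_congr {Ω : Opens (ℝ × ℝ)} {S T K L : Fin 2 → Fin 2 → ℝ × ℝ → ℝ}
    (h : ∀ i j, S i j =ᵐ[volume.restrict Ω] T i j) (h' : ∀ i j, K i j =ᵐ[volume.restrict Ω] L i j) :
    sform Ω S K = sform Ω T L := by
  refine integral_congr_ae ?_
  filter_upwards [h 0 0, h 0 1, h 1 0, h 1 1, h' 0 0, h' 0 1, h' 1 0, h' 1 1]
    with x a1 a2 a3 a4 b1 b2 b3 b4
  simp only [Fin.sum_univ_two, a1, a2, a3, a4, b1, b2, b3, b4]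

theorem mem_channel_abs_le {ε : ℝ} {x : ℝ × ℝ} (hx : x ∈ channel ε) : |x.2| ≤ ε / 2 :=
  abs_le.2 ⟨hx.2.1.le, hx.2.2.le⟩

/-- An approximate solution of the Stokes problem: `v` and `q` are the regular parts of the velocity
and of the pressure, `r` is their residual, `w` is a correction of the boundary values, and
`U₀`, `U₁` are the boundary layers. All the errors are bounded by `A`. -/
structure ApproxSolution (ε ν₀ : ℝ) (ν₁ f₁ : ℝ → ℝ) (A : ℝ)
    (v r w U₀ V₀ b₀ U₁ V₁ b₁ : Fin 2 → ℝ × ℝ → ℝ)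
    (q P₀ P₁ : ℝ × ℝ → ℝ) (Q W G₀ H₀ G₁ H₁ : Fin 2 → Fin 2 → ℝ × ℝ → ℝ) : Prop where
  grad : ∀ i, HasGrad (channel ε) (v i) (Q i)
  div : ∀ x ∈ channel ε, Q 0 0 x + Q 1 1 x = 0
  residual_memLp : ∀ i, MemLp (r i) 2 (volume.restrict (channel ε))
  residual_le : ∀ i, nrm (volume.restrict (channel ε)) (r i) ≤ A
  momentum : ∀ ψ : Fin 2 → ℝ × ℝ → ℝ, (∀ i, MemH10 (channel ε) (ψ i)) →
    (∫ x in channel ε, (ν₀ + ν₁ x.1) * ∑ i, ∑ j, (Q i j x + Q j i x) / 2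
        * weakPartial (channel ε) j (ψ i) x)
      - ∑ i, ∫ x in channel ε, q x * weakPartial (channel ε) i (ψ i) x
    = (∫ x in channel ε, f₁ x.1 * ψ 0 x) + ∑ i, ∫ x in channel ε, r i x * ψ i x
  pressure : ContinuousOn q (closure (channel ε))
  lift_grad : ∀ i, HasGrad (channel ε) (w i) (W i)
  lift_div : ∀ x ∈ channel ε, W 0 0 x + W 1 1 x = 0
  lift_le : ∀ i, nrm (volume.restrict (channel ε)) (w i) ≤ A
  lift_grad_le : ∀ i j, nrm (volume.restrict (channel ε)) (W i j) ≤ A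
  left : EndApprox ε ν₀ ν₁ A U₀ P₀ b₀ V₀ G₀ H₀
  right : EndApprox ε ν₀ ν₁ A U₁ P₁ b₁ V₁ G₁ H₁

namespace ApproxSolution

variable {ε ν₀ N κ A : ℝ} {ν₁ f₁ φ₀ φ₁ : ℝ → ℝ} {u v r w U₀ V₀ b₀ U₁ V₁ b₁ : Fin 2 → ℝ × ℝ → ℝ}
    {q P₀ P₁ : ℝ × ℝ → ℝ} {Q W G₀ H₀ G₁ H₁ : Fin 2 → Fin 2 → ℝ × ℝ → ℝ}
    {p : Distribution (channel ε) ℝ ⊤}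

/-- The gradient of the error. -/
def errGrad (ε : ℝ) (u : Fin 2 → ℝ × ℝ → ℝ) (Q G₀ G₁ : Fin 2 → Fin 2 → ℝ × ℝ → ℝ) (i j : Fin 2)
    (x : ℝ × ℝ) : ℝ := Q i j x + G₀ i j x + G₁ i j x - weakPartial (channel ε) j (u i) x

theorem hasGrad_err (h : ApproxSolution ε ν₀ ν₁ f₁ A v r w U₀ V₀ b₀ U₁ V₁ b₁ q P₀ P₁ Q W G₀ H₀ G₁ H₁)
    (hu : ∀ i, MemH1 (channel ε) (u i)) (i : Fin 2) :
    HasGrad (channel ε) (fun x => v i x + U₀ i x + U₁ i x - u i x) (errGrad ε u Q G₀ G₁ i) :=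
  (((h.grad i).add (h.left.grad i)).add (h.right.grad i)).sub (hu i).hasGrad

section Measurable

variable {ν : ℝ → ℝ}

theorem aestronglyMeasurable_axial (hν : ContinuousOn ν (Ioo 0 1)) :
    AEStronglyMeasurable (fun x : ℝ × ℝ => ν x.1) (volume.restrict (channel ε)) :=
  (hν.comp continuousOn_fst fun _ hx => hx.1 : ContinuousOn (fun x : ℝ × ℝ => ν x.1)
    (channel ε)).aestronglyMeasurable (channel ε).isOpen.measurableSet

theorem matL2_axial {T : Fin 2 → Fin 2 → ℝ × ℝ → ℝ} (hν : ContinuousOn ν (Ioo 0 1))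
    (hN : ∀ t ∈ Ioo (0 : ℝ) 1, |ν t| ≤ N) (hT : MatL2 (channel ε) T) :
    MatL2 (channel ε) (fun i j x => ν x.1 * T i j x) :=
  hT.axial_mul (aestronglyMeasurable_axial hν) fun _ hx => hN _ hx.1

end Measurable

/-- The equation for the error, tested with a field with zero boundary values. -/
theorem balance (h : ApproxSolution ε ν₀ ν₁ f₁ A v r w U₀ V₀ b₀ U₁ V₁ b₁ q P₀ P₁ Q W G₀ H₀ G₁ H₁)
    (hν : ContinuousOn ν₁ (Ioo 0 1)) (hN : ∀ t ∈ Ioo (0 : ℝ) 1, |ν₁ t| ≤ N)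
    (hu : ∀ i, MemH1 (channel ε) (u i)) {ψ : Fin 2 → ℝ × ℝ → ℝ}
    (hψ : ∀ i, MemH10 (channel ε) (ψ i)) :
    sform (channel ε) (fun i j x => (ν₀ + ν₁ x.1) * errGrad ε u Q G₀ G₁ i j x)
        (fun i j => weakPartial (channel ε) j (ψ i))
      = (∑ i, ∫ x in channel ε, r i x * ψ i x)
        + sform (channel ε) (fun i j x => ν₁ x.1 * G₀ i j x)
            (fun i j => weakPartial (channel ε) j (ψ i))
        + sform (channel ε) (fun i j x => ν₁ x.1 * G₁ i j x)
            (fun i j => weakPartial (channel ε) j (ψ i))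
        + (∑ i, ∫ x in channel ε, q x * weakPartial (channel ε) i (ψ i) x)
        + ν₀ / 2 * (∫ x in channel ε, ∑ i, ∑ j, G₀ i j x * weakPartial (channel ε) j (ψ i) x)
        + ν₀ / 2 * (∫ x in channel ε, ∑ i, ∑ j, G₁ i j x * weakPartial (channel ε) j (ψ i) x)
        + (∫ x in channel ε, f₁ x.1 * ψ 0 x)
        - sform (channel ε) (fun i j x => (ν₀ + ν₁ x.1) * weakPartial (channel ε) j (u i) x)
            (fun i j => weakPartial (channel ε) j (ψ i)) := by
  set Ω := channel ε
  set K : Fin 2 → Fin 2 → ℝ × ℝ → ℝ := fun i j => weakPartial Ω j (ψ i) with hKdef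
  have hK : MatL2 Ω K := MemH10.matL2 hψ
  have hν' : ContinuousOn (fun t => ν₀ + ν₁ t) (Ioo 0 1) := continuousOn_const.add hν
  have hN' : ∀ t ∈ Ioo (0 : ℝ) 1, |ν₀ + ν₁ t| ≤ |ν₀| + N := fun t ht =>
    (abs_add_le _ _).trans (add_le_add le_rfl (hN t ht))
  have lQ : MatL2 Ω Q := fun i j => (h.grad i).memLp_grad j
  have l0 : MatL2 Ω G₀ := fun i j => (h.left.grad i).memLp_grad j
  have l1 : MatL2 Ω G₁ := fun i j => (h.right.grad i).memLp_grad j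
  have lu : MatL2 Ω (fun i j => weakPartial Ω j (u i)) := fun i j => (weakPartial_spec (hu i) j).1
  have mQ := matL2_axial hν' hN' lQ
  have mu := matL2_axial hν' hN' lu
  have m0 := matL2_axial hν hN l0
  have m1 := matL2_axial hν hN l1
  have c0 : MatL2 Ω (fun i j x => ν₀ * G₀ i j x) := fun i j => (l0 i j).const_mul ν₀
  have c1 : MatL2 Ω (fun i j x => ν₀ * G₁ i j x) := fun i j => (l1 i j).const_mul ν₀
  have e1 : (fun i j x => (ν₀ + ν₁ x.1) * errGrad ε u Q G₀ G₁ i j x)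
      = fun i j (x : ℝ × ℝ) => ((ν₀ + ν₁ x.1) * Q i j x + ((ν₀ * G₀ i j x + ν₁ x.1 * G₀ i j x)
        + (ν₀ * G₁ i j x + ν₁ x.1 * G₁ i j x)))
        - (ν₀ + ν₁ x.1) * weakPartial Ω j (u i) x := by
    funext i j x
    rw [errGrad]; ring
  rw [e1, sform_sub (mQ.add ((c0.add m0).add (c1.add m1))) mu hK,
    sform_add mQ ((c0.add m0).add (c1.add m1)) hK, sform_add (c0.add m0) (c1.add m1) hK,
    sform_add c0 m0 hK, sform_add c1 m1 hK,
    sform_const h.left.grad hψ h.left.div ν₀, sform_const h.right.grad hψ h.right.div ν₀]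
  have e2 : sform Ω (fun i j x => (ν₀ + ν₁ x.1) * Q i j x) K
      = ∫ x in Ω, (ν₀ + ν₁ x.1) * ∑ i, ∑ j, (Q i j x + Q j i x) / 2 * weakPartial Ω j (ψ i) x := by
    rw [sform]
    congr with x
    simp only [hKdef, Fin.sum_univ_two]; ring
  rw [e2]
  linarith [h.momentum ψ hψ]

/-- Poincaré's inequality across the channel bounds ψ by ε times its gradient. The factor ε gained
is not needed and is estimated by one. -/
theorem abs_residual_le
    (h : ApproxSolution ε ν₀ ν₁ f₁ A v r w U₀ V₀ b₀ U₁ V₁ b₁ q P₀ P₁ Q W G₀ H₀ G₁ H₁)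
    (hε : 0 < ε) (hε1 : ε ≤ 1) {ψ : Fin 2 → ℝ × ℝ → ℝ} (hψ : ∀ i, MemH10 (channel ε) (ψ i)) :
    |∑ i, ∫ x in channel ε, r i x * ψ i x|
      ≤ A * matNrm (channel ε) (fun i j => weakPartial (channel ε) j (ψ i)) := by
  rw [matNrm, Finset.mul_sum]
  refine (Finset.abs_sum_le_sum_abs _ _).trans (Finset.sum_le_sum fun i _ => ?_)
  refine (abs_integral_mul_le (h.residual_memLp i) (hψ i).1.1).trans ?_
  have hA : 0 ≤ A := nrm_nonneg.trans (h.residual_le i)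
  refine mul_le_mul (h.residual_le i) ?_ nrm_nonneg hA
  have h1 := (hψ i).poincare (h := ε / 2) (by linarith) fun x hx => mem_channel_abs_le hx
  refine h1.trans ?_
  rw [Fin.sum_univ_two, show 2 * (ε / 2) = ε by ring]
  have h2 := mul_le_of_le_one_left
    (nrm_nonneg (μ := volume.restrict (channel ε : Set (ℝ × ℝ)))
      (f := weakPartial (channel ε) 1 (ψ i))) hε1
  have h3 := nrm_nonneg (μ := volume.restrict (channel ε : Set (ℝ × ℝ)))
    (f := weakPartial (channel ε) 0 (ψ i))
  linarith

/-- Pressures do not act on solenoidal fields, so the regular pressure disappears from the velocity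
estimate. -/
theorem integral_mul_div {Ω : Opens (ℝ × ℝ)} {ψ : Fin 2 → ℝ × ℝ → ℝ} (hψ : MemH Ω ψ)
    (hq : MemLp q 2 (volume.restrict Ω)) :
    ∑ i, ∫ x in Ω, q x * weakPartial Ω i (ψ i) x = 0 := by
  have hi := fun i => integrable_mul_of_memLp hq (weakPartial_spec (hψ.1 i).1 i).1
  rw [← integral_finsetSum _ fun i _ => hi i, integral_congr_ae (g := fun _ => 0), integral_zero]
  filter_upwards [hψ.2] with x hx
  rw [← Finset.mul_sum, hx, mul_zero]

theorem memLp_of_continuousOn_closure (hq : ContinuousOn q (closure (channel ε))) :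
    MemLp q 2 (volume.restrict (channel ε)) := by
  have hb : Bornology.IsBounded (closure (channel ε : Set (ℝ × ℝ))) :=
    ((Metric.isBounded_Ioo 0 1).prod (Metric.isBounded_Ioo _ _)).closure
  obtain ⟨C, hC⟩ := (Metric.isCompact_of_isClosed_isBounded isClosed_closure
    hb).exists_bound_of_continuousOn hq
  have : IsFiniteMeasure (volume.restrict (channel ε : Set (ℝ × ℝ))) :=
    ⟨by rw [Measure.restrict_apply_univ, volume_channel ε]; exact ENNReal.ofReal_lt_top⟩
  refine MemLp.of_bound ((hq.mono subset_closure).aestronglyMeasurable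
    (channel ε).isOpen.measurableSet) C ?_
  filter_upwards [ae_restrict_mem (channel ε).isOpen.measurableSet] with x hx
    using hC x (subset_closure hx)

/-- The estimate of the velocity. -/
theorem velocity_le
    (h : ApproxSolution ε ν₀ ν₁ f₁ A v r w U₀ V₀ b₀ U₁ V₁ b₁ q P₀ P₁ Q W G₀ H₀ G₁ H₁)
    (hε : 0 < ε) (hε1 : ε ≤ 1) (hν : ContinuousOn ν₁ (Ioo 0 1))
    (hN : ∀ t ∈ Ioo (0 : ℝ) 1, |ν₁ t| ≤ N) (hκ0 : 0 < κ) (hκ : ∀ t ∈ Ioo (0 : ℝ) 1, κ ≤ ν₀ + ν₁ t)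
    (hu : IsStokesSolution ε (fun t => ν₀ + ν₁ t) f₁ φ₀ φ₁ u p)
    (hz : ∀ i, MemH10 (channel ε) (fun x => v i x + V₀ i x + V₁ i x - w i x - u i x)) :
    (∀ i, nrm (volume.restrict (channel ε)) (fun x => v i x + U₀ i x + U₁ i x - u i x)
      ≤ (8 / κ * (3 + 3 * (|ν₀| + N)) + 3) * A) ∧
    ∀ i j, nrm (volume.restrict (channel ε)) (errGrad ε u Q G₀ G₁ i j)
      ≤ (8 / κ * (3 + 3 * (|ν₀| + N)) + 3) * A := by
  set Ω := channel ε
  have hA : 0 ≤ A := nrm_nonneg.trans (h.residual_le 0)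
  have hΩm := Ω.isOpen.measurableSet
  -- The true error is not admissible as a test field. In z the layers are replaced by their cut off
  -- versions and the lift is subtracted. The gradient of z differs from that of the error by `E`,
  -- of size 3A.
  set z : Fin 2 → ℝ × ℝ → ℝ := fun i x => v i x + V₀ i x + V₁ i x - w i x - u i x with hzdef
  have hzg : ∀ i, HasGrad Ω (z i) (fun j x => Q i j x + H₀ i j x + H₁ i j x - W i j x
      - weakPartial Ω j (u i) x) := fun i =>
    ((((h.grad i).add (h.left.grad_cut i)).add (h.right.grad_cut i)).sub (h.lift_grad i)).sub
      (hu.memH1 i).hasGrad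
  have hzH : MemH Ω z := by
    refine ⟨hz, ?_⟩
    filter_upwards [(hzg 0).grad 0, (hzg 1).grad 1, h.left.div_cut, h.right.div_cut, hu.divFree,
      ae_restrict_mem hΩm] with x a1 a2 a3 a4 a5 hx
    rw [Fin.sum_univ_two] at a5 ⊢
    rw [a1, a2]
    linarith [h.div x hx, h.lift_div x hx]
  have hK : MatL2 Ω (fun i j => weakPartial Ω j (z i)) := MemH10.matL2 hz
  have hν' : ContinuousOn (fun t => ν₀ + ν₁ t) (Ioo 0 1) := continuousOn_const.add hν
  have hN' : ∀ t ∈ Ioo (0 : ℝ) 1, |ν₀ + ν₁ t| ≤ |ν₀| + N := fun t ht =>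
    (abs_add_le _ _).trans (add_le_add le_rfl (hN t ht))
  have hN0 : 0 ≤ |ν₀| + N := (abs_nonneg _).trans (hN' (1 / 2) (by norm_num))
  have lΔ : MatL2 Ω (errGrad ε u Q G₀ G₁) := fun i j => (h.hasGrad_err hu.memH1 i).memLp_grad j
  set E : Fin 2 → Fin 2 → ℝ × ℝ → ℝ := fun i j x =>
    (H₀ i j x - G₀ i j x) + (H₁ i j x - G₁ i j x) - W i j x with hE
  have l0 : MatL2 Ω (fun i j x => H₀ i j x - G₀ i j x) := MatL2.sub
    (fun i j => (h.left.grad_cut i).memLp_grad j) fun i j => (h.left.grad i).memLp_grad j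
  have l1 : MatL2 Ω (fun i j x => H₁ i j x - G₁ i j x) := MatL2.sub
    (fun i j => (h.right.grad_cut i).memLp_grad j) fun i j => (h.right.grad i).memLp_grad j
  have lW : MatL2 Ω W := fun i j => (h.lift_grad i).memLp_grad j
  have lE : MatL2 Ω E := (l0.add l1).sub lW
  have hEle : ∀ i j, nrm (volume.restrict Ω) (E i j) ≤ 3 * A := fun i j => by
    have t1 := nrm_sub_le (f := fun x => (H₀ i j x - G₀ i j x) + (H₁ i j x - G₁ i j x)) (g := W i j)
      ((l0.add l1) i j) (lW i j)
    have t2 := nrm_add_le (f := fun x => H₀ i j x - G₀ i j x) (g := fun x => H₁ i j x - G₁ i j x)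
      (l0 i j) (l1 i j)
    have t3 : nrm (volume.restrict Ω) (E i j) ≤ _ := t1
    linarith [h.left.close_grad i j, h.right.close_grad i j, h.lift_grad_le i j]
  have hKE : ∀ i j, weakPartial Ω j (z i) =ᵐ[volume.restrict Ω]
      fun x => errGrad ε u Q G₀ G₁ i j x + E i j x := fun i j => by
    filter_upwards [(hzg i).grad j] with x hx
    rw [hx, errGrad, hE]; ring
  have hνm := aestronglyMeasurable_axial (ε := ε) hν'
  have hνE : ∀ i j, nrm (volume.restrict Ω) (fun x => (ν₀ + ν₁ x.1) * E i j x)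
      ≤ (|ν₀| + N) * (3 * A) := fun i j =>
    (nrm_bdd_mul_le hN0 (by
      filter_upwards [ae_restrict_mem hΩm] with x hx using hN' _ hx.1) (lE i j)).trans
      (mul_le_mul_of_nonneg_left (hEle i j) hN0)
  have hbal := h.balance hν hN hu.memH1 hz
  have hst : sform Ω (fun i j x => (ν₀ + ν₁ x.1) * weakPartial Ω j (u i) x)
      (fun i j => weakPartial Ω j (z i)) = ∫ x in Ω, f₁ x.1 * z 0 x := by
    rw [← hu.weak z hzH, sform]
    congr with x
    simp only [symGrad, Fin.sum_univ_two]; ring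
  -- For the solenoidal z the pressure term and both layer terms vanish, and the force cancels
  -- against the weak equation of u.
  rw [hst, integral_mul_div hzH (memLp_of_continuousOn_closure h.pressure), h.left.weak z hzH,
    h.right.weak z hzH] at hbal
  -- The first 3 counts the residual and the two terms ν₁∇U. The second is the bound 3A of `E`,
  -- multiplied by the bound of the viscosity.
  have henergy : sform Ω (fun i j x => (ν₀ + ν₁ x.1) * weakPartial Ω j (z i) x)
      (fun i j => weakPartial Ω j (z i)) ≤ ((3 + 3 * (|ν₀| + N)) * A) *
        matNrm Ω (fun i j => weakPartial Ω j (z i)) := by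
    have e1 : sform Ω (fun i j x => (ν₀ + ν₁ x.1) * weakPartial Ω j (z i) x)
        (fun i j => weakPartial Ω j (z i))
        = sform Ω (fun i j x => (ν₀ + ν₁ x.1) * errGrad ε u Q G₀ G₁ i j x)
            (fun i j => weakPartial Ω j (z i))
          + sform Ω (fun i j x => (ν₀ + ν₁ x.1) * E i j x) (fun i j => weakPartial Ω j (z i)) := by
      rw [← sform_add (matL2_axial hν' hN' lΔ) (matL2_axial hν' hN' lE) hK]
      refine sform_congr (fun i j => ?_) fun i j => ae_eq_refl _
      filter_upwards [hKE i j] with x hx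
      rw [hx, mul_add]
    have b0 := (abs_le.1 (abs_sform_le (matL2_axial hν hN fun i j => (h.left.grad i).memLp_grad j)
      hK h.left.small)).2
    have b1 := (abs_le.1 (abs_sform_le (matL2_axial hν hN fun i j => (h.right.grad i).memLp_grad j)
      hK h.right.small)).2
    have b2 := (abs_le.1 (h.abs_residual_le hε hε1 hz)).2
    have b3 := (abs_le.1 (abs_sform_le (matL2_axial hν' hN' lE) hK hνE)).2
    rw [e1, hbal]
    linarith
  have hS := hzH.matNrm_le (ν := fun t => ν₀ + ν₁ t) (κ := κ) (N := |ν₀| + N)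
    (A := (3 + 3 * (|ν₀| + N)) * A) hκ0 hνm (fun x hx => hN' _ hx.1) (fun x hx => hκ _ hx.1)
    (mul_nonneg (by linarith) hA) henergy
  -- Going back from z to the true error costs at most 3A: one A for each layer and one for the
  -- lift.
  constructor
  · intro i
    have t0 := (hz i).poincare (h := ε / 2) (by linarith) fun x hx => mem_channel_abs_le hx
    rw [show 2 * (ε / 2) = ε by ring] at t0
    have t1 : nrm (volume.restrict Ω) (z i) ≤ matNrm Ω (fun i j => weakPartial Ω j (z i)) :=
      (t0.trans (mul_le_of_le_one_left nrm_nonneg hε1)).trans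
        (nrm_le_matNrm (K := fun i j => weakPartial Ω j (z i)) i 1)
    have m0 : MemLp (fun x => V₀ i x - U₀ i x) 2 (volume.restrict Ω) :=
      ((h.left.grad_cut i).sub (h.left.grad i)).memLp
    have m1 : MemLp (fun x => V₁ i x - U₁ i x) 2 (volume.restrict Ω) :=
      ((h.right.grad_cut i).sub (h.right.grad i)).memLp
    have mw : MemLp (w i) 2 (volume.restrict Ω) := (h.lift_grad i).memLp
    have mz : MemLp (z i) 2 (volume.restrict Ω) := (hz i).1.1
    have ma : MemLp (fun x => z i x + w i x) 2 (volume.restrict Ω) := mz.add mw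
    have mb : MemLp (fun x => z i x + w i x - (V₀ i x - U₀ i x)) 2 (volume.restrict Ω) := ma.sub m0
    have s1 := nrm_add_le (f := z i) (g := w i) mz mw
    have s2 := nrm_sub_le (f := fun x => z i x + w i x) (g := fun x => V₀ i x - U₀ i x) ma m0
    have s3 := nrm_sub_le (f := fun x => z i x + w i x - (V₀ i x - U₀ i x))
      (g := fun x => V₁ i x - U₁ i x) mb m1
    have e1 : (fun x => v i x + U₀ i x + U₁ i x - u i x)
        = fun x => z i x + w i x - (V₀ i x - U₀ i x) - (V₁ i x - U₁ i x) := by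
      funext x; simp only [hzdef]; ring
    rw [e1]
    linarith [h.left.close i, h.right.close i, h.lift_le i]
  · intro i j
    have s1 := nrm_sub_le (f := weakPartial Ω j (z i)) (g := E i j) (hK i j) (lE i j)
    have e1 : nrm (volume.restrict Ω) (errGrad ε u Q G₀ G₁ i j)
        = nrm (volume.restrict Ω) (fun x => weakPartial Ω j (z i) x - E i j x) := by
      refine nrm_congr ?_
      filter_upwards [hKE i j] with x hx
      rw [hx, add_sub_cancel_right]
    rw [e1]
    have s2 := nrm_le_matNrm (Ω := Ω) (K := fun i j => weakPartial Ω j (z i)) i j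
    linarith [hEle i j]

/-- The estimate of the pressure. -/
theorem pressure_le
    (h : ApproxSolution ε ν₀ ν₁ f₁ A v r w U₀ V₀ b₀ U₁ V₁ b₁ q P₀ P₁ Q W G₀ H₀ G₁ H₁)
    (hε : 0 < ε) (hε1 : ε ≤ 1) (hν : ContinuousOn ν₁ (Ioo 0 1))
    (hN : ∀ t ∈ Ioo (0 : ℝ) 1, |ν₁ t| ≤ N)
    (hu : IsStokesSolution ε (fun t => ν₀ + ν₁ t) f₁ φ₀ φ₁ u p) {C : ℝ}
    (hΔ : ∀ i j, nrm (volume.restrict (channel ε)) (errGrad ε u Q G₀ G₁ i j) ≤ C * A)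
    (ψ : Fin 2 → 𝓓(channel ε, ℝ)) :
    |∑ i, (ThinChannel.grad (toDistribution (channel ε) (fun x => q x + P₀ x + P₁ x)) i
        - ThinChannel.grad p i) (ψ i)|
      ≤ ((|ν₀| + N) * C + 3) * A * matNrm (channel ε) (fun i j => pd j (ψ i)) := by
  have hm := (channel ε).isOpen.measurableSet
  have ht := fun i => isTest_testFunction (ψ i)
  have hψ : ∀ i, MemH10 (channel ε) (ψ i) := fun i => (ht i).memH10
  have hw : ∀ i j, weakPartial (channel ε) j (ψ i) =ᵐ[volume.restrict (channel ε)]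
      pd j (ψ i) := fun i j =>
    (ht i).weakPartial_ae j
  have hK : MatL2 (channel ε) (fun i j => weakPartial (channel ε) j (ψ i)) := MemH10.matL2 hψ
  have hν' : ContinuousOn (fun t => ν₀ + ν₁ t) (Ioo 0 1) := continuousOn_const.add hν
  have hN' : ∀ t ∈ Ioo (0 : ℝ) 1, |ν₀ + ν₁ t| ≤ |ν₀| + N := fun t ht =>
    (abs_add_le _ _).trans (add_le_add le_rfl (hN t ht))
  have hN0 : 0 ≤ |ν₀| + N := (abs_nonneg _).trans (hN' (1 / 2) (by norm_num))
  have lΔ : MatL2 (channel ε) (errGrad ε u Q G₀ G₁) := fun i j =>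
    (h.hasGrad_err hu.memH1 i).memLp_grad j
  have hνΔ : ∀ i j, nrm (volume.restrict (channel ε))
      (fun x => (ν₀ + ν₁ x.1) * errGrad ε u Q G₀ G₁ i j x)
      ≤ (|ν₀| + N) * (C * A) := fun i j =>
    (nrm_bdd_mul_le hN0 (by
      filter_upwards [ae_restrict_mem hm] with x hx using hN' _ hx.1) (lΔ i j)).trans
      (mul_le_mul_of_nonneg_left (hΔ i j) hN0)
  have hmat : matNrm (channel ε) (fun i j => weakPartial (channel ε) j (ψ i))
      = matNrm (channel ε) (fun i j => pd j (ψ i)) := by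
    simp only [matNrm, fun i j => nrm_congr (hw i j)]
  have hbal := h.balance hν hN hu.memH1 hψ
  have hq : LocallyIntegrableOn q (channel ε) :=
    ((h.pressure.mono subset_closure).locallyIntegrableOn hm)
  have hmom := hu.momentum ψ
  have hst : sform (channel ε) (fun i j x => (ν₀ + ν₁ x.1) * weakPartial (channel ε) j (u i) x)
      (fun i j => weakPartial (channel ε) j (ψ i)) = ∫ x in channel ε, (ν₀ + ν₁ x.1) *
        ∑ i, ∑ j, symGrad (channel ε) u i j x * (∂_{e j} (ψ i)) x := by
    rw [sform_congr (fun i j => ae_eq_refl _) hw, sform]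
    simp only [lineDeriv_eq_pd]
    congr with x
    simp only [symGrad, Fin.sum_univ_two]; ring
  have hG : ∀ G : Fin 2 → Fin 2 → ℝ × ℝ → ℝ,
      ∫ x in channel ε, ∑ i, ∑ j, G i j x * weakPartial (channel ε) j (ψ i) x
        = ∫ x in channel ε, ∑ i, ∑ j, G i j x * pd j (ψ i) x := fun G => by
    refine integral_congr_ae ?_
    filter_upwards [hw 0 0, hw 0 1, hw 1 0, hw 1 1] with x a1 a2 a3 a4
    simp only [Fin.sum_univ_two, a1, a2, a3, a4]
  have hqi : ∀ i, ∫ x in channel ε, q x * weakPartial (channel ε) i (ψ i) x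
      = ∫ x, q x * pd i (ψ i) x := fun i => by
    rw [← setIntegral_test (Ω := channel ε) (fun x hx => ((ht i).der i).eq_zero hx) q]
    refine integral_congr_ae ?_
    filter_upwards [hw i i] with x hx
    rw [hx]
  -- Here ψ need not be solenoidal. The layer terms then become the layer pressures tested with div
  -- ψ, and together with the regular pressure and the exact momentum equation they form the
  -- gradient of the pressure error. What remains are quantities already estimated.
  rw [hst, hG, hG, h.left.pressure _ ht, h.right.pressure _ ht] at hbal
  rw [Finset.sum_congr rfl fun i _ => hqi i] at hbal
  have hp : ∀ i, ThinChannel.grad (toDistribution (channel ε) (fun x => q x + P₀ x + P₁ x)) i (ψ i)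
      = -((∫ x, q x * pd i (ψ i) x) + (∫ x, P₀ x * pd i (ψ i) x) + ∫ x, P₁ x * pd i (ψ i) x) := by
    intro i
    have hl : LocallyIntegrableOn (fun x => q x + P₀ x + P₁ x) (channel ε) :=
      (hq.add h.left.locallyIntegrable).add h.right.locallyIntegrable
    have i0 := ((ht i).der i).integrable_mul hq
    have i1 := ((ht i).der i).integrable_mul h.left.locallyIntegrable
    have i2 := ((ht i).der i).integrable_mul h.right.locallyIntegrable
    rw [grad_toDistribution_apply hl, ← integral_add i0 i1,
      ← integral_add (integrable_fun_add i0 i1) i2]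
    simp only [add_mul]
  have hid : ∑ i, (ThinChannel.grad (toDistribution (channel ε) (fun x => q x + P₀ x + P₁ x)) i
        - ThinChannel.grad p i) (ψ i)
      = (∑ i, ∫ x in channel ε, r i x * ψ i x)
        + sform (channel ε) (fun i j x => ν₁ x.1 * G₀ i j x) (fun i j => weakPartial (channel ε) j (ψ i))
        + sform (channel ε) (fun i j x => ν₁ x.1 * G₁ i j x) (fun i j => weakPartial (channel ε) j (ψ i))
        - sform (channel ε) (fun i j x => (ν₀ + ν₁ x.1) * errGrad ε u Q G₀ G₁ i j x)
          (fun i j => weakPartial (channel ε) j (ψ i)) := by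
    have : ∀ i, (ThinChannel.grad (toDistribution (channel ε) (fun x => q x + P₀ x + P₁ x)) i
        - ThinChannel.grad p i) (ψ i)
        = ThinChannel.grad (toDistribution (channel ε) (fun x => q x + P₀ x + P₁ x)) i (ψ i)
          - ThinChannel.grad p i (ψ i) :=
      fun i => rfl
    simp only [this, hp]
    simp only [Fin.sum_univ_two] at hbal hmom ⊢
    linarith
  have b0 := abs_sform_le (matL2_axial hν hN fun i j => (h.left.grad i).memLp_grad j)
    hK h.left.small
  have b1 := abs_sform_le (matL2_axial hν hN fun i j => (h.right.grad i).memLp_grad j)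
    hK h.right.small
  have b2 := h.abs_residual_le hε hε1 hψ
  have b3 := abs_sform_le (matL2_axial hν' hN' lΔ) hK hνΔ
  rw [hid, ← hmat]
  refine (abs_sub _ _).trans ((add_le_add ((abs_add_le _ _).trans
    (add_le_add (abs_add_le _ _) le_rfl)) le_rfl).trans ?_)
  linarith

end ApproxSolution

end ThinChannel

end

/-! ### Norms, cancellation of the boundary values and conclusion. -/

noncomputable section

namespace ThinChannel

open Filter Topology

/-! ### Norms -/

/-- The squared norm is a sum of six squares, two for the components and four for the derivatives,
and 6 ≤ 3². -/
theorem h1Norm_le {Ω : Opens (ℝ × ℝ)} {d : Fin 2 → ℝ × ℝ → ℝ} {g : Fin 2 → Fin 2 → ℝ × ℝ → ℝ}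
    (h : ∀ i, HasGrad Ω (d i) (g i)) {M : ℝ} (hM : 0 ≤ M)
    (h0 : ∀ i, nrm (volume.restrict Ω) (d i) ≤ M)
    (h1 : ∀ i j, nrm (volume.restrict Ω) (g i j) ≤ M) : h1Norm Ω d ≤ ENNReal.ofReal (3 * M) := by
  have hsq : ∀ {a : ℝ}, 0 ≤ a → a ≤ M → a ^ 2 ≤ M ^ 2 := fun ha haM => by gcongr
  have hle : ∑ i, h1NormSq Ω (d i) ≤ ENNReal.ofReal ((3 * M) ^ 2) := by
    rw [Finset.sum_congr rfl fun i _ => h1NormSq_eq (h i).memH1,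
      ← ENNReal.ofReal_sum_of_nonneg fun i _ => by positivity]
    refine ENNReal.ofReal_le_ofReal ?_
    simp only [fun i j => nrm_congr ((h i).grad j), Fin.sum_univ_two]
    linarith [hsq nrm_nonneg (h0 0), hsq nrm_nonneg (h0 1), hsq nrm_nonneg (h1 0 0),
      hsq nrm_nonneg (h1 0 1), hsq nrm_nonneg (h1 1 0), hsq nrm_nonneg (h1 1 1), sq_nonneg M]
  refine (ENNReal.rpow_le_rpow hle (by norm_num)).trans (le_of_eq ?_)
  rw [ENNReal.ofReal_rpow_of_nonneg (sq_nonneg _) (by norm_num), ← Real.sqrt_eq_rpow,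
    Real.sqrt_sq (by positivity)]

/-- The sum of the four norms of derivatives is at most √4 = 2 times the L² norm of the gradient
used in the dual norm. -/
theorem hMinusOneNorm_le {Ω : Opens (ℝ × ℝ)} {T : Fin 2 → Distribution Ω ℝ ⊤} {M : ℝ} (hM : 0 ≤ M)
    (h : ∀ ψ : Fin 2 → 𝓓(Ω, ℝ), |∑ i, T i (ψ i)| ≤ M * matNrm Ω (fun i j => pd j (ψ i))) :
    hMinusOneNorm T ≤ ENNReal.ofReal (2 * M) := by
  refine iSup_le fun ψ => ENNReal.div_le_of_le_mul ?_
  have hm : ∀ i j, MemLp (pd j (ψ i)) 2 (volume.restrict (Ω : Set (ℝ × ℝ))) := fun i j =>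
    ((isTest_testFunction (ψ i)).der j).memLp_restrict
  have e1 : ∀ i j, eLpNorm (fun x => (∂_{e j} (ψ i)) x) 2 (volume.restrict (Ω : Set (ℝ × ℝ))) ^ 2
      = ENNReal.ofReal (nrm (volume.restrict Ω) (pd j (ψ i)) ^ 2) := fun i j => by
    simp only [lineDeriv_eq_pd]
    rw [ENNReal.ofReal_pow nrm_nonneg, ofReal_nrm (hm i j)]
  have e2 : ∑ i, ∑ j, eLpNorm (fun x => (∂_{e j} (ψ i)) x) 2 (volume.restrict (Ω : Set (ℝ × ℝ))) ^ 2
      = ENNReal.ofReal (∑ i, ∑ j, nrm (volume.restrict Ω) (pd j (ψ i)) ^ 2) := by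
    rw [ENNReal.ofReal_sum_of_nonneg fun i _ => Finset.sum_nonneg fun j _ => sq_nonneg _]
    refine Finset.sum_congr rfl fun i _ => ?_
    rw [ENNReal.ofReal_sum_of_nonneg fun j _ => sq_nonneg _]
    exact Finset.sum_congr rfl fun j _ => e1 i j
  have hs0 : 0 ≤ ∑ i, ∑ j, nrm (volume.restrict Ω) (pd j (ψ i)) ^ 2 :=
    Finset.sum_nonneg fun i _ => Finset.sum_nonneg fun j _ => sq_nonneg _
  rw [e2, ENNReal.ofReal_rpow_of_nonneg hs0 (by norm_num), ← Real.sqrt_eq_rpow,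
    ← ENNReal.ofReal_mul (by positivity)]
  refine ENNReal.ofReal_le_ofReal ((h ψ).trans ?_)
  rw [mul_comm 2 M, mul_assoc]
  refine mul_le_mul_of_nonneg_left ?_ hM
  rw [show (2 : ℝ) = Real.sqrt (2 ^ 2) by rw [Real.sqrt_sq (by norm_num)],
    ← Real.sqrt_mul (by norm_num)]
  refine Real.le_sqrt_of_sq_le ?_
  simp only [matNrm, Fin.sum_univ_two]
  generalize nrm (volume.restrict (Ω : Set (ℝ × ℝ))) (pd 0 (ψ 0)) = a
  generalize nrm (volume.restrict (Ω : Set (ℝ × ℝ))) (pd 1 (ψ 0)) = b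
  generalize nrm (volume.restrict (Ω : Set (ℝ × ℝ))) (pd 0 (ψ 1)) = c
  generalize nrm (volume.restrict (Ω : Set (ℝ × ℝ))) (pd 1 (ψ 1)) = d
  nlinarith [sq_nonneg (a - b), sq_nonneg (a - c), sq_nonneg (a - d), sq_nonneg (b - c),
    sq_nonneg (b - d), sq_nonneg (c - d)]

theorem EndApprox.mono {ε ν₀ A A' : ℝ} {ν₁ : ℝ → ℝ} {U b V : Fin 2 → ℝ × ℝ → ℝ} {P : ℝ × ℝ → ℝ}
    {G H : Fin 2 → Fin 2 → ℝ × ℝ → ℝ} (h : EndApprox ε ν₀ ν₁ A U P b V G H) (hA : A ≤ A') :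
    EndApprox ε ν₀ ν₁ A' U P b V G H :=
  { h with
    close := fun i => (h.close i).trans hA
    close_grad := fun i j => (h.close_grad i j).trans hA
    small := fun i j => (h.small i j).trans hA }

/-! ### The boundary values of the approximate solution -/

variable {ν f₁ φ₀ φ₁ : ℝ → ℝ} {k : ℕ} {R : RegularCoeffs} {ε : ℝ}

/-- Shifting the index by one shows which part of the transversal velocity the layers correct at an
end, and that the term of order ε^(k+3) is left to the lift. -/
theorem sum_sub_sum_lag (X : ℕ → ℝ × ℝ → ℝ) (y : ℝ × ℝ) (ε : ℝ) (k : ℕ) :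
    ∑ j ∈ Finset.range (k + 1), ε ^ (j + 3) * X j y
      = (∑ j ∈ Finset.range (k + 1), ε ^ (j + 2) * lag X 1 j y) + ε ^ (k + 3) * X k y := by
  rw [Finset.sum_range_succ, Finset.sum_range_succ' (fun j => ε ^ (j + 2) * lag X 1 j y)]
  simp [lag]

theorem continuousOn_regularVelocity (hε : 0 < ε) (hR : IsRegularAnsatz ν f₁ φ₀ k R) (i : Fin 2) :
    ContinuousOn (regularVelocity ε k R i) (closure (channel ε)) := by
  fin_cases i
  · exact continuousOn_finsetSum _ fun j hj => continuousOn_const.mul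
      (continuousOn_stretch hε (hR.contDiff_u₁ j (mem_le hj)).continuousOn)
  · exact continuousOn_finsetSum _ fun j hj => continuousOn_const.mul
      (continuousOn_stretch hε (hR.contDiff_u₂ j (mem_le hj)).continuousOn)

theorem continuousOn_regularPressure (hε : 0 < ε) (hR : IsRegularAnsatz ν f₁ φ₀ k R) :
    ContinuousOn (regularPressure ε k R) (closure (channel ε)) := by
  refine (continuousOn_finsetSum _ fun j hj => continuousOn_const.mul
      (continuousOn_stretch hε (hR.contDiff_p j (mem_le hj)).continuousOn)).add
    (continuousOn_finsetSum _ fun j hj => continuousOn_const.mul ?_)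
  exact (hR.contDiff_q j (mem_le hj)).continuousOn.comp continuousOn_fst fun x hx =>
    (mapsTo_closure_channel hε hx).1

theorem IsRegularAnsatz.regGrad_div (hε : 0 < ε) (hR : IsRegularAnsatz ν f₁ φ₀ k R) :
    ∀ x ∈ channel ε, regGrad ε k R 0 0 x + regGrad ε k R 1 1 x = 0 := by
  intro x hx
  have hy := rectInt_subset (mapsTo_channel hε hx)
  have hεε : ε * ε⁻¹ = 1 := mul_inv_cancel₀ hε.ne'
  simp only [regGrad, Matrix.cons_val_zero, Matrix.cons_val_one, Matrix.cons_val_fin_one,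
    ← Finset.sum_add_distrib]
  refine Finset.sum_eq_zero fun j hj => ?_
  have h := hR.div_rect (mem_le hj) hy
  simp only [wt, stretch, if_true, one_ne_zero, if_false]
  rw [show j + 3 = (j + 2) + 1 by ring, pow_succ]
  linear_combination ε ^ (j + 2) * h + ε ^ (j + 2) * dr 1 (R.u₂ j) (x.1, x.2 / ε) * hεε

/-- The lateral and end values cancel. -/
theorem boundary_cancel (hε : 0 < ε) (hR : IsRegularAnsatz ν f₁ φ₀ k R) (i : Fin 2) {x : ℝ × ℝ}
    (hx : x ∈ frontier (channel ε : Set (ℝ × ℝ))) :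
    regularVelocity ε k R i x
      + (∑ j ∈ Finset.range (k + 1), ε ^ (j + 2) * layerData 0 φ₀ R j i (zoom 0 ε x))
      + (∑ j ∈ Finset.range (k + 1), ε ^ (j + 2) * layerData 1 φ₁ R j i (zoom 1 ε x))
      - (if i = 1 ∧ (x.1 = 0 ∨ x.1 = 1) then ε ^ (k + 3) * R.u₂ k (x.1, x.2 / ε) else 0)
      - channelData ε φ₀ φ₁ i x = 0 := by
  obtain ⟨hr, hx'⟩ := frontier_channel_cases hε hx
  have z1 : ∀ a, (zoom a ε x).1 = 0 ↔ x.1 = a := fun a => by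
    change (x.1 - a) / ε = 0 ↔ _
    rw [div_eq_zero_iff, or_iff_left hε.ne', sub_eq_zero]
  have z2 : ∀ a, (zoom a ε x).2 = x.2 / ε := fun a => rfl
  have hoff : ∀ {a : ℝ} {φ : ℝ → ℝ}, x.1 ≠ a →
      ∑ j ∈ Finset.range (k + 1), ε ^ (j + 2) * layerData a φ R j i (zoom a ε x) = 0 := fun ha =>
    Finset.sum_eq_zero fun j _ => by
      rw [layerData, if_neg (fun h => ha ((z1 _).1 h)), mul_zero]
  have hon : ∀ {a : ℝ} {φ : ℝ → ℝ}, x.1 = a → regularVelocity ε k R i x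
      + (∑ j ∈ Finset.range (k + 1), ε ^ (j + 2) * layerData a φ R j i (zoom a ε x))
      = (if i = 1 then ε ^ (k + 3) * R.u₂ k (x.1, x.2 / ε) else 0)
        + if i = 0 then ε ^ 2 * φ (x.2 / ε) else 0 := by
    intro a φ ha
    have hl : ∀ j, layerData a φ R j i (zoom a ε x) = (if j = 0 ∧ i = 0 then φ (x.2 / ε) else 0)
        - ![R.u₁ j (x.1, x.2 / ε), lag R.u₂ 1 j (x.1, x.2 / ε)] i := fun j => by
      rw [layerData, if_pos ((z1 a).2 ha), z2, ha]
    simp only [hl]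
    fin_cases i
    · simp [regularVelocity, mul_sub, Finset.sum_sub_distrib]
    · have := sum_sub_sum_lag R.u₂ (x.1, x.2 / ε) ε k
      simp [regularVelocity, this]
  by_cases h0 : x.1 = 0
  · have h1 : x.1 ≠ 1 := by rw [h0]; norm_num
    rw [hon (φ := φ₀) h0, hoff h1, channelData]
    simp only [h0, true_or, and_true, if_true]
    ring
  by_cases h1 : x.1 = 1
  · rw [hoff h0, add_zero, hon (φ := φ₁) h1, channelData]
    simp only [h1, or_true, and_true, if_true, one_ne_zero, if_false]
    ring
  · rw [hoff h0, hoff h1, channelData]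
    have hw := (hx'.resolve_left h0).resolve_left h1
    have hreg : regularVelocity ε k R i x = 0 := by
      have hn := fun j (hj : j ≤ k) => hR.noSlip j hj x.1 hr.1
      fin_cases i
      · change ∑ j ∈ Finset.range (k + 1), ε ^ (j + 2) * R.u₁ j (x.1, x.2 / ε) = 0
        refine Finset.sum_eq_zero fun j hj => ?_
        obtain ⟨n1, n2, -, -⟩ := hn j (mem_le hj)
        rcases hw with hw | hw <;> rw [hw]
        · rw [n1, mul_zero]
        · rw [n2, mul_zero]
      · change ∑ j ∈ Finset.range (k + 1), ε ^ (j + 3) * R.u₂ j (x.1, x.2 / ε) = 0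
        refine Finset.sum_eq_zero fun j hj => ?_
        obtain ⟨-, -, n1, n2⟩ := hn j (mem_le hj)
        rcases hw with hw | hw <;> rw [hw]
        · rw [n1, mul_zero]
        · rw [n2, mul_zero]
    rw [hreg]
    simp [h0, h1]

theorem coe_stripPos : (stripPos : Set (ℝ × ℝ)) = halfPlane 1 ∩ hStrip := by
  ext x
  change x ∈ Ioi 0 ×ˢ Ioo (-(1 / 2) : ℝ) (1 / 2) ↔ 0 < 1 * x.1 ∧ x.2 ∈ Ioo (-(1 / 2) : ℝ) (1 / 2)
  rw [one_mul]; rfl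

theorem coe_stripNeg : (stripNeg : Set (ℝ × ℝ)) = halfPlane (-1) ∩ hStrip := by
  ext x
  change x ∈ Iio 0 ×ˢ Ioo (-(1 / 2) : ℝ) (1 / 2) ↔ 0 < -1 * x.1 ∧ x.2 ∈ Ioo (-(1 / 2) : ℝ) (1 / 2)
  rw [neg_one_mul, neg_pos]; rfl

theorem layerData_of_ne (a : ℝ) (φ : ℝ → ℝ) (R : RegularCoeffs) (j : ℕ) (i : Fin 2) (x : ℝ × ℝ)
    (hx : x.1 ≠ 0) : layerData a φ R j i x = 0 := if_neg hx

theorem rpow_eq_pow_mul_sqrt (hε : 0 < ε) (k : ℕ) :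
    ε ^ ((k : ℝ) + 3 / 2) = ε ^ (k + 1) * Real.sqrt ε := by
  rw [show (k : ℝ) + 3 / 2 = ((k + 1 : ℕ) : ℝ) + 1 / 2 by push_cast; ring, Real.rpow_add hε,
    Real.rpow_natCast, Real.sqrt_eq_rpow]

end ThinChannel

end

theorem mainTheorem2
    (ν₀ : ℝ) (ν₁ : ℝ → ℝ) (hν₁ : ContDiffOn ℝ 2 ν₁ (Icc 0 1))
    (κ : ℝ) (hκ : 0 < κ) (hνκ : ∀ t ∈ Ioo (0 : ℝ) 1, κ ≤ ν₀ + ν₁ t)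
    (ρ : ℝ) (hρ : 0 < ρ) (hν₁ρ : ∀ t ∈ Ioo (0 : ℝ) 1, t < ρ ∨ 1 - ρ < t → ν₁ t = 0)
    (f₁ : ℝ → ℝ) (hf₁ : ContDiffOn ℝ ∞ f₁ (Icc 0 1))
    (φ₀ φ₁ : ℝ → ℝ)
    (hφ₀ : ContDiffOn ℝ 2 φ₀ (Icc (-(1 / 2)) (1 / 2)))
    (hφ₁ : ContDiffOn ℝ 2 φ₁ (Icc (-(1 / 2)) (1 / 2)))
    (hφ₀b : φ₀ (-(1 / 2)) = 0 ∧ φ₀ (1 / 2) = 0)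
    (hφ₁b : φ₁ (-(1 / 2)) = 0 ∧ φ₁ (1 / 2) = 0)
    (hflux : ∫ ξ in (-(1 / 2) : ℝ)..(1 / 2), φ₀ ξ = ∫ ξ in (-(1 / 2) : ℝ)..(1 / 2), φ₁ ξ)
    (k : ℕ)
    (R : ThinChannel.RegularCoeffs)
    (hR : ThinChannel.IsRegularAnsatz (fun t => ν₀ + ν₁ t) f₁ φ₀ k R)
    (B₀ B₁ : ThinChannel.LayerCoeffs)
    (hB₀ : ∀ j ≤ k, ThinChannel.IsLayer ThinChannel.stripPos ν₀
      (ThinChannel.layerData 0 φ₀ R j) (B₀.u j) (B₀.p j))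
    (hB₁ : ∀ j ≤ k, ThinChannel.IsLayer ThinChannel.stripNeg ν₀
      (ThinChannel.layerData 1 φ₁ R j) (B₁.u j) (B₁.p j)) :
    ∃ C : ℝ, ∀ n : ℕ, 0 < n → ∀ ε : ℝ, ε = 1 / (n : ℝ) →
      ∀ (u : Fin 2 → ℝ × ℝ → ℝ) (p : Distribution (ThinChannel.channel ε) ℝ ⊤),
        ThinChannel.IsStokesSolution ε (fun t => ν₀ + ν₁ t) f₁ φ₀ φ₁ u p →
        (∀ i, ThinChannel.MemH1 (ThinChannel.channel ε)
          (fun x => ThinChannel.asymptVelocity ε k R B₀ B₁ i x - u i x)) ∧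
        ThinChannel.h1Norm (ThinChannel.channel ε)
          (fun i x => ThinChannel.asymptVelocity ε k R B₀ B₁ i x - u i x)
            ≤ ENNReal.ofReal (C * ε ^ ((k : ℝ) + 3 / 2)) ∧
        ThinChannel.hMinusOneNorm
          (fun i => ThinChannel.grad (ThinChannel.toDistribution (ThinChannel.channel ε)
              (ThinChannel.asymptPressure ε k R B₀ B₁)) i - ThinChannel.grad p i)
            ≤ ENNReal.ofReal (C * ε ^ ((k : ℝ) + 3 / 2)) := by
  obtain ⟨N, hN⟩ := isCompact_Icc.exists_bound_of_continuousOn hν₁.continuousOn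
  have hN' : ∀ t ∈ Ioo (0 : ℝ) 1, |ν₁ t| ≤ N := fun t ht => hN t (Ioo_subset_Icc_self ht)
  have hN0 : 0 ≤ N := (abs_nonneg _).trans (hN' (1 / 2) (by norm_num))
  -- Close to an end ν₁ vanishes, so there the viscosity is ν₀ itself and inherits the lower bound
  -- κ.
  have hν₀ : 0 < ν₀ := by
    have hm : min ρ 1 / 2 ∈ Ioo (0 : ℝ) 1 :=
      ⟨by positivity, by linarith [min_le_right ρ 1]⟩
    have h0 := hν₁ρ _ hm (Or.inl (by
      have : 0 < min ρ 1 := by positivity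
      linarith [min_le_left ρ 1]))
    linarith [hνκ _ hm]
  have hνc : ContinuousOn ν₁ (Ioo 0 1) := hν₁.continuousOn.mono Ioo_subset_Icc_self
  have hνd : ContDiffOn ℝ 1 (fun t => ν₀ + ν₁ t) (Icc 0 1) :=
    contDiffOn_const.add (hν₁.of_le (by norm_num))
  obtain ⟨Cr, hCr, hres⟩ := hR.exists_residual hνd hf₁.continuousOn
  obtain ⟨Cl, hCl, hlift⟩ := hR.exists_lift
  obtain ⟨C₀, hC₀, hend₀⟩ := ThinChannel.exists_endApprox (Or.inl ⟨rfl, rfl⟩)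
    ThinChannel.coe_stripPos hν₀.ne' hρ hN0 hN'
    (fun t ht h => hν₁ρ t ht (Or.inl (by linarith))) hB₀
    (ThinChannel.layerData_of_ne 0 φ₀ R)
  obtain ⟨C₁, hC₁, hend₁⟩ := ThinChannel.exists_endApprox (Or.inr ⟨rfl, rfl⟩)
    ThinChannel.coe_stripNeg hν₀.ne' hρ hN0 hN'
    (fun t ht h => hν₁ρ t ht (Or.inr (by linarith))) hB₁
    (ThinChannel.layerData_of_ne 1 φ₁ R)
  set C := Cr + Cl + C₀ + C₁ with hC
  set c := 8 / κ * (3 + 3 * (|ν₀| + N)) + 3 with hc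
  have hc0 : 0 ≤ c := by positivity
  set d := (|ν₀| + N) * c + 3 with hd
  have hd0 : 0 ≤ d := by positivity
  -- A single constant for both estimates: the factors 3 and 2 come from the passage to the H¹ and
  -- H⁻¹ norms, c and d from the velocity and pressure estimates.
  refine ⟨3 * (c * C) + 2 * (d * C), fun n hn ε hεn u p hu => ?_⟩
  have hn' : (0 : ℝ) < n := by exact_mod_cast hn
  have hε : 0 < ε := by rw [hεn]; positivity
  have hε1 : ε ≤ 1 := by
    rw [hεn, div_le_one hn']; exact_mod_cast hn
  rw [ThinChannel.rpow_eq_pow_mul_sqrt hε]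
  set δ := ε ^ (k + 1) * Real.sqrt ε with hδ
  have hδ0 : 0 ≤ δ := by positivity
  have hA : ∀ {c' : ℝ}, c' ≤ C → c' * δ ≤ C * δ := fun h => mul_le_mul_of_nonneg_right h hδ0
  obtain ⟨r, hr1, hr2, hr3⟩ := hres ε hε hε1
  obtain ⟨w, W, hw1, hw2, hw3, hw4, hw5⟩ := hlift ε hε hε1
  obtain ⟨V₀, G₀, H₀, h₀⟩ := hend₀ n hn ε hεn
  obtain ⟨V₁, G₁, H₁, h₁⟩ := hend₁ n hn ε hεn
  have happ : ThinChannel.ApproxSolution ε ν₀ ν₁ f₁ (C * δ) _ r w _ V₀ _ _ V₁ _ _ _ _ _ W G₀ H₀ G₁ H₁ :=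
    { grad := hR.hasGrad hε
      div := hR.regGrad_div hε
      residual_memLp := hr1
      residual_le := fun i => (hr2 i).trans (by
        rw [mul_assoc]; exact hA (by linarith))
      momentum := hr3
      pressure := ThinChannel.continuousOn_regularPressure hε hR
      lift_grad := hw1
      lift_div := hw2
      lift_le := fun i => (hw4 i).trans (hA (by linarith))
      lift_grad_le := fun i j => (hw5 i j).trans (hA (by linarith))
      left := h₀.mono (hA (by linarith))
      right := h₁.mono (hA (by linarith)) }
  -- The boundary values of the regular part, the cut off layers, the lift and the exact velocity
  -- add up to zero, so their combination lies in H¹₀.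
  have hz : ∀ i, ThinChannel.MemH10 (ThinChannel.channel ε) (fun x =>
      ThinChannel.regularVelocity ε k R i x + V₀ i x + V₁ i x - w i x - u i x) := fun i =>
    ThinChannel.HasBoundaryValue.memH10 (a₁ := 0) (a₂ := 1) (c₁ := -(ε / 2)) (c₂ := ε / 2) one_pos
      (by linarith) rfl
      (((((ThinChannel.HasBoundaryValue.of_continuousOn (hR.hasGrad hε i).memH1
        (ThinChannel.continuousOn_regularVelocity hε hR i)).add (h₀.boundary i)).add
        (h₁.boundary i)).sub (hw3 i)).sub (hu.boundary i))
      fun x hx => ThinChannel.boundary_cancel hε hR i hx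
  obtain ⟨hv1, hv2⟩ := happ.velocity_le hε hε1 hνc hN' hκ hνκ hu hz
  have hp := happ.pressure_le hε hε1 hνc hN' hu hv2
  have hg := happ.hasGrad_err hu.memH1
  have hz0 : ∀ x, ThinChannel.zoom 0 ε x = (x.1 / ε, x.2 / ε) := fun x => by
    rw [ThinChannel.zoom, sub_zero]
  have hCδ : 0 ≤ C * δ := by positivity
  simp only [hz0] at hv1 hg hp
  refine ⟨fun i => (hg i).memH1, ?_, ?_⟩
  · refine (ThinChannel.h1Norm_le hg (by positivity) hv1 hv2).trans (ENNReal.ofReal_le_ofReal ?_)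
    nlinarith [mul_nonneg hd0 hCδ]
  · refine (ThinChannel.hMinusOneNorm_le (by positivity) hp).trans (ENNReal.ofReal_le_ofReal ?_)
    nlinarith [mul_nonneg hc0 hCδ]
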